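/- Let $C$ be a commutative cocommutative Hopf algebra over $\mathbb{C}$, let $\Gamma=\mathrm{Spec}(C)$ be the abelian group of characters (algebra homomorphisms) $C\to\mathbb{C}$ under convolution, and let $\mathcal{C}=\mathrm{Rep}^{wt}(C)=\mathrm{Vect}_\Gamma$ be the category of finite-dimensional semisimple $C$-modules, i.e. of finite-dimensional $C$-modules spanned by weight vectors, with its trivial associator and with the braiding $v\otimes w\mapsto\sigma(\chi,\psi)\,w\otimes v$ ($v$ of weight $\chi$, $w$ of weight $\psi$) given by a bicharacter $\sigma:\Gamma\times\Gamma\to\mathbb{C}^\times$. Let $\gamma_1,\dots,\gamma_n\in\Gamma$, and let $X=\bigoplus_{i=1}^n\mathbb{C}_{\gamma_i}$ with basis $x_1,\dots,x_n$, where $c.x_i=\gamma_i(c)x_i$. Assume that there are grouplike elements $g_i,\bar g_i\in C$ with $\sigma(\gamma_i,\gamma)=\gamma(g_i)$ and $\sigma(\gamma,\gamma_i)=\gamma(\bar g_i)$ for all $\gamma\in\Gamma$, and that the Nichols algebra $\mathfrak{N}=\mathfrak{B}(X)$, with braiding matrix $q_{ij}=\sigma(\gamma_i,\gamma_j)$,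 is finite-dimensional. Let $X^*=\bigoplus_i\mathbb{C}_{\gamma_i^{-1}}$ with basis $x_1^*,\dots,x_n^*$, where $\gamma_i^{-1}=\gamma_i\circ S$. Let $U$ be the algebra generated by $C$, $\mathfrak{B}(X)$ and $\mathfrak{B}(X^*)$ (that is, with the relations of these three algebras) subject to the relations, for $c\in C$ and all $i,j$, $$c\,x_i=\gamma_i(c^{(1)})\,x_i c^{(2)},\qquad c\,x_i^*=\gamma_i(S(c^{(1)}))\,x_i^*c^{(2)},\qquad x_j^*x_i-\gamma_j(g_i)\,x_ix_j^*=\delta_{ij}(1-\bar g_ig_i).$$ Then: 1. The multiplication map $\mathfrak{B}(X)\otimes\mathfrak{B}(X^*)\otimes C\to U$, $a\otimes b\otimes c\mapsto abc$, is bijective. 2. $U$ is a Hopf algebra whose coproduct, counit and antipode restrict to those of $C$ and satisfy $$\Delta(x_i)=g_i\otimes x_i+x_i\otimes1,\quad \Delta(x_i^*)=\bar g_i\otimes x_i^*+x_i^*\otimes 1,\quad \varepsilon(x_i)=\varepsilon(x_i^*)=0,\quad S(x_i)=-g_i^{-1}x_i,\quad S(x_i^*)=-\bar g_i^{-1}x_i^*.$$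 3. Let ${}^{\mathfrak{N}}_{\mathfrak{N}}\mathcal{YD}(\mathcal{C})$ be the category of Yetter–Drinfeld modules over $\mathfrak{N}$ in $\mathcal{C}$: objects $M$ of $\mathcal{C}$ with a left action and a left coaction of $\mathfrak{N}$ in $\mathcal{C}$ satisfying $h^{(1)}m^{(-1)}\otimes h^{(2)}m^{(0)}=(h^{(1)}m)^{(-1)}h^{(2)}\otimes(h^{(1)}m)^{(0)}$, all exchanges of tensor factors being made with the braiding of $\mathcal{C}$. It is closed under the tensor product with the diagonal action and codiagonal coaction, and it is a braided tensor category with the braiding $m\otimes w\mapsto m^{(-1)}.w\otimes m^{(0)}$. Let $\mathrm{Rep}^{wt}(U)$ be the tensor category of finite-dimensional $U$-modules that are semisimple as $C$-modules. Then $\mathrm{Rep}^{wt}(U)$ has a braiding for which there is an equivalence of braided tensor categories $${}^{\mathfrak{N}}_{\mathfrak{N}}\mathcal{YD}(\mathcal{C})\;\simeq\;\mathrm{Rep}^{wt}(U)$$ that is compatible, up to natural isomorphism, with the forgetful functors to $\mathcal{C}$. 4. The braiding of ${}^{\mathfrak{N}}_{\mathfrak{N}}\mathcal{YD}(\mathcal{C})$,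 equivalently that of $\mathrm{Rep}^{wt}(U)$, is nondegenerate (every object whose double braiding with all objects is trivial is a finite direct sum of copies of the unit object) if and only if the braiding of $\mathcal{C}$ is nondegenerate, i.e. $\sigma(\chi,\psi)\sigma(\psi,\chi)=1$ for all $\psi\in\Gamma$ implies $\chi=1$. -/

import Mathlib

open CategoryTheory MonoidalCategory
open scoped TensorProduct

universe v u

set_option linter.unusedSectionVars false
set_option linter.unusedSimpArgs false

section YetterDrinfeld

variable {D : Type u} [Category.{v} D] [MonoidalCategory D]

/-- An object `X` with a map `act : H ⊗ X ⟶ X` and a map `coact : X ⟶ H ⊗ X`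
(no axioms yet; the axioms of a Yetter-Drinfeld module are in `IsYetterDrinfeld`). -/
structure ActCoact (H : D) where
  X : D
  act : H ⊗ X ⟶ X
  coact : X ⟶ H ⊗ X

namespace ActCoact

variable {H : D}

/-- Morphisms are `H`-linear and `H`-colinear. -/
@[ext]
structure Hom (M N : ActCoact H) where
  hom : M.X ⟶ N.X
  act_hom : M.act ≫ hom = H ◁ hom ≫ N.act
  coact_hom : M.coact ≫ H ◁ hom = hom ≫ N.coact

instance : Category (ActCoact H) where
  Hom := Hom
  id M := ⟨𝟙 _, by simp, by simp⟩
  comp f g := ⟨f.hom ≫ g.hom, by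
    rw [← Category.assoc, f.act_hom, Category.assoc, g.act_hom, whiskerLeft_comp, Category.assoc], by
    rw [whiskerLeft_comp, ← Category.assoc, f.coact_hom, Category.assoc, g.coact_hom,
      Category.assoc]⟩

@[ext]
theorem hom_ext {M N : ActCoact H} {f g : M ⟶ N} (h : f.hom = g.hom) : f = g := Hom.ext h

@[simp] theorem id_hom (M : ActCoact H) : Hom.hom (𝟙 M) = 𝟙 M.X := rfl
@[simp] theorem comp_hom {M N P : ActCoact H} (f : M ⟶ N) (g : N ⟶ P) :
    Hom.hom (f ≫ g) = f.hom ≫ g.hom := rfl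

/-- The underlying object in the ambient category. -/
@[simps]
def forget (H : D) : ActCoact H ⥤ D where
  obj M := M.X
  map f := f.hom

instance : (forget H).Faithful where
  map_injective h := hom_ext h

/-- Isomorphisms from isomorphisms of the underlying objects. -/
@[simps]
def isoMk {M N : ActCoact H} (e : M.X ≅ N.X) (h1 : M.act ≫ e.hom = H ◁ e.hom ≫ N.act)
    (h2 : M.coact ≫ H ◁ e.hom = e.hom ≫ N.coact) : M ≅ N where
  hom := ⟨e.hom, h1, h2⟩
  inv := ⟨e.inv, by
    rw [← cancel_mono e.hom, Category.assoc, Category.assoc, h1, ← whiskerLeft_comp_assoc]; simp, by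
    rw [← cancel_epi e.hom, ← Category.assoc, ← h2]; simp⟩

variable [BraidedCategory D] [MonObj H] [ComonObj H]

open MonObj ComonObj

section Aux

variable {X Y Z X' Y' : D}

/-- The diagonal action `h (x ⊗ y) = h₍₁₎ x ⊗ h₍₂₎ y`, where `h₍₂₎` and `x` are exchanged with the
braiding of `D`. -/
def tensorAct (a : H ⊗ X ⟶ X) (b : H ⊗ Y ⟶ Y) : H ⊗ (X ⊗ Y) ⟶ X ⊗ Y :=
  Δ[H] ▷ (X ⊗ Y) ≫ tensorμ H H X Y ≫ (a ⊗ₘ b)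

/-- The codiagonal coaction `x ⊗ y ↦ x₍₋₁₎ y₍₋₁₎ ⊗ (x₍₀₎ ⊗ y₍₀₎)`, where `x₍₀₎` and `y₍₋₁₎` are
exchanged with the braiding of `D`. -/
def tensorCoact (a : X ⟶ H ⊗ X) (b : Y ⟶ H ⊗ Y) : X ⊗ Y ⟶ H ⊗ (X ⊗ Y) :=
  (a ⊗ₘ b) ≫ tensorμ H X H Y ≫ μ[H] ▷ (X ⊗ Y)

theorem tensorAct_hom {a : H ⊗ X ⟶ X} {b : H ⊗ Y ⟶ Y} {a' : H ⊗ X' ⟶ X'} {b' : H ⊗ Y' ⟶ Y'}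
    {f : X ⟶ X'} {g : Y ⟶ Y'} (hf : a ≫ f = H ◁ f ≫ a') (hg : b ≫ g = H ◁ g ≫ b') :
    tensorAct a b ≫ (f ⊗ₘ g) = H ◁ (f ⊗ₘ g) ≫ tensorAct a' b' := by
  unfold tensorAct
  simp only [Category.assoc, tensorHom_comp_tensorHom, hf, hg]
  rw [whisker_exchange_assoc, tensorμ_natural_right_assoc, tensorHom_comp_tensorHom]

theorem tensorCoact_hom {a : X ⟶ H ⊗ X} {b : Y ⟶ H ⊗ Y} {a' : X' ⟶ H ⊗ X'} {b' : Y' ⟶ H ⊗ Y'}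
    {f : X ⟶ X'} {g : Y ⟶ Y'} (hf : a ≫ H ◁ f = f ≫ a') (hg : b ≫ H ◁ g = g ≫ b') :
    tensorCoact a b ≫ H ◁ (f ⊗ₘ g) = (f ⊗ₘ g) ≫ tensorCoact a' b' := by
  unfold tensorCoact
  simp only [Category.assoc, tensorHom_comp_tensorHom_assoc, ← hf, ← hg]
  rw [← whisker_exchange, ← tensorHom_comp_tensorHom_assoc]
  have := tensorμ_natural_assoc (𝟙 H) f (𝟙 H) g (μ[H] ▷ (X' ⊗ Y'))
  simp only [id_tensorHom, tensorHom_id, id_whiskerRight] at this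
  rw [this]

theorem tensorAct_assoc (a : H ⊗ X ⟶ X) (b : H ⊗ Y ⟶ Y) (c : H ⊗ Z ⟶ Z) :
    tensorAct (tensorAct a b) c ≫ (α_ X Y Z).hom =
      H ◁ (α_ X Y Z).hom ≫ tensorAct a (tensorAct b c) := by
  have key := associator_monoidal H H H X Y Z
  have e1 : tensorAct (tensorAct a b) c ≫ (α_ X Y Z).hom =
      (Δ[H] ≫ Δ[H] ▷ H) ▷ ((X ⊗ Y) ⊗ Z) ≫ (tensorμ (H ⊗ H) H (X ⊗ Y) Z ≫
        tensorμ H H X Y ▷ (H ⊗ Z) ≫ (α_ (H ⊗ X) (H ⊗ Y) (H ⊗ Z)).hom) ≫ (a ⊗ₘ (b ⊗ₘ c)) := by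
    unfold tensorAct
    have := tensorμ_natural_left_assoc Δ[H] (𝟙 H) (X ⊗ Y) Z
      (((tensorμ H H X Y ≫ (a ⊗ₘ b)) ⊗ₘ c) ≫ (α_ X Y Z).hom)
    simp only [tensorHom_id, id_whiskerRight, whiskerRight_comp_tensorHom_assoc] at this
    simp only [Category.assoc, comp_whiskerRight]
    rw [← associator_naturality, ← this]
    simp only [whiskerRight_comp_tensorHom_assoc]
  have e2 : H ◁ (α_ X Y Z).hom ≫ tensorAct a (tensorAct b c) =
      (Δ[H] ≫ H ◁ Δ[H]) ▷ ((X ⊗ Y) ⊗ Z) ≫ ((𝟙 _ ⊗ₘ (α_ X Y Z).hom) ≫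
        tensorμ H (H ⊗ H) X (Y ⊗ Z) ≫ (H ⊗ X) ◁ tensorμ H H Y Z) ≫ (a ⊗ₘ (b ⊗ₘ c)) := by
    unfold tensorAct
    have := tensorμ_natural_left_assoc (𝟙 H) Δ[H] X (Y ⊗ Z)
      (a ⊗ₘ (tensorμ H H Y Z ≫ (b ⊗ₘ c)))
    simp only [id_tensorHom, id_whiskerRight, whiskerLeft_comp_tensorHom] at this
    simp only [Category.assoc, comp_whiskerRight]
    rw [whisker_exchange_assoc, ← this, id_tensorHom, whisker_exchange_assoc]
    simp only [whiskerLeft_comp_tensorHom]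
  rw [e1, e2, key, comul_assoc]
  simp only [Category.assoc, comp_whiskerRight, MonoidalCategory.tensorHom_def,
    id_whiskerRight, Category.id_comp]

theorem tensorCoact_assoc (a : X ⟶ H ⊗ X) (b : Y ⟶ H ⊗ Y) (c : Z ⟶ H ⊗ Z) :
    tensorCoact (tensorCoact a b) c ≫ H ◁ (α_ X Y Z).hom =
      (α_ X Y Z).hom ≫ tensorCoact a (tensorCoact b c) := by
  have key := tensor_associativity H X H Y H Z
  have e1 : tensorCoact (tensorCoact a b) c ≫ H ◁ (α_ X Y Z).hom =
      ((a ⊗ₘ b) ⊗ₘ c) ≫ tensorμ H X H Y ▷ (H ⊗ Z) ≫ tensorμ (H ⊗ H) (X ⊗ Y) H Z ≫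
        (μ[H] ▷ H ≫ μ[H] ⊗ₘ (α_ X Y Z).hom) := by
    unfold tensorCoact
    have := tensorμ_natural_left_assoc μ[H] (𝟙 (X ⊗ Y)) H Z (μ[H] ⊗ₘ (α_ X Y Z).hom)
    simp only [tensorHom_id, id_whiskerRight, whiskerRight_comp_tensorHom,
      Category.id_comp, tensorHom_comp_tensorHom] at this
    rw [← this]
    simp only [Category.assoc, MonoidalCategory.tensorHom_def, comp_whiskerRight,
      whisker_exchange_assoc]
  have e2 : (α_ X Y Z).hom ≫ tensorCoact a (tensorCoact b c) =
      ((a ⊗ₘ b) ⊗ₘ c) ≫ (α_ (H ⊗ X) (H ⊗ Y) (H ⊗ Z)).hom ≫ (H ⊗ X) ◁ tensorμ H Y H Z ≫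
        tensorμ H X (H ⊗ H) (Y ⊗ Z) ≫ (H ◁ μ[H] ≫ μ[H]) ▷ (X ⊗ Y ⊗ Z) := by
    unfold tensorCoact
    have := tensorμ_natural_right_assoc H X μ[H] (𝟙 (Y ⊗ Z)) (μ[H] ▷ (X ⊗ Y ⊗ Z))
    simp only [tensorHom_id, whiskerLeft_id] at this
    rw [comp_whiskerRight, ← this, associator_naturality_assoc]
    simp only [Category.assoc, MonoidalCategory.tensorHom_def, whiskerLeft_comp]
  have h3 : (α_ H H H).hom ≫ H ◁ μ[H] ≫ μ[H] = μ[H] ▷ H ≫ μ[H] := (MonObj.mul_assoc H).symm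
  rw [e1, e2, ← h3]
  have h4 : ((α_ H H H).hom ≫ H ◁ μ[H] ≫ μ[H] ⊗ₘ (α_ X Y Z).hom) =
      ((α_ H H H).hom ⊗ₘ (α_ X Y Z).hom) ≫ (H ◁ μ[H] ≫ μ[H]) ▷ (X ⊗ Y ⊗ Z) := by
    rw [← tensorHom_id, tensorHom_comp_tensorHom, Category.comp_id]
  rw [h4, reassoc_of% key]

/-- The action on the unit object, through the counit. -/
def unitAct (H : D) [ComonObj H] : H ⊗ 𝟙_ D ⟶ 𝟙_ D := (ρ_ H).hom ≫ ε[H]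

/-- The coaction on the unit object, through the unit. -/
def unitCoact (H : D) [MonObj H] : 𝟙_ D ⟶ H ⊗ 𝟙_ D := η[H] ≫ (ρ_ H).inv

theorem tensorAct_leftUnitor (a : H ⊗ X ⟶ X) :
    tensorAct (unitAct H) a ≫ (λ_ X).hom = H ◁ (λ_ X).hom ≫ a := by
  unfold tensorAct unitAct
  have h1 : ((ρ_ H).hom ≫ ε[H] ⊗ₘ a) ≫ (λ_ X).hom =
      (ε[H] ▷ 𝟙_ D ⊗ₘ 𝟙 H ▷ X) ≫ (λ_ (𝟙_ D)).hom ▷ (H ⊗ X) ≫ (λ_ (H ⊗ X)).hom ≫ a := by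
    rw [← rightUnitor_naturality, unitors_equal, ← leftUnitor_naturality, id_whiskerRight,
      tensorHom_id, ← comp_whiskerRight_assoc, MonoidalCategory.tensorHom_def, Category.assoc]
  rw [Category.assoc, Category.assoc, h1, ← tensorμ_natural_left_assoc,
    ← reassoc_of% (leftUnitor_monoidal H X), tensorHom_id, ← comp_whiskerRight_assoc,
    counit_comul, whiskerRight_comp_tensorHom_assoc, Iso.inv_hom_id, id_tensorHom]

theorem tensorAct_rightUnitor (a : H ⊗ X ⟶ X) :
    tensorAct a (unitAct H) ≫ (ρ_ X).hom = H ◁ (ρ_ X).hom ≫ a := by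
  unfold tensorAct unitAct
  have h1 : (a ⊗ₘ (ρ_ H).hom ≫ ε[H]) ≫ (ρ_ X).hom =
      (𝟙 H ▷ X ⊗ₘ ε[H] ▷ 𝟙_ D) ≫ (H ⊗ X) ◁ (λ_ (𝟙_ D)).hom ≫ (ρ_ (H ⊗ X)).hom ≫ a := by
    rw [← rightUnitor_naturality ε[H], unitors_equal, ← rightUnitor_naturality, id_whiskerRight,
      id_tensorHom, ← whiskerLeft_comp_assoc, tensorHom_def', Category.assoc]
  rw [Category.assoc, Category.assoc, h1, ← tensorμ_natural_left_assoc,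
    ← reassoc_of% (rightUnitor_monoidal H X), id_tensorHom, ← comp_whiskerRight_assoc,
    comul_counit, whiskerRight_comp_tensorHom_assoc, Iso.inv_hom_id, id_tensorHom]

theorem tensorCoact_leftUnitor (a : X ⟶ H ⊗ X) :
    tensorCoact (unitCoact H) a ≫ H ◁ (λ_ X).hom = (λ_ X).hom ≫ a := by
  unfold tensorCoact unitCoact
  have h1 : (η[H] ≫ (ρ_ H).inv ⊗ₘ a) =
      𝟙_ D ◁ a ≫ (λ_ (𝟙_ D)).inv ▷ (H ⊗ X) ≫ (η[H] ⊗ₘ 𝟙 (𝟙_ D)) ▷ (H ⊗ X) := by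
    rw [rightUnitor_inv_naturality, tensorHom_id, unitors_inv_equal, tensorHom_def',
      comp_whiskerRight]
  rw [h1]
  simp only [Category.assoc]
  rw [tensorμ_natural_left_assoc, ← leftUnitor_naturality, tensor_left_unitality H X]
  simp only [MonoidalCategory.tensorHom_def, id_whiskerRight, Category.comp_id, Category.assoc,
    whiskerLeft_id, ← comp_whiskerRight_assoc, MonObj.one_mul, Category.id_comp]

theorem tensorCoact_rightUnitor (a : X ⟶ H ⊗ X) :
    tensorCoact a (unitCoact H) ≫ H ◁ (ρ_ X).hom = (ρ_ X).hom ≫ a := by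
  unfold tensorCoact unitCoact
  have h1 : (a ⊗ₘ η[H] ≫ (ρ_ H).inv) =
      a ▷ 𝟙_ D ≫ (H ⊗ X) ◁ (λ_ (𝟙_ D)).inv ≫ (H ⊗ X) ◁ (η[H] ⊗ₘ 𝟙 (𝟙_ D)) := by
    rw [rightUnitor_inv_naturality, tensorHom_id, unitors_inv_equal,
      MonoidalCategory.tensorHom_def, whiskerLeft_comp]
  rw [h1]
  simp only [Category.assoc]
  rw [tensorμ_natural_right_assoc, ← rightUnitor_naturality, tensor_right_unitality H X]
  simp only [MonoidalCategory.tensorHom_def, id_whiskerRight, Category.comp_id, Category.assoc,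
    whiskerLeft_id, ← comp_whiskerRight_assoc, MonObj.mul_one, Category.id_comp]

end Aux

@[simps]
instance : MonoidalCategoryStruct (ActCoact H) where
  tensorObj M N := ⟨M.X ⊗ N.X, tensorAct M.act N.act, tensorCoact M.coact N.coact⟩
  tensorUnit := ⟨𝟙_ D, unitAct H, unitCoact H⟩
  tensorHom f g :=
    ⟨f.hom ⊗ₘ g.hom, tensorAct_hom f.act_hom g.act_hom, tensorCoact_hom f.coact_hom g.coact_hom⟩
  whiskerLeft M _ _ f :=
    ⟨M.X ◁ f.hom,
      by simpa using tensorAct_hom (f := 𝟙 M.X) (a := M.act) (a' := M.act) (by simp) f.act_hom,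
      by simpa using
        tensorCoact_hom (f := 𝟙 M.X) (a := M.coact) (a' := M.coact) (by simp) f.coact_hom⟩
  whiskerRight f M :=
    ⟨f.hom ▷ M.X,
      by simpa using tensorAct_hom (g := 𝟙 M.X) (b := M.act) (b' := M.act) f.act_hom (by simp),
      by simpa using
        tensorCoact_hom (g := 𝟙 M.X) (b := M.coact) (b' := M.coact) f.coact_hom (by simp)⟩
  associator M N P := isoMk (α_ M.X N.X P.X) (tensorAct_assoc _ _ _) (tensorCoact_assoc _ _ _)
  leftUnitor M := isoMk (λ_ M.X) (tensorAct_leftUnitor _) (tensorCoact_leftUnitor _)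
  rightUnitor M := isoMk (ρ_ M.X) (tensorAct_rightUnitor _) (tensorCoact_rightUnitor _)

instance : MonoidalCategory (ActCoact H) where
  tensorHom_def f g := hom_ext (MonoidalCategory.tensorHom_def f.hom g.hom)
  id_tensorHom_id M N := hom_ext (id_tensorHom_id M.X N.X)
  tensorHom_comp_tensorHom f g f' g' :=
    hom_ext (tensorHom_comp_tensorHom f.hom g.hom f'.hom g'.hom)
  whiskerLeft_id M N := hom_ext (whiskerLeft_id M.X N.X)
  id_whiskerRight M N := hom_ext (id_whiskerRight M.X N.X)
  associator_naturality f g h := hom_ext (associator_naturality f.hom g.hom h.hom)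
  leftUnitor_naturality f := hom_ext (leftUnitor_naturality f.hom)
  rightUnitor_naturality f := hom_ext (rightUnitor_naturality f.hom)
  pentagon M N P Q := hom_ext (pentagon M.X N.X P.X Q.X)
  triangle M N := hom_ext (triangle M.X N.X)

/-- The axioms of a (left-left) Yetter-Drinfeld module over `H`: the action is unital and
associative, the coaction is counital and coassociative, and
`h₍₁₎ x₍₋₁₎ ⊗ h₍₂₎ x₍₀₎ = (h₍₁₎ x)₍₋₁₎ h₍₂₎ ⊗ (h₍₁₎ x)₍₀₎`, where all exchanges of tensor factors
are performed with the braiding of `D`. -/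
structure IsYetterDrinfeld (M : ActCoact H) : Prop where
  one_act : η[H] ▷ M.X ≫ M.act = (λ_ M.X).hom
  mul_act : μ[H] ▷ M.X ≫ M.act = (α_ H H M.X).hom ≫ H ◁ M.act ≫ M.act
  coact_counit : M.coact ≫ ε[H] ▷ M.X = (λ_ M.X).inv
  coact_comul : M.coact ≫ Δ[H] ▷ M.X = M.coact ≫ H ◁ M.coact ≫ (α_ H H M.X).inv
  compat :
    (Δ[H] ⊗ₘ M.coact) ≫ tensorμ H H H M.X ≫ (μ[H] ⊗ₘ M.act) =
      Δ[H] ▷ M.X ≫ (α_ H H M.X).hom ≫ H ◁ (β_ H M.X).hom ≫ (α_ H M.X H).inv ≫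
        (M.act ≫ M.coact) ▷ H ≫
          (α_ H M.X H).hom ≫ H ◁ (β_ M.X H).hom ≫ (α_ H H M.X).inv ≫ μ[H] ▷ M.X

end ActCoact

/-- The property of being a Yetter-Drinfeld module. -/
def isYetterDrinfeld [BraidedCategory D] (H : D) [MonObj H] [ComonObj H] :
    ObjectProperty (ActCoact H) := fun M => M.IsYetterDrinfeld

/-- The category of Yetter-Drinfeld modules over `H` in the braided category `D`, with
`H`-linear and `H`-colinear morphisms. -/
abbrev YetterDrinfeld [BraidedCategory D] (H : D) [MonObj H] [ComonObj H] :=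
  (isYetterDrinfeld H).FullSubcategory

/-- The morphism `x ⊗ y ↦ x₍₋₁₎ y ⊗ x₍₀₎`, where `x₍₀₎` and `y` are exchanged with the braiding
of `D`. -/
def ydBraiding [BraidedCategory D] {H : D} (M N : ActCoact H) :
    M.X ⊗ N.X ⟶ N.X ⊗ M.X :=
  M.coact ▷ N.X ≫ (α_ H M.X N.X).hom ≫ H ◁ (β_ M.X N.X).hom ≫ (α_ H N.X M.X).inv ≫ N.act ▷ M.X
end YetterDrinfeld

noncomputable section WeightModules

/-- The group of characters `Spec(C)(ℂ)` of a Hopf algebra `C`, with the convolution product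
`(χ ψ)(c) = χ(c₍₁₎) ψ(c₍₂₎)`. -/
abbrev CharGroup (C : Type u) [CommRing C] [HopfAlgebra ℂ C] := WithConv (C →ₐ[ℂ] ℂ)

variable {C : Type u} [CommRing C] [HopfAlgebra ℂ C]
variable {A : Type v} [Ring A] [Bialgebra ℂ A]

/-- The space of vectors on which `C` acts through the character `χ`. -/
def weightSpace {V : Type} [AddCommGroup V] [Module ℂ V] (r : C →ₐ[ℂ] Module.End ℂ V)
    (χ : CharGroup C) : Submodule ℂ V where
  carrier := {x | ∀ c, r c x = χ c • x}
  add_mem' hx hy c := by rw [map_add, hx c, hy c, smul_add]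
  zero_mem' c := by simp
  smul_mem' a x hx c := by rw [map_smul, hx c, smul_comm]

/-- A weight module over a bialgebra `A` with respect to `j : C → A`: a finite-dimensional
`A`-module which is spanned by weight vectors for `C`, i.e. which is semisimple as a `C`-module. -/
structure WeightModule (j : C →ₐc[ℂ] A) where
  V : Type
  [addCommGroup : AddCommGroup V]
  [module : Module ℂ V]
  [finiteDimensional : FiniteDimensional ℂ V]
  ρ : A →ₐ[ℂ] Module.End ℂ V
  iSup_weightSpace : ⨆ χ, weightSpace (ρ.comp (j : C →ₐ[ℂ] A)) χ = ⊤

attribute [instance] WeightModule.addCommGroup WeightModule.module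
  WeightModule.finiteDimensional

namespace WeightModule

variable {j : C →ₐc[ℂ] A}

/-- The weight spaces of a weight module. -/
abbrev weight (M : WeightModule j) (χ : CharGroup C) : Submodule ℂ M.V :=
  weightSpace (M.ρ.comp (j : C →ₐ[ℂ] A)) χ

theorem mem_weight {M : WeightModule j} {χ : CharGroup C} {x : M.V} :
    x ∈ M.weight χ ↔ ∀ c, M.ρ (j c) x = χ c • x := Iff.rfl

/-- Morphisms are `A`-linear maps. -/
@[ext]
structure Hom (M N : WeightModule j) where
  lin : M.V →ₗ[ℂ] N.V
  comm : ∀ a x, lin (M.ρ a x) = N.ρ a (lin x)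

instance : Category (WeightModule j) where
  Hom := Hom
  id M := ⟨LinearMap.id, fun _ _ => rfl⟩
  comp f g := ⟨g.lin ∘ₗ f.lin, fun a x => by simp [f.comm, g.comm]⟩

/-- The linear map underlying a morphism. -/
abbrev lin {M N : WeightModule j} (f : M ⟶ N) : M.V →ₗ[ℂ] N.V := Hom.lin f

theorem hom_ext {M N : WeightModule j} {f g : M ⟶ N} (h : lin f = lin g) : f = g := Hom.ext h

theorem comm {M N : WeightModule j} (f : M ⟶ N) (a : A) (x : M.V) :
    lin f (M.ρ a x) = N.ρ a (lin f x) := Hom.comm f a x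

@[simp] theorem lin_id (M : WeightModule j) : lin (𝟙 M) = LinearMap.id := rfl
@[simp] theorem lin_comp {M N P : WeightModule j} (f : M ⟶ N) (g : N ⟶ P) :
    lin (f ≫ g) = lin g ∘ₗ lin f := rfl

/-- An `A`-linear isomorphism is an isomorphism of weight modules. -/
@[simps]
def isoMk {M N : WeightModule j} (e : M.V ≃ₗ[ℂ] N.V) (h : ∀ a x, e (M.ρ a x) = N.ρ a (e x)) :
    M ≅ N where
  hom := ⟨e, h⟩
  inv := ⟨e.symm, fun a x => by
    simp only [LinearEquiv.coe_coe]
    rw [LinearEquiv.symm_apply_eq, h, LinearEquiv.apply_symm_apply]⟩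
  hom_inv_id := hom_ext (by ext x; exact e.symm_apply_apply x)
  inv_hom_id := hom_ext (by ext x; exact e.apply_symm_apply x)

section Tensor

variable {B : Type*} [Ring B] [Algebra ℂ B] {E : Type*} [Ring E] [Algebra ℂ E]
variable {V W X : Type} [AddCommGroup V] [Module ℂ V] [AddCommGroup W] [Module ℂ W]
  [AddCommGroup X] [Module ℂ X]

/-- The action `(a ⊗ b) (x ⊗ y) = a x ⊗ b y` of `B ⊗ E` on `V ⊗ W`. -/
def tensorEnd (r : B →ₐ[ℂ] Module.End ℂ V) (s : E →ₐ[ℂ] Module.End ℂ W) :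
    B ⊗[ℂ] E →ₐ[ℂ] Module.End ℂ (V ⊗[ℂ] W) :=
  (Module.endTensorEndAlgHom (R := ℂ) (S := ℂ) (A := ℂ) (M := V) (N := W)).comp
    (Algebra.TensorProduct.map r s)

@[simp] theorem tensorEnd_tmul (r : B →ₐ[ℂ] Module.End ℂ V) (s : E →ₐ[ℂ] Module.End ℂ W)
    (a : B) (b : E) (x : V) (y : W) :
    tensorEnd r s (a ⊗ₜ b) (x ⊗ₜ y) = r a x ⊗ₜ s b y := rfl

/-- The diagonal action `a (x ⊗ y) = a₍₁₎ x ⊗ a₍₂₎ y`. -/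
def diag (r : A →ₐ[ℂ] Module.End ℂ V) (s : A →ₐ[ℂ] Module.End ℂ W) :
    A →ₐ[ℂ] Module.End ℂ (V ⊗[ℂ] W) :=
  (tensorEnd r s).comp (Bialgebra.comulAlgHom ℂ A)

theorem diag_apply (r : A →ₐ[ℂ] Module.End ℂ V) (s : A →ₐ[ℂ] Module.End ℂ W) (a : A) :
    diag r s a = tensorEnd r s (Coalgebra.comul a) := rfl

theorem map_diag {V' W' : Type} [AddCommGroup V'] [Module ℂ V'] [AddCommGroup W'] [Module ℂ W']
    {r : A →ₐ[ℂ] Module.End ℂ V} {s : A →ₐ[ℂ] Module.End ℂ W}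
    {r' : A →ₐ[ℂ] Module.End ℂ V'} {s' : A →ₐ[ℂ] Module.End ℂ W'}
    {f : V →ₗ[ℂ] V'} {g : W →ₗ[ℂ] W'} (hf : ∀ a x, f (r a x) = r' a (f x))
    (hg : ∀ a x, g (s a x) = s' a (g x)) (a : A) (z : V ⊗[ℂ] W) :
    TensorProduct.map f g (diag r s a z) = diag r' s' a (TensorProduct.map f g z) := by
  rw [diag_apply, diag_apply]
  induction (Coalgebra.comul (R := ℂ) a) with
  | zero => simp
  | add p q hp hq => simp [hp, hq]
  | tmul p q =>
    induction z with
    | zero => simp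
    | add x y hx hy => simp [hx, hy]
    | tmul x y => simp [hf, hg]

theorem assoc_tensorEnd (r : B →ₐ[ℂ] Module.End ℂ V) (s : B →ₐ[ℂ] Module.End ℂ W)
    (t : B →ₐ[ℂ] Module.End ℂ X) (w : (B ⊗[ℂ] B) ⊗[ℂ] B) (z : (V ⊗[ℂ] W) ⊗[ℂ] X) :
    TensorProduct.assoc ℂ V W X (tensorEnd (tensorEnd r s) t w z) =
      tensorEnd r (tensorEnd s t) (TensorProduct.assoc ℂ B B B w)
        (TensorProduct.assoc ℂ V W X z) := by
  induction w with
  | zero => simp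
  | add p q hp hq => simp [hp, hq]
  | tmul p c =>
    induction p with
    | zero => simp
    | add p q hp hq => simp [hp, hq, TensorProduct.add_tmul]
    | tmul a b =>
      induction z with
      | zero => simp
      | add p q hp hq => simp [hp, hq]
      | tmul p z =>
        induction p with
        | zero => simp
        | add p q hp hq => rw [TensorProduct.add_tmul, map_add, map_add, map_add, map_add, hp, hq]
        | tmul x y => simp

theorem assoc_diag (r : A →ₐ[ℂ] Module.End ℂ V) (s : A →ₐ[ℂ] Module.End ℂ W)
    (t : A →ₐ[ℂ] Module.End ℂ X) (a : A) (z : (V ⊗[ℂ] W) ⊗[ℂ] X) :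
    TensorProduct.assoc ℂ V W X (diag (diag r s) t a z) =
      diag r (diag s t) a (TensorProduct.assoc ℂ V W X z) := by
  have h1 : ∀ p : A ⊗[ℂ] A, tensorEnd (diag r s) t p =
      tensorEnd (tensorEnd r s) t ((Coalgebra.comul (R := ℂ)).rTensor A p) := by
    intro p
    induction p with
    | zero => simp
    | add p q hp hq => simp [hp, hq]
    | tmul p q => rfl
  have h2 : ∀ p : A ⊗[ℂ] A, tensorEnd r (diag s t) p =
      tensorEnd r (tensorEnd s t) ((Coalgebra.comul (R := ℂ)).lTensor A p) := by
    intro p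
    induction p with
    | zero => simp
    | add p q hp hq => simp [hp, hq]
    | tmul p q => rfl
  rw [diag_apply, h1, assoc_tensorEnd, Coalgebra.coassoc_apply, diag_apply, h2]

/-- The trivial action through the counit. -/
def triv (A : Type*) [Ring A] [Bialgebra ℂ A] : A →ₐ[ℂ] Module.End ℂ ℂ :=
  (Algebra.lmul ℂ ℂ).comp (Bialgebra.counitAlgHom ℂ A)

@[simp] theorem triv_apply (a : A) (z : ℂ) : triv A a z = Coalgebra.counit (R := ℂ) a * z := rfl

theorem lid_diag (r : A →ₐ[ℂ] Module.End ℂ V) (a : A) (z : ℂ ⊗[ℂ] V) :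
    TensorProduct.lid ℂ V (diag (triv A) r a z) = r a (TensorProduct.lid ℂ V z) := by
  have h : ∀ p : A ⊗[ℂ] A, ∀ z, TensorProduct.lid ℂ V (tensorEnd (triv A) r p z) =
      r (TensorProduct.lid ℂ A ((Coalgebra.counit (R := ℂ)).rTensor A p))
        (TensorProduct.lid ℂ V z) := by
    intro p z
    induction p with
    | zero => simp
    | add p q hp hq => simp [hp, hq]
    | tmul p q =>
      induction z with
      | zero => simp
      | add p q hp hq => simp [hp, hq]
      | tmul x y => simp [smul_smul, mul_comm]
  rw [diag_apply, h, Coalgebra.rTensor_counit_comul]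
  simp

theorem rid_diag (r : A →ₐ[ℂ] Module.End ℂ V) (a : A) (z : V ⊗[ℂ] ℂ) :
    TensorProduct.rid ℂ V (diag r (triv A) a z) = r a (TensorProduct.rid ℂ V z) := by
  have h : ∀ p : A ⊗[ℂ] A, ∀ z, TensorProduct.rid ℂ V (tensorEnd r (triv A) p z) =
      r (TensorProduct.rid ℂ A ((Coalgebra.counit (R := ℂ)).lTensor A p))
        (TensorProduct.rid ℂ V z) := by
    intro p z
    induction p with
    | zero => simp
    | add p q hp hq => simp [hp, hq]
    | tmul p q =>
      induction z with
      | zero => simp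
      | add p q hp hq => simp [hp, hq]
      | tmul x y => simp [smul_smul, mul_comm]
  rw [diag_apply, h, Coalgebra.lTensor_counit_comul]
  simp

theorem tmul_mem_weightSpace {j : C →ₐc[ℂ] A} {r : A →ₐ[ℂ] Module.End ℂ V}
    {s : A →ₐ[ℂ] Module.End ℂ W} {χ ψ : CharGroup C} {x : V} {y : W}
    (hx : x ∈ weightSpace (r.comp (j : C →ₐ[ℂ] A)) χ)
    (hy : y ∈ weightSpace (s.comp (j : C →ₐ[ℂ] A)) ψ) :
    x ⊗ₜ[ℂ] y ∈ weightSpace ((diag r s).comp (j : C →ₐ[ℂ] A)) (χ * ψ) := by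
  intro c
  have h1 : ∀ p : C ⊗[ℂ] C, tensorEnd r s (TensorProduct.map (j : C →ₗ[ℂ] A) (j : C →ₗ[ℂ] A) p)
      (x ⊗ₜ y) = (LinearMap.mul' ℂ ℂ
        (TensorProduct.map χ.ofConv.toLinearMap ψ.ofConv.toLinearMap p)) • (x ⊗ₜ[ℂ] y) := by
    intro p
    induction p with
    | zero => simp
    | add p q hp hq => simp [hp, hq, add_smul]
    | tmul p q =>
      have e1 : r (j p) x = χ p • x := hx p
      have e2 : s (j q) y = ψ q • y := hy q
      simp only [TensorProduct.map_tmul, tensorEnd_tmul, LinearMap.mul'_apply,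
        AlgHom.toLinearMap_apply, mul_smul]
      erw [e1, e2]
      rw [TensorProduct.tmul_smul, ← TensorProduct.smul_tmul', smul_smul, smul_smul, mul_comm]
  have h2 := CoalgHomClass.map_comp_comul_apply j c
  change diag r s (j c) (x ⊗ₜ y) = _
  rw [diag_apply, ← h2, h1]
  rfl

theorem iSup_weightSpace_diag {j : C →ₐc[ℂ] A} {r : A →ₐ[ℂ] Module.End ℂ V}
    {s : A →ₐ[ℂ] Module.End ℂ W} (hr : ⨆ χ, weightSpace (r.comp (j : C →ₐ[ℂ] A)) χ = ⊤)
    (hs : ⨆ χ, weightSpace (s.comp (j : C →ₐ[ℂ] A)) χ = ⊤) :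
    ⨆ χ, weightSpace ((diag r s).comp (j : C →ₐ[ℂ] A)) χ = ⊤ := by
  rw [eq_top_iff]
  rintro z -
  induction z with
  | zero => exact zero_mem _
  | add x y hx hy => exact add_mem hx hy
  | tmul x y =>
    have hx : x ∈ ⨆ χ, weightSpace (r.comp (j : C →ₐ[ℂ] A)) χ := hr ▸ Submodule.mem_top
    have hy : y ∈ ⨆ χ, weightSpace (s.comp (j : C →ₐ[ℂ] A)) χ := hs ▸ Submodule.mem_top
    induction hx using Submodule.iSup_induction' with
    | zero => simp
    | add x x' _ _ h h' => rw [TensorProduct.add_tmul]; exact add_mem h h'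
    | mem χ x hx =>
      induction hy using Submodule.iSup_induction' with
      | zero => simp
      | add y y' _ _ h h' => rw [TensorProduct.tmul_add]; exact add_mem h h'
      | mem ψ y hy => exact Submodule.mem_iSup_of_mem _ (tmul_mem_weightSpace hx hy)

theorem iSup_weightSpace_triv (j : C →ₐc[ℂ] A) :
    ⨆ χ, weightSpace ((triv A).comp (j : C →ₐ[ℂ] A)) χ = ⊤ := by
  rw [eq_top_iff]
  refine le_trans ?_ (le_iSup _ (1 : CharGroup C))
  rintro z - c
  change Coalgebra.counit (R := ℂ) (j c) * z = Coalgebra.counit (R := ℂ) c * z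
  rw [CoalgHomClass.counit_comp_apply]

end Tensor

instance : MonoidalCategoryStruct (WeightModule j) where
  tensorObj M N := ⟨M.V ⊗[ℂ] N.V, diag M.ρ N.ρ,
    iSup_weightSpace_diag M.iSup_weightSpace N.iSup_weightSpace⟩
  tensorUnit := ⟨ℂ, triv A, iSup_weightSpace_triv j⟩
  tensorHom f g := ⟨TensorProduct.map (lin f) (lin g), map_diag (comm f) (comm g)⟩
  whiskerLeft M _ _ g := ⟨(lin g).lTensor M.V, map_diag (fun _ _ => rfl) (comm g)⟩
  whiskerRight f N := ⟨(lin f).rTensor N.V, map_diag (comm f) (fun _ _ => rfl)⟩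
  associator M N P := isoMk (TensorProduct.assoc ℂ M.V N.V P.V) (assoc_diag M.ρ N.ρ P.ρ)
  leftUnitor M := isoMk (TensorProduct.lid ℂ M.V) (lid_diag M.ρ)
  rightUnitor M := isoMk (TensorProduct.rid ℂ M.V) (rid_diag M.ρ)

instance : MonoidalCategory (WeightModule j) where
  tensorHom_def f g := hom_ext (by
    refine TensorProduct.ext' fun x y => rfl)
  id_tensorHom_id M N := hom_ext (TensorProduct.ext' fun x y => rfl)
  tensorHom_comp_tensorHom f g f' g' := hom_ext (TensorProduct.ext' fun x y => rfl)
  whiskerLeft_id M N := hom_ext (TensorProduct.ext' fun x y => rfl)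
  id_whiskerRight M N := hom_ext (TensorProduct.ext' fun x y => rfl)
  associator_naturality f g h := hom_ext (TensorProduct.ext_threefold fun x y z => rfl)
  leftUnitor_naturality f := hom_ext (TensorProduct.ext' fun x y =>
    (map_smul (lin f) (show ℂ from x) y).symm)
  rightUnitor_naturality f := hom_ext (TensorProduct.ext' fun x y =>
    (map_smul (lin f) (show ℂ from y) x).symm)
  pentagon M N P Q := hom_ext (TensorProduct.ext_fourfold fun x y z w => rfl)
  triangle M N := hom_ext (TensorProduct.ext_threefold fun x y z =>
    (TensorProduct.smul_tmul (R := ℂ) (show ℂ from y) x z).symm)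

@[simp] theorem lin_tensorHom {M N M' N' : WeightModule j} (f : M ⟶ N) (g : M' ⟶ N') :
    lin (f ⊗ₘ g) = TensorProduct.map (lin f) (lin g) := rfl
@[simp] theorem lin_whiskerLeft (M : WeightModule j) {N N' : WeightModule j} (g : N ⟶ N') :
    lin (M ◁ g) = (lin g).lTensor M.V := rfl
@[simp] theorem lin_whiskerRight {M M' : WeightModule j} (f : M ⟶ M') (N : WeightModule j) :
    lin (f ▷ N) = (lin f).rTensor N.V := rfl
@[simp] theorem lin_associator_hom (M N P : WeightModule j) :
    lin (α_ M N P).hom = TensorProduct.assoc ℂ M.V N.V P.V := rfl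
@[simp] theorem lin_associator_inv (M N P : WeightModule j) :
    lin (α_ M N P).inv = (TensorProduct.assoc ℂ M.V N.V P.V).symm := rfl
@[simp] theorem lin_leftUnitor_hom (M : WeightModule j) :
    lin (λ_ M).hom = TensorProduct.lid ℂ M.V := rfl
@[simp] theorem lin_leftUnitor_inv (M : WeightModule j) :
    lin (λ_ M).inv = (TensorProduct.lid ℂ M.V).symm := rfl
@[simp] theorem lin_rightUnitor_hom (M : WeightModule j) :
    lin (ρ_ M).hom = TensorProduct.rid ℂ M.V := rfl
@[simp] theorem lin_rightUnitor_inv (M : WeightModule j) :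
    lin (ρ_ M).inv = (TensorProduct.rid ℂ M.V).symm := rfl

/-- Every weight module has a basis of weight vectors. -/
theorem exists_basis (M : WeightModule j) : ∃ (κ : Type) (b : Module.Basis κ ℂ M.V)
    (w : κ → CharGroup C), ∀ k, b k ∈ M.weight (w k) := by
  let S : Set M.V := ⋃ χ, (M.weight χ : Set M.V)
  have hS : ⊤ ≤ Submodule.span ℂ S := by
    rw [Submodule.span_iUnion]
    simpa using M.iSup_weightSpace.ge
  let b := Module.Basis.ofSpan hS
  have hb : ∀ k, ∃ χ, b k ∈ M.weight χ := by
    intro k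
    have : b k ∈ S := Module.Basis.ofSpan_subset hS ⟨k, rfl⟩
    simpa [S] using this
  choose w hw using hb
  exact ⟨_, b, w, hw⟩

theorem weight_of_repr_ne_zero {M : WeightModule j} {κ : Type} (b : Module.Basis κ ℂ M.V)
    {w : κ → CharGroup C} (hw : ∀ k, b k ∈ M.weight (w k)) {χ : CharGroup C} {x : M.V}
    (hx : x ∈ M.weight χ) {k : κ} (hk : b.repr x k ≠ 0) : w k = χ := by
  apply WithConv.ext
  ext c
  have h1 : b.coord k ∘ₗ M.ρ (j c) = w k c • b.coord k := b.ext fun l => by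
    have := mem_weight.1 (hw l) c
    by_cases h : l = k
    · subst h; simp [this]
    · simp [this, h]
  have h2 := LinearMap.congr_fun h1 x
  rw [LinearMap.comp_apply, mem_weight.1 hx c] at h2
  simp only [map_smul, LinearMap.smul_apply, smul_eq_mul, Module.Basis.coord_apply] at h2
  exact (mul_right_cancel₀ hk h2).symm

/-- A linear map defined on the tensor product of weight modules is determined by its values on
tensor products of weight vectors. -/
theorem ext_weight {M N : WeightModule j} {Z : Type*} [AddCommGroup Z] [Module ℂ Z]
    {f g : M.V ⊗[ℂ] N.V →ₗ[ℂ] Z}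
    (h : ∀ χ ψ, ∀ x ∈ M.weight χ, ∀ y ∈ N.weight ψ, f (x ⊗ₜ y) = g (x ⊗ₜ y)) : f = g := by
  obtain ⟨κ, b, w, hw⟩ := M.exists_basis
  obtain ⟨κ', b', w', hw'⟩ := N.exists_basis
  refine (b.tensorProduct b').ext fun ⟨k, l⟩ => ?_
  rw [Module.Basis.tensorProduct_apply]
  exact h _ _ _ (hw k) _ (hw' l)

/-- A linear map which preserves the weight spaces is a morphism of `C`-modules. -/
theorem comm_of_weight {M N : WeightModule (BialgHom.id ℂ C)} {f : M.V →ₗ[ℂ] N.V}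
    (h : ∀ χ, ∀ x ∈ M.weight χ, f x ∈ N.weight χ) (c : C) (x : M.V) :
    f (M.ρ c x) = N.ρ c (f x) := by
  obtain ⟨κ, b, w, hw⟩ := M.exists_basis
  have : f ∘ₗ (M.ρ c) = (N.ρ c) ∘ₗ f := b.ext fun k => by
    have e1 : M.ρ c (b k) = w k c • b k := hw k c
    have e2 : N.ρ c (f (b k)) = w k c • f (b k) := h _ _ (hw k) c
    simp [e1, e2]
  exact LinearMap.congr_fun this x

end WeightModule

/-- The braided category `Vect_Γ` of finite-dimensional `Γ`-graded vector spaces, for the group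
`Γ = Spec(C)` of characters of `C`, realized as the category of weight modules of `C`. The
bicharacter `σ` on `Γ` determines the braiding. -/
def VectGraded [Coalgebra.IsCocomm ℂ C] (_ : CharGroup C →* CharGroup C →* ℂˣ) :=
  WeightModule (BialgHom.id ℂ C)

namespace VectGraded

open WeightModule

variable [Coalgebra.IsCocomm ℂ C] (σ : CharGroup C →* CharGroup C →* ℂˣ)

instance : Category (VectGraded σ) :=
  inferInstanceAs (Category (WeightModule (BialgHom.id ℂ C)))

instance : MonoidalCategory (VectGraded σ) :=
  inferInstanceAs (MonoidalCategory (WeightModule (BialgHom.id ℂ C)))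

/-- There is a linear map with `x ⊗ y ↦ σ(χ, ψ) y ⊗ x` for `x` of weight `χ` and `y` of
weight `ψ`. -/
theorem exists_braid (M N : WeightModule (BialgHom.id ℂ C)) :
    ∃ f : M.V ⊗[ℂ] N.V →ₗ[ℂ] N.V ⊗[ℂ] M.V, ∀ χ ψ, ∀ x ∈ M.weight χ, ∀ y ∈ N.weight ψ,
      f (x ⊗ₜ y) = ((σ χ ψ : ℂˣ) : ℂ) • (y ⊗ₜ x) := by
  obtain ⟨κ, b, w, hw⟩ := M.exists_basis
  obtain ⟨κ', b', w', hw'⟩ := N.exists_basis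
  refine ⟨(b.tensorProduct b').constr ℂ fun p => ((σ (w p.1) (w' p.2) : ℂˣ) : ℂ) • (b' p.2 ⊗ₜ b p.1),
    fun χ ψ x hx y hy => ?_⟩
  have hb : ∀ k l, (b.tensorProduct b').constr ℂ
      (fun p => ((σ (w p.1) (w' p.2) : ℂˣ) : ℂ) • (b' p.2 ⊗ₜ[ℂ] b p.1)) (b k ⊗ₜ b' l) =
      ((σ (w k) (w' l) : ℂˣ) : ℂ) • (b' l ⊗ₜ b k) := fun k l => by
    rw [← Module.Basis.tensorProduct_apply, Module.Basis.constr_basis]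
  generalize (b.tensorProduct b').constr ℂ
    (fun p => ((σ (w p.1) (w' p.2) : ℂˣ) : ℂ) • (b' p.2 ⊗ₜ[ℂ] b p.1)) = f at hb
  rw [← b.linearCombination_repr x, ← b'.linearCombination_repr y]
  simp only [Finsupp.linearCombination_apply, Finsupp.sum, TensorProduct.sum_tmul,
    TensorProduct.tmul_sum, map_sum, Finset.smul_sum]
  rw [Finset.sum_comm]
  refine Finset.sum_congr rfl fun k hk => Finset.sum_congr rfl fun l hl => ?_
  have e1 := weight_of_repr_ne_zero b hw hx (Finsupp.mem_support_iff.1 (by assumption))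
  have e2 := weight_of_repr_ne_zero b' hw' hy (Finsupp.mem_support_iff.1 (by assumption))
  rw [← e1, ← e2]
  simp only [← TensorProduct.smul_tmul', TensorProduct.tmul_smul, map_smul, hb, smul_smul]
  congr 1
  ring

/-- The linear map `x ⊗ y ↦ σ(χ, ψ) y ⊗ x` for `x` of weight `χ` and `y` of weight `ψ`. -/
def braid (M N : WeightModule (BialgHom.id ℂ C)) : M.V ⊗[ℂ] N.V →ₗ[ℂ] N.V ⊗[ℂ] M.V :=
  (exists_braid σ M N).choose

theorem braid_tmul {M N : WeightModule (BialgHom.id ℂ C)} {χ ψ : CharGroup C} {x : M.V} {y : N.V}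
    (hx : x ∈ M.weight χ) (hy : y ∈ N.weight ψ) :
    braid σ M N (x ⊗ₜ y) = ((σ χ ψ : ℂˣ) : ℂ) • (y ⊗ₜ x) :=
  (exists_braid σ M N).choose_spec χ ψ x hx y hy

/-- The inverse bicharacter with exchanged arguments. -/
def flipInv : CharGroup C →* CharGroup C →* ℂˣ := σ.flip⁻¹

theorem braid_flipInv_braid (M N : WeightModule (BialgHom.id ℂ C)) :
    braid (flipInv σ) N M ∘ₗ braid σ M N = LinearMap.id :=
  ext_weight fun χ ψ x hx y hy => by
    simp [braid_tmul _ hx hy, braid_tmul _ hy hx, flipInv]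

theorem braid_braid_flipInv (M N : WeightModule (BialgHom.id ℂ C)) :
    braid σ M N ∘ₗ braid (flipInv σ) N M = LinearMap.id :=
  ext_weight fun χ ψ x hx y hy => by
    simp [braid_tmul _ hx hy, braid_tmul _ hy hx, flipInv]

theorem tmul_mem_weight {M N : WeightModule (BialgHom.id ℂ C)} {χ ψ : CharGroup C} {x : M.V}
    {y : N.V} (hx : x ∈ M.weight χ) (hy : y ∈ N.weight ψ) :
    (x ⊗ₜ y : M.V ⊗[ℂ] N.V) ∈ (M ⊗ N).weight (χ * ψ) := tmul_mem_weightSpace hx hy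

theorem braid_comm (M N : WeightModule (BialgHom.id ℂ C)) (c : C) (z : M.V ⊗[ℂ] N.V) :
    braid σ M N ((M ⊗ N).ρ c z) = (N ⊗ M).ρ c (braid σ M N z) := by
  have : braid σ M N ∘ₗ (M ⊗ N).ρ c = (N ⊗ M).ρ c ∘ₗ braid σ M N :=
    ext_weight fun χ ψ x hx y hy => by
      have e1 : (M ⊗ N).ρ c (x ⊗ₜ y) = (χ * ψ) c • (x ⊗ₜ y) := tmul_mem_weight hx hy c
      have e2 : (N ⊗ M).ρ c (y ⊗ₜ x) = (ψ * χ) c • (y ⊗ₜ x) := tmul_mem_weight hy hx c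
      rw [LinearMap.comp_apply, LinearMap.comp_apply, e1, map_smul, braid_tmul σ hx hy, map_smul, e2,
        smul_comm, mul_comm]
  exact LinearMap.congr_fun this z

/-- The isomorphism `M ⊗ N ≅ N ⊗ M` given by the bicharacter `σ`. -/
def braidIso (M N : WeightModule (BialgHom.id ℂ C)) : M ⊗ N ≅ N ⊗ M :=
  isoMk (LinearEquiv.ofLinearMap (braid σ M N) (braid (flipInv σ) N M) (braid_braid_flipInv σ M N)
    (braid_flipInv_braid σ M N)) (braid_comm σ M N)

theorem lin_braidIso_hom (M N : WeightModule (BialgHom.id ℂ C)) :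
    lin (braidIso σ M N).hom = braid σ M N := rfl

theorem lin_mem_weight {M N : WeightModule (BialgHom.id ℂ C)} (f : M ⟶ N) {χ : CharGroup C}
    {x : M.V} (hx : x ∈ M.weight χ) : lin f x ∈ N.weight χ := fun c => by
  have : M.ρ c x = χ c • x := hx c
  change N.ρ c _ = _
  rw [← comm f, this, map_smul]

theorem ext_weight₃ {M N P : WeightModule (BialgHom.id ℂ C)} {Z : Type*} [AddCommGroup Z]
    [Module ℂ Z] {f g : (M.V ⊗[ℂ] N.V) ⊗[ℂ] P.V →ₗ[ℂ] Z}
    (h : ∀ χ ψ φ, ∀ x ∈ M.weight χ, ∀ y ∈ N.weight ψ, ∀ z ∈ P.weight φ,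
      f ((x ⊗ₜ y) ⊗ₜ z) = g ((x ⊗ₜ y) ⊗ₜ z)) : f = g := by
  obtain ⟨κ, b, w, hw⟩ := M.exists_basis
  obtain ⟨κ', b', w', hw'⟩ := N.exists_basis
  obtain ⟨κ'', b'', w'', hw''⟩ := P.exists_basis
  refine ((b.tensorProduct b').tensorProduct b'').ext fun ⟨⟨k, l⟩, m⟩ => ?_
  rw [Module.Basis.tensorProduct_apply, Module.Basis.tensorProduct_apply]
  exact h _ _ _ _ (hw k) _ (hw' l) _ (hw'' m)

instance : BraidedCategory (VectGraded σ) :=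
  show BraidedCategory (WeightModule (BialgHom.id ℂ C)) from
  { braiding := braidIso σ
    braiding_naturality_right := fun M {N N'} f => hom_ext (ext_weight fun χ ψ x hx y hy => by
      change braid σ M N' (x ⊗ₜ lin f y) = (lin f).rTensor _ (braid σ M N (x ⊗ₜ y))
      rw [braid_tmul σ hx hy, braid_tmul σ hx (lin_mem_weight f hy), map_smul]
      rfl)
    braiding_naturality_left := fun {M M'} f N => hom_ext (ext_weight fun χ ψ x hx y hy => by
      change braid σ M' N (lin f x ⊗ₜ y) = (lin f).lTensor _ (braid σ M N (x ⊗ₜ y))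
      rw [braid_tmul σ hx hy, braid_tmul σ (lin_mem_weight f hx) hy, map_smul]
      rfl)
    hexagon_forward := fun M N P => hom_ext (ext_weight₃ fun χ ψ φ x hx y hy z hz => by
      change TensorProduct.assoc ℂ _ _ _ (braid σ M (N ⊗ P) (x ⊗ₜ (y ⊗ₜ z))) =
        (braid σ M P).lTensor _ (TensorProduct.assoc ℂ _ _ _ (braid σ M N (x ⊗ₜ y) ⊗ₜ z))
      have e : braid σ M (N ⊗ P) (x ⊗ₜ (y ⊗ₜ z)) =
        ((σ χ (ψ * φ) : ℂˣ) : ℂ) • ((y ⊗ₜ z) ⊗ₜ x) := braid_tmul σ hx (tmul_mem_weight hy hz)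
      rw [e, braid_tmul σ hx hy, ← TensorProduct.smul_tmul', map_smul, map_smul, map_smul,
        TensorProduct.assoc_tmul, TensorProduct.assoc_tmul, LinearMap.lTensor_tmul,
        braid_tmul σ hx hz, TensorProduct.tmul_smul, smul_smul, map_mul, Units.val_mul])
    hexagon_reverse := fun M N P => by
      rw [← cancel_epi (α_ M N P).hom]
      refine hom_ext (ext_weight₃ fun χ ψ φ x hx y hy z hz => ?_)
      change (TensorProduct.assoc ℂ _ _ _).symm (braid σ (M ⊗ N) P ((x ⊗ₜ y) ⊗ₜ z)) =
        (braid σ M P).rTensor _ ((TensorProduct.assoc ℂ _ _ _).symm (x ⊗ₜ braid σ N P (y ⊗ₜ z)))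
      have e : braid σ (M ⊗ N) P ((x ⊗ₜ y) ⊗ₜ z) =
        ((σ (χ * ψ) φ : ℂˣ) : ℂ) • (z ⊗ₜ (x ⊗ₜ y)) := braid_tmul σ (tmul_mem_weight hx hy) hz
      rw [e, braid_tmul σ hy hz, TensorProduct.tmul_smul, map_smul, map_smul, map_smul,
        TensorProduct.assoc_symm_tmul, TensorProduct.assoc_symm_tmul, LinearMap.rTensor_tmul,
        braid_tmul σ hx hz, ← TensorProduct.smul_tmul', smul_smul, map_mul, MonoidHom.mul_apply,
        Units.val_mul, mul_comm] }

end VectGraded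
end WeightModules

noncomputable section NicholsAlgebras

namespace NicholsAlgebra

variable {n : ℕ}

/-- The tensor algebra of a vector space with basis `x_0, …, x_{n-1}`. -/
abbrev TensorAlg (n : ℕ) := FreeAlgebra ℂ (Fin n)

/-- The monomials `x_{i_1} ⋯ x_{i_k}`. -/
def word : FreeMonoid (Fin n) →* TensorAlg n := FreeMonoid.lift (FreeAlgebra.ι ℂ)

/-- The basis of monomials of the tensor algebra. -/
abbrev wordBasis (n : ℕ) : Module.Basis (FreeMonoid (Fin n)) ℂ (TensorAlg n) :=
  FreeAlgebra.basisFreeMonoid ℂ (Fin n)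

@[simp] theorem wordBasis_apply (w : FreeMonoid (Fin n)) : wordBasis n w = word w := by
  simp only [wordBasis, FreeAlgebra.basisFreeMonoid, Module.Basis.map_apply,
    Finsupp.coe_basisSingleOne]
  change FreeAlgebra.equivMonoidAlgebraFreeMonoid.symm (MonoidAlgebra.single w (1 : ℂ)) = _
  rw [AlgEquiv.symm_apply_eq]
  induction w using FreeMonoid.inductionOn' with
  | one => simp [MonoidAlgebra.one_def]
  | of_mul i w ih =>
    rw [map_mul, map_mul, ← ih]
    simp [word, FreeAlgebra.equivMonoidAlgebraFreeMonoid, MonoidAlgebra.single_mul_single]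

/-- The projection onto the component of multidegree `d` in `ℕⁿ`, where `x_i` has multidegree
`e_i`; multidegrees are written as multisets. -/
def component (d : Multiset (Fin n)) : TensorAlg n →ₗ[ℂ] TensorAlg n :=
  (wordBasis n).constr ℂ fun w => if (w.toList : Multiset (Fin n)) = d then word w else 0

/-- The algebra automorphism `x_j ↦ q_{ij} x_j`; the braiding is
`c (x_i ⊗ a) = braidAut q i a ⊗ x_i`. -/
def braidAut (q : Fin n → Fin n → ℂ) (i : Fin n) : TensorAlg n →ₐ[ℂ] TensorAlg n :=
  FreeAlgebra.lift ℂ fun j => q i j • FreeAlgebra.ι ℂ j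

/-- Left multiplication with `x_i`. -/
def mulGen (i : Fin n) : TensorAlg n →ₗ[ℂ] TensorAlg n := LinearMap.mulLeft ℂ (FreeAlgebra.ι ℂ i)

/-- Left multiplication with `x_i ⊗ 1 + 1 ⊗ x_i` in the braided tensor product algebra, whose
product is `(a ⊗ b)(a' ⊗ b') = a c(b ⊗ a') b'`. -/
def primMul (q : Fin n → Fin n → ℂ) (i : Fin n) :
    TensorAlg n ⊗[ℂ] TensorAlg n →ₗ[ℂ] TensorAlg n ⊗[ℂ] TensorAlg n :=
  TensorProduct.map (mulGen i) LinearMap.id +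
    TensorProduct.map (braidAut q i).toLinearMap (mulGen i)

/-- The coproduct of the tensor algebra of a braided vector space with the diagonal braiding
`c (x_i ⊗ x_j) = q_{ij} x_j ⊗ x_i`: the homomorphism to the braided tensor product algebra with
`Δ(x_i) = x_i ⊗ 1 + 1 ⊗ x_i`, that is, `Δ(x_i a) = (x_i ⊗ 1 + 1 ⊗ x_i) Δ(a)` and
`Δ(1) = 1 ⊗ 1`. -/
def braidedComul (q : Fin n → Fin n → ℂ) : TensorAlg n →ₗ[ℂ] TensorAlg n ⊗[ℂ] TensorAlg n :=
  (LinearMap.applyₗ (1 ⊗ₜ[ℂ] 1)) ∘ₗ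
    (FreeAlgebra.lift ℂ (A := Module.End ℂ (TensorAlg n ⊗[ℂ] TensorAlg n)) (primMul q)).toLinearMap

/-- A multigraded two-sided ideal `J` of the tensor algebra which lies in degrees `≥ 2` and such
that the coproduct descends to the quotient by `J`. (The quotient is then a multigraded bialgebra
with degree `0` component `ℂ`, hence a Hopf algebra, and the generators map injectively to it.) -/
structure IsGradedBiideal (q : Fin n → Fin n → ℂ) (J : Ideal (TensorAlg n)) : Prop where
  mul_mem_right : ∀ a b, a ∈ J → a * b ∈ J
  component_mem : ∀ d, ∀ a ∈ J, component d a ∈ J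
  degree_ge_two : ∀ a ∈ J, ∀ w, w.toList.length < 2 → (wordBasis n).repr a w = 0
  comul_mem : ∀ a ∈ J, TensorProduct.map (J.mkQ.restrictScalars ℂ) (J.mkQ.restrictScalars ℂ)
    (braidedComul q a) = 0

/-- The defining ideal of the Nichols algebra: the largest graded biideal in degrees `≥ 2`. -/
def nicholsIdeal (q : Fin n → Fin n → ℂ) : Ideal (TensorAlg n) :=
  sSup {J | IsGradedBiideal q J}

theorem map_mkQ_eq_zero_of_le {J K : Ideal (TensorAlg n)} (h : J ≤ K)
    {z : TensorAlg n ⊗[ℂ] TensorAlg n}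
    (hz : TensorProduct.map (J.mkQ.restrictScalars ℂ) (J.mkQ.restrictScalars ℂ) z = 0) :
    TensorProduct.map (K.mkQ.restrictScalars ℂ) (K.mkQ.restrictScalars ℂ) z = 0 := by
  let f : (TensorAlg n ⧸ J) →ₗ[ℂ] (TensorAlg n ⧸ K) := (Submodule.factor h).restrictScalars ℂ
  have hf : K.mkQ.restrictScalars ℂ = f ∘ₗ (J.mkQ.restrictScalars ℂ) := rfl
  rw [hf, TensorProduct.map_comp, LinearMap.comp_apply, hz, map_zero]

theorem nicholsIdeal_induction {q : Fin n → Fin n → ℂ} {p : TensorAlg n → Prop}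
    (mem : ∀ J, IsGradedBiideal q J → ∀ a ∈ J, p a) (zero : p 0)
    (add : ∀ a b, p a → p b → p (a + b)) {a : TensorAlg n} (ha : a ∈ nicholsIdeal q) : p a := by
  rw [nicholsIdeal, sSup_eq_iSup'] at ha
  exact Submodule.iSup_induction _ (motive := p) ha (fun J a ha => mem J.1 J.2 a ha) zero add

theorem le_nicholsIdeal {q : Fin n → Fin n → ℂ} {J : Ideal (TensorAlg n)}
    (h : IsGradedBiideal q J) : J ≤ nicholsIdeal q := le_sSup h

theorem isGradedBiideal_nicholsIdeal (q : Fin n → Fin n → ℂ) :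
    IsGradedBiideal q (nicholsIdeal q) where
  mul_mem_right a b ha := nicholsIdeal_induction (p := fun a => a * b ∈ nicholsIdeal q)
    (fun _ hJ a ha => le_nicholsIdeal hJ (hJ.mul_mem_right a b ha))
    (by rw [zero_mul]; exact zero_mem _)
    (fun a a' h h' => by rw [add_mul]; exact add_mem h h') ha
  component_mem d a ha := nicholsIdeal_induction (p := fun a => component d a ∈ nicholsIdeal q)
    (fun _ hJ a ha => le_nicholsIdeal hJ (hJ.component_mem d a ha))
    (by rw [map_zero]; exact zero_mem _)
    (fun a a' h h' => by rw [map_add]; exact add_mem h h') ha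
  degree_ge_two a ha w hw := nicholsIdeal_induction (p := fun a => (wordBasis n).repr a w = 0)
    (fun _ hJ a ha => hJ.degree_ge_two a ha w hw) (by simp)
    (fun a a' h h' => by simp [h, h']) ha
  comul_mem a ha := nicholsIdeal_induction
    (fun _ hJ a ha => map_mkQ_eq_zero_of_le (le_nicholsIdeal hJ) (hJ.comul_mem a ha)) (by simp)
    (fun a a' h h' => by rw [map_add, map_add, h, h', add_zero]) ha

instance (q : Fin n → Fin n → ℂ) : (nicholsIdeal q).IsTwoSided :=
  ⟨fun b ha => (isGradedBiideal_nicholsIdeal q).mul_mem_right _ b ha⟩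

end NicholsAlgebra

open NicholsAlgebra

/-- The Nichols algebra of the braided vector space with basis `x_0, …, x_{n-1}` and diagonal
braiding `c (x_i ⊗ x_j) = q_{ij} x_j ⊗ x_i`: the smallest multigraded quotient Hopf algebra of the
tensor algebra into which the span of the `x_i` maps injectively. -/
def Nichols {n : ℕ} (q : Fin n → Fin n → ℂ) := TensorAlg n ⧸ nicholsIdeal q

instance {n : ℕ} (q : Fin n → Fin n → ℂ) : Ring (Nichols q) :=
  inferInstanceAs (Ring (TensorAlg n ⧸ nicholsIdeal q))

instance {n : ℕ} (q : Fin n → Fin n → ℂ) : Algebra ℂ (Nichols q) :=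
  inferInstanceAs (Algebra ℂ (TensorAlg n ⧸ nicholsIdeal q))

namespace NicholsAlgebra

variable {n : ℕ} (q : Fin n → Fin n → ℂ)

/-- The quotient map. -/
def proj : TensorAlg n →ₐ[ℂ] Nichols q := Ideal.Quotient.mkₐ ℂ (nicholsIdeal q)

theorem proj_surjective : Function.Surjective (proj q) := Ideal.Quotient.mk_surjective

theorem proj_eq_zero {a : TensorAlg n} : proj q a = 0 ↔ a ∈ nicholsIdeal q :=
  Ideal.Quotient.eq_zero_iff_mem

variable {q}

/-- Extend a linear map on the tensor algebra to the Nichols algebra. -/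
def descend {Z : Type*} [AddCommGroup Z] [Module ℂ Z] (f : TensorAlg n →ₗ[ℂ] Z)
    (h : ∀ a ∈ nicholsIdeal q, f a = 0) : Nichols q →ₗ[ℂ] Z :=
  ((nicholsIdeal q).restrictScalars ℂ).liftQ f h

@[simp] theorem descend_proj {Z : Type*} [AddCommGroup Z] [Module ℂ Z] (f : TensorAlg n →ₗ[ℂ] Z)
    (h : ∀ a ∈ nicholsIdeal q, f a = 0) (a : TensorAlg n) : descend f h (proj q a) = f a := rfl

theorem lin_ext {Z : Type*} [AddCommGroup Z] [Module ℂ Z] {f g : Nichols q →ₗ[ℂ] Z}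
    (h : ∀ w, f (proj q (word w)) = g (proj q (word w))) : f = g := by
  have : f ∘ₗ (proj q).toLinearMap = g ∘ₗ (proj q).toLinearMap :=
    (wordBasis n).ext fun w => by simpa using h w
  ext a
  obtain ⟨a, rfl⟩ := proj_surjective q a
  exact LinearMap.congr_fun this a

theorem lin_ext₂ {Z : Type*} [AddCommGroup Z] [Module ℂ Z]
    {f g : Nichols q ⊗[ℂ] Nichols q →ₗ[ℂ] Z}
    (h : ∀ u v, f (proj q (word u) ⊗ₜ proj q (word v)) = g (proj q (word u) ⊗ₜ proj q (word v))) :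
    f = g :=
  TensorProduct.ext (lin_ext fun u => lin_ext fun v => h u v)

theorem word_one : word (1 : FreeMonoid (Fin n)) = 1 := map_one _

theorem word_of_mul (i : Fin n) (w : FreeMonoid (Fin n)) :
    word (FreeMonoid.of i * w) = FreeAlgebra.ι ℂ i * word w := by simp [word]

variable (q)

@[simp] theorem braidedComul_one : braidedComul q 1 = 1 ⊗ₜ 1 := by
  simp [braidedComul]

@[simp] theorem braidedComul_ι_mul (i : Fin n) (a : TensorAlg n) :
    braidedComul q (FreeAlgebra.ι ℂ i * a) = primMul q i (braidedComul q a) := by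
  simp [braidedComul]

/-- The coefficient of `word v` in `braidAut q i (word v)`. -/
def braidScalar (i : Fin n) : FreeMonoid (Fin n) →* ℂ := FreeMonoid.lift (q i)

theorem braidAut_word (i : Fin n) (w : FreeMonoid (Fin n)) :
    braidAut q i (word w) = braidScalar q i w • word w := by
  induction w using FreeMonoid.inductionOn' with
  | one => simp [word_one]
  | of_mul j w ih =>
    rw [word_of_mul, map_mul, ih, map_mul]
    simp [braidAut, braidScalar, smul_smul, mul_comm]

theorem braidedComul_braidAut (i : Fin n) (a : TensorAlg n) :
    braidedComul q (braidAut q i a) =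
      TensorProduct.map (braidAut q i).toLinearMap (braidAut q i).toLinearMap
        (braidedComul q a) := by
  have : braidedComul q ∘ₗ (braidAut q i).toLinearMap =
      TensorProduct.map (braidAut q i).toLinearMap (braidAut q i).toLinearMap ∘ₗ
        braidedComul q := (wordBasis n).ext fun w => by
    rw [wordBasis_apply]
    induction w using FreeMonoid.inductionOn' with
    | one => simp [word_one]
    | of_mul j w ih =>
      simp only [LinearMap.comp_apply, AlgHom.toLinearMap_apply] at ih
      simp only [LinearMap.comp_apply, AlgHom.toLinearMap_apply, word_of_mul]
      rw [braidedComul_ι_mul, map_mul]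
      have e : braidAut q i (FreeAlgebra.ι ℂ j) = q i j • FreeAlgebra.ι ℂ j := by simp [braidAut]
      rw [e, smul_mul_assoc, map_smul, braidedComul_ι_mul, ih]
      generalize braidedComul q (word w) = z
      induction z with
      | zero => simp
      | add x y hx hy => rw [map_add, map_add, map_add, map_add, smul_add, hx, hy]
      | tmul x y =>
        have c : ∀ x, braidAut q i (braidAut q j x) = braidAut q j (braidAut q i x) := by
          intro x
          have : (braidAut q i).comp (braidAut q j) = (braidAut q j).comp (braidAut q i) := by
            ext k; simp [braidAut, smul_smul, mul_comm]
          exact AlgHom.congr_fun this x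
        simp only [primMul, mulGen, LinearMap.add_apply, TensorProduct.map_tmul,
          LinearMap.mulLeft_apply, LinearMap.id_apply, AlgHom.toLinearMap_apply, map_add, map_mul, e,
          c, smul_mul_assoc, TensorProduct.tmul_smul, ← TensorProduct.smul_tmul', smul_add]
  exact LinearMap.congr_fun this a

theorem braidedComul_coassoc (a : TensorAlg n) :
    TensorProduct.assoc ℂ _ _ _ ((braidedComul q).rTensor _ (braidedComul q a)) =
      (braidedComul q).lTensor _ (braidedComul q a) := by
  have : (TensorProduct.assoc ℂ _ _ _).toLinearMap ∘ₗ (braidedComul q).rTensor _ ∘ₗ braidedComul q =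
      (braidedComul q).lTensor _ ∘ₗ braidedComul q := (wordBasis n).ext fun w => by
    rw [wordBasis_apply]
    induction w using FreeMonoid.inductionOn' with
    | one => simp [word_one]
    | of_mul i w ih =>
      simp only [LinearMap.comp_apply, LinearEquiv.coe_coe, word_of_mul,
        braidedComul_ι_mul] at ih ⊢
      let P : TensorAlg n ⊗[ℂ] (TensorAlg n ⊗[ℂ] TensorAlg n) →ₗ[ℂ]
          TensorAlg n ⊗[ℂ] (TensorAlg n ⊗[ℂ] TensorAlg n) :=
        TensorProduct.map (mulGen i) LinearMap.id +
          TensorProduct.map (braidAut q i).toLinearMap (primMul q i)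
      have h1 : ∀ z, TensorProduct.assoc ℂ _ _ _ ((braidedComul q).rTensor _ (primMul q i z)) =
          P (TensorProduct.assoc ℂ _ _ _ ((braidedComul q).rTensor _ z)) := by
        intro z
        induction z with
        | zero => simp
        | add x y hx hy => simp only [map_add, hx, hy]
        | tmul x y =>
          have e : primMul q i (x ⊗ₜ[ℂ] y) = (FreeAlgebra.ι ℂ i * x) ⊗ₜ y +
            (braidAut q i x) ⊗ₜ (FreeAlgebra.ι ℂ i * y) := by simp [primMul, mulGen]
          rw [e, map_add, LinearMap.rTensor_tmul, LinearMap.rTensor_tmul, LinearMap.rTensor_tmul,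
            braidedComul_ι_mul, braidedComul_braidAut]
          generalize braidedComul q x = z
          induction z with
          | zero => simp
          | add x y hx hy =>
            simp only [map_add, TensorProduct.add_tmul, ← hx, ← hy] at hx hy ⊢
            abel
          | tmul x x' => simp [primMul, mulGen, P, TensorProduct.add_tmul, TensorProduct.tmul_add,
              add_assoc]
      have h2 : ∀ z, (braidedComul q).lTensor _ (primMul q i z) =
          P ((braidedComul q).lTensor _ z) := by
        intro z
        induction z with
        | zero => simp
        | add x y hx hy => simp only [map_add, hx, hy]
        | tmul x y => simp [primMul, mulGen, P]
      rw [h1, h2, ih]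
  exact LinearMap.congr_fun this a

theorem counit_braidAut (i : Fin n) (a : TensorAlg n) :
    FreeAlgebra.algebraMapInv (braidAut q i a) = FreeAlgebra.algebraMapInv (R := ℂ) a := by
  have : FreeAlgebra.algebraMapInv.comp (braidAut q i) =
      FreeAlgebra.algebraMapInv (R := ℂ) (X := Fin n) := by
    ext k; simp [braidAut, FreeAlgebra.algebraMapInv]
  exact AlgHom.congr_fun this a

theorem counit_ι (i : Fin n) : FreeAlgebra.algebraMapInv (FreeAlgebra.ι ℂ i) = 0 := by
  simp [FreeAlgebra.algebraMapInv]

theorem rTensor_counit_braidedComul (a : TensorAlg n) :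
    (FreeAlgebra.algebraMapInv (R := ℂ) (X := Fin n)).toLinearMap.rTensor _ (braidedComul q a) =
      1 ⊗ₜ a := by
  have : (FreeAlgebra.algebraMapInv (R := ℂ) (X := Fin n)).toLinearMap.rTensor _ ∘ₗ
      braidedComul q = TensorProduct.mk ℂ ℂ (TensorAlg n) 1 := (wordBasis n).ext fun w => by
    rw [wordBasis_apply]
    induction w using FreeMonoid.inductionOn' with
    | one => simp [word_one]
    | of_mul i w ih =>
      have h : ∀ z, (FreeAlgebra.algebraMapInv (R := ℂ) (X := Fin n)).toLinearMap.rTensor _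
          (primMul q i z) = (mulGen i).lTensor _
            ((FreeAlgebra.algebraMapInv (R := ℂ) (X := Fin n)).toLinearMap.rTensor _ z) := by
        intro z
        induction z with
        | zero => simp
        | add x y hx hy => simp only [map_add, hx, hy]
        | tmul x y => simp [primMul, mulGen, counit_braidAut, counit_ι]
      rw [LinearMap.comp_apply] at ih
      rw [LinearMap.comp_apply, word_of_mul, braidedComul_ι_mul, h, ih]
      simp [mulGen]
  exact LinearMap.congr_fun this a

theorem lTensor_counit_braidedComul (a : TensorAlg n) :
    (FreeAlgebra.algebraMapInv (R := ℂ) (X := Fin n)).toLinearMap.lTensor _ (braidedComul q a) =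
      a ⊗ₜ 1 := by
  have : (FreeAlgebra.algebraMapInv (R := ℂ) (X := Fin n)).toLinearMap.lTensor _ ∘ₗ
      braidedComul q = (TensorProduct.mk ℂ (TensorAlg n) ℂ).flip 1 := (wordBasis n).ext fun w => by
    rw [wordBasis_apply]
    induction w using FreeMonoid.inductionOn' with
    | one => simp [word_one]
    | of_mul i w ih =>
      have h : ∀ z, (FreeAlgebra.algebraMapInv (R := ℂ) (X := Fin n)).toLinearMap.lTensor _
          (primMul q i z) = (mulGen i).rTensor _
            ((FreeAlgebra.algebraMapInv (R := ℂ) (X := Fin n)).toLinearMap.lTensor _ z) := by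
        intro z
        induction z with
        | zero => simp
        | add x y hx hy => simp only [map_add, hx, hy]
        | tmul x y => simp [primMul, mulGen, counit_ι]
      rw [LinearMap.comp_apply] at ih
      rw [LinearMap.comp_apply, word_of_mul, braidedComul_ι_mul, h, ih]
      simp [mulGen]
  exact LinearMap.congr_fun this a

/-- The coproduct of the Nichols algebra. -/
def nicholsComul : Nichols q →ₗ[ℂ] Nichols q ⊗[ℂ] Nichols q :=
  descend (TensorProduct.map (proj q).toLinearMap (proj q).toLinearMap ∘ₗ braidedComul q)
    fun a ha => (isGradedBiideal_nicholsIdeal q).comul_mem a ha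

theorem counit_eq (a : TensorAlg n) :
    FreeAlgebra.algebraMapInv a = (wordBasis n).repr a 1 := by
  have : (FreeAlgebra.algebraMapInv (R := ℂ) (X := Fin n)).toLinearMap =
      (wordBasis n).coord 1 := (wordBasis n).ext fun w => by
    rw [Module.Basis.coord_apply, Module.Basis.repr_self, wordBasis_apply]
    induction w using FreeMonoid.inductionOn' with
    | one => simp [word_one]
    | of_mul i w _ =>
      rw [Finsupp.single_eq_of_ne, word_of_mul, AlgHom.toLinearMap_apply, map_mul, counit_ι,
        zero_mul]
      exact fun h => by simpa using congrArg (fun w => w.toList.length) h.symm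
  exact LinearMap.congr_fun this a

/-- The counit of the Nichols algebra. -/
def nicholsCounit : Nichols q →ₗ[ℂ] ℂ :=
  descend (FreeAlgebra.algebraMapInv (R := ℂ) (X := Fin n)).toLinearMap fun a ha => by
    rw [AlgHom.toLinearMap_apply, counit_eq]
    exact (isGradedBiideal_nicholsIdeal q).degree_ge_two a ha 1 (by simp)

theorem nicholsComul_proj (a : TensorAlg n) : nicholsComul q (proj q a) =
    TensorProduct.map (proj q).toLinearMap (proj q).toLinearMap (braidedComul q a) := rfl

theorem nicholsCounit_proj (a : TensorAlg n) :
    nicholsCounit q (proj q a) = FreeAlgebra.algebraMapInv a := rfl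

/-- The quotient map as a linear map. -/
abbrev projₗ : TensorAlg n →ₗ[ℂ] Nichols q := (proj q).toLinearMap

theorem nicholsComul_comp : nicholsComul q ∘ₗ projₗ q =
    TensorProduct.map (projₗ q) (projₗ q) ∘ₗ braidedComul q := rfl

theorem nicholsCounit_comp : nicholsCounit q ∘ₗ projₗ q =
    (FreeAlgebra.algebraMapInv (R := ℂ) (X := Fin n)).toLinearMap := rfl

theorem nicholsComul_coassoc (a : Nichols q) :
    TensorProduct.assoc ℂ _ _ _ ((nicholsComul q).rTensor _ (nicholsComul q a)) =
      (nicholsComul q).lTensor _ (nicholsComul q a) := by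
  obtain ⟨a, rfl⟩ := proj_surjective q a
  rw [nicholsComul_proj]
  have h1 : (TensorProduct.assoc ℂ (Nichols q) (Nichols q) (Nichols q)).toLinearMap ∘ₗ
      (nicholsComul q).rTensor _ ∘ₗ TensorProduct.map (projₗ q) (projₗ q) =
      TensorProduct.map (projₗ q) (TensorProduct.map (projₗ q) (projₗ q)) ∘ₗ
        (TensorProduct.assoc ℂ _ _ _).toLinearMap ∘ₗ (braidedComul q).rTensor _ := by
    rw [LinearMap.rTensor_comp_map, nicholsComul_comp, ← LinearMap.comp_assoc _ _ (TensorProduct.map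
      _ _), TensorProduct.map_map_comp_assoc_eq, LinearMap.comp_assoc, LinearMap.map_comp_rTensor]
  have h2 : (nicholsComul q).lTensor _ ∘ₗ TensorProduct.map (projₗ q) (projₗ q) =
      TensorProduct.map (projₗ q) (TensorProduct.map (projₗ q) (projₗ q)) ∘ₗ
        (braidedComul q).lTensor _ := by
    rw [LinearMap.lTensor_comp_map, nicholsComul_comp, LinearMap.map_comp_lTensor]
  have h1' := LinearMap.congr_fun h1 (braidedComul q a)
  have h2' := LinearMap.congr_fun h2 (braidedComul q a)
  simp only [LinearMap.comp_apply, LinearEquiv.coe_coe] at h1' h2'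
  rw [h1', h2', braidedComul_coassoc]

theorem rTensor_nicholsCounit (a : Nichols q) :
    (nicholsCounit q).rTensor _ (nicholsComul q a) = 1 ⊗ₜ a := by
  obtain ⟨a, rfl⟩ := proj_surjective q a
  rw [nicholsComul_proj, ← LinearMap.comp_apply, LinearMap.rTensor_comp_map, nicholsCounit_comp,
    ← LinearMap.lTensor_comp_rTensor, LinearMap.comp_apply, rTensor_counit_braidedComul]
  rfl

theorem lTensor_nicholsCounit (a : Nichols q) :
    (nicholsCounit q).lTensor _ (nicholsComul q a) = a ⊗ₜ 1 := by
  obtain ⟨a, rfl⟩ := proj_surjective q a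
  rw [nicholsComul_proj, ← LinearMap.comp_apply, LinearMap.lTensor_comp_map, nicholsCounit_comp,
    ← LinearMap.rTensor_comp_lTensor, LinearMap.comp_apply, lTensor_counit_braidedComul]
  rfl

end NicholsAlgebra

end NicholsAlgebras

noncomputable section NicholsObject

namespace NicholsAlgebra

open WeightModule

variable {C : Type u} [CommRing C] [HopfAlgebra ℂ C] [Coalgebra.IsCocomm ℂ C]
variable {n : ℕ} (γ : Fin n → CharGroup C)

/-- The weight of a monomial, where `x_i` has weight `γ_i`. -/
def charWord : FreeMonoid (Fin n) →* CharGroup C := FreeMonoid.lift γ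

/-- The action of `C` on the tensor algebra, where `x_i` has weight `γ_i`. -/
def charAct : C →ₐ[ℂ] Module.End ℂ (TensorAlg n) where
  toFun c := (wordBasis n).constr ℂ fun w => charWord γ w c • word w
  map_one' := (wordBasis n).ext fun w => by
    rw [Module.Basis.constr_basis, map_one, one_smul, wordBasis_apply, Module.End.one_apply]
  map_mul' c d := (wordBasis n).ext fun w => by
    rw [Module.End.mul_apply, Module.Basis.constr_basis, Module.Basis.constr_basis, map_smul,
      ← wordBasis_apply, Module.Basis.constr_basis, wordBasis_apply, map_mul, smul_smul, mul_comm]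
  map_zero' := (wordBasis n).ext fun w => by
    rw [Module.Basis.constr_basis, map_zero, zero_smul, LinearMap.zero_apply]
  map_add' c d := (wordBasis n).ext fun w => by
    rw [LinearMap.add_apply, Module.Basis.constr_basis, Module.Basis.constr_basis,
      Module.Basis.constr_basis, map_add, add_smul]
  commutes' r := (wordBasis n).ext fun w => by
    rw [Module.Basis.constr_basis, Module.algebraMap_end_apply, wordBasis_apply]
    congr 1
    exact AlgHomClass.commutes (charWord γ w).ofConv r

theorem charAct_word (c : C) (w : FreeMonoid (Fin n)) :
    charAct γ c (word w) = charWord γ w c • word w := by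
  conv_lhs => rw [← wordBasis_apply]
  exact Module.Basis.constr_basis _ _ _ _

theorem component_word (d : Multiset (Fin n)) (w : FreeMonoid (Fin n)) :
    component d (word w) = if (w.toList : Multiset (Fin n)) = d then word w else 0 := by
  conv_lhs => rw [← wordBasis_apply]
  exact Module.Basis.constr_basis _ _ _ _

theorem charWord_eq (w : FreeMonoid (Fin n)) :
    charWord γ w = ((w.toList : Multiset (Fin n)).map γ).prod := by
  rw [charWord, FreeMonoid.lift_apply, Multiset.map_coe, Multiset.prod_coe]

theorem charAct_eq (c : C) (a : TensorAlg n) : ∃ S : Finset (Multiset (Fin n)),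
    charAct γ c a = ∑ d ∈ S, (d.map γ).prod c • component d a := by
  refine ⟨((wordBasis n).repr a).support.image fun w => (w.toList : Multiset (Fin n)), ?_⟩
  generalize hS : ((wordBasis n).repr a).support.image
    (fun w => (w.toList : Multiset (Fin n))) = S
  conv_lhs => rw [← (wordBasis n).linearCombination_repr a]
  conv_rhs => enter [2, d]; rw [← (wordBasis n).linearCombination_repr a]
  simp only [Finsupp.linearCombination_apply, Finsupp.sum, map_sum, map_smul, wordBasis_apply,
    charAct_word, component_word, Finset.smul_sum]
  rw [Finset.sum_comm]
  refine Finset.sum_congr rfl fun w hw => ?_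
  rw [Finset.sum_eq_single (w.toList : Multiset (Fin n))]
  · rw [if_pos rfl, charWord_eq, smul_comm]
  · intro d _ hd
    rw [if_neg hd.symm, smul_zero, smul_zero]
  · intro h
    exact absurd (hS ▸ Finset.mem_image_of_mem _ hw) h

theorem charAct_mem (q : Fin n → Fin n → ℂ) (c : C) {a : TensorAlg n} (ha : a ∈ nicholsIdeal q) :
    charAct γ c a ∈ nicholsIdeal q := by
  obtain ⟨S, hS⟩ := charAct_eq γ c a
  rw [hS]
  exact sum_mem fun d _ => ((nicholsIdeal q).restrictScalars ℂ).smul_mem _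
    ((isGradedBiideal_nicholsIdeal q).component_mem d a ha)

theorem projₗ_charAct (q : Fin n → Fin n → ℂ) (c : C) :
    ∀ a ∈ nicholsIdeal q, (projₗ q ∘ₗ charAct γ c) a = 0 :=
  fun _ ha => (proj_eq_zero q).2 (charAct_mem γ q c ha)

/-- The action of `C` on the Nichols algebra, where `x_i` has weight `γ_i`. -/
def nicholsAct (q : Fin n → Fin n → ℂ) : C →ₐ[ℂ] Module.End ℂ (Nichols q) where
  toFun c := descend (projₗ q ∘ₗ charAct γ c) (projₗ_charAct γ q c)
  map_one' := lin_ext fun w => by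
    rw [descend_proj, map_one]; rfl
  map_mul' c d := lin_ext fun w => by
    rw [descend_proj, map_mul]; rfl
  map_zero' := lin_ext fun w => by
    rw [descend_proj, map_zero]; rfl
  map_add' c d := lin_ext fun w => by
    rw [descend_proj, map_add]; rfl
  commutes' r := lin_ext fun w => by
    rw [descend_proj, AlgHomClass.commutes]; rfl

theorem nicholsAct_proj (q : Fin n → Fin n → ℂ) (c : C) (a : TensorAlg n) :
    nicholsAct γ q c (proj q a) = proj q (charAct γ c a) := rfl

theorem nicholsAct_word (q : Fin n → Fin n → ℂ) (c : C) (w : FreeMonoid (Fin n)) :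
    nicholsAct γ q c (proj q (word w)) = charWord γ w c • proj q (word w) := by
  rw [nicholsAct_proj, charAct_word, map_smul]

theorem diag_word (q : Fin n → Fin n → ℂ) (c : C) (u v : FreeMonoid (Fin n)) :
    diag (nicholsAct γ q) (nicholsAct γ q) c (proj q (word u) ⊗ₜ[ℂ] proj q (word v)) =
      (charWord γ u * charWord γ v) c • (proj q (word u) ⊗ₜ[ℂ] proj q (word v)) :=
  tmul_mem_weightSpace (j := BialgHom.id ℂ C) (r := nicholsAct γ q) (s := nicholsAct γ q)
    (fun c => nicholsAct_word γ q c u) (fun c => nicholsAct_word γ q c v) c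

variable (σ : CharGroup C →* CharGroup C →* ℂˣ)

/-- The braiding matrix `q_{ij} = σ(γ_i, γ_j)` of `X = ⨁ ℂ_{γ_i}`. -/
def braidingMatrix (i j : Fin n) : ℂ := (σ (γ i) (γ j) : ℂˣ)

theorem iSup_weightSpace_nichols (q : Fin n → Fin n → ℂ) :
    ⨆ χ, weightSpace ((nicholsAct γ q).comp (BialgHom.id ℂ C : C →ₐ[ℂ] C)) χ = ⊤ := by
  rw [eq_top_iff]
  rintro a -
  obtain ⟨a, rfl⟩ := proj_surjective q a
  have ha : a ∈ Submodule.span ℂ (Set.range (wordBasis n)) := by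
    rw [(wordBasis n).span_eq]; exact Submodule.mem_top
  induction ha using Submodule.span_induction with
  | mem x hx =>
    obtain ⟨w, rfl⟩ := hx
    rw [wordBasis_apply]
    exact Submodule.mem_iSup_of_mem (charWord γ w) fun c => nicholsAct_word γ q c w
  | zero => rw [map_zero]; exact zero_mem _
  | add x y _ _ hx hy => rw [map_add]; exact add_mem hx hy
  | smul r x _ hx => rw [map_smul]; exact Submodule.smul_mem _ _ hx

variable [FiniteDimensional ℂ (Nichols (braidingMatrix γ σ))]

/-- The Nichols algebra `𝔅(X)`, for `X = ⨁ ℂ_{γ_i}`, as an object of `Vect_Γ`. -/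
def nicholsObj : VectGraded σ :=
  show WeightModule (BialgHom.id ℂ C) from
  { V := Nichols (braidingMatrix γ σ)
    ρ := nicholsAct γ (braidingMatrix γ σ)
    iSup_weightSpace := iSup_weightSpace_nichols γ _ }

/-- `nicholsObj` without its braiding. -/
abbrev nicholsMod : WeightModule (BialgHom.id ℂ C) := nicholsObj γ σ

theorem braidedComul_word_mem (q : Fin n → Fin n → ℂ) (w : FreeMonoid (Fin n)) :
    braidedComul q (word w) ∈ Submodule.span ℂ
      {z | ∃ u v, charWord γ u * charWord γ v = charWord γ w ∧ z = word u ⊗ₜ[ℂ] word v} := by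
  induction w using FreeMonoid.inductionOn' with
  | one =>
    rw [word_one, braidedComul_one]
    exact Submodule.subset_span ⟨1, 1, by simp, by rw [word_one]⟩
  | of_mul i w ih =>
    rw [word_of_mul, braidedComul_ι_mul]
    generalize braidedComul q (word w) = z at ih
    induction ih using Submodule.span_induction with
    | zero => rw [map_zero]; exact zero_mem _
    | add x y _ _ hx hy => rw [map_add]; exact add_mem hx hy
    | smul r x _ hx => rw [map_smul]; exact Submodule.smul_mem _ _ hx
    | mem z hz =>
      obtain ⟨u, v, h, rfl⟩ := hz
      have e : primMul q i (word u ⊗ₜ[ℂ] word v) = word (FreeMonoid.of i * u) ⊗ₜ word v +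
          braidScalar q i u • (word u ⊗ₜ word (FreeMonoid.of i * v)) := by
        rw [word_of_mul, word_of_mul, TensorProduct.smul_tmul', ← braidAut_word]
        simp [primMul, mulGen]
      rw [e]
      refine add_mem (Submodule.subset_span ⟨_, _, ?_, rfl⟩)
        (Submodule.smul_mem _ _ (Submodule.subset_span ⟨_, _, ?_, rfl⟩))
      · rw [map_mul, map_mul, mul_assoc, h]
      · rw [map_mul, map_mul, mul_left_comm, h]

theorem mul_comm_act (q : Fin n → Fin n → ℂ) (c : C) (x : Nichols q ⊗[ℂ] Nichols q) :
    LinearMap.mul' ℂ (Nichols q) (diag (nicholsAct γ q) (nicholsAct γ q) c x) =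
      nicholsAct γ q c (LinearMap.mul' ℂ (Nichols q) x) := by
  have : LinearMap.mul' ℂ (Nichols q) ∘ₗ diag (nicholsAct γ q) (nicholsAct γ q) c =
      nicholsAct γ q c ∘ₗ LinearMap.mul' ℂ (Nichols q) := lin_ext₂ fun u v => by
    rw [LinearMap.comp_apply, diag_word, map_smul, LinearMap.comp_apply, LinearMap.mul'_apply,
      ← map_mul (proj q), ← map_mul word, nicholsAct_word, map_mul (charWord γ)]
  exact LinearMap.congr_fun this x

theorem one_comm_act (q : Fin n → Fin n → ℂ) (c : C) (x : ℂ) :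
    algebraMap ℂ (Nichols q) (Coalgebra.counit (R := ℂ) c * x) =
      nicholsAct γ q c (algebraMap ℂ (Nichols q) x) := by
  have h := nicholsAct_word γ q c 1
  rw [word_one, map_one (proj q), map_one (charWord γ)] at h
  rw [Algebra.algebraMap_eq_smul_one, Algebra.algebraMap_eq_smul_one, map_smul, h, smul_smul,
    mul_comm]
  rfl

theorem comul_comm_act (q : Fin n → Fin n → ℂ) (c : C) (x : Nichols q) :
    nicholsComul q (nicholsAct γ q c x) =
      diag (nicholsAct γ q) (nicholsAct γ q) c (nicholsComul q x) := by
  have : nicholsComul q ∘ₗ nicholsAct γ q c =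
      diag (nicholsAct γ q) (nicholsAct γ q) c ∘ₗ nicholsComul q := lin_ext fun w => by
    rw [LinearMap.comp_apply, nicholsAct_word, map_smul, LinearMap.comp_apply, nicholsComul_proj]
    have h := braidedComul_word_mem γ q w
    generalize braidedComul q (word w) = z at h
    induction h using Submodule.span_induction with
    | zero => simp only [map_zero, smul_zero]
    | add x y _ _ hx hy => simp only [map_add, smul_add, hx, hy]
    | smul r x _ hx => simp only [map_smul]; rw [smul_comm, hx]
    | mem z hz =>
      obtain ⟨u, v, h, rfl⟩ := hz
      rw [← h]
      exact (diag_word γ q c u v).symm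
  exact LinearMap.congr_fun this x

theorem counit_comm_act (q : Fin n → Fin n → ℂ) (c : C) (x : Nichols q) :
    nicholsCounit q (nicholsAct γ q c x) = Coalgebra.counit (R := ℂ) c * nicholsCounit q x := by
  have : nicholsCounit q ∘ₗ nicholsAct γ q c = Coalgebra.counit (R := ℂ) c • nicholsCounit q :=
    lin_ext fun w => by
      rw [LinearMap.comp_apply, nicholsAct_word, map_smul, LinearMap.smul_apply,
        nicholsCounit_proj]
      induction w using FreeMonoid.inductionOn' with
      | one => rw [map_one (charWord γ)]; rfl
      | of_mul i w _ =>
        have e : FreeAlgebra.algebraMapInv (R := ℂ) (word (FreeMonoid.of i * w)) = 0 := by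
          rw [word_of_mul, map_mul, counit_ι, zero_mul]
        rw [e, smul_zero, smul_zero]
  exact LinearMap.congr_fun this x

/-- The multiplication of the Nichols algebra as a morphism of `Vect_Γ`. -/
def mulHom : nicholsMod γ σ ⊗ nicholsMod γ σ ⟶ nicholsMod γ σ :=
  ⟨LinearMap.mul' ℂ (Nichols (braidingMatrix γ σ)), mul_comm_act γ _⟩

/-- The unit of the Nichols algebra as a morphism of `Vect_Γ`. -/
def oneHom : 𝟙_ (WeightModule (BialgHom.id ℂ C)) ⟶ nicholsMod γ σ :=
  ⟨Algebra.linearMap ℂ (Nichols (braidingMatrix γ σ)), one_comm_act γ _⟩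

/-- The coproduct of the Nichols algebra as a morphism of `Vect_Γ`. -/
def comulHom : nicholsMod γ σ ⟶ nicholsMod γ σ ⊗ nicholsMod γ σ :=
  ⟨nicholsComul (braidingMatrix γ σ), comul_comm_act γ _⟩

/-- The counit of the Nichols algebra as a morphism of `Vect_Γ`. -/
def counitHom : nicholsMod γ σ ⟶ 𝟙_ (WeightModule (BialgHom.id ℂ C)) :=
  ⟨nicholsCounit (braidingMatrix γ σ), counit_comm_act γ _⟩

instance : MonObj (nicholsObj γ σ) :=
  show MonObj (nicholsMod γ σ) from
  { one := oneHom γ σ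
    mul := mulHom γ σ
    one_mul := WeightModule.hom_ext (TensorProduct.ext' fun (r : ℂ) (a : Nichols _) =>
      (Algebra.smul_def r a).symm)
    mul_one := WeightModule.hom_ext (TensorProduct.ext' fun (a : Nichols _) (r : ℂ) =>
      (Algebra.smul_def' r a).trans (Algebra.commutes r a) |>.symm)
    mul_assoc := WeightModule.hom_ext (TensorProduct.ext_threefold
      fun (a b c : Nichols (braidingMatrix γ σ)) => _root_.mul_assoc a b c) }

instance : ComonObj (nicholsObj γ σ) :=
  show ComonObj (nicholsMod γ σ) from
  { counit := counitHom γ σ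
    comul := comulHom γ σ
    counit_comul := WeightModule.hom_ext (LinearMap.ext fun a => rTensor_nicholsCounit _ a)
    comul_counit := WeightModule.hom_ext (LinearMap.ext fun a => lTensor_nicholsCounit _ a)
    comul_assoc := WeightModule.hom_ext (LinearMap.ext fun a => (nicholsComul_coassoc _ a).symm) }

end NicholsAlgebra

end NicholsObject

noncomputable section QuantumGroup

/-- A bicharacter is nondegenerate if its symmetrization `(χ, ψ) ↦ σ(χ, ψ) σ(ψ, χ)`, the double
braiding, has trivial radical. -/
def IsNondegenerateBichar {G : Type*} [CommGroup G] (σ : G →* G →* ℂˣ) : Prop :=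
  ∀ χ, (∀ ψ, σ χ ψ * σ ψ χ = 1) → χ = 1

/-- A braiding is nondegenerate if every transparent object (whose double braiding with all objects
is trivial) is a finite direct sum of copies of the unit object. -/
def IsNondegenerateBraiding (D : Type u) [Category.{v} D] [MonoidalCategory D]
    [BraidedCategory D] : Prop :=
  ∀ X : D, (∀ Y, (β_ X Y).hom ≫ (β_ Y X).hom = 𝟙 (X ⊗ Y)) →
    ∃ (k : ℕ) (f : Fin k → (𝟙_ D ⟶ X)), Nonempty (Limits.IsColimit (Limits.Cofan.mk X f))

/-- A Hopf algebra structure on a given algebra `A`. -/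
structure HopfStructure (A : Type u) [Ring A] [Algebra ℂ A] where
  comul : A →ₐ[ℂ] A ⊗[ℂ] A
  counit : A →ₐ[ℂ] ℂ
  antipode : A →ₗ[ℂ] A
  coassoc : (Algebra.TensorProduct.assoc ℂ ℂ ℂ A A A : _ →ₐ[ℂ] _).comp
      ((Algebra.TensorProduct.map comul (AlgHom.id ℂ A)).comp comul) =
    (Algebra.TensorProduct.map (AlgHom.id ℂ A) comul).comp comul
  rTensor_counit : (Algebra.TensorProduct.map counit (AlgHom.id ℂ A)).comp comul =
    (Algebra.TensorProduct.lid ℂ A).symm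
  lTensor_counit : (Algebra.TensorProduct.map (AlgHom.id ℂ A) counit).comp comul =
    (Algebra.TensorProduct.rid ℂ ℂ A).symm
  antipode_left : LinearMap.mul' ℂ A ∘ₗ antipode.rTensor A ∘ₗ comul.toLinearMap =
    Algebra.linearMap ℂ A ∘ₗ counit.toLinearMap
  antipode_right : LinearMap.mul' ℂ A ∘ₗ antipode.lTensor A ∘ₗ comul.toLinearMap =
    Algebra.linearMap ℂ A ∘ₗ counit.toLinearMap

/-- The Hopf algebra given by a Hopf algebra structure. -/
@[reducible]
def HopfStructure.toHopfAlgebra {A : Type u} [Ring A] [Algebra ℂ A] (H : HopfStructure A) :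
    HopfAlgebra ℂ A :=
  letI : Bialgebra ℂ A :=
    Bialgebra.ofAlgHom H.comul H.counit H.coassoc H.rTensor_counit H.lTensor_counit
  { antipode := H.antipode
    mul_antipode_rTensor_comul := H.antipode_left
    mul_antipode_lTensor_comul := H.antipode_right }

namespace WeightModule

variable {C : Type u} [CommRing C] [HopfAlgebra ℂ C] [Coalgebra.IsCocomm ℂ C]
variable {A : Type v} [Ring A] [Bialgebra ℂ A]

/-- The restriction of a weight module to `C`. -/
def restrict (j : C →ₐc[ℂ] A) (σ : CharGroup C →* CharGroup C →* ℂˣ) :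
    WeightModule j ⥤ VectGraded σ where
  obj M := show WeightModule (BialgHom.id ℂ C) from
    { V := M.V
      ρ := M.ρ.comp (j : C →ₐ[ℂ] A)
      iSup_weightSpace := M.iSup_weightSpace }
  map f := ⟨lin (j := j) f, fun c x => comm (j := j) f (j c) x⟩

end WeightModule

open NicholsAlgebra

variable {C : Type u} [CommRing C] [HopfAlgebra ℂ C] [Coalgebra.IsCocomm ℂ C] {n : ℕ}

/-- The map `c ↦ χ(c₍₁₎) c₍₂₎`. -/
def charShift (χ : CharGroup C) : C →ₗ[ℂ] C :=
  (TensorProduct.lid ℂ C).toLinearMap ∘ₗ χ.ofConv.toLinearMap.rTensor C ∘ₗ Coalgebra.comul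

/-- Generators of the algebra `U`: the elements of `C`, the `x_i` and the `x_i^*`. -/
inductive QuantumGen (C : Type u) (n : ℕ) : Type u
  | ofC (c : C) : QuantumGen C n
  | x (i : Fin n) : QuantumGen C n
  | y (i : Fin n) : QuantumGen C n

namespace QuantumGroup

/-- The free algebra on the generators. -/
abbrev Free (C : Type u) (n : ℕ) := FreeAlgebra ℂ (QuantumGen C n)

/-- The generator for an element of `C`. -/
abbrev cc (n : ℕ) (c : C) : Free C n := FreeAlgebra.ι ℂ (QuantumGen.ofC c)

/-- The generator `x_i`. -/
abbrev xx (C : Type u) {n : ℕ} (i : Fin n) : Free C n := FreeAlgebra.ι ℂ (QuantumGen.x i)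

/-- The generator `x_i^*`. -/
abbrev yy (C : Type u) {n : ℕ} (i : Fin n) : Free C n := FreeAlgebra.ι ℂ (QuantumGen.y i)

variable (σ : CharGroup C →* CharGroup C →* ℂˣ) (γ : Fin n → CharGroup C) (g g' : Fin n → C)

/-- The defining relations: those of `C`, of `𝔅(X)` and of `𝔅(X^*)`, where `X^*` has the basis
`x_i^*` in degrees `γ_i⁻¹ = γ_i ∘ S`, the commutation relations
`c x_i = γ_i(c₍₁₎) x_i c₍₂₎` and `c x_i^* = γ_i(S(c₍₁₎)) x_i^* c₍₂₎`, and the linking relation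
`x_j^* x_i - γ_j(g_i) x_i x_j^* = δ_{ij} (1 - g'_i g_i)`. -/
inductive Rel : Free C n → Free C n → Prop
  | add (c d : C) : Rel (cc n (c + d)) (cc n c + cc n d)
  | mul (c d : C) : Rel (cc n (c * d)) (cc n c * cc n d)
  | scalar (r : ℂ) : Rel (cc n (algebraMap ℂ C r)) (algebraMap ℂ (Free C n) r)
  | nichols (a : TensorAlg n) (ha : a ∈ nicholsIdeal (braidingMatrix γ σ)) :
      Rel (FreeAlgebra.lift ℂ (xx C) a) 0
  | nicholsDual (a : TensorAlg n)
      (ha : a ∈ nicholsIdeal (braidingMatrix (fun i => (γ i)⁻¹) σ)) :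
      Rel (FreeAlgebra.lift ℂ (yy C) a) 0
  | commX (c : C) (i : Fin n) : Rel (cc n c * xx C i) (xx C i * cc n (charShift (γ i) c))
  | commY (c : C) (i : Fin n) : Rel (cc n c * yy C i) (yy C i * cc n (charShift (γ i)⁻¹ c))
  | link (i j : Fin n) : Rel (yy C j * xx C i - (γ j) (g i) • (xx C i * yy C j))
      (if i = j then 1 - cc n (g' i * g i) else 0)

end QuantumGroup

open QuantumGroup

/-- The algebra `U` with generators `C`, `x_i`, `x_i^*` and the relations `QuantumGroup.Rel`. -/
def QuantumGroup (σ : CharGroup C →* CharGroup C →* ℂˣ) (γ : Fin n → CharGroup C)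
    (g g' : Fin n → C) := RingQuot (Rel σ γ g g')

namespace QuantumGroup

variable (σ : CharGroup C →* CharGroup C →* ℂˣ) (γ : Fin n → CharGroup C) (g g' : Fin n → C)

instance : Ring (QuantumGroup σ γ g g') := inferInstanceAs (Ring (RingQuot (Rel σ γ g g')))

instance : Algebra ℂ (QuantumGroup σ γ g g') :=
  inferInstanceAs (Algebra ℂ (RingQuot (Rel σ γ g g')))

/-- The quotient map. -/
def mk : Free C n →ₐ[ℂ] QuantumGroup σ γ g g' := RingQuot.mkAlgHom ℂ (Rel σ γ g g')

theorem mk_rel {a b : Free C n} (h : Rel σ γ g g' a b) : mk σ γ g g' a = mk σ γ g g' b :=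
  RingQuot.mkAlgHom_rel ℂ h

/-- The element `x_i` of `U`. -/
def x (i : Fin n) : QuantumGroup σ γ g g' := mk σ γ g g' (xx C i)

/-- The element `x_i^*` of `U`. -/
def y (i : Fin n) : QuantumGroup σ γ g g' := mk σ γ g g' (yy C i)

/-- The homomorphism `C → U`. -/
def ofC : C →ₐ[ℂ] QuantumGroup σ γ g g' where
  toFun c := mk σ γ g g' (cc n c)
  map_one' := by
    have h := mk_rel σ γ g g' (.scalar 1)
    rwa [map_one, map_one, map_one] at h
  map_mul' c d := by rw [mk_rel σ γ g g' (.mul c d), map_mul]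
  map_zero' := by
    have h := mk_rel σ γ g g' (.scalar 0)
    rwa [map_zero, map_zero, map_zero] at h
  map_add' c d := by rw [mk_rel σ γ g g' (.add c d), map_add]
  commutes' r := by rw [mk_rel σ γ g g' (.scalar r), AlgHomClass.commutes]

/-- The homomorphism `𝔅(X) → U`. -/
def ofNichols : Nichols (braidingMatrix γ σ) →ₐ[ℂ] QuantumGroup σ γ g g' :=
  Ideal.Quotient.liftₐ (nicholsIdeal (braidingMatrix γ σ))
    ((mk σ γ g g').comp (FreeAlgebra.lift ℂ (xx C)))
    fun a ha => (mk_rel σ γ g g' (.nichols a ha)).trans (map_zero _)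

/-- The homomorphism `𝔅(X^*) → U`. -/
def ofNicholsDual : Nichols (braidingMatrix (fun i => (γ i)⁻¹) σ) →ₐ[ℂ] QuantumGroup σ γ g g' :=
  Ideal.Quotient.liftₐ (nicholsIdeal (braidingMatrix (fun i => (γ i)⁻¹) σ))
    ((mk σ γ g g').comp (FreeAlgebra.lift ℂ (yy C)))
    fun a ha => (mk_rel σ γ g g' (.nicholsDual a ha)).trans (map_zero _)

/-- The linear map `𝔅(X) ⊗ 𝔅(X^*) ⊗ C → U`, `a ⊗ b ⊗ c ↦ a b c`. -/
def mulMap : Nichols (braidingMatrix γ σ) ⊗[ℂ] Nichols (braidingMatrix (fun i => (γ i)⁻¹) σ) ⊗[ℂ] C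
    →ₗ[ℂ] QuantumGroup σ γ g g' :=
  LinearMap.mul' ℂ _ ∘ₗ TensorProduct.map
    (LinearMap.mul' ℂ _ ∘ₗ TensorProduct.map (ofNichols σ γ g g').toLinearMap
      (ofNicholsDual σ γ g g').toLinearMap) (ofC σ γ g g').toLinearMap

/-- The stated coproduct, counit and antipode on the generators of `U`. -/
structure IsStandard (H : HopfStructure (QuantumGroup σ γ g g')) : Prop where
  comul_ofC : ∀ c, H.comul (ofC σ γ g g' c) =
    TensorProduct.map (ofC σ γ g g').toLinearMap (ofC σ γ g g').toLinearMap
      (Coalgebra.comul (R := ℂ) c)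
  counit_ofC : ∀ c, H.counit (ofC σ γ g g' c) = Coalgebra.counit (R := ℂ) c
  antipode_ofC : ∀ c, H.antipode (ofC σ γ g g' c) = ofC σ γ g g' (HopfAlgebra.antipode ℂ c)
  comul_x : ∀ i, H.comul (x σ γ g g' i) =
    ofC σ γ g g' (g i) ⊗ₜ x σ γ g g' i + x σ γ g g' i ⊗ₜ 1
  comul_y : ∀ i, H.comul (y σ γ g g' i) =
    ofC σ γ g g' (g' i) ⊗ₜ y σ γ g g' i + y σ γ g g' i ⊗ₜ 1
  counit_x : ∀ i, H.counit (x σ γ g g' i) = 0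
  counit_y : ∀ i, H.counit (y σ γ g g' i) = 0
  antipode_x : ∀ i, H.antipode (x σ γ g g' i) =
    -(ofC σ γ g g' (HopfAlgebra.antipode ℂ (g i)) * x σ γ g g' i)
  antipode_y : ∀ i, H.antipode (y σ γ g g' i) =
    -(ofC σ γ g g' (HopfAlgebra.antipode ℂ (g' i)) * y σ γ g g' i)

end QuantumGroup

end QuantumGroup

/-!
Let `q` be the braiding matrix of `X`, and write `y_j` for the generators `x_j^*` of `U` and `g'_j`
for the grouplike elements `\bar g_j`.

**The form.** The tensor algebra carries skew derivations `derivR q i` and `derivL q i`, which split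
off a generator `x_i` on the right and on the left. Let `(·, ·)` be the bilinear form `form q` with
`(x_i b, v) = (b, derivR q i v)`. It is symmetric because the two kinds of derivations commute, and
it pairs the product with the braided coproduct (`form_mul`). Its radical is a graded biideal, and
it contains all other graded biideals, so it is the defining ideal of the Nichols algebra
(`nicholsIdeal_eq`). Thus `𝔅(X)` has a nondegenerate form `nForm`. The braiding matrices of `X` and
of `X^*` coincide, and replacing the braiding by its inverse does not change the ideal
(`nicholsIdeal_invBraiding`). So the generators of `𝔅(X^*)` may be regarded as acting on `𝔅(X)` by
skew derivations.

**The Hopf algebra `U`.** An algebra homomorphism from `U` is a choice of images of the generators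
subject to the relations (`Realization.lift`). To define the coproduct and the antipode, one has to
see that sums of `q`-commuting solutions of the relations of `𝔅(X)` are solutions again, as the ideal
is a coideal (`eq_zero_of_qcommute`), and that the ideal is stable under the braided antipode
(`lift_op_eq_zero`).

**The triangular decomposition.** The products `a b c` span `U` by the commutation relations. They
are linearly independent since `U` acts on the module `𝔅(X) ⊗ M` induced from any representation `M`
of the algebra generated by `C` and `𝔅(X^*)` (`BorelRep.ind`), where `y_j` acts on `𝔅(X)` by the
difference of the two skew derivations, twisted by the `g_j` and `g'_j`. For `M = 𝔅(X^*) ⊗ C` the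
product `a b c` maps `1 ⊗ (1 ⊗ 1)` to `a ⊗ (b ⊗ c)` (`mulMap_bijective`).

**Yetter-Drinfeld modules.** A coaction of `𝔅(X)` on `V` gives an action of `𝔅(X^*)` by
`b m = (b, m₍₋₁₎) m₍₀₎` (`IsRepOf`). As `𝔅(X)` is finite-dimensional, the form identifies
`𝔅(X) ⊗ V` with `Hom(𝔅(X), V)` (`sliceEquiv`), so the coaction can be recovered. The Yetter-Drinfeld
condition has to be checked for `h = x_i` only (`compat_of_isGenCompat`), where after pairing with
the elements of `𝔅(X^*)` it becomes the linking relation of `U` (`IsRepOf.isGenCompat`,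
`IsYetterDrinfeld.rep`). Diagonal action and codiagonal coaction correspond to the tensor product of
representations of `U` (`IsRepOf.tensor`). This gives an equivalence `toRep` of tensor categories,
which is the identity on underlying spaces. The map `m ⊗ w ↦ m₍₋₁₎ w ⊗ m₍₀₎` is `U`-linear
(`rep_braidL`), and it satisfies the hexagon identities. It is invertible, since long monomials
vanish in `𝔅(X)` and so the map is unitriangular up to scalars (`braidL_bijective`). Hence it is a
braiding for the representations of `U`, and therefore for Yetter-Drinfeld modules.

**Nondegeneracy.** If `σ` is nondegenerate, then testing a transparent representation against the
highest weight vectors of the Verma modules shows that all its weights are trivial. Since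
`γ_i ≠ 1` (otherwise `[∂_i, x_i] = 1` on the finite-dimensional space `𝔅(X)`), the `x_i` and `y_i`
act by zero, and the representation is trivial (`isNondegenerateBraiding_rep`). Nondegeneracy is
transported by the braided equivalence (`IsNondegenerateBraiding.of_functor`). Conversely, a
character in the radical of the symmetrization of `σ` extends to `U`, and the corresponding
one-dimensional Yetter-Drinfeld module is transparent (`isNondegenerateBichar_of_braiding`).
-/

/-! ### The bilinear form of the tensor algebra and its skew derivations -/

noncomputable section NicholsForm

namespace NicholsAlgebra

variable {n : ℕ} (q : Fin n → Fin n → ℂ)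

/-- The coefficient of `x_i`. -/
def coeffGen (i : Fin n) : TensorAlg n →ₗ[ℂ] ℂ := (wordBasis n).coord (FreeMonoid.of i)

open Classical in
theorem coeffGen_word (i : Fin n) (w : FreeMonoid (Fin n)) :
    coeffGen i (word w) = if w = FreeMonoid.of i then 1 else 0 := by
  rw [← wordBasis_apply, coeffGen, Module.Basis.coord_apply, Module.Basis.repr_self,
    Finsupp.single_apply]

theorem lin_ext_word {Z : Type*} [AddCommMonoid Z] [Module ℂ Z] {f g : TensorAlg n →ₗ[ℂ] Z}
    (h : ∀ w, f (word w) = g (word w)) : f = g :=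
  (wordBasis n).ext fun w => by simpa using h w

/-- Monomials span: an induction principle over linear maps, by left multiplication with
generators. -/
theorem lin_ext_gen {Z : Type*} [AddCommMonoid Z] [Module ℂ Z] {f g : TensorAlg n →ₗ[ℂ] Z}
    (h1 : f 1 = g 1) (h : ∀ i w, f (word w) = g (word w) →
      f (FreeAlgebra.ι ℂ i * word w) = g (FreeAlgebra.ι ℂ i * word w)) : f = g :=
  lin_ext_word fun w => by
    induction w using FreeMonoid.inductionOn' with
    | one => rwa [word_one]
    | of_mul i w ih => rw [word_of_mul]; exact h i w ih

theorem counit_ι_mul (i : Fin n) (a : TensorAlg n) :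
    FreeAlgebra.algebraMapInv (R := ℂ) (FreeAlgebra.ι ℂ i * a) = 0 := by
  rw [map_mul, counit_ι, zero_mul]

theorem coeffGen_one (i : Fin n) : coeffGen i (1 : TensorAlg n) = 0 := by
  rw [← word_one, coeffGen_word, if_neg]
  exact fun h => by simpa using congrArg (fun w => w.toList.length) h

theorem coeffGen_ι_mul (i j : Fin n) (a : TensorAlg n) :
    coeffGen i (FreeAlgebra.ι ℂ j * a) =
      if j = i then FreeAlgebra.algebraMapInv (R := ℂ) a else 0 := by
  have : coeffGen i ∘ₗ mulGen j = if j = i then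
      (FreeAlgebra.algebraMapInv (R := ℂ) (X := Fin n)).toLinearMap else 0 :=
    lin_ext_word fun w => by
      rw [LinearMap.comp_apply, mulGen, LinearMap.mulLeft_apply, ← word_of_mul, coeffGen_word]
      by_cases hj : j = i
      · subst hj
        rw [if_pos rfl, AlgHom.toLinearMap_apply]
        induction w using FreeMonoid.inductionOn' with
        | one => rw [mul_one, if_pos rfl, word_one, map_one]
        | of_mul k w _ =>
          rw [word_of_mul, counit_ι_mul, if_neg]
          exact fun h => by simpa using congrArg (fun w => w.toList.length) h
      · rw [if_neg hj, if_neg, LinearMap.zero_apply]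
        intro h
        have := congrArg FreeMonoid.toList h
        simp at this
        exact hj this.1
  have h2 := LinearMap.congr_fun this a
  rw [LinearMap.comp_apply, mulGen, LinearMap.mulLeft_apply] at h2
  rw [h2]
  split_ifs <;> rfl

@[simp] theorem braidAut_ι (i j : Fin n) :
    braidAut q i (FreeAlgebra.ι ℂ j) = q i j • FreeAlgebra.ι ℂ j := by simp [braidAut]

theorem braidAut_ι_mul (i j : Fin n) (a : TensorAlg n) :
    braidAut q i (FreeAlgebra.ι ℂ j * a) = q i j • (FreeAlgebra.ι ℂ j * braidAut q i a) := by
  rw [map_mul, braidAut_ι, smul_mul_assoc]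

theorem coeffGen_braidAut (i j : Fin n) (a : TensorAlg n) :
    coeffGen i (braidAut q j a) = q j i * coeffGen i a := by
  have : coeffGen i ∘ₗ (braidAut q j).toLinearMap = q j i • coeffGen i :=
    lin_ext_gen (by simp [coeffGen_one]) fun k w _ => by
      simp only [LinearMap.comp_apply, AlgHom.toLinearMap_apply, braidAut_ι_mul, map_smul,
        coeffGen_ι_mul, LinearMap.smul_apply, counit_braidAut]
      by_cases h : k = i
      · subst h; simp
      · simp [h]
  exact LinearMap.congr_fun this a

/-- The skew derivation `∂ᵢ`: the coefficient of `- ⊗ x_i` in the coproduct. -/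
def derivR (i : Fin n) : TensorAlg n →ₗ[ℂ] TensorAlg n :=
  (TensorProduct.rid ℂ _).toLinearMap ∘ₗ (coeffGen i).lTensor _ ∘ₗ braidedComul q

/-- The skew derivation with the other side: the coefficient of `x_i ⊗ -` in the coproduct. -/
def derivL (i : Fin n) : TensorAlg n →ₗ[ℂ] TensorAlg n :=
  (TensorProduct.lid ℂ _).toLinearMap ∘ₗ (coeffGen i).rTensor _ ∘ₗ braidedComul q

@[simp] theorem derivR_one (i : Fin n) : derivR q i 1 = 0 := by simp [derivR, coeffGen_one]
@[simp] theorem derivL_one (i : Fin n) : derivL q i 1 = 0 := by simp [derivL, coeffGen_one]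

theorem derivR_ι_mul (i j : Fin n) (a : TensorAlg n) :
    derivR q i (FreeAlgebra.ι ℂ j * a) =
      FreeAlgebra.ι ℂ j * derivR q i a + if j = i then braidAut q i a else 0 := by
  have h : ∀ z, TensorProduct.rid ℂ _ ((coeffGen i).lTensor _ (primMul q j z)) =
      FreeAlgebra.ι ℂ j * TensorProduct.rid ℂ _ ((coeffGen i).lTensor _ z) +
      if j = i then braidAut q i (TensorProduct.rid ℂ _
        ((FreeAlgebra.algebraMapInv (R := ℂ) (X := Fin n)).toLinearMap.lTensor _ z)) else 0 := by
    intro z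
    induction z with
    | zero => simp
    | add x y hx hy =>
      simp only [map_add, hx, hy, mul_add]
      split_ifs <;> abel
    | tmul x y =>
      by_cases h : j = i
      · subst h; simp [primMul, mulGen, coeffGen_ι_mul]
      · simp [primMul, mulGen, coeffGen_ι_mul, h]
  simp only [derivR, LinearMap.comp_apply, LinearEquiv.coe_coe, braidedComul_ι_mul]
  rw [h, lTensor_counit_braidedComul]
  simp

theorem derivL_ι_mul (i j : Fin n) (a : TensorAlg n) :
    derivL q i (FreeAlgebra.ι ℂ j * a) =
      (if j = i then a else 0) + q j i • (FreeAlgebra.ι ℂ j * derivL q i a) := by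
  have h : ∀ z, TensorProduct.lid ℂ _ ((coeffGen i).rTensor _ (primMul q j z)) =
      (if j = i then TensorProduct.lid ℂ _
        ((FreeAlgebra.algebraMapInv (R := ℂ) (X := Fin n)).toLinearMap.rTensor _ z) else 0) +
      q j i • (FreeAlgebra.ι ℂ j * TensorProduct.lid ℂ _ ((coeffGen i).rTensor _ z)) := by
    intro z
    induction z with
    | zero => simp
    | add x y hx hy =>
      simp only [map_add, hx, hy, mul_add, smul_add]
      split_ifs <;> abel
    | tmul x y =>
      by_cases h : j = i
      · subst h; simp [primMul, mulGen, coeffGen_ι_mul, coeffGen_braidAut, smul_smul]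
      · simp [primMul, mulGen, coeffGen_ι_mul, coeffGen_braidAut, smul_smul, h]
  simp only [derivL, LinearMap.comp_apply, LinearEquiv.coe_coe, braidedComul_ι_mul]
  rw [h, rTensor_counit_braidedComul]
  simp

theorem braidAut_comm (q q' : Fin n → Fin n → ℂ) (i j : Fin n) (a : TensorAlg n) :
    braidAut q i (braidAut q' j a) = braidAut q' j (braidAut q i a) := by
  have : (braidAut q i).comp (braidAut q' j) = (braidAut q' j).comp (braidAut q i) := by
    ext k; simp [smul_smul, mul_comm]
  exact AlgHom.congr_fun this a

theorem derivR_braidAut (q q' : Fin n → Fin n → ℂ) (i j : Fin n) (a : TensorAlg n) :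
    derivR q i (braidAut q' j a) = q' j i • braidAut q' j (derivR q i a) := by
  have : derivR q i ∘ₗ (braidAut q' j).toLinearMap =
      q' j i • (braidAut q' j).toLinearMap ∘ₗ derivR q i :=
    lin_ext_gen (by simp) fun k w ih => by
      simp only [LinearMap.comp_apply, AlgHom.toLinearMap_apply, LinearMap.smul_apply] at ih ⊢
      rw [braidAut_ι_mul, map_smul, derivR_ι_mul, ih, derivR_ι_mul, map_add, braidAut_ι_mul]
      by_cases h : k = i
      · subst h
        simp [smul_add, smul_smul, mul_comm, braidAut_comm q q']
      · simp [h, smul_smul, mul_comm]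
  exact LinearMap.congr_fun this a

theorem derivL_braidAut (q q' : Fin n → Fin n → ℂ) (i j : Fin n) (a : TensorAlg n) :
    derivL q i (braidAut q' j a) = q' j i • braidAut q' j (derivL q i a) := by
  have : derivL q i ∘ₗ (braidAut q' j).toLinearMap =
      q' j i • (braidAut q' j).toLinearMap ∘ₗ derivL q i :=
    lin_ext_gen (by simp) fun k w ih => by
      simp only [LinearMap.comp_apply, AlgHom.toLinearMap_apply, LinearMap.smul_apply] at ih ⊢
      rw [braidAut_ι_mul, map_smul, derivL_ι_mul, ih, derivL_ι_mul, map_add, map_smul,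
        braidAut_ι_mul]
      by_cases h : k = i
      · subst h
        simp [smul_add, smul_smul, mul_comm, mul_left_comm]
      · simp [h, smul_smul, mul_comm, mul_left_comm]
  exact LinearMap.congr_fun this a

/-- Splitting off a generator on the left and on the right commute. This is what makes the form
symmetric. -/
theorem derivL_derivR (i j : Fin n) (a : TensorAlg n) :
    derivL q i (derivR q j a) = derivR q j (derivL q i a) := by
  have : derivL q i ∘ₗ derivR q j = derivR q j ∘ₗ derivL q i :=
    lin_ext_gen (by simp) fun k w ih => by
      simp only [LinearMap.comp_apply] at ih ⊢
      rw [derivR_ι_mul, map_add, derivL_ι_mul, ih, derivL_ι_mul, map_add, map_smul, derivR_ι_mul]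
      by_cases hi : k = i <;> by_cases hj : k = j
      · subst hi; subst hj; simp [derivL_braidAut]; abel
      · subst hi; simp [hj]
      · subst hj; simp [hi, derivL_braidAut]
      · simp [hi, hj]
  exact LinearMap.congr_fun this a

/-- Iterated derivations: `x_{i_1} ⋯ x_{i_k}` acts by `∂_{i_k} ⋯ ∂_{i_1}`. -/
def derivAct : TensorAlg n →ₐ[ℂ] (Module.End ℂ (TensorAlg n))ᵐᵒᵖ :=
  FreeAlgebra.lift ℂ fun i => MulOpposite.op (derivR q i)

/-- The bilinear form on the tensor algebra with `(x_i b, v) = (b, ∂ᵢ v)` and `(1, v) = ε(v)`.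
Its radical is the defining ideal of the Nichols algebra. -/
def form : TensorAlg n →ₗ[ℂ] TensorAlg n →ₗ[ℂ] ℂ where
  toFun b := FreeAlgebra.algebraMapInv.toLinearMap ∘ₗ (derivAct q b).unop
  map_add' a b := by ext; simp
  map_smul' r b := by ext; simp

@[simp] theorem form_one (v : TensorAlg n) : form q 1 v = FreeAlgebra.algebraMapInv v := by
  simp [form]

theorem form_ι_mul (i : Fin n) (b v : TensorAlg n) :
    form q (FreeAlgebra.ι ℂ i * b) v = form q b (derivR q i v) := by
  simp [form, derivAct]

theorem form_braidAut (q q' : Fin n → Fin n → ℂ) (i : Fin n) (b v : TensorAlg n) :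
    form q (braidAut q' i b) v = form q b (braidAut q' i v) := by
  have : form q ∘ₗ (braidAut q' i).toLinearMap =
      (LinearMap.lcomp ℂ ℂ (braidAut q' i).toLinearMap) ∘ₗ form q :=
    lin_ext_gen (by ext v; simp [counit_braidAut]) fun j w ih => by
      ext v
      have ih' := fun v => LinearMap.congr_fun ih v
      simp only [LinearMap.comp_apply, AlgHom.toLinearMap_apply, LinearMap.lcomp_apply] at ih' ⊢
      rw [braidAut_ι_mul, map_smul, LinearMap.smul_apply, form_ι_mul, ih', form_ι_mul,
        derivR_braidAut, map_smul]
  exact LinearMap.congr_fun (LinearMap.congr_fun this b) v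

theorem form_one_right (b : TensorAlg n) : form q b 1 = FreeAlgebra.algebraMapInv b := by
  have : (form q).flip 1 = (FreeAlgebra.algebraMapInv (R := ℂ) (X := Fin n)).toLinearMap :=
    lin_ext_gen (by simp) fun j w ih => by
      simp [form_ι_mul, counit_ι]
  exact LinearMap.congr_fun this b

theorem form_ι_mul_right (i : Fin n) (b v : TensorAlg n) :
    form q b (FreeAlgebra.ι ℂ i * v) = form q (derivR q i b) v := by
  have : (LinearMap.lcomp ℂ ℂ (mulGen i)) ∘ₗ form q = form q ∘ₗ derivR q i :=
    lin_ext_gen (by ext v; simp [mulGen, counit_ι]) fun j w ih => by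
      ext v
      have ih' := fun v => LinearMap.congr_fun ih v
      simp only [LinearMap.comp_apply, LinearMap.lcomp_apply, mulGen,
        LinearMap.mulLeft_apply] at ih' ⊢
      rw [form_ι_mul, derivR_ι_mul, map_add, ih', derivR_ι_mul, map_add, LinearMap.add_apply,
        form_ι_mul]
      by_cases h : j = i
      · subst h; simp [form_braidAut]
      · simp [h, Ne.symm h]
  exact LinearMap.congr_fun (LinearMap.congr_fun this b) v

/-- The skew derivations `derivR` and `derivL` are adjoint to left and to right multiplication with a
generator, and they commute. Hence the form is symmetric. -/
theorem form_symm (b v : TensorAlg n) : form q b v = form q v b := by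
  have : form q = (form q).flip :=
    lin_ext_gen (by ext v; simp [form_one_right]) fun j w ih => by
      ext v
      have ih' := fun v => LinearMap.congr_fun ih v
      simp only [LinearMap.flip_apply] at ih' ⊢
      rw [form_ι_mul, ih', form_ι_mul_right]
  exact LinearMap.congr_fun (LinearMap.congr_fun this b) v

theorem form_mul_ι (i : Fin n) (b v : TensorAlg n) :
    form q (b * FreeAlgebra.ι ℂ i) v = form q b (derivL q i v) := by
  have : form q ∘ₗ LinearMap.mulRight ℂ (FreeAlgebra.ι ℂ i) =
      (LinearMap.lcomp ℂ ℂ (derivL q i)) ∘ₗ form q :=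
    lin_ext_gen (by
      refine lin_ext_gen ?_ fun j w _ => ?_
      · simp [form_one_right, counit_ι]
      · have e := form_ι_mul q i 1 (FreeAlgebra.ι ℂ j * word w)
        rw [mul_one] at e
        simp only [LinearMap.comp_apply, LinearMap.mulRight_apply, one_mul,
          LinearMap.lcomp_apply, form_one, e, derivR_ι_mul, derivL_ι_mul]
        by_cases h : j = i
        · subst h; simp [counit_ι, counit_braidAut]
        · simp [h, counit_ι]) fun j w ih => by
      ext v
      have ih' := fun v => LinearMap.congr_fun ih v
      simp only [LinearMap.comp_apply, LinearMap.lcomp_apply,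
        LinearMap.mulRight_apply] at ih' ⊢
      rw [mul_assoc, form_ι_mul, ih', form_ι_mul, derivL_derivR]
  exact LinearMap.congr_fun (LinearMap.congr_fun this b) v

theorem form_mul_ι_right (i : Fin n) (b v : TensorAlg n) :
    form q b (v * FreeAlgebra.ι ℂ i) = form q (derivL q i b) v := by
  rw [form_symm, form_mul_ι, form_symm]

end NicholsAlgebra
end NicholsForm

/-! ### The defining ideal of the Nichols algebra as the radical of the form -/

noncomputable section NicholsRadical

/-- Contraction of the first tensor factor with a linear functional. -/
def slice {A V : Type*} [AddCommGroup A] [Module ℂ A] [AddCommGroup V] [Module ℂ V]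
    (f : A →ₗ[ℂ] ℂ) : A ⊗[ℂ] V →ₗ[ℂ] V :=
  (TensorProduct.lid ℂ V).toLinearMap ∘ₗ f.rTensor V

@[simp] theorem slice_tmul {A V : Type*} [AddCommGroup A] [Module ℂ A] [AddCommGroup V]
    [Module ℂ V] (f : A →ₗ[ℂ] ℂ) (a : A) (x : V) : slice f (a ⊗ₜ[ℂ] x) = f a • x := by
  simp [slice]

/-- A family of functionals which separates the points of `A` separates the points of
`A ⊗ V` by contraction. -/
theorem eq_zero_of_slice {A V : Type*} [AddCommGroup A] [Module ℂ A] [AddCommGroup V]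
    [Module ℂ V] {I : Type*} (f : I → A →ₗ[ℂ] ℂ) (hf : ∀ a, (∀ i, f i a = 0) → a = 0)
    (z : A ⊗[ℂ] V) (hz : ∀ i, slice (f i) z = 0) : z = 0 := by
  classical
  let b := Module.Basis.ofVectorSpace ℂ V
  have key : ∀ i k (z : A ⊗[ℂ] V), f i (TensorProduct.equivFinsuppOfBasisRight b z k) =
      b.repr (slice (f i) z) k := by
    intro i k z
    induction z with
    | zero => simp
    | add x y hx hy => simp [hx, hy]
    | tmul x y => simp [mul_comm]
  apply (TensorProduct.equivFinsuppOfBasisRight b).injective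
  rw [map_zero]
  ext k
  exact hf _ fun i => by rw [key, hz]; simp

theorem eq_of_slice {A V : Type*} [AddCommGroup A] [Module ℂ A] [AddCommGroup V]
    [Module ℂ V] {I : Type*} (f : I → A →ₗ[ℂ] ℂ) (hf : ∀ a, (∀ i, f i a = 0) → a = 0)
    {z w : A ⊗[ℂ] V} (h : ∀ i, slice (f i) z = slice (f i) w) : z = w :=
  sub_eq_zero.1 (eq_zero_of_slice f hf _ fun i => by rw [map_sub, h, sub_self])

namespace NicholsAlgebra

variable {n : ℕ} (q : Fin n → Fin n → ℂ)

/-- By coassociativity, taking the coefficient of a generator in the last tensor factor commutes with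
the coproduct. -/
theorem braidedComul_derivR (i : Fin n) (a : TensorAlg n) :
    braidedComul q (derivR q i a) = (derivR q i).lTensor _ (braidedComul q a) := by
  have h : ∀ z : TensorAlg n ⊗[ℂ] TensorAlg n,
      braidedComul q (TensorProduct.rid ℂ _ ((coeffGen i).lTensor _ z)) =
      ((TensorProduct.rid ℂ _).toLinearMap ∘ₗ (coeffGen i).lTensor (TensorAlg n)).lTensor
        (TensorAlg n) (TensorProduct.assoc ℂ _ _ _ ((braidedComul q).rTensor _ z)) := by
    intro z
    induction z with
    | zero => simp
    | add x y hx hy => simp only [map_add, hx, hy]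
    | tmul x y =>
      simp only [LinearMap.lTensor_tmul, TensorProduct.rid_tmul, map_smul, LinearMap.rTensor_tmul]
      generalize braidedComul q x = w
      induction w with
      | zero => simp
      | add x y hx hy => simp only [smul_add, TensorProduct.add_tmul, map_add, hx, hy]
      | tmul x y => simp
  rw [derivR, LinearMap.comp_apply, LinearMap.comp_apply, LinearEquiv.coe_coe, h,
    braidedComul_coassoc, ← LinearMap.comp_apply, ← LinearMap.lTensor_comp]
  rfl

theorem derivR_mul (i : Fin n) (a b : TensorAlg n) :
    derivR q i (a * b) = a * derivR q i b + derivR q i a * braidAut q i b := by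
  have : derivR q i ∘ₗ LinearMap.mulRight ℂ b = LinearMap.mulRight ℂ (derivR q i b) +
      LinearMap.mulRight ℂ (braidAut q i b) ∘ₗ derivR q i :=
    lin_ext_gen (by simp) fun j w ih => by
      simp only [LinearMap.comp_apply, LinearMap.mulRight_apply, LinearMap.add_apply] at ih ⊢
      rw [mul_assoc, derivR_ι_mul, ih, derivR_ι_mul, add_mul, mul_add, ← mul_assoc, ← mul_assoc]
      by_cases h : j = i
      · subst h; simp [add_assoc]
      · simp [h]
  exact LinearMap.congr_fun this a

theorem derivL_mul (i : Fin n) (a b : TensorAlg n) :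
    derivL q i (a * b) = derivL q i a * b + braidAut (fun i k => q k i) i a * derivL q i b := by
  have : derivL q i ∘ₗ LinearMap.mulRight ℂ b = LinearMap.mulRight ℂ b ∘ₗ derivL q i +
      LinearMap.mulRight ℂ (derivL q i b) ∘ₗ (braidAut (fun i k => q k i) i).toLinearMap :=
    lin_ext_gen (by simp) fun j w ih => by
      simp only [LinearMap.comp_apply, LinearMap.mulRight_apply, LinearMap.add_apply,
        AlgHom.toLinearMap_apply] at ih ⊢
      rw [mul_assoc, derivL_ι_mul, ih, derivL_ι_mul, add_mul, mul_add, braidAut_ι_mul, ← mul_assoc,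
        ← mul_assoc, smul_add, smul_mul_assoc, smul_mul_assoc, add_assoc, mul_assoc, mul_assoc]
      congr 1
      split_ifs <;> simp
  exact LinearMap.congr_fun this a

/-- The form is compatible with coproduct and product. -/
theorem form_mul (b b' v : TensorAlg n) :
    form q (b' * b) v = form q b' (slice (form q b) (braidedComul q v)) := by
  have : ∀ w v, form q (word w * b) v = form q (word w) (slice (form q b) (braidedComul q v)) := by
    intro w
    induction w using FreeMonoid.inductionOn' with
    | one =>
      intro v
      rw [word_one, one_mul, form_one]
      have h : ∀ z : TensorAlg n ⊗[ℂ] TensorAlg n,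
          FreeAlgebra.algebraMapInv (slice (form q b) z) =
            form q b (TensorProduct.rid ℂ _
              ((FreeAlgebra.algebraMapInv (R := ℂ) (X := Fin n)).toLinearMap.lTensor _ z)) := by
        intro z
        induction z with
        | zero => simp
        | add x y hx hy => simp only [map_add, hx, hy]
        | tmul x y => simp [mul_comm]
      rw [h, lTensor_counit_braidedComul]
      simp
    | of_mul i w ih =>
      intro v
      rw [word_of_mul, mul_assoc, form_ι_mul, ih, form_ι_mul, braidedComul_derivR]
      congr 1
      generalize braidedComul q v = z
      induction z with
      | zero => simp
      | add x y hx hy => simp only [map_add, hx, hy]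
      | tmul x y => simp
  have h2 : form q ∘ₗ LinearMap.mulRight ℂ b =
      LinearMap.lcomp ℂ ℂ (slice (form q b) ∘ₗ braidedComul q) ∘ₗ form q :=
    lin_ext_word fun w => by ext v; exact this w v
  exact LinearMap.congr_fun (LinearMap.congr_fun h2 b') v

/-- Monomials of different multidegrees are orthogonal. -/
theorem form_word_word {u w : FreeMonoid (Fin n)} (h : form q (word u) (word w) ≠ 0) :
    (u.toList : Multiset (Fin n)) = w.toList := by
  ext k
  let t : Fin n → Fin n → ℂ := fun _ j => if j = k then 2 else 1
  have ht : ∀ w, braidScalar t k w = 2 ^ (w.toList.count k) := by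
    intro w
    induction w using FreeMonoid.inductionOn' with
    | one => simp
    | of_mul j w ih =>
      rw [map_mul, ih]
      by_cases hj : j = k
      · subst hj; simp [braidScalar, t, pow_succ, mul_comm]
      · simp [braidScalar, t, hj]
  have h2 := form_braidAut q t k (word u) (word w)
  rw [braidAut_word, braidAut_word, map_smul, map_smul, LinearMap.smul_apply, smul_eq_mul,
    smul_eq_mul] at h2
  have h3 := mul_right_cancel₀ h h2
  rw [ht, ht] at h3
  rw [Multiset.coe_count, Multiset.coe_count]
  have h4 : (2 : ℕ) ^ u.toList.count k = 2 ^ w.toList.count k := by exact_mod_cast h3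
  exact Nat.pow_right_injective le_rfl h4

theorem component_word' (d : Multiset (Fin n)) (w : FreeMonoid (Fin n)) :
    component d (word w) = if (w.toList : Multiset (Fin n)) = d then word w else 0 := by
  conv_lhs => rw [← wordBasis_apply]
  exact Module.Basis.constr_basis _ _ _ _

theorem form_component (d : Multiset (Fin n)) (b v : TensorAlg n) :
    form q b (component d v) = form q (component d b) v := by
  have : LinearMap.lcomp ℂ ℂ (component d) ∘ₗ form q = form q ∘ₗ component d :=
    lin_ext_word fun u => lin_ext_word fun w => by
      simp only [LinearMap.comp_apply, LinearMap.lcomp_apply, component_word']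
      by_cases h : form q (word u) (word w) = 0
      · split_ifs <;> simp [h]
      · rw [form_word_word q h]
        split_ifs <;> simp
  exact LinearMap.congr_fun (LinearMap.congr_fun this b) v

/-- The radical of the form. -/
def formRadical : Ideal (TensorAlg n) where
  carrier := {v | ∀ b, form q b v = 0}
  add_mem' ha hb c := by rw [map_add, ha c, hb c, add_zero]
  zero_mem' c := map_zero _
  smul_mem' c v hv := by
    have : ∀ w v, (∀ b, form q b v = 0) → ∀ b, form q b (word w * v) = 0 := by
      intro w
      induction w using FreeMonoid.inductionOn' with
      | one => intro v hv b; rw [word_one, one_mul, hv]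
      | of_mul i w ih =>
        intro v hv b
        rw [word_of_mul, mul_assoc, form_ι_mul_right, ih v hv]
    intro b
    have h2 : (form q b) ∘ₗ LinearMap.mulRight ℂ v = 0 := lin_ext_word fun w => this w v hv b
    exact LinearMap.congr_fun h2 c

theorem mem_formRadical {v : TensorAlg n} : v ∈ formRadical q ↔ ∀ b, form q b v = 0 := Iff.rfl

/-- Extend a linear map to the quotient by an ideal. -/
def quotLift (J : Ideal (TensorAlg n)) {Z : Type*} [AddCommGroup Z] [Module ℂ Z]
    (f : TensorAlg n →ₗ[ℂ] Z) (h : ∀ a ∈ J, f a = 0) : (TensorAlg n ⧸ J) →ₗ[ℂ] Z :=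
  (J.restrictScalars ℂ).liftQ f h

/-- The coefficient of `x_i` is given by pairing with `x_i`, so that the radical of the form has no
elements with components of degree one. -/
theorem coeffGen_eq (i : Fin n) (v : TensorAlg n) :
    coeffGen i v = form q (FreeAlgebra.ι ℂ i) v := by
  have : coeffGen i = form q (FreeAlgebra.ι ℂ i) := lin_ext_gen (by
      rw [form_one_right, counit_ι, coeffGen_one]) fun j w _ => by
    have e := form_ι_mul q i 1 (FreeAlgebra.ι ℂ j * word w)
    rw [mul_one] at e
    rw [e, coeffGen_ι_mul, derivR_ι_mul, form_one, map_add, counit_ι_mul, zero_add]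
    split_ifs <;> simp [counit_braidAut]
  exact LinearMap.congr_fun this v

/-- The radical of the form is a graded biideal: it is a coideal because the form pairs the product
with the coproduct. -/
theorem isGradedBiideal_formRadical : IsGradedBiideal q (formRadical q) where
  mul_mem_right v c hv := by
    have : ∀ w v, (∀ b, form q b v = 0) → ∀ b, form q b (v * word w) = 0 := by
      intro w
      induction w using FreeMonoid.inductionOn' with
      | one => intro v hv b; rw [word_one, mul_one, hv]
      | of_mul i w ih =>
        intro v hv b
        rw [word_of_mul, ← mul_assoc]
        exact ih _ (fun b => by rw [form_mul_ι_right, hv]) b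
    intro b
    have h2 : (form q b) ∘ₗ LinearMap.mulLeft ℂ v = 0 := lin_ext_word fun w => this w v hv b
    exact LinearMap.congr_fun h2 c
  component_mem d v hv b := by rw [form_component, hv]
  degree_ge_two v hv w hw := by
    have hw' : w = 1 ∨ ∃ i, w = FreeMonoid.of i := by
      induction w using FreeMonoid.inductionOn' with
      | one => exact Or.inl rfl
      | of_mul i w _ =>
        induction w using FreeMonoid.inductionOn' with
        | one => exact Or.inr ⟨i, mul_one _⟩
        | of_mul j w _ => simp at hw
    rcases hw' with rfl | ⟨i, rfl⟩
    · rw [← counit_eq, ← form_one q, hv]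
    · exact (coeffGen_eq q i v).trans (hv _)
  comul_mem v hv := by
    let f : TensorAlg n → (TensorAlg n ⧸ formRadical q) →ₗ[ℂ] ℂ := fun b =>
      quotLift (formRadical q) (form q b) fun a ha => ha b
    refine eq_zero_of_slice f (fun a ha => ?_) _ fun b => ?_
    · obtain ⟨a, rfl⟩ := Submodule.Quotient.mk_surjective _ a
      exact (Submodule.Quotient.mk_eq_zero _).2 fun b => ha b
    · have h : ∀ z : TensorAlg n ⊗[ℂ] TensorAlg n, slice (f b) (TensorProduct.map
          ((formRadical q).mkQ.restrictScalars ℂ) ((formRadical q).mkQ.restrictScalars ℂ) z) =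
          (formRadical q).mkQ (slice (form q b) z) := by
        intro z
        induction z with
        | zero => simp
        | add x y hx hy => simp only [map_add, hx, hy]
        | tmul x y =>
          rw [TensorProduct.map_tmul, slice_tmul, slice_tmul]
          rfl
      rw [h]
      exact (Submodule.Quotient.mk_eq_zero _).2 fun b' => by rw [← form_mul, hv]

/-- Graded biideals are stable under the skew derivations, because their elements have no components
of degree one. Therefore they are contained in the radical of the form. -/
theorem derivR_mem_of_isGradedBiideal {J : Ideal (TensorAlg n)} (hJ : IsGradedBiideal q J)
    (i : Fin n) {a : TensorAlg n} (ha : a ∈ J) : derivR q i a ∈ J := by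
  let f : (TensorAlg n ⧸ J) →ₗ[ℂ] ℂ := quotLift J (coeffGen i) fun a ha =>
    hJ.degree_ge_two a ha (FreeMonoid.of i) (by simp)
  have h : ∀ z : TensorAlg n ⊗[ℂ] TensorAlg n, TensorProduct.rid ℂ _ (f.lTensor _
      (TensorProduct.map (J.mkQ.restrictScalars ℂ) (J.mkQ.restrictScalars ℂ) z)) =
      J.mkQ (TensorProduct.rid ℂ _ ((coeffGen i).lTensor _ z)) := by
    intro z
    induction z with
    | zero => simp
    | add x y hx hy => simp only [map_add, hx, hy]
    | tmul x y =>
      rw [TensorProduct.map_tmul, LinearMap.lTensor_tmul, LinearMap.lTensor_tmul,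
        TensorProduct.rid_tmul, TensorProduct.rid_tmul]
      rfl
  have h2 := h (braidedComul q a)
  rw [hJ.comul_mem a ha] at h2
  simp only [map_zero] at h2
  exact (Submodule.Quotient.mk_eq_zero _).1 h2.symm

/-- The defining ideal of the Nichols algebra is the radical of the form. -/
theorem nicholsIdeal_eq : nicholsIdeal q = formRadical q := by
  refine le_antisymm (sSup_le fun J hJ a ha => ?_) (le_nicholsIdeal (isGradedBiideal_formRadical q))
  have : ∀ w, ∀ a ∈ J, form q (word w) a = 0 := by
    intro w
    induction w using FreeMonoid.inductionOn' with
    | one =>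
      intro a ha
      rw [word_one, form_one, counit_eq]
      exact hJ.degree_ge_two a ha 1 (by simp)
    | of_mul i w ih =>
      intro a ha
      rw [word_of_mul, form_ι_mul]
      exact ih _ (derivR_mem_of_isGradedBiideal q hJ i ha)
  intro b
  have h2 : (form q).flip a = 0 := lin_ext_word fun w => this w a ha
  exact LinearMap.congr_fun h2 b

theorem mem_nicholsIdeal {v : TensorAlg n} : v ∈ nicholsIdeal q ↔ ∀ b, form q b v = 0 := by
  rw [nicholsIdeal_eq, mem_formRadical]

theorem derivR_mem (i : Fin n) {a : TensorAlg n} (ha : a ∈ nicholsIdeal q) :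
    derivR q i a ∈ nicholsIdeal q :=
  (mem_nicholsIdeal q).2 fun b => by rw [← form_ι_mul, (mem_nicholsIdeal q).1 ha]

theorem derivL_mem (i : Fin n) {a : TensorAlg n} (ha : a ∈ nicholsIdeal q) :
    derivL q i a ∈ nicholsIdeal q :=
  (mem_nicholsIdeal q).2 fun b => by rw [← form_mul_ι, (mem_nicholsIdeal q).1 ha]

theorem braidAut_mem (q' : Fin n → Fin n → ℂ) (i : Fin n) {a : TensorAlg n}
    (ha : a ∈ nicholsIdeal q) : braidAut q' i a ∈ nicholsIdeal q :=
  (mem_nicholsIdeal q).2 fun b => by rw [← form_braidAut, (mem_nicholsIdeal q).1 ha]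

/-- The matrix of the inverse braiding. -/
def invBraiding (i j : Fin n) : ℂ := (q j i)⁻¹

theorem invBraiding_invBraiding : invBraiding (invBraiding q) = q := by
  ext i j; simp [invBraiding]

variable {q}

theorem derivR_invBraiding (hq : ∀ i j, q i j ≠ 0) (i : Fin n) (a : TensorAlg n) :
    derivR (invBraiding q) i a = braidAut (invBraiding q) i (derivL q i a) := by
  have : derivR (invBraiding q) i = (braidAut (invBraiding q) i).toLinearMap ∘ₗ derivL q i :=
    lin_ext_gen (by simp) fun j w ih => by
      simp only [LinearMap.comp_apply, AlgHom.toLinearMap_apply] at ih ⊢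
      have e : q j i * invBraiding q i j = 1 := mul_inv_cancel₀ (hq j i)
      rw [derivR_ι_mul, ih, derivL_ι_mul, map_add, map_smul, braidAut_ι_mul, smul_smul, e, one_smul,
        add_comm]
      congr 1
      split_ifs <;> simp
  exact LinearMap.congr_fun this a

/-- The skew derivations for the inverse braiding agree with the left skew derivations up to braiding
automorphisms, so each linear form `(b, ·)` for the inverse braiding is of the form `(b', ·)` for
the braiding itself. -/
theorem nicholsIdeal_le_invBraiding (hq : ∀ i j, q i j ≠ 0) :
    nicholsIdeal q ≤ nicholsIdeal (invBraiding q) := by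
  intro a ha
  have : ∀ w, ∃ b, ∀ v, form (invBraiding q) (word w) v = form q b v := by
    intro w
    induction w using FreeMonoid.inductionOn' with
    | one => exact ⟨1, fun v => by rw [word_one, form_one, form_one]⟩
    | of_mul i w ih =>
      obtain ⟨b, hb⟩ := ih
      refine ⟨braidAut (invBraiding q) i b * FreeAlgebra.ι ℂ i, fun v => ?_⟩
      rw [word_of_mul, form_ι_mul, hb, derivR_invBraiding hq, form_mul_ι, form_braidAut]
  rw [mem_nicholsIdeal]
  intro b
  have h2 : (form (invBraiding q)).flip a = 0 := lin_ext_word fun w => by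
    obtain ⟨b, hb⟩ := this w
    exact (hb a).trans ((mem_nicholsIdeal q).1 ha b)
  exact LinearMap.congr_fun h2 b

/-- The inverse braiding defines the same Nichols algebra. -/
theorem nicholsIdeal_invBraiding (hq : ∀ i j, q i j ≠ 0) :
    nicholsIdeal (invBraiding q) = nicholsIdeal q :=
  le_antisymm (by
    have := nicholsIdeal_le_invBraiding (q := invBraiding q) fun i j => inv_ne_zero (hq j i)
    rwa [invBraiding_invBraiding] at this) (nicholsIdeal_le_invBraiding hq)

variable (q)

/-- The braided reversal of monomials, `x_i b ↦ -(braidAut q i b') x_i` where `b ↦ b'`: the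
antipode of the braided Hopf algebra `T(X)`. -/
def braidedRev : TensorAlg n →ₗ[ℂ] TensorAlg n :=
  LinearMap.applyₗ 1 ∘ₗ (FreeAlgebra.lift ℂ (A := Module.End ℂ (TensorAlg n)) fun i =>
    -(LinearMap.mulRight ℂ (FreeAlgebra.ι ℂ i) ∘ₗ (braidAut q i).toLinearMap)).toLinearMap

@[simp] theorem braidedRev_one : braidedRev q 1 = 1 := by simp [braidedRev]

theorem braidedRev_ι_mul (i : Fin n) (a : TensorAlg n) :
    braidedRev q (FreeAlgebra.ι ℂ i * a) =
      -(braidAut q i (braidedRev q a) * FreeAlgebra.ι ℂ i) := by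
  simp [braidedRev]

theorem braidedRev_braidAut (q' : Fin n → Fin n → ℂ) (i : Fin n) (a : TensorAlg n) :
    braidedRev q (braidAut q' i a) = braidAut q' i (braidedRev q a) := by
  have : braidedRev q ∘ₗ (braidAut q' i).toLinearMap =
      (braidAut q' i).toLinearMap ∘ₗ braidedRev q :=
    lin_ext_gen (by simp) fun j w ih => by
      simp only [LinearMap.comp_apply, AlgHom.toLinearMap_apply] at ih ⊢
      rw [braidAut_ι_mul, map_smul, braidedRev_ι_mul, ih, braidedRev_ι_mul, map_neg, map_mul,
        braidAut_ι, braidAut_comm q q', mul_smul_comm, smul_neg]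
  exact LinearMap.congr_fun this a

theorem derivR_braidedRev (i : Fin n) (a : TensorAlg n) :
    derivR q i (braidedRev q a) = -braidedRev q (braidAut q i (derivL q i a)) := by
  have : derivR q i ∘ₗ braidedRev q =
      -(braidedRev q ∘ₗ (braidAut q i).toLinearMap ∘ₗ derivL q i) :=
    lin_ext_gen (by simp) fun j w ih => by
      simp only [LinearMap.comp_apply, AlgHom.toLinearMap_apply, LinearMap.neg_apply] at ih ⊢
      have e : derivR q i (FreeAlgebra.ι ℂ j) = if j = i then 1 else 0 := by
        have := derivR_ι_mul q i j 1
        simpa using this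
      rw [braidedRev_ι_mul, map_neg, derivR_mul, derivR_braidAut, ih, derivL_ι_mul, map_add,
        map_smul, map_add, map_smul, braidAut_ι_mul, map_smul, braidedRev_ι_mul, e, braidAut_ι,
        map_neg]
      by_cases h : j = i
      · subst h
        simp [smul_smul, braidedRev_braidAut]
      · simp [h, smul_smul, mul_comm (q i j)]
  exact LinearMap.congr_fun this a

/-- The braided reversal is self-adjoint, so it preserves the radical of the form. -/
theorem form_braidedRev (b v : TensorAlg n) :
    form q (braidedRev q b) v = form q b (braidedRev q v) := by
  have : form q ∘ₗ braidedRev q = LinearMap.lcomp ℂ ℂ (braidedRev q) ∘ₗ form q :=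
    lin_ext_gen (lin_ext_gen (by simp) fun j w _ => by
      simp [braidedRev_ι_mul, counit_ι]) fun j w ih => by
      ext v
      have ih' := fun v => LinearMap.congr_fun ih v
      simp only [LinearMap.comp_apply, LinearMap.lcomp_apply] at ih' ⊢
      rw [braidedRev_ι_mul, map_neg, LinearMap.neg_apply, form_mul_ι, form_braidAut, ih',
        form_ι_mul, derivR_braidedRev, map_neg]
  exact LinearMap.congr_fun (LinearMap.congr_fun this b) v

theorem braidedRev_mem {a : TensorAlg n} (ha : a ∈ nicholsIdeal q) :
    braidedRev q a ∈ nicholsIdeal q :=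
  (mem_nicholsIdeal q).2 fun b => by rw [← form_braidedRev, (mem_nicholsIdeal q).1 ha]

end NicholsAlgebra
end NicholsRadical

/-! ### Descent of form, derivations and coproduct to the Nichols algebra -/

noncomputable section NicholsDescent

namespace NicholsAlgebra

variable {n : ℕ} (q : Fin n → Fin n → ℂ)

/-- The generator `x_i` of the Nichols algebra. -/
def gen (i : Fin n) : Nichols q := proj q (FreeAlgebra.ι ℂ i)

theorem gen_mul_proj (i : Fin n) (a : TensorAlg n) :
    gen q i * proj q a = proj q (FreeAlgebra.ι ℂ i * a) := (map_mul _ _ _).symm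

variable {q} in
theorem nichols_ext_gen {Z : Type*} [AddCommGroup Z] [Module ℂ Z] {f g : Nichols q →ₗ[ℂ] Z}
    (h1 : f 1 = g 1) (h : ∀ i w, f (proj q (word w)) = g (proj q (word w)) →
      f (gen q i * proj q (word w)) = g (gen q i * proj q (word w))) : f = g :=
  lin_ext fun w => by
    induction w using FreeMonoid.inductionOn' with
    | one => rwa [word_one, map_one]
    | of_mul i w ih => rw [word_of_mul, map_mul]; exact h i w ih

/-- The form on the Nichols algebra. -/
def nForm : Nichols q →ₗ[ℂ] Nichols q →ₗ[ℂ] ℂ :=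
  descend
    { toFun := fun b => descend (form q b) fun _ ha => (mem_nicholsIdeal q).1 ha b
      map_add' := fun a b => lin_ext fun w => LinearMap.congr_fun (map_add (form q) a b) (word w)
      map_smul' := fun r b => lin_ext fun w =>
        LinearMap.congr_fun (map_smul (form q) r b) (word w) }
    fun a ha => lin_ext fun w => by
      change form q a (word w) = 0
      rw [form_symm, (mem_nicholsIdeal q).1 ha]

@[simp] theorem nForm_proj (a b : TensorAlg n) : nForm q (proj q a) (proj q b) = form q a b := rfl

/-- The descent of `derivR` to the Nichols algebra. -/
def nDerivR (i : Fin n) : Nichols q →ₗ[ℂ] Nichols q :=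
  descend (projₗ q ∘ₗ derivR q i) fun _ ha => (proj_eq_zero q).2 (derivR_mem q i ha)

/-- The descent of `derivL` to the Nichols algebra. -/
def nDerivL (i : Fin n) : Nichols q →ₗ[ℂ] Nichols q :=
  descend (projₗ q ∘ₗ derivL q i) fun _ ha => (proj_eq_zero q).2 (derivL_mem q i ha)

/-- The automorphism `x_j ↦ q'_{ij} x_j` of the Nichols algebra, as a linear map. -/
def nBraid (q' : Fin n → Fin n → ℂ) (i : Fin n) : Nichols q →ₗ[ℂ] Nichols q :=
  descend (projₗ q ∘ₗ (braidAut q' i).toLinearMap) fun _ ha =>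
    (proj_eq_zero q).2 (braidAut_mem q q' i ha)

theorem nDerivR_proj (i : Fin n) (a : TensorAlg n) :
    nDerivR q i (proj q a) = proj q (derivR q i a) := rfl
theorem nDerivL_proj (i : Fin n) (a : TensorAlg n) :
    nDerivL q i (proj q a) = proj q (derivL q i a) := rfl
theorem nBraid_proj (q' : Fin n → Fin n → ℂ) (i : Fin n) (a : TensorAlg n) :
    nBraid q q' i (proj q a) = proj q (braidAut q' i a) := rfl

theorem nForm_symm (a b : Nichols q) : nForm q a b = nForm q b a := by
  obtain ⟨a, rfl⟩ := proj_surjective q a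
  obtain ⟨b, rfl⟩ := proj_surjective q b
  exact form_symm q a b

/-- The form on the Nichols algebra is nondegenerate. -/
theorem eq_zero_of_nForm (a : Nichols q) (h : ∀ b, nForm q b a = 0) : a = 0 := by
  obtain ⟨a, rfl⟩ := proj_surjective q a
  exact (proj_eq_zero q).2 ((mem_nicholsIdeal q).2 fun b => h (proj q b))

theorem nForm_one (a : Nichols q) : nForm q 1 a = nicholsCounit q a := by
  obtain ⟨a, rfl⟩ := proj_surjective q a
  exact form_one q a

theorem nForm_gen_mul (i : Fin n) (a b : Nichols q) :
    nForm q (gen q i * a) b = nForm q a (nDerivR q i b) := by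
  obtain ⟨a, rfl⟩ := proj_surjective q a
  obtain ⟨b, rfl⟩ := proj_surjective q b
  exact form_ι_mul q i a b

theorem nForm_mul_gen (i : Fin n) (a b : Nichols q) :
    nForm q (a * gen q i) b = nForm q a (nDerivL q i b) := by
  obtain ⟨a, rfl⟩ := proj_surjective q a
  obtain ⟨b, rfl⟩ := proj_surjective q b
  exact form_mul_ι q i a b

theorem nForm_gen_mul_right (i : Fin n) (a b : Nichols q) :
    nForm q a (gen q i * b) = nForm q (nDerivR q i a) b := by
  rw [nForm_symm, nForm_gen_mul, nForm_symm]

theorem nForm_mul_gen_right (i : Fin n) (a b : Nichols q) :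
    nForm q a (b * gen q i) = nForm q (nDerivL q i a) b := by
  rw [nForm_symm, nForm_mul_gen, nForm_symm]

theorem nForm_nBraid (q' : Fin n → Fin n → ℂ) (i : Fin n) (a b : Nichols q) :
    nForm q (nBraid q q' i a) b = nForm q a (nBraid q q' i b) := by
  obtain ⟨a, rfl⟩ := proj_surjective q a
  obtain ⟨b, rfl⟩ := proj_surjective q b
  exact form_braidAut q q' i a b

@[simp] theorem nDerivR_one (i : Fin n) : nDerivR q i 1 = 0 := by
  rw [← map_one (proj q), nDerivR_proj, derivR_one, map_zero]

@[simp] theorem nDerivL_one (i : Fin n) : nDerivL q i 1 = 0 := by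
  rw [← map_one (proj q), nDerivL_proj, derivL_one, map_zero]

theorem nBraid_mul (q' : Fin n → Fin n → ℂ) (i : Fin n) (a b : Nichols q) :
    nBraid q q' i (a * b) = nBraid q q' i a * nBraid q q' i b := by
  obtain ⟨a, rfl⟩ := proj_surjective q a
  obtain ⟨b, rfl⟩ := proj_surjective q b
  rw [← map_mul, nBraid_proj, map_mul, map_mul]; rfl

@[simp] theorem nBraid_one (q' : Fin n → Fin n → ℂ) (i : Fin n) : nBraid q q' i 1 = 1 := by
  rw [← map_one (proj q), nBraid_proj, map_one]

@[simp] theorem nBraid_gen (q' : Fin n → Fin n → ℂ) (i j : Fin n) :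
    nBraid q q' i (gen q j) = q' i j • gen q j := by
  rw [gen, nBraid_proj, braidAut_ι, map_smul]

theorem nDerivR_gen_mul (i j : Fin n) (a : Nichols q) : nDerivR q i (gen q j * a) =
    gen q j * nDerivR q i a + if j = i then nBraid q q i a else 0 := by
  obtain ⟨a, rfl⟩ := proj_surjective q a
  rw [gen_mul_proj, nDerivR_proj, derivR_ι_mul, map_add, map_mul]
  split_ifs
  · rfl
  · rw [map_zero]; rfl

theorem nDerivL_gen_mul (i j : Fin n) (a : Nichols q) : nDerivL q i (gen q j * a) =
    (if j = i then a else 0) + q j i • (gen q j * nDerivL q i a) := by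
  obtain ⟨a, rfl⟩ := proj_surjective q a
  rw [gen_mul_proj, nDerivL_proj, derivL_ι_mul, map_add, map_smul, map_mul]
  split_ifs
  · rfl
  · rw [map_zero]; rfl

theorem nDerivL_mul (i : Fin n) (a b : Nichols q) : nDerivL q i (a * b) =
    nDerivL q i a * b + nBraid q (fun i k => q k i) i a * nDerivL q i b := by
  obtain ⟨a, rfl⟩ := proj_surjective q a
  obtain ⟨b, rfl⟩ := proj_surjective q b
  rw [← map_mul, nDerivL_proj, derivL_mul, map_add, map_mul, map_mul]
  rfl

/-- The form pairs the product of the Nichols algebra with its braided coproduct. -/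
theorem nForm_mul (b b' v : Nichols q) :
    nForm q (b' * b) v = nForm q b' (slice (nForm q b) (nicholsComul q v)) := by
  obtain ⟨b, rfl⟩ := proj_surjective q b
  obtain ⟨b', rfl⟩ := proj_surjective q b'
  obtain ⟨v, rfl⟩ := proj_surjective q v
  rw [← map_mul, nForm_proj, form_mul, nicholsComul_proj, ← nForm_proj]
  congr 1
  generalize braidedComul q v = z
  induction z with
  | zero => simp
  | add x y hx hy => simp only [map_add, hx, hy]
  | tmul x y => simp

/-- Multiplication with the coproduct of `x_i` in the braided tensor square of the Nichols
algebra. -/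
def nPrimMul (i : Fin n) : Nichols q ⊗[ℂ] Nichols q →ₗ[ℂ] Nichols q ⊗[ℂ] Nichols q :=
  TensorProduct.map (LinearMap.mulLeft ℂ (gen q i)) LinearMap.id +
    TensorProduct.map (nBraid q q i) (LinearMap.mulLeft ℂ (gen q i))

@[simp] theorem nPrimMul_tmul (i : Fin n) (a b : Nichols q) :
    nPrimMul q i (a ⊗ₜ b) = (gen q i * a) ⊗ₜ b + nBraid q q i a ⊗ₜ (gen q i * b) := rfl

@[simp] theorem nicholsComul_one : nicholsComul q 1 = 1 ⊗ₜ 1 := by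
  rw [← map_one (proj q), nicholsComul_proj, braidedComul_one]; rfl

theorem nicholsComul_gen_mul (i : Fin n) (a : Nichols q) :
    nicholsComul q (gen q i * a) = nPrimMul q i (nicholsComul q a) := by
  obtain ⟨a, rfl⟩ := proj_surjective q a
  rw [gen_mul_proj, nicholsComul_proj, braidedComul_ι_mul, nicholsComul_proj]
  generalize braidedComul q a = z
  induction z with
  | zero => simp
  | add x y hx hy => simp only [map_add, hx, hy]
  | tmul x y =>
    rw [primMul, LinearMap.add_apply, map_add]
    simp only [TensorProduct.map_tmul, mulGen, LinearMap.mulLeft_apply, AlgHom.toLinearMap_apply,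
      map_mul, LinearMap.id_apply, nPrimMul_tmul]
    rfl

theorem nicholsComul_gen (i : Fin n) :
    nicholsComul q (gen q i) = gen q i ⊗ₜ 1 + 1 ⊗ₜ gen q i := by
  have := nicholsComul_gen_mul q i 1
  rw [mul_one] at this
  rw [this]; simp

theorem nicholsCounit_gen_mul (i : Fin n) (a : Nichols q) :
    nicholsCounit q (gen q i * a) = 0 := by
  obtain ⟨a, rfl⟩ := proj_surjective q a
  rw [gen_mul_proj, nicholsCounit_proj, counit_ι_mul]

@[simp] theorem nicholsCounit_one : nicholsCounit q 1 = 1 := by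
  rw [← map_one (proj q), nicholsCounit_proj, map_one]

section Kill

variable {q} {R : Type*} [Ring R] [Algebra ℂ R]

theorem sum_component (a : TensorAlg n) : ∃ S : Finset (Multiset (Fin n)),
    a = ∑ d ∈ S, component d a := by
  obtain ⟨S, hS⟩ := charAct_eq (C := ℂ) (fun _ : Fin n => 1) 1 a
  refine ⟨S, ?_⟩
  rw [map_one] at hS
  simpa using hS

/-- The defining ideal is multigraded: a linear map which agrees on each multigraded component,
up to left multiplication with a constant, with a map that kills the ideal also kills it. -/
theorem eq_zero_of_graded {f h : TensorAlg n →ₗ[ℂ] R} (hh : ∀ a ∈ nicholsIdeal q, h a = 0)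
    (t : Multiset (Fin n) → R)
    (hf : ∀ w, f (word w) = t (w.toList : Multiset (Fin n)) * h (word w)) :
    ∀ a ∈ nicholsIdeal q, f a = 0 := by
  intro a ha
  obtain ⟨S, hS⟩ := sum_component a
  rw [hS, map_sum]
  refine Finset.sum_eq_zero fun d _ => ?_
  have : f ∘ₗ component d = LinearMap.mulLeft ℂ (t d) ∘ₗ h ∘ₗ component d :=
    lin_ext_word fun w => by
      simp only [LinearMap.comp_apply, component_word', LinearMap.mulLeft_apply]
      split_ifs with hd
      · rw [hf, hd]
      · simp
  have h2 := LinearMap.congr_fun this a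
  simp only [LinearMap.comp_apply, LinearMap.mulLeft_apply] at h2
  rw [h2, hh _ ((isGradedBiideal_nicholsIdeal q).component_mem d a ha), mul_zero]

/-- An element which `q`-commutes with the images of all generators moves past the image of any
element at the cost of a braiding automorphism. -/
theorem mul_algHom_braidAut {α : TensorAlg n →ₐ[ℂ] R} {b : R} {i : Fin n}
    (hc : ∀ j, b * α (FreeAlgebra.ι ℂ j) = q i j • (α (FreeAlgebra.ι ℂ j) * b))
    (a : TensorAlg n) : b * α a = α (braidAut q i a) * b := by
  have : LinearMap.mulLeft ℂ b ∘ₗ α.toLinearMap =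
      LinearMap.mulRight ℂ b ∘ₗ α.toLinearMap ∘ₗ (braidAut q i).toLinearMap :=
    lin_ext_gen (by simp) fun j w ih => by
      simp only [LinearMap.comp_apply, AlgHom.toLinearMap_apply, LinearMap.mulLeft_apply,
        LinearMap.mulRight_apply] at ih ⊢
      rw [braidAut_ι_mul, map_smul, map_mul, map_mul, ← mul_assoc, hc, smul_mul_assoc, mul_assoc,
        ih, smul_mul_assoc, mul_assoc]
  exact LinearMap.congr_fun this a

/-- Sums of `q`-commuting realizations of the generators satisfy the relations of the Nichols
algebra; this expresses that the coproduct of the Nichols algebra is multiplicative. -/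
theorem eq_zero_of_qcommute {α β p : TensorAlg n →ₐ[ℂ] R}
    (hα : ∀ a ∈ nicholsIdeal q, α a = 0) (hβ : ∀ a ∈ nicholsIdeal q, β a = 0)
    (hp : ∀ i, p (FreeAlgebra.ι ℂ i) = α (FreeAlgebra.ι ℂ i) + β (FreeAlgebra.ι ℂ i))
    (hc : ∀ i j, β (FreeAlgebra.ι ℂ i) * α (FreeAlgebra.ι ℂ j) =
      q i j • (α (FreeAlgebra.ι ℂ j) * β (FreeAlgebra.ι ℂ i))) :
    ∀ a ∈ nicholsIdeal q, p a = 0 := by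
  have h1 : p.toLinearMap = LinearMap.mul' ℂ R ∘ₗ
      TensorProduct.map α.toLinearMap β.toLinearMap ∘ₗ braidedComul q :=
    lin_ext_gen (by simp) fun i w ih => by
      simp only [LinearMap.comp_apply, AlgHom.toLinearMap_apply, braidedComul_ι_mul] at ih ⊢
      rw [map_mul, ih, hp]
      generalize braidedComul q (word w) = z
      induction z with
      | zero => simp
      | add x y hx hy => simp only [map_add, mul_add, hx, hy]
      | tmul x y =>
        simp only [primMul, mulGen, LinearMap.add_apply, map_add, TensorProduct.map_tmul,
          LinearMap.mul'_apply, AlgHom.toLinearMap_apply, LinearMap.mulLeft_apply, map_mul,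
          LinearMap.id_apply]
        rw [add_mul, ← mul_assoc, ← mul_assoc, ← mul_assoc,
          mul_algHom_braidAut (fun j => hc i j)]
  have h2 : TensorProduct.map α.toLinearMap β.toLinearMap =
      TensorProduct.map (descend α.toLinearMap hα) (descend β.toLinearMap hβ) ∘ₗ
        TensorProduct.map (projₗ q) (projₗ q) := by
    rw [← TensorProduct.map_comp]; rfl
  intro a ha
  have h3 := LinearMap.congr_fun h1 a
  rw [h2] at h3
  refine h3.trans ?_
  have h4 : TensorProduct.map (projₗ q) (projₗ q) (braidedComul q a) = 0 :=
    (isGradedBiideal_nicholsIdeal q).comul_mem a ha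
  simp only [LinearMap.comp_apply, h4, map_zero]

end Kill

end NicholsAlgebra
end NicholsDescent

/-! ### Shifts of a Hopf algebra by its characters -/

noncomputable section CharacterShift

variable {C : Type u} [CommRing C] [HopfAlgebra ℂ C]

theorem IsGroupLikeElem.char_mul {a : C} (ha : IsGroupLikeElem ℂ a) (χ ψ : CharGroup C) :
    (χ * ψ) a = χ a * ψ a := by
  change LinearMap.mul' ℂ ℂ (TensorProduct.map χ.ofConv.toLinearMap ψ.ofConv.toLinearMap
    (Coalgebra.comul (R := ℂ) a)) = _
  rw [ha.comul_eq_tmul_self]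
  rfl

theorem IsGroupLikeElem.char_one {a : C} (ha : IsGroupLikeElem ℂ a) :
    (1 : CharGroup C) a = 1 := ha.counit_eq_one

theorem charShift_grouplike {a : C} (ha : IsGroupLikeElem ℂ a) (χ : CharGroup C) :
    charShift χ a = χ a • a := by
  simp only [charShift, LinearMap.comp_apply, ha.comul_eq_tmul_self]
  rfl

theorem char_charShift (χ ψ : CharGroup C) (c : C) : ψ (charShift χ c) = (χ * ψ) c := by
  change ψ (charShift χ c) = LinearMap.mul' ℂ ℂ (TensorProduct.map χ.ofConv.toLinearMap
    ψ.ofConv.toLinearMap (Coalgebra.comul (R := ℂ) c))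
  simp only [charShift, LinearMap.comp_apply]
  generalize Coalgebra.comul (R := ℂ) c = z
  induction z with
  | zero => simp
  | add x y hx hy => simp only [map_add, hx, hy]
  | tmul x y =>
    simp only [LinearMap.rTensor_tmul, LinearEquiv.coe_coe, TensorProduct.lid_tmul,
      TensorProduct.map_tmul, LinearMap.mul'_apply, AlgHom.toLinearMap_apply, map_smul, smul_eq_mul]

/-- A character, considered as an algebra homomorphism with values in `C`. -/
def charUnit (χ : CharGroup C) : WithConv (C →ₐ[ℂ] C) :=
  .toConv ((Algebra.ofId ℂ C).comp χ.ofConv)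

variable [Coalgebra.IsCocomm ℂ C]

/-- The map `charShift` is the convolution of a character and the identity. -/
theorem charShift_eq (χ : CharGroup C) (c : C) :
    charShift χ c = (charUnit χ * .toConv (AlgHom.id ℂ C)) c := by
  change _ = LinearMap.mul' ℂ C (TensorProduct.map (charUnit χ).ofConv.toLinearMap
    (AlgHom.id ℂ C).toLinearMap (Coalgebra.comul (R := ℂ) c))
  simp only [charShift, LinearMap.comp_apply]
  generalize Coalgebra.comul (R := ℂ) c = z
  induction z with
  | zero => simp
  | add x y hx hy => simp only [map_add, hx, hy]
  | tmul x y => exact Algebra.smul_def _ _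

theorem comp_charUnit (h : C →ₐ[ℂ] C) (χ : CharGroup C) :
    WithConv.toConv (h.comp (charUnit χ).ofConv) = charUnit χ := by
  apply WithConv.ext
  ext c
  exact h.commutes _

/-- The map `charShift` is an algebra endomorphism of `C`. -/
def charShiftAlg (χ : CharGroup C) : C →ₐ[ℂ] C := (charUnit χ * .toConv (AlgHom.id ℂ C)).ofConv

theorem charShiftAlg_apply (χ : CharGroup C) (c : C) : charShiftAlg χ c = charShift χ c :=
  (charShift_eq χ c).symm

theorem comp_charShiftAlg (h : C →ₐ[ℂ] C) (χ : CharGroup C) :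
    WithConv.toConv (h.comp (charShiftAlg χ)) = charUnit χ * .toConv h := by
  rw [charShiftAlg, AlgHom.comp_convMul_distrib, comp_charUnit]
  rfl

theorem charUnit_mul (χ ψ : CharGroup C) : charUnit (χ * ψ) = charUnit χ * charUnit ψ := by
  rw [charUnit, AlgHom.comp_convMul_distrib]
  rfl

theorem charShift_charShift (χ ψ : CharGroup C) (c : C) :
    charShift χ (charShift ψ c) = charShift (χ * ψ) c := by
  have h := comp_charShiftAlg (charShiftAlg χ) ψ
  have e : WithConv.toConv (charShiftAlg χ) = charUnit χ * .toConv (AlgHom.id ℂ C) := rfl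
  rw [e, ← mul_assoc, ← charUnit_mul, mul_comm ψ χ] at h
  have h2 := congrArg (fun f : WithConv (C →ₐ[ℂ] C) => f c) h
  rw [charShift_eq (χ * ψ), ← charShiftAlg_apply, ← charShiftAlg_apply]
  exact h2

@[simp] theorem charShift_one (c : C) : charShift (1 : CharGroup C) c = c := by
  rw [charShift_eq]
  have : charUnit (1 : CharGroup C) = 1 := rfl
  rw [this, one_mul]
  rfl

theorem charShift_antipode (χ : CharGroup C) (c : C) :
    charShift χ (HopfAlgebra.antipode ℂ (charShift χ c)) = HopfAlgebra.antipode ℂ c := by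
  have h1 : WithConv.toConv ((charShiftAlg χ).comp (HopfAlgebra.antipodeAlgHom ℂ C)) =
      (charUnit χ * .toConv (AlgHom.id ℂ C))⁻¹ := by
    rw [eq_inv_iff_mul_eq_one]
    have h := AlgHom.comp_convMul_distrib (charShiftAlg χ)
      (.toConv (HopfAlgebra.antipodeAlgHom ℂ C)) (.toConv (AlgHom.id ℂ C))
    rw [AlgHom.antipode_id_cancel] at h
    have h' := congrArg WithConv.toConv h
    refine Eq.trans ?_ (h'.symm.trans ?_)
    · rfl
    · apply WithConv.ext
      ext c
      exact (charShiftAlg χ).commutes _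
  have h2 : (WithConv.toConv (AlgHom.id ℂ C) : WithConv (C →ₐ[ℂ] C))⁻¹ =
      .toConv (HopfAlgebra.antipodeAlgHom ℂ C) :=
    inv_eq_of_mul_eq_one_left AlgHom.antipode_id_cancel
  have h3 := comp_charShiftAlg ((charShiftAlg χ).comp (HopfAlgebra.antipodeAlgHom ℂ C)) χ
  rw [h1, mul_inv, mul_inv_cancel_left, h2] at h3
  have h4 := congrArg (fun f : WithConv (C →ₐ[ℂ] C) => f c) h3
  rw [← charShiftAlg_apply, ← charShiftAlg_apply]
  exact h4

theorem comul_charShift_left (χ : CharGroup C) (c : C) :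
    Coalgebra.comul (R := ℂ) (charShift χ c) =
      (charShift χ).rTensor C (Coalgebra.comul (R := ℂ) c) := by
  have h : ∀ z : C ⊗[ℂ] C, Coalgebra.comul (R := ℂ) (TensorProduct.lid ℂ C
      (χ.ofConv.toLinearMap.rTensor C z)) =
      ((TensorProduct.lid ℂ C).toLinearMap ∘ₗ χ.ofConv.toLinearMap.rTensor C).rTensor C
        ((TensorProduct.assoc ℂ C C C).symm ((Coalgebra.comul (R := ℂ)).lTensor C z)) := by
    intro z
    induction z with
    | zero => simp
    | add x y hx hy => simp only [map_add, hx, hy]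
    | tmul x y =>
      simp only [LinearMap.rTensor_tmul, TensorProduct.lid_tmul, map_smul, LinearMap.lTensor_tmul]
      generalize Coalgebra.comul (R := ℂ) y = w
      induction w with
      | zero => simp
      | add x y hx hy => simp only [smul_add, TensorProduct.tmul_add, map_add, hx, hy]
      | tmul x y => simp [TensorProduct.smul_tmul']
  have e : charShift χ c = TensorProduct.lid ℂ C
    (χ.ofConv.toLinearMap.rTensor C (Coalgebra.comul (R := ℂ) c)) := rfl
  rw [e, h, Coalgebra.coassoc_symm_apply, ← LinearMap.comp_apply, ← LinearMap.rTensor_comp]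
  rfl

theorem comul_charShift_right (χ : CharGroup C) (c : C) :
    Coalgebra.comul (R := ℂ) (charShift χ c) =
      (charShift χ).lTensor C (Coalgebra.comul (R := ℂ) c) := by
  have h : ∀ z : C ⊗[ℂ] C, TensorProduct.comm ℂ C C ((charShift χ).rTensor C z) =
      (charShift χ).lTensor C (TensorProduct.comm ℂ C C z) := by
    intro z
    induction z with
    | zero => simp
    | add x y hx hy => simp only [map_add, hx, hy]
    | tmul x y => simp
  rw [← Coalgebra.comm_comul ℂ (charShift χ c), comul_charShift_left, h, Coalgebra.comm_comul]

end CharacterShift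

/-! ### Realizations of the generators of `U` -/

noncomputable section Realizations

open NicholsAlgebra

variable {C : Type u} [CommRing C] [HopfAlgebra ℂ C] [Coalgebra.IsCocomm ℂ C] {n : ℕ}

namespace QuantumGroup

/-- The grouplike elements `g_i`, `g'_i` represent the bicharacter: `σ(γ_i, χ) = χ(g_i)` and
`σ(χ, γ_i) = χ(g'_i)`. -/
class IsLinkingDatum (σ : CharGroup C →* CharGroup C →* ℂˣ) (γ : Fin n → CharGroup C)
    (g g' : Fin n → C) : Prop where
  left_grouplike : ∀ i, IsGroupLikeElem ℂ (g i)
  right_grouplike : ∀ i, IsGroupLikeElem ℂ (g' i)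
  left_eval : ∀ i (χ : CharGroup C), ((σ (γ i) χ : ℂˣ) : ℂ) = χ (g i)
  right_eval : ∀ i (χ : CharGroup C), ((σ χ (γ i) : ℂˣ) : ℂ) = χ (g' i)

variable (σ : CharGroup C →* CharGroup C →* ℂˣ) (γ : Fin n → CharGroup C) (g g' : Fin n → C)

/-- Elements of an algebra `R` which satisfy the commutation relations between `C` and the
generators `x_i`, `x_i^*` and the linking relation, but not necessarily the relations of the Nichols
algebras. -/
structure Realization (R : Type*) [Ring R] [Algebra ℂ R] where
  ofC : C →ₐ[ℂ] R
  x : Fin n → R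
  y : Fin n → R
  commX : ∀ c i, ofC c * x i = x i * ofC (charShift (γ i) c)
  commY : ∀ c i, ofC c * y i = y i * ofC (charShift (γ i)⁻¹ c)
  link : ∀ i j, y j * x i - braidingMatrix γ σ i j • (x i * y j) =
    if i = j then 1 - ofC (g' i * g i) else 0

variable {σ γ g g'}

theorem braidingMatrix_inv (γ : Fin n → CharGroup C) (σ : CharGroup C →* CharGroup C →* ℂˣ) :
    braidingMatrix (fun i => (γ i)⁻¹) σ = braidingMatrix γ σ := by
  ext i j; simp [braidingMatrix]

theorem braidingMatrix_ne_zero (i j : Fin n) : braidingMatrix γ σ i j ≠ 0 := Units.ne_zero _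

theorem char_left (h : IsLinkingDatum σ γ g g') (i j : Fin n) :
    γ j (g i) = braidingMatrix γ σ i j := (h.left_eval i (γ j)).symm

theorem char_right (h : IsLinkingDatum σ γ g g') (i j : Fin n) :
    γ j (g' i) = braidingMatrix γ σ j i := (h.right_eval i (γ j)).symm

theorem char_inv_left (h : IsLinkingDatum σ γ g g') (χ : CharGroup C) (i : Fin n) :
    χ⁻¹ (g i) = (χ (g i))⁻¹ := by
  refine eq_inv_of_mul_eq_one_left ?_
  rw [← (h.left_grouplike i).char_mul, inv_mul_cancel, (h.left_grouplike i).char_one]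

theorem char_inv_right (h : IsLinkingDatum σ γ g g') (χ : CharGroup C) (i : Fin n) :
    χ⁻¹ (g' i) = (χ (g' i))⁻¹ := by
  refine eq_inv_of_mul_eq_one_left ?_
  rw [← (h.right_grouplike i).char_mul, inv_mul_cancel, (h.right_grouplike i).char_one]

namespace Realization

variable {R : Type*} [Ring R] [Algebra ℂ R] (D : Realization σ γ g g' R)

/-- The evaluation of noncommutative polynomials in the elements `x_i`. -/
def polyX : TensorAlg n →ₐ[ℂ] R := FreeAlgebra.lift ℂ D.x

/-- The evaluation of noncommutative polynomials in the elements `x_i^*`. -/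
def polyY : TensorAlg n →ₐ[ℂ] R := FreeAlgebra.lift ℂ D.y

@[simp] theorem polyX_ι (i : Fin n) : D.polyX (FreeAlgebra.ι ℂ i) = D.x i := by simp [polyX]
@[simp] theorem polyY_ι (i : Fin n) : D.polyY (FreeAlgebra.ι ℂ i) = D.y i := by simp [polyY]

variable [h : IsLinkingDatum σ γ g g']

include h

theorem left_mul_x (i j : Fin n) :
    D.ofC (g i) * D.x j = braidingMatrix γ σ i j • (D.x j * D.ofC (g i)) := by
  rw [D.commX, charShift_grouplike (h.left_grouplike i), map_smul, mul_smul_comm, char_left h]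

theorem right_mul_x (i j : Fin n) :
    D.ofC (g' i) * D.x j = braidingMatrix γ σ j i • (D.x j * D.ofC (g' i)) := by
  rw [D.commX, charShift_grouplike (h.right_grouplike i), map_smul, mul_smul_comm, char_right h]

theorem left_mul_y (i j : Fin n) :
    D.ofC (g i) * D.y j = (braidingMatrix γ σ i j)⁻¹ • (D.y j * D.ofC (g i)) := by
  rw [D.commY, charShift_grouplike (h.left_grouplike i), map_smul, mul_smul_comm,
    char_inv_left h, char_left h]

theorem right_mul_y (i j : Fin n) :
    D.ofC (g' i) * D.y j = (braidingMatrix γ σ j i)⁻¹ • (D.y j * D.ofC (g' i)) := by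
  rw [D.commY, charShift_grouplike (h.right_grouplike i), map_smul, mul_smul_comm,
    char_inv_right h, char_right h]

theorem y_mul_x (i j : Fin n) : D.y j * D.x i = braidingMatrix γ σ i j • (D.x i * D.y j) +
    if i = j then 1 - D.ofC (g' i) * D.ofC (g i) else 0 := by
  rw [← map_mul, ← D.link]; abel

theorem left_mul_polyX (i : Fin n) (a : TensorAlg n) :
    D.ofC (g i) * D.polyX a = D.polyX (braidAut (braidingMatrix γ σ) i a) * D.ofC (g i) :=
  mul_algHom_braidAut (fun j => by rw [polyX_ι, D.left_mul_x]) a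

theorem polyY_mul_left (i : Fin n) (a : TensorAlg n) :
    D.polyY a * D.ofC (g i) = D.ofC (g i) * D.polyY (braidAut (braidingMatrix γ σ) i a) := by
  have h1 := mul_algHom_braidAut (q := fun i j => (braidingMatrix γ σ i j)⁻¹) (α := D.polyY)
    (b := D.ofC (g i)) (i := i) (fun j => by rw [polyY_ι, D.left_mul_y])
    (braidAut (braidingMatrix γ σ) i a)
  rw [h1]
  congr 2
  have : (braidAut (fun i j => (braidingMatrix γ σ i j)⁻¹) i).comp
      (braidAut (braidingMatrix γ σ) i) = AlgHom.id ℂ (TensorAlg n) := by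
    ext j
    simp [smul_smul, braidingMatrix_ne_zero]
  exact (AlgHom.congr_fun this a).symm

/-- The commutation of polynomials in the `x_j^*` with the `x_i`. -/
theorem polyY_mul_x (i : Fin n) (b : TensorAlg n) :
    D.polyY b * D.x i = D.x i * D.polyY (braidAut (braidingMatrix γ σ) i b) +
      D.polyY (derivR (braidingMatrix γ σ) i b) -
      D.ofC (g' i) * D.polyY (derivL (braidingMatrix γ σ) i b) * D.ofC (g i) := by
  set q := braidingMatrix γ σ
  have : LinearMap.mulRight ℂ (D.x i) ∘ₗ D.polyY.toLinearMap =
      LinearMap.mulLeft ℂ (D.x i) ∘ₗ D.polyY.toLinearMap ∘ₗ (braidAut q i).toLinearMap +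
      D.polyY.toLinearMap ∘ₗ derivR q i -
      LinearMap.mulRight ℂ (D.ofC (g i)) ∘ₗ LinearMap.mulLeft ℂ (D.ofC (g' i)) ∘ₗ
        D.polyY.toLinearMap ∘ₗ derivL q i :=
    lin_ext_gen (by simp) fun j w ih => by
      simp only [LinearMap.comp_apply, AlgHom.toLinearMap_apply, LinearMap.mulLeft_apply,
        LinearMap.mulRight_apply, LinearMap.add_apply, LinearMap.sub_apply] at ih ⊢
      have e1 : D.ofC (g' i) * (q j i • (D.y j * D.polyY (derivL q i (word w)))) =
          D.y j * (D.ofC (g' i) * D.polyY (derivL q i (word w))) := by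
        rw [mul_smul_comm, ← mul_assoc, D.right_mul_y, smul_mul_assoc, smul_smul,
          mul_inv_cancel₀ (braidingMatrix_ne_zero _ _), one_smul, mul_assoc]
      have e2 := D.polyY_mul_left i (word w)
      rw [braidAut_ι_mul, map_smul, map_mul, map_mul, derivR_ι_mul, derivL_ι_mul, map_add, map_add,
        map_smul, map_mul, map_mul, polyY_ι, mul_assoc, ih, mul_sub, mul_add, ← mul_assoc (D.y j),
        D.y_mul_x, add_mul, mul_add (D.ofC (g' i)), e1, add_mul, mul_smul_comm,
        smul_mul_assoc]
      by_cases hij : i = j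
      · subst hij
        simp only [if_true, sub_mul, one_mul, mul_assoc, e2]
        abel
      · simp only [hij, Ne.symm hij, if_false, map_zero, zero_mul, mul_zero, mul_assoc]
        abel
  exact LinearMap.congr_fun this b

/-- The commutation of the `x_j^*` with polynomials in the `x_i`. -/
theorem y_mul_polyX (j : Fin n) (a : TensorAlg n) :
    D.y j * D.polyX a = D.polyX (braidAut (fun j i => braidingMatrix γ σ i j) j a) * D.y j +
      D.polyX (derivL (braidingMatrix γ σ) j a) -
      D.ofC (g' j) * D.polyX (derivR (braidingMatrix γ σ) j a) * D.ofC (g j) := by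
  set q := braidingMatrix γ σ with hq
  have : LinearMap.mulLeft ℂ (D.y j) ∘ₗ D.polyX.toLinearMap =
      LinearMap.mulRight ℂ (D.y j) ∘ₗ D.polyX.toLinearMap ∘ₗ
        (braidAut (fun j i => q i j) j).toLinearMap +
      D.polyX.toLinearMap ∘ₗ derivL q j -
      LinearMap.mulRight ℂ (D.ofC (g j)) ∘ₗ LinearMap.mulLeft ℂ (D.ofC (g' j)) ∘ₗ
        D.polyX.toLinearMap ∘ₗ derivR q j :=
    lin_ext_gen (by simp) fun i w ih => by
      simp only [LinearMap.comp_apply, AlgHom.toLinearMap_apply, LinearMap.mulLeft_apply,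
        LinearMap.mulRight_apply, LinearMap.add_apply, LinearMap.sub_apply] at ih ⊢
      have e1 : D.ofC (g' j) * (D.x i * D.polyX (derivR q j (word w))) =
          q i j • (D.x i * (D.ofC (g' j) * D.polyX (derivR q j (word w)))) := by
        rw [← mul_assoc, D.right_mul_x, smul_mul_assoc, mul_assoc]
      have e2 := D.left_mul_polyX j (word w)
      rw [braidAut_ι_mul, map_smul, map_mul, map_mul, derivR_ι_mul, derivL_ι_mul, map_add, map_add,
        map_smul, map_mul, map_mul, polyX_ι, ← mul_assoc, D.y_mul_x, add_mul,
        smul_mul_assoc, mul_assoc (D.x i), ih, mul_sub, mul_add, mul_add (D.ofC (g' j)), e1,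
        add_mul, smul_sub, smul_add, smul_mul_assoc]
      by_cases hij : i = j
      · subst hij
        simp only [if_true, sub_mul, one_mul, mul_assoc, e2, smul_mul_assoc, ← hq]
        abel
      · simp only [hij, if_false, map_zero, zero_mul, mul_zero, mul_assoc, smul_mul_assoc, ← hq]
        abel
  exact LinearMap.congr_fun this a

end Realization

end QuantumGroup
end Realizations

/-! ### The universal property and the Hopf algebra structure of `U` -/

noncomputable section HopfAlgebraU

open NicholsAlgebra

variable {C : Type u} [CommRing C] [HopfAlgebra ℂ C] [Coalgebra.IsCocomm ℂ C] {n : ℕ}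

namespace QuantumGroup

variable {σ : CharGroup C →* CharGroup C →* ℂˣ} {γ : Fin n → CharGroup C} {g g' : Fin n → C}

section Universal

variable (σ γ g g')

theorem mk_surjective : Function.Surjective (mk σ γ g g') := RingQuot.mkAlgHom_surjective ℂ _

/-- A subalgebra of `U` which contains the generators is everything. -/
theorem subalgebra_eq_top {S : Subalgebra ℂ (QuantumGroup σ γ g g')}
    (hc : ∀ c, ofC σ γ g g' c ∈ S) (hx : ∀ i, x σ γ g g' i ∈ S) (hy : ∀ i, y σ γ g g' i ∈ S)
    (a : QuantumGroup σ γ g g') : a ∈ S := by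
  obtain ⟨a, rfl⟩ := mk_surjective σ γ g g' a
  induction a using FreeAlgebra.induction with
  | grade0 r => rw [AlgHomClass.commutes]; exact S.algebraMap_mem r
  | grade1 z =>
    cases z with
    | ofC c => exact hc c
    | x i => exact hx i
    | y i => exact hy i
  | mul a b ha hb => rw [map_mul]; exact S.mul_mem ha hb
  | add a b ha hb => rw [map_add]; exact S.add_mem ha hb

variable {σ γ g g'}

/-- An algebra homomorphism from `U` is determined by its values on `C`, on the `x_i` and on the
`x_i^*`. -/
theorem algHom_ext {R : Type*} [Ring R] [Algebra ℂ R] {f f' : QuantumGroup σ γ g g' →ₐ[ℂ] R}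
    (hc : ∀ c, f (ofC σ γ g g' c) = f' (ofC σ γ g g' c))
    (hx : ∀ i, f (x σ γ g g' i) = f' (x σ γ g g' i))
    (hy : ∀ i, f (y σ γ g g' i) = f' (y σ γ g g' i)) : f = f' :=
  AlgHom.ext fun a => subalgebra_eq_top σ γ g g' (S := AlgHom.equalizer f f') hc hx hy a

variable {R : Type*} [Ring R] [Algebra ℂ R]

/-- The images of the generators under the map from the free algebra to `R`. -/
def Realization.genMap (D : Realization σ γ g g' R) : QuantumGen C n → R
  | .ofC c => D.ofC c
  | .x i => D.x i
  | .y i => D.y i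

theorem Realization.lift_genMap_xx (D : Realization σ γ g g' R) (a : TensorAlg n) :
    FreeAlgebra.lift ℂ D.genMap (FreeAlgebra.lift ℂ (xx C) a) = D.polyX a := by
  have : (FreeAlgebra.lift ℂ D.genMap).comp (FreeAlgebra.lift ℂ (xx C)) = D.polyX := by
    ext i; simp [genMap, xx]
  exact AlgHom.congr_fun this a

theorem Realization.lift_genMap_yy (D : Realization σ γ g g' R) (a : TensorAlg n) :
    FreeAlgebra.lift ℂ D.genMap (FreeAlgebra.lift ℂ (yy C) a) = D.polyY a := by
  have : (FreeAlgebra.lift ℂ D.genMap).comp (FreeAlgebra.lift ℂ (yy C)) = D.polyY := by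
    ext i; simp [genMap, yy]
  exact AlgHom.congr_fun this a

/-- The universal property of `U`. -/
def Realization.lift [h : IsLinkingDatum σ γ g g'] (D : Realization σ γ g g' R)
    (hX : ∀ a ∈ nicholsIdeal (braidingMatrix γ σ), D.polyX a = 0)
    (hY : ∀ a ∈ nicholsIdeal (braidingMatrix γ σ), D.polyY a = 0) :
    QuantumGroup σ γ g g' →ₐ[ℂ] R :=
  RingQuot.liftAlgHom ℂ ⟨FreeAlgebra.lift ℂ D.genMap, by
    intro a b hab
    cases hab with
    | add c d => simp [genMap]
    | mul c d => simp [genMap]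
    | scalar r => simp [genMap]
    | nichols a ha => rw [D.lift_genMap_xx, hX a ha, map_zero]
    | nicholsDual a ha => rw [D.lift_genMap_yy, hY a (by rwa [braidingMatrix_inv] at ha), map_zero]
    | commX c i => simpa [genMap] using D.commX c i
    | commY c i => simpa [genMap] using D.commY c i
    | link i j =>
      have := D.link i j
      rw [← char_left h] at this
      split_ifs with hij
      · subst hij; simpa [genMap] using this
      · rw [if_neg hij] at this; simpa [genMap] using this⟩

section

variable [h : IsLinkingDatum σ γ g g'] (D : Realization σ γ g g' R)
    (hX : ∀ a ∈ nicholsIdeal (braidingMatrix γ σ), D.polyX a = 0)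
    (hY : ∀ a ∈ nicholsIdeal (braidingMatrix γ σ), D.polyY a = 0)

theorem Realization.lift_mk (a : Free C n) :
    D.lift hX hY (QuantumGroup.mk σ γ g g' a) = FreeAlgebra.lift ℂ D.genMap a :=
  RingQuot.liftAlgHom_mkAlgHom_apply ℂ _ _ a

@[simp] theorem Realization.lift_ofC (c : C) : D.lift hX hY (QuantumGroup.ofC σ γ g g' c) = D.ofC c := by
  change D.lift hX hY (QuantumGroup.mk σ γ g g' _) = _
  rw [D.lift_mk, FreeAlgebra.lift_ι_apply]; rfl

@[simp] theorem Realization.lift_x (i : Fin n) : D.lift hX hY (QuantumGroup.x σ γ g g' i) = D.x i := by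
  rw [QuantumGroup.x, D.lift_mk, FreeAlgebra.lift_ι_apply]; rfl

@[simp] theorem Realization.lift_y (i : Fin n) : D.lift hX hY (QuantumGroup.y σ γ g g' i) = D.y i := by
  rw [QuantumGroup.y, D.lift_mk, FreeAlgebra.lift_ι_apply]; rfl

end

variable (σ γ g g') in
/-- The generators of `U`. -/
def univ [h : IsLinkingDatum σ γ g g'] : Realization σ γ g g' (QuantumGroup σ γ g g') where
  ofC := ofC σ γ g g'
  x := x σ γ g g'
  y := y σ γ g g'
  commX c i := by
    have := mk_rel σ γ g g' (.commX c i)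
    rw [map_mul, map_mul] at this
    exact this
  commY c i := by
    have := mk_rel σ γ g g' (.commY c i)
    rw [map_mul, map_mul] at this
    exact this
  link i j := by
    have := mk_rel σ γ g g' (.link i j)
    rw [char_left h, map_sub, map_mul, map_smul, map_mul] at this
    refine this.trans ?_
    split_ifs
    · rw [map_sub, map_one]; rfl
    · rw [map_zero]

variable [h : IsLinkingDatum σ γ g g']

@[simp] theorem univ_ofC (c : C) : (univ σ γ g g').ofC c = ofC σ γ g g' c := rfl
@[simp] theorem univ_x (i : Fin n) : (univ σ γ g g').x i = x σ γ g g' i := rfl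
@[simp] theorem univ_y (i : Fin n) : (univ σ γ g g').y i = y σ γ g g' i := rfl

theorem ofC_mul_x (c : C) (i : Fin n) : ofC σ γ g g' c * x σ γ g g' i =
    x σ γ g g' i * ofC σ γ g g' (charShift (γ i) c) := (univ σ γ g g').commX c i

theorem ofC_mul_y (c : C) (i : Fin n) : ofC σ γ g g' c * y σ γ g g' i =
    y σ γ g g' i * ofC σ γ g g' (charShift (γ i)⁻¹ c) := (univ σ γ g g').commY c i

theorem univ_polyX_eq_zero : ∀ a ∈ nicholsIdeal (braidingMatrix γ σ),
    (univ σ γ g g').polyX a = 0 := by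
  intro a ha
  have := mk_rel σ γ g g' (.nichols a ha)
  rw [map_zero] at this
  rw [← this]
  have e : (univ σ γ g g').polyX = (mk σ γ g g').comp (FreeAlgebra.lift ℂ (xx C)) := by
    ext i; simp [univ, x]
  rw [e]; rfl

theorem univ_polyY_eq_zero : ∀ a ∈ nicholsIdeal (braidingMatrix γ σ),
    (univ σ γ g g').polyY a = 0 := by
  intro a ha
  have := mk_rel σ γ g g' (.nicholsDual a (by rwa [braidingMatrix_inv]))
  rw [map_zero] at this
  rw [← this]
  have e : (univ σ γ g g').polyY = (mk σ γ g g').comp (FreeAlgebra.lift ℂ (yy C)) := by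
    ext i; simp [univ, y]
  rw [e]; rfl

end Universal

section Kill

variable {q : Fin n → Fin n → ℂ} {R : Type*} [Ring R] [Algebra ℂ R]

/-- If the `z_i` satisfy the relations of a Nichols algebra, then so do the `s_i z_i`, where the
`s_i` commute with each other and with the `z_j`. -/
theorem lift_mul_eq_zero {φ : C →ₐ[ℂ] R} {s : Fin n → C} {z : Fin n → R}
    (hz : ∀ a ∈ nicholsIdeal q, FreeAlgebra.lift ℂ z a = 0)
    (hs : ∀ i j, z j * φ (s i) = φ (s i) * z j) :
    ∀ a ∈ nicholsIdeal q, FreeAlgebra.lift ℂ (fun i => φ (s i) * z i) a = 0 := by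
  refine eq_zero_of_graded (f := (FreeAlgebra.lift ℂ fun i => φ (s i) * z i).toLinearMap)
    (h := (FreeAlgebra.lift ℂ z).toLinearMap) hz (fun d => φ (d.map s).prod) fun w => ?_
  have hs' : ∀ (l : List (Fin n)) j, z j * φ (l.map s).prod = φ (l.map s).prod * z j := by
    intro l j
    induction l with
    | nil => simp
    | cons i l ih => simp only [List.map_cons, List.prod_cons, map_mul]; rw [← mul_assoc, hs,
        mul_assoc, ih, mul_assoc]
  simp only [AlgHom.toLinearMap_apply, Multiset.map_coe, Multiset.prod_coe]
  induction w using FreeMonoid.inductionOn' with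
  | one => simp [word_one]
  | of_mul i w ih =>
    rw [FreeMonoid.toList_of_mul, List.map_cons, List.prod_cons, word_of_mul, map_mul, map_mul,
      map_mul, ih, FreeAlgebra.lift_ι_apply, FreeAlgebra.lift_ι_apply, mul_assoc, ← mul_assoc (z i),
      hs', mul_assoc, mul_assoc]

/-- If the `z_i` satisfy the relations of a Nichols algebra and `z_j s_i = q_{ij} s_i z_j`, then
the `-s_i z_i` satisfy these relations in the opposite algebra. -/
theorem lift_op_eq_zero {φ : C →ₐ[ℂ] R} {s : Fin n → C} {z : Fin n → R}
    (hz : ∀ a ∈ nicholsIdeal q, FreeAlgebra.lift ℂ z a = 0)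
    (hs : ∀ i j, z j * φ (s i) = q i j • (φ (s i) * z j)) :
    ∀ a ∈ nicholsIdeal q,
      FreeAlgebra.lift ℂ (fun i => MulOpposite.op (-(φ (s i) * z i))) a = 0 := by
  set Z : TensorAlg n →ₐ[ℂ] R := FreeAlgebra.lift ℂ z with hZ
  have hs' : ∀ i a, Z a * φ (s i) = φ (s i) * Z (braidAut q i a) := by
    intro i a
    have : LinearMap.mulRight ℂ (φ (s i)) ∘ₗ Z.toLinearMap =
        LinearMap.mulLeft ℂ (φ (s i)) ∘ₗ Z.toLinearMap ∘ₗ (braidAut q i).toLinearMap :=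
      lin_ext_gen (by simp) fun j w ih => by
        simp only [LinearMap.comp_apply, AlgHom.toLinearMap_apply, LinearMap.mulLeft_apply,
          LinearMap.mulRight_apply] at ih ⊢
        rw [braidAut_ι_mul, map_smul, map_mul, map_mul, mul_assoc, ih, ← mul_assoc, hZ,
          FreeAlgebra.lift_ι_apply, hs, smul_mul_assoc, mul_smul_comm, mul_assoc]
    exact LinearMap.congr_fun this a
  have key := eq_zero_of_graded (q := q) (f := (MulOpposite.opLinearEquiv ℂ).symm.toLinearMap ∘ₗ
    (FreeAlgebra.lift ℂ fun i => MulOpposite.op (-(φ (s i) * z i))).toLinearMap)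
    (h := Z.toLinearMap ∘ₗ braidedRev q) (fun a ha => hz _ (braidedRev_mem q ha))
    (fun d => φ (d.map s).prod) fun w => by
      simp only [AlgHom.toLinearMap_apply, Multiset.map_coe, Multiset.prod_coe,
        LinearMap.comp_apply, LinearEquiv.coe_coe, MulOpposite.coe_opLinearEquiv_symm]
      induction w using FreeMonoid.inductionOn' with
      | one => simp [word_one]
      | of_mul i w ih =>
        rw [FreeMonoid.toList_of_mul, List.map_cons, List.prod_cons, mul_comm (s i), map_mul φ,
          word_of_mul, map_mul, MulOpposite.unop_mul, ih, FreeAlgebra.lift_ι_apply,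
          MulOpposite.unop_op, braidedRev_ι_mul, map_neg, map_mul Z, mul_neg, mul_neg, mul_assoc,
          ← mul_assoc (Z _), hs', hZ, FreeAlgebra.lift_ι_apply]
        simp only [mul_assoc]
  intro a ha
  exact MulOpposite.unop_injective (key a ha)

end Kill

section Comul

variable [h : IsLinkingDatum σ γ g g']

local notation "U" => QuantumGroup σ γ g g'

variable (σ γ g g')

/-- The homomorphism `C → U ⊗ U`, the composition of the coproduct with the inclusion. -/
def comulC : C →ₐ[ℂ] U ⊗[ℂ] U :=
  (Algebra.TensorProduct.map (ofC σ γ g g') (ofC σ γ g g')).comp (Bialgebra.comulAlgHom ℂ C)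

variable {σ γ g g'}

theorem comulC_apply (c : C) : comulC σ γ g g' c = TensorProduct.map (ofC σ γ g g').toLinearMap
    (ofC σ γ g g').toLinearMap (Coalgebra.comul (R := ℂ) c) := rfl

theorem comulC_mul_left {c : C} {χ : CharGroup C} {z : U}
    (hz : ∀ c, ofC σ γ g g' c * z = z * ofC σ γ g g' (charShift χ c)) :
    comulC σ γ g g' c * (z ⊗ₜ 1) = (z ⊗ₜ 1) * comulC σ γ g g' (charShift χ c) := by
  rw [comulC_apply, comulC_apply, comul_charShift_left]
  generalize Coalgebra.comul (R := ℂ) c = w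
  induction w with
  | zero => simp
  | add a b ha hb => simp only [map_add, add_mul, mul_add, ha, hb]
  | tmul a b => simp [hz]

theorem comulC_mul_right {c : C} {χ : CharGroup C} {a : C} {z : U}
    (hz : ∀ c, ofC σ γ g g' c * z = z * ofC σ γ g g' (charShift χ c)) :
    comulC σ γ g g' c * (ofC σ γ g g' a ⊗ₜ z) =
      (ofC σ γ g g' a ⊗ₜ z) * comulC σ γ g g' (charShift χ c) := by
  rw [comulC_apply, comulC_apply, comul_charShift_right]
  generalize Coalgebra.comul (R := ℂ) c = w
  induction w with
  | zero => simp
  | add a b ha hb => simp only [map_add, add_mul, mul_add, ha, hb]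
  | tmul b c => simp [hz, ← map_mul, mul_comm]

theorem comulC_grouplike {a : C} (ha : IsGroupLikeElem ℂ a) :
    comulC σ γ g g' a = ofC σ γ g g' a ⊗ₜ ofC σ γ g g' a := by
  rw [comulC_apply, ha.comul_eq_tmul_self]; rfl

variable (σ γ g g')

/-- The coproducts of the generators in `U ⊗ U`. -/
def comulRealization : Realization σ γ g g' (U ⊗[ℂ] U) where
  ofC := comulC σ γ g g'
  x i := ofC σ γ g g' (g i) ⊗ₜ x σ γ g g' i + x σ γ g g' i ⊗ₜ 1
  y i := ofC σ γ g g' (g' i) ⊗ₜ y σ γ g g' i + y σ γ g g' i ⊗ₜ 1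
  commX c i := by
    rw [mul_add, add_mul, comulC_mul_left fun c => ofC_mul_x c i,
      comulC_mul_right fun c => ofC_mul_x c i]
  commY c i := by
    rw [mul_add, add_mul, comulC_mul_left fun c => ofC_mul_y c i,
      comulC_mul_right fun c => ofC_mul_y c i]
  link i j := by
    have e1 := (univ σ γ g g').right_mul_x j i
    have e2 := (univ σ γ g g').left_mul_y i j
    have e3 := (univ σ γ g g').y_mul_x i j
    simp only [univ] at e1 e2 e3
    have e4 : y σ γ g g' j * ofC σ γ g g' (g i) =
        braidingMatrix γ σ i j • (ofC σ γ g g' (g i) * y σ γ g g' j) := by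
      rw [e2, smul_smul, mul_inv_cancel₀ (braidingMatrix_ne_zero _ _), one_smul]
    have e5 : ofC σ γ g g' (g' j) * ofC σ γ g g' (g i) =
        ofC σ γ g g' (g i) * ofC σ γ g g' (g' j) := by rw [← map_mul, mul_comm, map_mul]
    simp only [add_mul, mul_add, Algebra.TensorProduct.tmul_mul_tmul, mul_one, one_mul, e1, e3, e4,
      e5]
    simp only [TensorProduct.tmul_add, TensorProduct.add_tmul, ← TensorProduct.smul_tmul',
      TensorProduct.tmul_smul, smul_add]
    by_cases hij : i = j
    · subst hij
      simp only [if_true, TensorProduct.tmul_sub, TensorProduct.sub_tmul, map_mul,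
        comulC_grouplike (h.left_grouplike _), comulC_grouplike (h.right_grouplike _), e5,
        Algebra.TensorProduct.tmul_mul_tmul, Algebra.TensorProduct.one_def]
      abel
    · simp only [hij, if_false, TensorProduct.tmul_zero, TensorProduct.zero_tmul]
      abel

/-- The elements `x_i ⊗ 1` and `g_i ⊗ x_i` `q`-commute, so their sums satisfy the relations of the
Nichols algebra. -/
theorem comulRealization_polyX : ∀ a ∈ nicholsIdeal (braidingMatrix γ σ),
    (comulRealization σ γ g g').polyX a = 0 := by
  refine eq_zero_of_qcommute
    (α := Algebra.TensorProduct.includeLeft.comp (univ σ γ g g').polyX)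
    (β := FreeAlgebra.lift ℂ fun i => ((Algebra.TensorProduct.includeLeft (R := ℂ) (S := ℂ)
      (A := U) (B := U)).comp (ofC σ γ g g')) (g i) *
        (Algebra.TensorProduct.includeRight (R := ℂ) (A := U) (B := U) (x σ γ g g' i)))
    (fun a ha => ?_) ?_ (fun i => ?_) fun i j => ?_
  · rw [AlgHom.comp_apply, univ_polyX_eq_zero a ha, map_zero]
  · refine lift_mul_eq_zero (fun a ha => ?_) fun i j => ?_
    · have := univ_polyX_eq_zero (σ := σ) (γ := γ) (g := g) (g' := g') a ha
      have e : FreeAlgebra.lift ℂ (fun i => Algebra.TensorProduct.includeRight (R := ℂ) (A := U)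
          (B := U) (x σ γ g g' i)) =
          Algebra.TensorProduct.includeRight.comp (univ σ γ g g').polyX := by
        ext i; simp [univ]
      rw [e, AlgHom.comp_apply, this, map_zero]
    · simp
  · simp [comulRealization, univ, add_comm]
  · have e1 := (univ σ γ g g').left_mul_x i j
    simp only [univ] at e1
    simp [univ, e1, TensorProduct.smul_tmul']

/-- The elements `x_i^* ⊗ 1` and `g'_i ⊗ x_i^*` commute up to the inverse braiding, which has the same
Nichols algebra. -/
theorem comulRealization_polyY : ∀ a ∈ nicholsIdeal (braidingMatrix γ σ),
    (comulRealization σ γ g g').polyY a = 0 := by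
  rw [← nicholsIdeal_invBraiding braidingMatrix_ne_zero]
  refine eq_zero_of_qcommute
    (α := Algebra.TensorProduct.includeLeft.comp (univ σ γ g g').polyY)
    (β := FreeAlgebra.lift ℂ fun i => ((Algebra.TensorProduct.includeLeft (R := ℂ) (S := ℂ)
      (A := U) (B := U)).comp (ofC σ γ g g')) (g' i) *
        (Algebra.TensorProduct.includeRight (R := ℂ) (A := U) (B := U) (y σ γ g g' i)))
    (fun a ha => ?_) ?_ (fun i => ?_) fun i j => ?_
  · rw [nicholsIdeal_invBraiding braidingMatrix_ne_zero] at ha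
    rw [AlgHom.comp_apply, univ_polyY_eq_zero a ha, map_zero]
  · refine lift_mul_eq_zero (fun a ha => ?_) fun i j => ?_
    · rw [nicholsIdeal_invBraiding braidingMatrix_ne_zero] at ha
      have := univ_polyY_eq_zero (σ := σ) (γ := γ) (g := g) (g' := g') a ha
      have e : FreeAlgebra.lift ℂ (fun i => Algebra.TensorProduct.includeRight (R := ℂ) (A := U)
          (B := U) (y σ γ g g' i)) =
          Algebra.TensorProduct.includeRight.comp (univ σ γ g g').polyY := by
        ext i; simp [univ]
      rw [e, AlgHom.comp_apply, this, map_zero]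
    · simp
  · simp [comulRealization, univ, add_comm]
  · have e1 := (univ σ γ g g').right_mul_y i j
    simp only [univ] at e1
    simp [univ, e1, TensorProduct.smul_tmul', invBraiding]

/-- The coproduct of `U`. -/
def comulU : U →ₐ[ℂ] U ⊗[ℂ] U :=
  (comulRealization σ γ g g').lift (comulRealization_polyX σ γ g g')
    (comulRealization_polyY σ γ g g')

theorem lift_zero_eq_zero {R : Type*} [Ring R] [Algebra ℂ R] (q : Fin n → Fin n → ℂ) :
    ∀ a ∈ nicholsIdeal q, FreeAlgebra.lift ℂ (fun _ : Fin n => (0 : R)) a = 0 := by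
  intro a ha
  have e : (FreeAlgebra.lift ℂ fun _ : Fin n => (0 : R)) =
      (Algebra.ofId ℂ R).comp (FreeAlgebra.algebraMapInv (R := ℂ) (X := Fin n)) := by
    ext i; simp [counit_ι]
  rw [e, AlgHom.comp_apply, counit_eq,
    (isGradedBiideal_nicholsIdeal q).degree_ge_two a ha 1 (by simp), map_zero]

/-- The counits of the generators. -/
def counitRealization : Realization σ γ g g' ℂ where
  ofC := Bialgebra.counitAlgHom ℂ C
  x _ := 0
  y _ := 0
  commX := by simp
  commY := by simp
  link i j := by
    simp [(h.left_grouplike _).counit_eq_one, (h.right_grouplike _).counit_eq_one]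

/-- The counit of `U`. -/
def counitU : U →ₐ[ℂ] ℂ :=
  (counitRealization σ γ g g').lift (lift_zero_eq_zero _) (lift_zero_eq_zero _)

/-- If `a` and `z` commute up to the scalar `r`, then so do `z` and `S(a) = a⁻¹`. -/
theorem mul_antipode_of_mul {R : Type*} [Ring R] [Algebra ℂ R] {D : Realization σ γ g g' R}
    {z : R} {r : ℂ} {a : C} (ha : IsGroupLikeElem ℂ a)
    (hz : D.ofC a * z = r • (z * D.ofC a)) :
    z * D.ofC (HopfAlgebra.antipode ℂ a) = r • (D.ofC (HopfAlgebra.antipode ℂ a) * z) := by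
  have e1 : D.ofC (HopfAlgebra.antipode ℂ a) * D.ofC a = 1 := by
    rw [← map_mul, ha.antipode_mul_cancel, map_one]
  have e2 : D.ofC a * D.ofC (HopfAlgebra.antipode ℂ a) = 1 := by
    rw [← map_mul, ha.mul_antipode_cancel, map_one]
  calc z * D.ofC (HopfAlgebra.antipode ℂ a)
      = D.ofC (HopfAlgebra.antipode ℂ a) * (D.ofC a * z) * D.ofC (HopfAlgebra.antipode ℂ a) := by
        rw [← mul_assoc, e1, one_mul]
    _ = _ := by rw [hz, mul_smul_comm, smul_mul_assoc, mul_assoc, mul_assoc, e2, mul_one]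

/-- The antipodes of the generators. -/
def antipodeRealization : Realization σ γ g g' Uᵐᵒᵖ where
  ofC := (AlgHom.toOpposite (ofC σ γ g g') fun a b => by
    rw [Commute, SemiconjBy, ← map_mul, mul_comm, map_mul]).comp (HopfAlgebra.antipodeAlgHom ℂ C)
  x i := MulOpposite.op (-(ofC σ γ g g' (HopfAlgebra.antipode ℂ (g i)) * x σ γ g g' i))
  y i := MulOpposite.op (-(ofC σ γ g g' (HopfAlgebra.antipode ℂ (g' i)) * y σ γ g g' i))
  commX c i := by
    apply MulOpposite.unop_injective
    have e := (univ σ γ g g').commX (HopfAlgebra.antipode ℂ (charShift (γ i) c)) i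
    rw [charShift_antipode] at e
    simp only [univ] at e
    change -(_ * _) * ofC σ γ g g' (HopfAlgebra.antipode ℂ c) =
      ofC σ γ g g' (HopfAlgebra.antipode ℂ (charShift (γ i) c)) * -(_ * _)
    rw [neg_mul, mul_neg, mul_assoc, ← e, ← mul_assoc, ← mul_assoc, ← map_mul, mul_comm, map_mul]
  commY c i := by
    apply MulOpposite.unop_injective
    have e := (univ σ γ g g').commY (HopfAlgebra.antipode ℂ (charShift (γ i)⁻¹ c)) i
    rw [charShift_antipode] at e
    simp only [univ] at e
    change -(_ * _) * ofC σ γ g g' (HopfAlgebra.antipode ℂ c) =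
      ofC σ γ g g' (HopfAlgebra.antipode ℂ (charShift (γ i)⁻¹ c)) * -(_ * _)
    rw [neg_mul, mul_neg, mul_assoc, ← e, ← mul_assoc, ← mul_assoc, ← map_mul, mul_comm, map_mul]
  link i j := by
    apply MulOpposite.unop_injective
    have e1 := mul_antipode_of_mul σ γ g g' (h.right_grouplike j)
      ((univ σ γ g g').right_mul_x j i)
    have e2 := mul_antipode_of_mul σ γ g g' (h.left_grouplike i)
      ((univ σ γ g g').left_mul_y i j)
    have e3 := (univ σ γ g g').y_mul_x i j
    simp only [univ_ofC, univ_x, univ_y] at e1 e2 e3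
    have e4 : ofC σ γ g g' (HopfAlgebra.antipode ℂ (g' j)) *
        ofC σ γ g g' (HopfAlgebra.antipode ℂ (g i)) =
        ofC σ γ g g' (HopfAlgebra.antipode ℂ (g i)) *
          ofC σ γ g g' (HopfAlgebra.antipode ℂ (g' j)) := by rw [← map_mul, mul_comm, map_mul]
    have e5 : ofC σ γ g g' (HopfAlgebra.antipode ℂ (g i)) *
        ofC σ γ g g' (HopfAlgebra.antipode ℂ (g' j)) *
          (ofC σ γ g g' (g' j) * ofC σ γ g g' (g i)) = 1 := by
      have e : HopfAlgebra.antipode ℂ (g i) * HopfAlgebra.antipode ℂ (g' j) * (g' j * g i) = 1 := by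
        rw [mul_comm (g' j), mul_mul_mul_comm, (h.left_grouplike i).antipode_mul_cancel,
          (h.right_grouplike j).antipode_mul_cancel, mul_one]
      rw [← map_mul (ofC σ γ g g'), ← map_mul (ofC σ γ g g'), ← map_mul (ofC σ γ g g'), e, map_one]
    change -(_ * x σ γ g g' i) * -(_ * y σ γ g g' j) -
      braidingMatrix γ σ i j • (-(_ * y σ γ g g' j) * -(_ * x σ γ g g' i)) = _
    rw [neg_mul_neg, neg_mul_neg, mul_assoc, ← mul_assoc (x σ γ g g' i), e1, mul_assoc,
      ← mul_assoc (y σ γ g g' j), e2, smul_mul_assoc, smul_mul_assoc, mul_smul_comm, mul_smul_comm,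
      smul_smul, mul_inv_cancel₀ (braidingMatrix_ne_zero _ _), one_smul]
    simp only [mul_assoc, e3]
    rw [← mul_assoc (ofC σ γ g g' (HopfAlgebra.antipode ℂ (g' j)))
      (ofC σ γ g g' (HopfAlgebra.antipode ℂ (g i))), e4,
      ← mul_assoc _ _ (x σ γ g g' i * y σ γ g g' j), mul_add, mul_smul_comm, sub_add_cancel_left]
    by_cases hij : i = j
    · subst hij
      simp only [if_true]
      rw [mul_sub, mul_one, e5, neg_sub]
      change _ = 1 - ofC σ γ g g' (HopfAlgebra.antipode ℂ (g' i * g i))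
      rw [HopfAlgebra.antipode_mul_distrib, mul_comm (HopfAlgebra.antipode ℂ (g' i)), map_mul]
    · simp [hij]

theorem antipodeRealization_polyX : ∀ a ∈ nicholsIdeal (braidingMatrix γ σ),
    (antipodeRealization σ γ g g').polyX a = 0 :=
  lift_op_eq_zero (φ := ofC σ γ g g') (s := fun i => HopfAlgebra.antipode ℂ (g i))
    (z := x σ γ g g') (univ_polyX_eq_zero (σ := σ) (γ := γ) (g := g) (g' := g'))
    fun i j => mul_antipode_of_mul σ γ g g' (h.left_grouplike i) ((univ σ γ g g').left_mul_x i j)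

theorem antipodeRealization_polyY : ∀ a ∈ nicholsIdeal (braidingMatrix γ σ),
    (antipodeRealization σ γ g g').polyY a = 0 := by
  rw [← nicholsIdeal_invBraiding braidingMatrix_ne_zero]
  refine lift_op_eq_zero (φ := ofC σ γ g g') (s := fun i => HopfAlgebra.antipode ℂ (g' i))
    (z := y σ γ g g') (fun a ha => ?_)
    fun i j => mul_antipode_of_mul σ γ g g' (h.right_grouplike i) ((univ σ γ g g').right_mul_y i j)
  rw [nicholsIdeal_invBraiding braidingMatrix_ne_zero] at ha
  exact univ_polyY_eq_zero (σ := σ) (γ := γ) (g := g) (g' := g') a ha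

/-- The antipode of `U`, as a homomorphism to the opposite algebra. -/
def antipodeU : U →ₐ[ℂ] Uᵐᵒᵖ :=
  (antipodeRealization σ γ g g').lift (antipodeRealization_polyX σ γ g g')
    (antipodeRealization_polyY σ γ g g')

/-- The antipode of `U` as a linear map. -/
def antipodeLin : U →ₗ[ℂ] U :=
  (MulOpposite.opLinearEquiv ℂ).symm.toLinearMap ∘ₗ (antipodeU σ γ g g').toLinearMap

variable {σ γ g g'}

theorem comulU_ofC (c : C) : comulU σ γ g g' (ofC σ γ g g' c) =
    TensorProduct.map (ofC σ γ g g').toLinearMap (ofC σ γ g g').toLinearMap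
      (Coalgebra.comul (R := ℂ) c) := Realization.lift_ofC _ _ _ c

theorem comulU_x (i : Fin n) : comulU σ γ g g' (x σ γ g g' i) =
    ofC σ γ g g' (g i) ⊗ₜ x σ γ g g' i + x σ γ g g' i ⊗ₜ 1 := Realization.lift_x _ _ _ i

theorem comulU_y (i : Fin n) : comulU σ γ g g' (y σ γ g g' i) =
    ofC σ γ g g' (g' i) ⊗ₜ y σ γ g g' i + y σ γ g g' i ⊗ₜ 1 := Realization.lift_y _ _ _ i

theorem comulU_ofC_grouplike {a : C} (ha : IsGroupLikeElem ℂ a) :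
    comulU σ γ g g' (ofC σ γ g g' a) = ofC σ γ g g' a ⊗ₜ ofC σ γ g g' a := by
  rw [comulU_ofC, ha.comul_eq_tmul_self]; rfl

theorem counitU_ofC (c : C) : counitU σ γ g g' (ofC σ γ g g' c) = Coalgebra.counit (R := ℂ) c :=
  Realization.lift_ofC _ _ _ c

theorem counitU_x (i : Fin n) : counitU σ γ g g' (x σ γ g g' i) = 0 := Realization.lift_x _ _ _ i
theorem counitU_y (i : Fin n) : counitU σ γ g g' (y σ γ g g' i) = 0 := Realization.lift_y _ _ _ i

theorem antipodeLin_mul (a b : U) : antipodeLin σ γ g g' (a * b) =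
    antipodeLin σ γ g g' b * antipodeLin σ γ g g' a := by
  simp [antipodeLin]

theorem antipodeLin_algebraMap (r : ℂ) : antipodeLin σ γ g g' (algebraMap ℂ _ r) =
    algebraMap ℂ _ r := by
  simp only [antipodeLin, LinearMap.comp_apply, AlgHom.toLinearMap_apply, AlgHomClass.commutes]
  rfl

theorem antipodeLin_ofC (c : C) : antipodeLin σ γ g g' (ofC σ γ g g' c) =
    ofC σ γ g g' (HopfAlgebra.antipode ℂ c) := by
  simp only [antipodeLin, LinearMap.comp_apply, AlgHom.toLinearMap_apply, antipodeU,
    Realization.lift_ofC]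
  rfl

theorem antipodeLin_x (i : Fin n) : antipodeLin σ γ g g' (x σ γ g g' i) =
    -(ofC σ γ g g' (HopfAlgebra.antipode ℂ (g i)) * x σ γ g g' i) := by
  simp only [antipodeLin, LinearMap.comp_apply, AlgHom.toLinearMap_apply, antipodeU,
    Realization.lift_x]
  rfl

theorem antipodeLin_y (i : Fin n) : antipodeLin σ γ g g' (y σ γ g g' i) =
    -(ofC σ γ g g' (HopfAlgebra.antipode ℂ (g' i)) * y σ γ g g' i) := by
  simp only [antipodeLin, LinearMap.comp_apply, AlgHom.toLinearMap_apply, antipodeU,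
    Realization.lift_y]
  rfl

theorem comulU_coassoc : (Algebra.TensorProduct.assoc ℂ ℂ ℂ U U U : _ →ₐ[ℂ] _).comp
      ((Algebra.TensorProduct.map (comulU σ γ g g') (AlgHom.id ℂ U)).comp (comulU σ γ g g')) =
    (Algebra.TensorProduct.map (AlgHom.id ℂ U) (comulU σ γ g g')).comp (comulU σ γ g g') := by
  refine algHom_ext (fun c => ?_) (fun i => ?_) fun i => ?_
  · simp only [AlgHom.comp_apply, comulU_ofC]
    have e := congrArg (TensorProduct.map (ofC σ γ g g').toLinearMap (TensorProduct.map
      (ofC σ γ g g').toLinearMap (ofC σ γ g g').toLinearMap)) (Coalgebra.coassoc_apply (R := ℂ) c)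
    refine Eq.trans ?_ (e.trans ?_) <;> generalize Coalgebra.comul (R := ℂ) c = w
    · induction w with
      | zero => simp
      | add a b ha hb => simp only [map_add, ha, hb]
      | tmul a b =>
        simp only [TensorProduct.map_tmul, Algebra.TensorProduct.map_tmul, LinearMap.rTensor_tmul,
          AlgHom.toLinearMap_apply, comulU_ofC, AlgHom.id_apply]
        generalize Coalgebra.comul (R := ℂ) a = w
        induction w with
        | zero => simp
        | add a b ha hb => simp only [map_add, TensorProduct.add_tmul, ha, hb]
        | tmul a b => rfl
    · induction w with
      | zero => simp
      | add a b ha hb => simp only [map_add, ha, hb]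
      | tmul a b =>
        simp only [TensorProduct.map_tmul, Algebra.TensorProduct.map_tmul, LinearMap.lTensor_tmul,
          AlgHom.toLinearMap_apply, comulU_ofC, AlgHom.id_apply]
  · simp only [AlgHom.comp_apply, comulU_x, map_add, Algebra.TensorProduct.map_tmul,
      AlgHom.id_apply, comulU_ofC_grouplike (h.left_grouplike _), map_one,
      TensorProduct.add_tmul, TensorProduct.tmul_add]
    rw [← add_assoc]
    rfl
  · simp only [AlgHom.comp_apply, comulU_y, map_add, Algebra.TensorProduct.map_tmul,
      AlgHom.id_apply, comulU_ofC_grouplike (h.right_grouplike _), map_one,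
      TensorProduct.add_tmul, TensorProduct.tmul_add]
    rw [← add_assoc]
    rfl

theorem counitU_left : (Algebra.TensorProduct.map (counitU σ γ g g') (AlgHom.id ℂ U)).comp
    (comulU σ γ g g') = (Algebra.TensorProduct.lid ℂ U).symm := by
  refine algHom_ext (fun c => ?_) (fun i => ?_) fun i => ?_
  · rw [AlgHom.comp_apply, comulU_ofC]
    have e := congrArg (TensorProduct.map LinearMap.id (ofC σ γ g g').toLinearMap)
      (Coalgebra.rTensor_counit_comul (R := ℂ) c)
    refine Eq.trans ?_ e
    generalize Coalgebra.comul (R := ℂ) c = w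
    induction w with
    | zero => simp
    | add a b ha hb => simp only [map_add, ha, hb]
    | tmul a b => simp [counitU_ofC]
  · simp [comulU_x, counitU_x, counitU_ofC, (h.left_grouplike _).counit_eq_one]
  · simp [comulU_y, counitU_y, counitU_ofC, (h.right_grouplike _).counit_eq_one]

theorem counitU_right : (Algebra.TensorProduct.map (AlgHom.id ℂ U) (counitU σ γ g g')).comp
    (comulU σ γ g g') = (Algebra.TensorProduct.rid ℂ ℂ U).symm := by
  refine algHom_ext (fun c => ?_) (fun i => ?_) fun i => ?_
  · rw [AlgHom.comp_apply, comulU_ofC]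
    have e := congrArg (TensorProduct.map (ofC σ γ g g').toLinearMap LinearMap.id)
      (Coalgebra.lTensor_counit_comul (R := ℂ) c)
    refine Eq.trans ?_ e
    generalize Coalgebra.comul (R := ℂ) c = w
    induction w with
    | zero => simp
    | add a b ha hb => simp only [map_add, ha, hb]
    | tmul a b => simp [counitU_ofC]
  · simp [comulU_x, counitU_x, counitU_ofC, (h.left_grouplike _).counit_eq_one]
  · simp [comulU_y, counitU_y, counitU_ofC, (h.right_grouplike _).counit_eq_one]

/-- The convolution `S * id` of the antipode with the identity. -/
def antipodeConvLeft : U →ₗ[ℂ] U :=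
  LinearMap.mul' ℂ U ∘ₗ (antipodeLin σ γ g g').rTensor U ∘ₗ (comulU σ γ g g').toLinearMap

/-- The convolution `id * S` of the identity with the antipode. -/
def antipodeConvRight : U →ₗ[ℂ] U :=
  LinearMap.mul' ℂ U ∘ₗ (antipodeLin σ γ g g').lTensor U ∘ₗ (comulU σ γ g g').toLinearMap

/-- If the value of `S * id` on `a` is a scalar, then this scalar can be taken out of its value on
`a b`. Hence the antipode axiom has to be checked on generators only. -/
theorem antipodeConvLeft_mul {a b : U} {r : ℂ} (ha : antipodeConvLeft a = algebraMap ℂ U r) :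
    antipodeConvLeft (a * b) = r • antipodeConvLeft b := by
  have key : ∀ w z : U ⊗[ℂ] U,
      LinearMap.mul' ℂ U ((antipodeLin σ γ g g').rTensor U (w * z)) =
      LinearMap.mul' ℂ U (TensorProduct.map (antipodeLin σ γ g g')
        (LinearMap.mulLeft ℂ (LinearMap.mul' ℂ U ((antipodeLin σ γ g g').rTensor U w))) z) := by
    intro w z
    induction z with
    | zero => simp
    | add x y hx hy => simp only [mul_add, map_add, hx, hy]
    | tmul c d =>
      induction w with
      | zero => simp
      | add x y hx hy => simp only [add_mul, map_add, hx, hy, TensorProduct.map_tmul,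
          LinearMap.mulLeft_apply, LinearMap.mul'_apply, mul_add]
      | tmul a b => simp [antipodeLin_mul, mul_assoc]
  simp only [antipodeConvLeft, LinearMap.comp_apply, AlgHom.toLinearMap_apply] at ha ⊢
  rw [map_mul, key, ha]
  generalize comulU σ γ g g' b = w
  induction w with
  | zero => simp
  | add x y hx hy => simp only [map_add, hx, hy, smul_add]
  | tmul c d => simp [← Algebra.smul_def]

/-- The analogue of `antipodeConvLeft_mul` for `id * S`. -/
theorem antipodeConvRight_mul {a b : U} {r : ℂ} (hb : antipodeConvRight b = algebraMap ℂ U r) :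
    antipodeConvRight (a * b) = r • antipodeConvRight a := by
  have key : ∀ w z : U ⊗[ℂ] U,
      LinearMap.mul' ℂ U ((antipodeLin σ γ g g').lTensor U (w * z)) =
      LinearMap.mul' ℂ U (TensorProduct.map
        (LinearMap.mulRight ℂ (LinearMap.mul' ℂ U ((antipodeLin σ γ g g').lTensor U z)))
          (antipodeLin σ γ g g') w) := by
    intro w z
    induction w with
    | zero => simp
    | add x y hx hy => simp only [add_mul, map_add, hx, hy]
    | tmul c d =>
      induction z with
      | zero => simp
      | add x y hx hy => simp only [mul_add, map_add, hx, hy, TensorProduct.map_tmul,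
          LinearMap.mulRight_apply, LinearMap.mul'_apply, add_mul]
      | tmul a b => simp [antipodeLin_mul, mul_assoc]
  simp only [antipodeConvRight, LinearMap.comp_apply, AlgHom.toLinearMap_apply] at hb ⊢
  rw [map_mul, key, hb]
  generalize comulU σ γ g g' a = w
  induction w with
  | zero => simp
  | add x y hx hy => simp only [map_add, hx, hy, smul_add]
  | tmul c d => simp [← Algebra.commutes r, ← Algebra.smul_def]

theorem antipodeConvLeft_eq : (antipodeConvLeft : U →ₗ[ℂ] U) =
    Algebra.linearMap ℂ U ∘ₗ (counitU σ γ g g').toLinearMap := by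
  let S : Subalgebra ℂ U :=
    { carrier := {a | antipodeConvLeft a = algebraMap ℂ U (counitU σ γ g g' a)}
      mul_mem' := fun {a b} ha hb => by
        simp only [Set.mem_ofPred_eq] at ha hb ⊢
        rw [antipodeConvLeft_mul ha, hb, map_mul, map_mul, Algebra.smul_def]
      add_mem' := fun {a b} ha hb => by
        simp only [Set.mem_ofPred_eq] at ha hb ⊢
        rw [map_add, map_add, map_add, ha, hb]
      algebraMap_mem' := fun r => by
        simp only [Set.mem_ofPred_eq, antipodeConvLeft, LinearMap.comp_apply,
          AlgHom.toLinearMap_apply, AlgHomClass.commutes, Algebra.TensorProduct.algebraMap_apply,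
          LinearMap.rTensor_tmul, antipodeLin_algebraMap, LinearMap.mul'_apply, mul_one]
        rfl }
  refine LinearMap.ext fun a => subalgebra_eq_top σ γ g g' (S := S) (fun c => ?_) (fun i => ?_)
    (fun i => ?_) a
  · change antipodeConvLeft _ = _
    rw [counitU_ofC, ← AlgHomClass.commutes (ofC σ γ g g'),
      ← HopfAlgebra.mul_antipode_rTensor_comul_apply]
    simp only [antipodeConvLeft, LinearMap.comp_apply, AlgHom.toLinearMap_apply, comulU_ofC]
    generalize Coalgebra.comul (R := ℂ) c = w
    induction w with
    | zero => simp
    | add x y hx hy => simp only [map_add, hx, hy]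
    | tmul a b => simp [antipodeLin_ofC]
  · change antipodeConvLeft _ = _
    simp [antipodeConvLeft, comulU_x, antipodeLin_ofC, antipodeLin_x, counitU_x]
  · change antipodeConvLeft _ = _
    simp [antipodeConvLeft, comulU_y, antipodeLin_ofC, antipodeLin_y, counitU_y]

theorem antipodeConvRight_eq : (antipodeConvRight : U →ₗ[ℂ] U) =
    Algebra.linearMap ℂ U ∘ₗ (counitU σ γ g g').toLinearMap := by
  have h1 : antipodeLin σ γ g g' 1 = 1 := by
    simpa using antipodeLin_algebraMap (σ := σ) (γ := γ) (g := g) (g' := g') 1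
  have hcancel : ∀ {a : C} (_ : IsGroupLikeElem ℂ a) (z : U),
      ofC σ γ g g' a * (ofC σ γ g g' (HopfAlgebra.antipode ℂ a) * z) = z := by
    intro a ha z
    rw [← mul_assoc, ← map_mul, ha.mul_antipode_cancel, map_one, one_mul]
  let S : Subalgebra ℂ U :=
    { carrier := {a | antipodeConvRight a = algebraMap ℂ U (counitU σ γ g g' a)}
      mul_mem' := fun {a b} ha hb => by
        simp only [Set.mem_ofPred_eq] at ha hb ⊢
        rw [antipodeConvRight_mul hb, ha, map_mul, map_mul, Algebra.smul_def, Algebra.commutes]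
      add_mem' := fun {a b} ha hb => by
        simp only [Set.mem_ofPred_eq] at ha hb ⊢
        rw [map_add, map_add, map_add, ha, hb]
      algebraMap_mem' := fun r => by
        simp only [Set.mem_ofPred_eq, antipodeConvRight, LinearMap.comp_apply,
          AlgHom.toLinearMap_apply, AlgHomClass.commutes, Algebra.TensorProduct.algebraMap_apply,
          LinearMap.lTensor_tmul, h1, LinearMap.mul'_apply, mul_one]
        rfl }
  refine LinearMap.ext fun a => subalgebra_eq_top σ γ g g' (S := S) (fun c => ?_) (fun i => ?_)
    (fun i => ?_) a
  · change antipodeConvRight _ = _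
    rw [counitU_ofC, ← AlgHomClass.commutes (ofC σ γ g g'),
      ← HopfAlgebra.mul_antipode_lTensor_comul_apply]
    simp only [antipodeConvRight, LinearMap.comp_apply, AlgHom.toLinearMap_apply, comulU_ofC]
    generalize Coalgebra.comul (R := ℂ) c = w
    induction w with
    | zero => simp
    | add x y hx hy => simp only [map_add, hx, hy]
    | tmul a b => simp [antipodeLin_ofC]
  · change antipodeConvRight _ = _
    simp [antipodeConvRight, comulU_x, h1, antipodeLin_x, counitU_x, hcancel (h.left_grouplike _)]
  · change antipodeConvRight _ = _
    simp [antipodeConvRight, comulU_y, h1, antipodeLin_y, counitU_y, hcancel (h.right_grouplike _)]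

variable (σ γ g g')

/-- The Hopf algebra structure of `U`. -/
def hopfStructure : HopfStructure U where
  comul := comulU σ γ g g'
  counit := counitU σ γ g g'
  antipode := antipodeLin σ γ g g'
  coassoc := comulU_coassoc
  rTensor_counit := counitU_left
  lTensor_counit := counitU_right
  antipode_left := antipodeConvLeft_eq
  antipode_right := antipodeConvRight_eq

theorem isStandard_hopfStructure : IsStandard σ γ g g' (hopfStructure σ γ g g') where
  comul_ofC := comulU_ofC
  counit_ofC := counitU_ofC
  antipode_ofC := antipodeLin_ofC
  comul_x := comulU_x
  comul_y := comulU_y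
  counit_x := counitU_x
  counit_y := counitU_y
  antipode_x := antipodeLin_x
  antipode_y := antipodeLin_y

instance instHopfAlgebra : HopfAlgebra ℂ U := (hopfStructure σ γ g g').toHopfAlgebra

/-- The inclusion `C → U` as a homomorphism of bialgebras. -/
def incl : C →ₐc[ℂ] U :=
  { (ofC σ γ g g' : C →ₗ[ℂ] U) with
    counit_comp := LinearMap.ext counitU_ofC
    map_comp_comul := LinearMap.ext fun c => (comulU_ofC c).symm
    map_mul' := map_mul (ofC σ γ g g')
    map_one' := map_one (ofC σ γ g g') }

end Comul
end QuantumGroup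
end HopfAlgebraU

/-! ### Induced modules and the triangular decomposition -/

noncomputable section InducedModules

open NicholsAlgebra WeightModule

variable {C : Type u} [CommRing C] [HopfAlgebra ℂ C] [Coalgebra.IsCocomm ℂ C] {n : ℕ}

namespace NicholsAlgebra

section Weights

variable {γ : Fin n → CharGroup C} {q : Fin n → Fin n → ℂ}

theorem proj_word_mem_weightSpace (w : FreeMonoid (Fin n)) :
    proj q (word w) ∈ weightSpace (nicholsAct γ q) (charWord γ w) :=
  fun c => nicholsAct_word γ q c w

theorem one_mem_weightSpace : (1 : Nichols q) ∈ weightSpace (nicholsAct γ q) 1 := by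
  have := proj_word_mem_weightSpace (γ := γ) (q := q) 1
  rwa [word_one, map_one, map_one] at this

theorem gen_mem_weightSpace (i : Fin n) : gen q i ∈ weightSpace (nicholsAct γ q) (γ i) := by
  have := proj_word_mem_weightSpace (γ := γ) (q := q) (FreeMonoid.of i)
  rwa [charWord, FreeMonoid.lift_eval_of, word, FreeMonoid.lift_eval_of] at this

theorem mul_mem_weightSpace {χ ψ : CharGroup C} {a b : Nichols q}
    (ha : a ∈ weightSpace (nicholsAct γ q) χ) (hb : b ∈ weightSpace (nicholsAct γ q) ψ) :
    a * b ∈ weightSpace (nicholsAct γ q) (χ * ψ) := fun c => by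
  have h1 := mul_comm_act γ q c (a ⊗ₜ b)
  have h2 : diag (nicholsAct γ q) (nicholsAct γ q) c (a ⊗ₜ b) = (χ * ψ) c • (a ⊗ₜ b) :=
    tmul_mem_weightSpace (j := BialgHom.id ℂ C) (r := nicholsAct γ q) (s := nicholsAct γ q)
      ha hb c
  rw [h2, map_smul] at h1
  exact h1.symm

/-- Splitting off `x_j` lowers the weight of a monomial by `γ_j`. -/
theorem nDerivL_mem_weightSpace (j : Fin n) (w : FreeMonoid (Fin n)) :
    nDerivL q j (proj q (word w)) ∈ weightSpace (nicholsAct γ q) ((γ j)⁻¹ * charWord γ w) := by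
  induction w using FreeMonoid.inductionOn' with
  | one => rw [word_one, map_one (proj q), nDerivL_one]; exact zero_mem _
  | of_mul i w ih =>
    rw [word_of_mul, ← gen_mul_proj, nDerivL_gen_mul, map_mul]
    refine add_mem ?_ (Submodule.smul_mem _ _ ?_)
    · split_ifs with hij
      · subst hij
        rw [charWord, FreeMonoid.lift_eval_of, inv_mul_cancel_left]
        exact proj_word_mem_weightSpace w
      · exact zero_mem _
    · rw [mul_left_comm]
      have := gen_mem_weightSpace (γ := γ) (q := q) i
      rw [charWord, FreeMonoid.lift_eval_of]
      exact mul_mem_weightSpace this ih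

theorem nBraid_proj_word (q' : Fin n → Fin n → ℂ) (j : Fin n) (w : FreeMonoid (Fin n)) :
    nBraid q q' j (proj q (word w)) = braidScalar q' j w • proj q (word w) := by
  rw [nBraid_proj, braidAut_word, map_smul]

theorem nBraid_mem_weightSpace (q' : Fin n → Fin n → ℂ) (j : Fin n) {χ : CharGroup C}
    {a : Nichols q} (ha : a ∈ weightSpace (nicholsAct γ q) χ) :
    nBraid q q' j a ∈ weightSpace (nicholsAct γ q) χ := fun c => by
  have : nicholsAct γ q c ∘ₗ nBraid q q' j = nBraid q q' j ∘ₗ nicholsAct γ q c :=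
    lin_ext fun w => by
      rw [LinearMap.comp_apply, LinearMap.comp_apply, nicholsAct_word, nBraid_proj_word, map_smul,
        map_smul, nicholsAct_word, nBraid_proj_word, smul_comm]
  have h2 := LinearMap.congr_fun this a
  rw [LinearMap.comp_apply, LinearMap.comp_apply, ha c, map_smul] at h2
  exact h2

theorem nDerivR_mem_weightSpace (j : Fin n) (w : FreeMonoid (Fin n)) :
    nDerivR q j (proj q (word w)) ∈ weightSpace (nicholsAct γ q) ((γ j)⁻¹ * charWord γ w) := by
  induction w using FreeMonoid.inductionOn' with
  | one => rw [word_one, map_one (proj q), nDerivR_one]; exact zero_mem _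
  | of_mul i w ih =>
    rw [word_of_mul, ← gen_mul_proj, nDerivR_gen_mul, map_mul]
    refine add_mem ?_ ?_
    · rw [mul_left_comm]
      have := gen_mem_weightSpace (γ := γ) (q := q) i
      rw [charWord, FreeMonoid.lift_eval_of]
      exact mul_mem_weightSpace this ih
    · split_ifs with hij
      · subst hij
        rw [charWord, FreeMonoid.lift_eval_of, inv_mul_cancel_left]
        exact nBraid_mem_weightSpace _ _ (proj_word_mem_weightSpace w)
      · exact zero_mem _

end Weights

section Smash

variable {γ : Fin n → CharGroup C} {q : Fin n → Fin n → ℂ}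
variable {M : Type*} [AddCommGroup M] [Module ℂ M]

variable (γ q) in
/-- The diagonal action of `C` on the tensor product of the Nichols algebra and a `C`-module. -/
def smashAct (r : C →ₐ[ℂ] Module.End ℂ M) : C →ₐ[ℂ] Module.End ℂ (Nichols q ⊗[ℂ] M) :=
  (Module.endTensorEndAlgHom (R := ℂ) (S := ℂ) (A := ℂ) (M := Nichols q) (N := M)).comp
    ((Algebra.TensorProduct.map (nicholsAct γ q) r).comp (Bialgebra.comulAlgHom ℂ C))

theorem smashAct_tmul (r : C →ₐ[ℂ] Module.End ℂ M) {χ : CharGroup C} {a : Nichols q}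
    (ha : a ∈ weightSpace (nicholsAct γ q) χ) (c : C) (m : M) :
    smashAct γ q r c (a ⊗ₜ m) = a ⊗ₜ r (charShift χ c) m := by
  change Module.endTensorEndAlgHom (R := ℂ) (S := ℂ) (A := ℂ)
    (Algebra.TensorProduct.map (nicholsAct γ q) r (Coalgebra.comul c)) (a ⊗ₜ m) =
    a ⊗ₜ r (TensorProduct.lid ℂ C (χ.ofConv.toLinearMap.rTensor C (Coalgebra.comul c))) m
  generalize Coalgebra.comul (R := ℂ) c = z
  induction z with
  | zero => simp
  | add x y hx hy => simp only [map_add, LinearMap.add_apply, TensorProduct.tmul_add, hx, hy]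
  | tmul x y =>
    have := ha x
    simp only [Algebra.TensorProduct.map_tmul, LinearMap.rTensor_tmul, TensorProduct.lid_tmul,
      map_smul, LinearMap.smul_apply, TensorProduct.tmul_smul]
    rw [Module.endTensorEndAlgHom_apply]
    simp only [TensorProduct.AlgebraTensorModule.map_tmul, this]
    rfl

theorem smash_ext {Z : Type*} [AddCommGroup Z] [Module ℂ Z] {f f' : Nichols q ⊗[ℂ] M →ₗ[ℂ] Z}
    (h : ∀ w m, f (proj q (word w) ⊗ₜ m) = f' (proj q (word w) ⊗ₜ m)) : f = f' :=
  TensorProduct.ext (lin_ext fun w => LinearMap.ext fun m => h w m)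

/-- A grouplike element whose eigenvalues on the generators are `q'_{ji}` acts by a braiding
automorphism. -/
theorem smashAct_grouplike (r : C →ₐ[ℂ] Module.End ℂ M) {c : C} (hc : IsGroupLikeElem ℂ c)
    {q' : Fin n → Fin n → ℂ} {j : Fin n} (h : ∀ i, γ i c = q' j i) :
    smashAct γ q r c = TensorProduct.map (nBraid q q' j) (r c) := by
  have e : ∀ w, charWord γ w c = braidScalar q' j w := by
    intro w
    induction w using FreeMonoid.inductionOn' with
    | one => rw [map_one, map_one, hc.char_one]
    | of_mul i w ih =>
      rw [map_mul, map_mul, hc.char_mul, ih, charWord, FreeMonoid.lift_eval_of, h, braidScalar,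
        FreeMonoid.lift_eval_of]
  refine smash_ext fun w m => ?_
  rw [smashAct_tmul r (proj_word_mem_weightSpace w), charShift_grouplike hc, map_smul,
    TensorProduct.map_tmul, nBraid_proj_word, e, LinearMap.smul_apply, TensorProduct.tmul_smul,
    TensorProduct.smul_tmul']

theorem smashAct_gen (r : C →ₐ[ℂ] Module.End ℂ M) (c : C) (i : Fin n) :
    smashAct γ q r c * (LinearMap.mulLeft ℂ (gen q i)).rTensor M =
      (LinearMap.mulLeft ℂ (gen q i)).rTensor M * smashAct γ q r (charShift (γ i) c) :=
  smash_ext fun w m => by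
    simp only [Module.End.mul_apply, LinearMap.rTensor_tmul, LinearMap.mulLeft_apply]
    rw [smashAct_tmul r (mul_mem_weightSpace (gen_mem_weightSpace i) (proj_word_mem_weightSpace w)),
      smashAct_tmul r (proj_word_mem_weightSpace w), charShift_charShift, mul_comm (γ i)]
    rfl

end Smash

end NicholsAlgebra

namespace QuantumGroup

variable {σ : CharGroup C →* CharGroup C →* ℂˣ} {γ : Fin n → CharGroup C} {g g' : Fin n → C}

variable (σ γ) in
/-- Representations of the subalgebra of `U` generated by `C` and the `x_i^*`. -/
structure BorelRep (M : Type*) [AddCommGroup M] [Module ℂ M] where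
  ofC : C →ₐ[ℂ] Module.End ℂ M
  y : Fin n → Module.End ℂ M
  commY : ∀ c i, ofC c * y i = y i * ofC (charShift (γ i)⁻¹ c)
  nichols : ∀ a ∈ nicholsIdeal (braidingMatrix γ σ), FreeAlgebra.lift ℂ y a = 0

namespace BorelRep

variable {M : Type*} [AddCommGroup M] [Module ℂ M] [h : IsLinkingDatum σ γ g g']

local notation "q" => braidingMatrix γ σ

variable (g g') in
/-- The action of the generators of `U` on the induced module `𝔅(X) ⊗ M`. The action of `x_j^*` is
forced by its commutation relations with the elements of `𝔅(X)`. -/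
def indRealization (B : BorelRep σ γ M) : Realization σ γ g g' (Module.End ℂ (Nichols q ⊗[ℂ] M)) where
  ofC := smashAct γ q B.ofC
  x i := (LinearMap.mulLeft ℂ (gen q i)).rTensor M
  y j := TensorProduct.map (nBraid q (fun j i => q i j) j) (B.y j) +
    (nDerivL q j).rTensor M -
    TensorProduct.map (nBraid q (fun j i => q i j) j ∘ₗ nDerivR q j) (B.ofC (g' j * g j))
  commX c i := smashAct_gen B.ofC c i
  commY c j := smash_ext fun w m => by
    have e1 : ∀ c m, B.ofC c (B.y j m) = B.y j (B.ofC (charShift (γ j)⁻¹ c) m) :=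
      fun c m => LinearMap.congr_fun (B.commY c j) m
    have e2 : ∀ c m, B.ofC c (B.ofC (g' j * g j) m) = B.ofC (g' j * g j) (B.ofC c m) := by
      intro c m
      rw [← Module.End.mul_apply, ← map_mul, mul_comm, map_mul]; rfl
    simp only [Module.End.mul_apply, LinearMap.add_apply, LinearMap.sub_apply,
      TensorProduct.map_tmul, LinearMap.rTensor_tmul, map_add, map_sub, LinearMap.comp_apply]
    rw [smashAct_tmul B.ofC (proj_word_mem_weightSpace w),
      smashAct_tmul B.ofC (nBraid_mem_weightSpace _ _ (proj_word_mem_weightSpace w)),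
      smashAct_tmul B.ofC (nDerivL_mem_weightSpace j w),
      smashAct_tmul B.ofC (nBraid_mem_weightSpace _ _ (nDerivR_mem_weightSpace j w)),
      e1, e2, charShift_charShift, charShift_charShift, mul_comm (charWord γ w)]
    rfl
  link i j := TensorProduct.ext' fun a m => by
    have hg : smashAct γ q B.ofC (g' j * g j) (a ⊗ₜ m) =
        nBraid q (fun j i => q i j) j (nBraid q q j a) ⊗ₜ B.ofC (g' j * g j) m := by
      rw [map_mul, Module.End.mul_apply,
        smashAct_grouplike B.ofC (h.left_grouplike j) fun i => char_left h j i,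
        smashAct_grouplike B.ofC (h.right_grouplike j) (q' := fun j i => q i j)
          fun i => char_right h j i, TensorProduct.map_tmul, TensorProduct.map_tmul, map_mul]
      rfl
    simp only [Module.End.mul_apply, LinearMap.add_apply, LinearMap.sub_apply, LinearMap.smul_apply,
      TensorProduct.map_tmul, LinearMap.rTensor_tmul, map_add, map_sub, LinearMap.comp_apply,
      LinearMap.mulLeft_apply, nBraid_mul, nBraid_gen, nDerivL_gen_mul, nDerivR_gen_mul,
      smul_mul_assoc, TensorProduct.add_tmul, ← TensorProduct.smul_tmul', smul_add, smul_sub]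
    by_cases hij : i = j
    · subst hij
      simp only [if_true, LinearMap.sub_apply, Module.End.one_apply, hg]
      abel
    · simp only [hij, Ne.symm hij, if_false, LinearMap.zero_apply, map_zero,
        TensorProduct.zero_tmul]
      abel

theorem indRealization_polyX (B : BorelRep σ γ M) (a : TensorAlg n) :
    (indRealization g g' B).polyX a = (LinearMap.mulLeft ℂ (proj q a)).rTensor M := by
  induction a using FreeAlgebra.induction with
  | grade0 r =>
    rw [AlgHomClass.commutes, AlgHomClass.commutes]
    refine TensorProduct.ext' fun a m => ?_
    rw [Module.algebraMap_end_apply, LinearMap.rTensor_tmul, LinearMap.mulLeft_apply,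
      ← Algebra.smul_def, TensorProduct.smul_tmul']
  | grade1 i => rw [Realization.polyX_ι]; rfl
  | mul a b ha hb =>
    rw [map_mul, ha, hb, map_mul, LinearMap.mulLeft_mul, LinearMap.rTensor_comp]; rfl
  | add a b ha hb =>
    rw [map_add, ha, hb, map_add]
    refine TensorProduct.ext' fun x m => ?_
    simp [add_mul, TensorProduct.add_tmul]

/-- On the vectors `1 ⊗ m`, which the skew derivations kill, `𝔅(X^*)` acts as on the module `M` from
which the module is induced. -/
theorem indRealization_polyY_one (B : BorelRep σ γ M) (a : TensorAlg n) (m : M) :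
    (indRealization g g' B).polyY a (1 ⊗ₜ m) = 1 ⊗ₜ FreeAlgebra.lift ℂ B.y a m := by
  induction a using FreeAlgebra.induction generalizing m with
  | grade0 r => simp
  | grade1 i => simp [indRealization]
  | mul a b ha hb => rw [map_mul, Module.End.mul_apply, hb, ha, map_mul]; rfl
  | add a b ha hb =>
    rw [map_add, LinearMap.add_apply, ha, hb, map_add, LinearMap.add_apply, TensorProduct.tmul_add]

/-- The elements of `𝔅(X^*)` act on the induced module: an element of the defining ideal kills the
vectors `1 ⊗ m`, and its commutators with the `x_i` are in the ideal again. -/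
theorem indRealization_polyY (B : BorelRep σ γ M) : ∀ a ∈ nicholsIdeal q,
    (indRealization g g' B).polyY a = 0 := by
  suffices H : ∀ w, ∀ a ∈ nicholsIdeal q, ∀ m,
      (indRealization g g' B).polyY a (proj q (word w) ⊗ₜ m) = 0 from
    fun a ha => smash_ext fun w m => (H w a ha m).trans rfl
  intro w
  induction w using FreeMonoid.inductionOn' with
  | one =>
    intro a ha m
    rw [word_one, map_one, indRealization_polyY_one, B.nichols a ha, LinearMap.zero_apply,
      TensorProduct.tmul_zero]
  | of_mul i w ih =>
    intro a ha m
    have e1 : proj q (word (FreeMonoid.of i * w)) ⊗ₜ[ℂ] m =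
        (indRealization g g' B).x i (proj q (word w) ⊗ₜ m) := by
      rw [word_of_mul, ← gen_mul_proj]; rfl
    have e2 := LinearMap.congr_fun ((indRealization g g' B).polyY_mul_x i a)
      (proj q (word w) ⊗ₜ m)
    rw [Module.End.mul_apply] at e2
    rw [e1, e2]
    have e3 : (indRealization g g' B).ofC (g i) (proj q (word w) ⊗ₜ m) =
        proj q (word w) ⊗ₜ B.ofC (charShift (charWord γ w) (g i)) m :=
      smashAct_tmul B.ofC (proj_word_mem_weightSpace w) _ _
    simp only [LinearMap.sub_apply, LinearMap.add_apply, Module.End.mul_apply, e3]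
    rw [ih _ (braidAut_mem _ _ _ ha), ih _ (derivR_mem _ _ ha), ih _ (derivL_mem _ _ ha)]
    simp

variable (g g') in
/-- The `U`-module induced from a representation of the subalgebra generated by `C` and the
`x_i^*`. -/
def ind (B : BorelRep σ γ M) : QuantumGroup σ γ g g' →ₐ[ℂ] Module.End ℂ (Nichols q ⊗[ℂ] M) :=
  (indRealization g g' B).lift
    (fun a ha => by
      rw [indRealization_polyX, (proj_eq_zero q).2 ha]
      refine TensorProduct.ext' fun a m => ?_
      simp)
    B.indRealization_polyY

end BorelRep

section PBW

variable [h : IsLinkingDatum σ γ g g']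

theorem ofNichols_proj (a : TensorAlg n) :
    ofNichols σ γ g g' (proj (braidingMatrix γ σ) a) = (univ σ γ g g').polyX a := by
  have : (ofNichols σ γ g g').comp (proj (braidingMatrix γ σ)) = (univ σ γ g g').polyX := by
    ext i
    rw [Function.comp_apply, Function.comp_apply, Realization.polyX_ι]
    change mk σ γ g g' (FreeAlgebra.lift ℂ (xx C) _) = _
    rw [FreeAlgebra.lift_ι_apply]; rfl
  exact AlgHom.congr_fun this a

theorem ofNicholsDual_proj (a : TensorAlg n) :
    ofNicholsDual σ γ g g' (proj (braidingMatrix (fun i => (γ i)⁻¹) σ) a) =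
      (univ σ γ g g').polyY a := by
  have : (ofNicholsDual σ γ g g').comp (proj (braidingMatrix (fun i => (γ i)⁻¹) σ)) =
      (univ σ γ g g').polyY := by
    ext i
    rw [Function.comp_apply, Function.comp_apply, Realization.polyY_ι]
    change mk σ γ g g' (FreeAlgebra.lift ℂ (yy C) _) = _
    rw [FreeAlgebra.lift_ι_apply]; rfl
  exact AlgHom.congr_fun this a

theorem lift_polyX {R : Type*} [Ring R] [Algebra ℂ R] (D : Realization σ γ g g' R) (hX hY)
    (a : TensorAlg n) : D.lift hX hY ((univ σ γ g g').polyX a) = D.polyX a := by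
  have : (D.lift hX hY).comp (univ σ γ g g').polyX = D.polyX := by
    ext i; simp
  exact AlgHom.congr_fun this a

theorem lift_polyY {R : Type*} [Ring R] [Algebra ℂ R] (D : Realization σ γ g g' R) (hX hY)
    (a : TensorAlg n) : D.lift hX hY ((univ σ γ g g').polyY a) = D.polyY a := by
  have : (D.lift hX hY).comp (univ σ γ g g').polyY = D.polyY := by
    ext i; simp
  exact AlgHom.congr_fun this a

variable {M : Type*} [AddCommGroup M] [Module ℂ M]

theorem ind_ofNichols (B : BorelRep σ γ M) (a b : Nichols (braidingMatrix γ σ)) (m : M) :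
    B.ind g g' (ofNichols σ γ g g' a) (b ⊗ₜ m) = (a * b) ⊗ₜ m := by
  obtain ⟨a, rfl⟩ := proj_surjective _ a
  rw [ofNichols_proj, BorelRep.ind, lift_polyX, BorelRep.indRealization_polyX]
  rfl

theorem ind_polyY_one (B : BorelRep σ γ M) (a : TensorAlg n) (m : M) :
    B.ind g g' ((univ σ γ g g').polyY a) (1 ⊗ₜ m) = 1 ⊗ₜ FreeAlgebra.lift ℂ B.y a m := by
  rw [BorelRep.ind, lift_polyY, BorelRep.indRealization_polyY_one]

theorem ind_ofC (B : BorelRep σ γ M) {χ : CharGroup C} {a : Nichols (braidingMatrix γ σ)}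
    (ha : a ∈ weightSpace (nicholsAct γ _) χ) (c : C) (m : M) :
    B.ind g g' (ofC σ γ g g' c) (a ⊗ₜ m) = a ⊗ₜ B.ofC (charShift χ c) m := by
  rw [BorelRep.ind, Realization.lift_ofC]
  exact smashAct_tmul B.ofC ha c m

variable (σ γ) in
/-- The representation of the subalgebra generated by `C` and the `x_i^*` on `𝔅(X^*) ⊗ C`. -/
def dualRep : BorelRep σ γ (Nichols (braidingMatrix (fun i => (γ i)⁻¹) σ) ⊗[ℂ] C) where
  ofC := smashAct (fun i => (γ i)⁻¹) _ (Algebra.lmul ℂ C)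
  y i := (LinearMap.mulLeft ℂ (gen _ i)).rTensor C
  commY c i := smashAct_gen _ c i
  nichols a ha := by
    rw [← braidingMatrix_inv] at ha
    have e : ∀ a, FreeAlgebra.lift ℂ (fun i => (LinearMap.mulLeft ℂ (gen _ i)).rTensor C) a =
        (LinearMap.mulLeft ℂ (proj (braidingMatrix (fun i => (γ i)⁻¹) σ) a)).rTensor C := by
      intro a
      induction a using FreeAlgebra.induction with
      | grade0 r =>
        rw [AlgHomClass.commutes, AlgHomClass.commutes]
        refine TensorProduct.ext' fun a m => ?_
        rw [Module.algebraMap_end_apply, LinearMap.rTensor_tmul, LinearMap.mulLeft_apply,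
          ← Algebra.smul_def, TensorProduct.smul_tmul']
      | grade1 i => rw [FreeAlgebra.lift_ι_apply]; rfl
      | mul a b ha hb =>
        rw [map_mul, ha, hb, map_mul, LinearMap.mulLeft_mul, LinearMap.rTensor_comp]; rfl
      | add a b ha hb =>
        rw [map_add, ha, hb, map_add]
        refine TensorProduct.ext' fun x m => ?_
        simp [add_mul, TensorProduct.add_tmul]
    rw [e, (proj_eq_zero _).2 ha]
    refine TensorProduct.ext' fun x m => ?_
    simp

/-- In the Borel representation on `𝔅(X^*) ⊗ C`, an element of `𝔅(X^*)` is recovered from its action on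
`1 ⊗ c`. -/
theorem dualRep_y (a : TensorAlg n) (c : C) :
    FreeAlgebra.lift ℂ (dualRep σ γ).y a (1 ⊗ₜ c) = proj _ a ⊗ₜ c := by
  suffices H : ∀ b, FreeAlgebra.lift ℂ (dualRep σ γ).y a (b ⊗ₜ c) = (proj _ a * b) ⊗ₜ c by
    rw [H, mul_one]
  induction a using FreeAlgebra.induction with
  | grade0 r =>
    intro b
    rw [AlgHomClass.commutes, AlgHomClass.commutes, Module.algebraMap_end_apply,
      ← Algebra.smul_def, TensorProduct.smul_tmul']
  | grade1 i => intro b; rw [FreeAlgebra.lift_ι_apply]; rfl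
  | mul a b ha hb => intro d; rw [map_mul, Module.End.mul_apply, hb, ha, map_mul, mul_assoc]
  | add a b ha hb =>
    intro d
    rw [map_add, LinearMap.add_apply, ha, hb, map_add, add_mul, TensorProduct.add_tmul]

theorem mulMap_tmul (a : Nichols (braidingMatrix γ σ))
    (b : Nichols (braidingMatrix (fun i => (γ i)⁻¹) σ)) (c : C) :
    mulMap σ γ g g' ((a ⊗ₜ b) ⊗ₜ c) =
      ofNichols σ γ g g' a * ofNicholsDual σ γ g g' b * ofC σ γ g g' c := by
  simp [mulMap]

/-- On the module induced from `𝔅(X^*) ⊗ C`, the product `a b c` maps `1 ⊗ (1 ⊗ 1)` to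
`a ⊗ (b ⊗ c)`. -/
theorem mulMap_injective : Function.Injective (mulMap σ γ g g') := by
  let f : QuantumGroup σ γ g g' →ₗ[ℂ] _ :=
    LinearMap.applyₗ (1 ⊗ₜ[ℂ] (1 ⊗ₜ[ℂ] (1 : C))) ∘ₗ ((dualRep σ γ).ind g g').toLinearMap
  have key : f ∘ₗ mulMap σ γ g g' = (TensorProduct.assoc ℂ _ _ _).toLinearMap :=
    TensorProduct.ext_threefold fun a b c => by
      obtain ⟨b, rfl⟩ := proj_surjective _ b
      rw [LinearMap.comp_apply, mulMap_tmul, LinearEquiv.coe_coe, TensorProduct.assoc_tmul]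
      change (dualRep σ γ).ind g g' (ofNichols σ γ g g' a * ofNicholsDual σ γ g g' _ *
        ofC σ γ g g' c) (1 ⊗ₜ (1 ⊗ₜ 1)) = a ⊗ₜ (_ ⊗ₜ c)
      rw [map_mul, map_mul, Module.End.mul_apply, Module.End.mul_apply,
        ind_ofC _ one_mem_weightSpace, charShift_one, ofNicholsDual_proj, ind_polyY_one]
      have e : (dualRep σ γ).ofC c (1 ⊗ₜ[ℂ] (1 : C)) = 1 ⊗ₜ c := by
        refine (smashAct_tmul _ one_mem_weightSpace c 1).trans ?_
        rw [charShift_one]; simp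
      rw [e, dualRep_y, ind_ofNichols, mul_one]
  have : Function.Injective (f ∘ₗ mulMap σ γ g g') := by
    rw [key]; exact (TensorProduct.assoc ℂ _ _ _).injective
  exact Function.Injective.of_comp (f := f) this

theorem ofC_mul_polyX (c : C) (w : FreeMonoid (Fin n)) :
    ofC σ γ g g' c * (univ σ γ g g').polyX (word w) =
      (univ σ γ g g').polyX (word w) * ofC σ γ g g' (charShift (charWord γ w) c) := by
  induction w using FreeMonoid.inductionOn' generalizing c with
  | one => simp [word_one]
  | of_mul i w ih =>
    rw [word_of_mul, map_mul, Realization.polyX_ι, univ_x, ← mul_assoc, ofC_mul_x, mul_assoc, ih,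
      charShift_charShift, mul_assoc, map_mul, mul_comm (charWord γ w), charWord,
      FreeMonoid.lift_eval_of]

theorem ofC_mul_polyY (c : C) (w : FreeMonoid (Fin n)) :
    ofC σ γ g g' c * (univ σ γ g g').polyY (word w) =
      (univ σ γ g g').polyY (word w) *
        ofC σ γ g g' (charShift (charWord (fun i => (γ i)⁻¹) w) c) := by
  induction w using FreeMonoid.inductionOn' generalizing c with
  | one => simp [word_one]
  | of_mul i w ih =>
    rw [word_of_mul, map_mul, Realization.polyY_ι, univ_y, ← mul_assoc, ofC_mul_y, mul_assoc, ih,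
      charShift_charShift, mul_assoc, map_mul, mul_comm (charWord _ w), charWord,
      FreeMonoid.lift_eval_of]

/-- The span of the products `a b c` is stable under left multiplication with the generators, by the
commutation relations. -/
theorem mulMap_surjective : Function.Surjective (mulMap σ γ g g') := by
  set P : Submodule ℂ (QuantumGroup σ γ g g') := LinearMap.range (mulMap σ γ g g') with hP
  have mem : ∀ a b c, (univ σ γ g g').polyX a * (univ σ γ g g').polyY b * ofC σ γ g g' c ∈ P :=
    fun a b c => ⟨(proj _ a ⊗ₜ proj _ b) ⊗ₜ c, by
      rw [← ofNichols_proj, ← ofNicholsDual_proj]; rfl⟩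
  -- The elements `u` with `u P ⊆ P` form a subalgebra, which turns out to contain the generators.
  let S : Subalgebra ℂ (QuantumGroup σ γ g g') :=
    { carrier := {u | ∀ v ∈ P, u * v ∈ P}
      mul_mem' := fun {a b} ha hb v hv => by rw [mul_assoc]; exact ha _ (hb v hv)
      add_mem' := fun {a b} ha hb v hv => by rw [add_mul]; exact add_mem (ha v hv) (hb v hv)
      algebraMap_mem' := fun r v hv => by rw [← Algebra.smul_def]; exact P.smul_mem _ hv }
  have memS : ∀ u, (∀ w w' c, u * ((univ σ γ g g').polyX (word w) *
      (univ σ γ g g').polyY (word w') * ofC σ γ g g' c) ∈ P) → u ∈ S := by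
    rintro u hu v ⟨z, rfl⟩
    induction z with
    | zero => simp
    | add x y hx hy => rw [map_add, mul_add]; exact add_mem hx hy
    | tmul z c =>
      induction z with
      | zero => simp
      | add x y hx hy => rw [TensorProduct.add_tmul, map_add, mul_add]; exact add_mem hx hy
      | tmul a b =>
        obtain ⟨a, rfl⟩ := proj_surjective _ a
        obtain ⟨b, rfl⟩ := proj_surjective _ b
        rw [mulMap_tmul, ofNichols_proj, ofNicholsDual_proj]
        have h1 : ∀ w, (P.comap (LinearMap.mulLeft ℂ u ∘ₗ LinearMap.mulRight ℂ (ofC σ γ g g' c) ∘ₗ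
            LinearMap.mulLeft ℂ ((univ σ γ g g').polyX (word w)) ∘ₗ
              (univ σ γ g g').polyY.toLinearMap)) = ⊤ := fun w => by
          rw [eq_top_iff, ← (wordBasis n).span_eq, Submodule.span_le]
          rintro _ ⟨w', rfl⟩
          rw [wordBasis_apply]
          exact hu w w' c
        have h2 : (P.comap (LinearMap.mulLeft ℂ u ∘ₗ LinearMap.mulRight ℂ (ofC σ γ g g' c) ∘ₗ
            LinearMap.mulRight ℂ ((univ σ γ g g').polyY b) ∘ₗ
              (univ σ γ g g').polyX.toLinearMap)) = ⊤ := by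
          rw [eq_top_iff, ← (wordBasis n).span_eq, Submodule.span_le]
          rintro _ ⟨w, rfl⟩
          rw [wordBasis_apply]
          exact (h1 w).ge (Submodule.mem_top (x := b))
        exact h2.ge (Submodule.mem_top (x := a))
  have hC : ∀ c, ofC σ γ g g' c ∈ S := fun c => memS _ fun w w' d => by
    rw [← mul_assoc, ← mul_assoc, ofC_mul_polyX, mul_assoc _ (ofC σ γ g g' _), ofC_mul_polyY,
      mul_assoc, mul_assoc, ← map_mul, ← mul_assoc]
    exact mem _ _ _
  have hX : ∀ a, (univ σ γ g g').polyX a ∈ S := fun a => memS _ fun w w' d => by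
    rw [← mul_assoc, ← mul_assoc, ← map_mul]
    exact mem _ _ _
  have top : ∀ u, u ∈ S := subalgebra_eq_top σ γ g g' hC
    (fun i => by simpa using hX (FreeAlgebra.ι ℂ i)) fun j => memS _ fun w w' d => by
      rw [← mul_assoc, ← mul_assoc, ← univ_y, Realization.y_mul_polyX, sub_mul, add_mul, sub_mul,
        add_mul]
      refine sub_mem (add_mem ?_ (mem _ _ _)) ?_
      · rw [mul_assoc (Realization.polyX _ _), ← Realization.polyY_ι, ← map_mul]
        exact mem _ _ _
      · simp only [mul_assoc, univ_ofC]
        refine hC _ _ (hX _ _ (hC _ _ ?_))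
        simpa using mem 1 (word w') d
  intro u
  have := top u 1 (by simpa using mem 1 1 1)
  rwa [mul_one] at this

theorem mulMap_bijective : Function.Bijective (mulMap σ γ g g') :=
  ⟨mulMap_injective, mulMap_surjective⟩

end PBW

end QuantumGroup
end InducedModules

/-! ### Linear maps on graded vector spaces and their braidings -/

noncomputable section GradedLinearMaps

open NicholsAlgebra WeightModule

variable {C : Type u} [CommRing C] [HopfAlgebra ℂ C] [Coalgebra.IsCocomm ℂ C]
variable {σ : CharGroup C →* CharGroup C →* ℂˣ}

/-- Graded vector spaces, without a choice of braiding. -/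
abbrev GradedSpace (C : Type u) [CommRing C] [HopfAlgebra ℂ C] := WeightModule (BialgHom.id ℂ C)

namespace GradedSpace

theorem lin_mem_weightSpace {V W : GradedSpace C} {f : V.V →ₗ[ℂ] W.V}
    (hf : ∀ c x, f (V.ρ c x) = W.ρ c (f x)) {χ : CharGroup C} {x : V.V}
    (hx : x ∈ weightSpace V.ρ χ) : f x ∈ weightSpace W.ρ χ := fun c => by
  rw [← hf, hx c, map_smul]

theorem tmul_mem_weightSpace {V W : Type} [AddCommGroup V] [Module ℂ V] [AddCommGroup W]
    [Module ℂ W] {r : C →ₐ[ℂ] Module.End ℂ V} {s : C →ₐ[ℂ] Module.End ℂ W} {χ ψ : CharGroup C}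
    {x : V} {y : W} (hx : x ∈ weightSpace r χ) (hy : y ∈ weightSpace s ψ) :
    x ⊗ₜ[ℂ] y ∈ weightSpace (diag r s) (χ * ψ) :=
  WeightModule.tmul_mem_weightSpace (j := BialgHom.id ℂ C) hx hy

section Ext

variable {Z : Type*} [AddCommGroup Z] [Module ℂ Z] {V W X Y : GradedSpace C}

theorem ext₁ {f f' : V.V →ₗ[ℂ] Z} (h : ∀ χ, ∀ x ∈ weightSpace V.ρ χ, f x = f' x) : f = f' := by
  obtain ⟨κ, b, w, hw⟩ := V.exists_basis
  exact b.ext fun k => h _ _ (hw k)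

theorem ext₂ {f f' : V.V ⊗[ℂ] W.V →ₗ[ℂ] Z}
    (h : ∀ χ ψ, ∀ x ∈ weightSpace V.ρ χ, ∀ y ∈ weightSpace W.ρ ψ, f (x ⊗ₜ y) = f' (x ⊗ₜ y)) :
    f = f' := ext_weight h

theorem ext₃ {f f' : (V.V ⊗[ℂ] W.V) ⊗[ℂ] X.V →ₗ[ℂ] Z}
    (h : ∀ χ ψ φ, ∀ x ∈ weightSpace V.ρ χ, ∀ y ∈ weightSpace W.ρ ψ, ∀ z ∈ weightSpace X.ρ φ,
      f ((x ⊗ₜ y) ⊗ₜ z) = f' ((x ⊗ₜ y) ⊗ₜ z)) : f = f' :=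
  VectGraded.ext_weight₃ h

theorem ext₄ {f f' : (V.V ⊗[ℂ] W.V) ⊗[ℂ] (X.V ⊗[ℂ] Y.V) →ₗ[ℂ] Z}
    (h : ∀ χ ψ φ η, ∀ x ∈ weightSpace V.ρ χ, ∀ y ∈ weightSpace W.ρ ψ, ∀ z ∈ weightSpace X.ρ φ,
      ∀ w ∈ weightSpace Y.ρ η, f ((x ⊗ₜ y) ⊗ₜ (z ⊗ₜ w)) = f' ((x ⊗ₜ y) ⊗ₜ (z ⊗ₜ w))) :
    f = f' := by
  obtain ⟨_, b, _, hw⟩ := V.exists_basis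
  obtain ⟨_, b', _, hw'⟩ := W.exists_basis
  obtain ⟨_, b'', _, hw''⟩ := X.exists_basis
  obtain ⟨_, b₄, _, hw₄⟩ := Y.exists_basis
  refine ((b.tensorProduct b').tensorProduct (b''.tensorProduct b₄)).ext
    fun ⟨⟨k, l⟩, ⟨m, o⟩⟩ => ?_
  rw [Module.Basis.tensorProduct_apply, Module.Basis.tensorProduct_apply,
    Module.Basis.tensorProduct_apply]
  exact h _ _ _ _ _ (hw k) _ (hw' l) _ (hw'' m) _ (hw₄ o)

/-- Two maps which are linear in an element of a graded vector space agree if they agree on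
homogeneous elements. -/
theorem forall_of_weight (f f' : V.V →ₗ[ℂ] Z) (h : ∀ χ, ∀ x ∈ weightSpace V.ρ χ, f x = f' x)
    (x : V.V) : f x = f' x :=
  LinearMap.congr_fun (ext₁ h) x

end Ext

variable (σ) in
/-- The braiding of `Vect_Γ` as a linear map. -/
abbrev braid (V W : GradedSpace C) : V.V ⊗[ℂ] W.V →ₗ[ℂ] W.V ⊗[ℂ] V.V := VectGraded.braid σ V W

theorem braid_tmul {V W : GradedSpace C} {χ ψ : CharGroup C} {x : V.V} {y : W.V}
    (hx : x ∈ weightSpace V.ρ χ) (hy : y ∈ weightSpace W.ρ ψ) :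
    braid σ V W (x ⊗ₜ y) = ((σ χ ψ : ℂˣ) : ℂ) • (y ⊗ₜ x) := VectGraded.braid_tmul σ hx hy

/-- The exchange of the two middle tensor factors with a map `b`. -/
def exchange {P V W Q : Type} [AddCommGroup P] [Module ℂ P] [AddCommGroup Q] [Module ℂ Q]
    [AddCommGroup V] [Module ℂ V] [AddCommGroup W] [Module ℂ W]
    (b : V ⊗[ℂ] W →ₗ[ℂ] W ⊗[ℂ] V) :
    (P ⊗[ℂ] V) ⊗[ℂ] (W ⊗[ℂ] Q) →ₗ[ℂ] (P ⊗[ℂ] W) ⊗[ℂ] (V ⊗[ℂ] Q) :=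
  (TensorProduct.assoc ℂ P W (V ⊗[ℂ] Q)).symm.toLinearMap ∘ₗ
    (TensorProduct.assoc ℂ W V Q).toLinearMap.lTensor P ∘ₗ (b.rTensor Q).lTensor P ∘ₗ
    (TensorProduct.assoc ℂ V W Q).symm.toLinearMap.lTensor P ∘ₗ
    (TensorProduct.assoc ℂ P V (W ⊗[ℂ] Q)).toLinearMap

theorem exchange_tmul {P V W Q : Type} [AddCommGroup P] [Module ℂ P] [AddCommGroup Q] [Module ℂ Q]
    [AddCommGroup V] [Module ℂ V] [AddCommGroup W] [Module ℂ W]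
    {b : V ⊗[ℂ] W →ₗ[ℂ] W ⊗[ℂ] V} (p : P) {v : V} {w : W} (t : Q) {r : ℂ}
    (h : b (v ⊗ₜ w) = r • (w ⊗ₜ v)) :
    exchange b ((p ⊗ₜ v) ⊗ₜ (w ⊗ₜ t)) = r • ((p ⊗ₜ[ℂ] w) ⊗ₜ[ℂ] (v ⊗ₜ[ℂ] t)) := by
  have e : exchange b ((p ⊗ₜ v) ⊗ₜ (w ⊗ₜ t)) = (TensorProduct.assoc ℂ P W (V ⊗[ℂ] Q)).symm
      (p ⊗ₜ TensorProduct.assoc ℂ W V Q (b (v ⊗ₜ w) ⊗ₜ[ℂ] t)) := rfl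
  rw [e, h, ← TensorProduct.smul_tmul', map_smul, TensorProduct.tmul_smul, map_smul]
  rfl

end GradedSpace

namespace NicholsAlgebra

variable {n : ℕ} {γ : Fin n → CharGroup C}

/-- The scalar from braiding `x_i` with a monomial depends only on the weight of the monomial. -/
theorem braidScalar_braidingMatrix (i : Fin n) (w : FreeMonoid (Fin n)) :
    braidScalar (braidingMatrix γ σ) i w = ((σ (γ i) (charWord γ w) : ℂˣ) : ℂ) := by
  induction w using FreeMonoid.inductionOn' with
  | one => simp
  | of_mul j w ih =>
    rw [map_mul, ih, map_mul, map_mul, Units.val_mul, charWord, FreeMonoid.lift_eval_of,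
      braidScalar, FreeMonoid.lift_eval_of]
    rfl

theorem braidScalar_braidingMatrix_flip (j : Fin n) (w : FreeMonoid (Fin n)) :
    braidScalar (fun j i => braidingMatrix γ σ i j) j w = ((σ (charWord γ w) (γ j) : ℂˣ) : ℂ) := by
  induction w using FreeMonoid.inductionOn' with
  | one => simp
  | of_mul i w ih =>
    rw [map_mul, ih, map_mul, map_mul, MonoidHom.mul_apply, Units.val_mul, charWord,
      FreeMonoid.lift_eval_of, braidScalar, FreeMonoid.lift_eval_of]
    rfl

/-- The bilinear form is compatible with the grading. -/
theorem nForm_nicholsAct (q : Fin n → Fin n → ℂ) (c : C) (a b : Nichols q) :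
    nForm q (nicholsAct γ q c a) b = nForm q a (nicholsAct γ q c b) := by
  have key : ∀ u v, charWord γ u c * nForm q (proj q (word u)) (proj q (word v)) =
      charWord γ v c * nForm q (proj q (word u)) (proj q (word v)) := by
    intro u v
    by_cases h : nForm q (proj q (word u)) (proj q (word v)) = 0
    · rw [h, mul_zero, mul_zero]
    · rw [charWord_eq, charWord_eq, form_word_word q h]
  have : (nForm q) ∘ₗ nicholsAct γ q c = (nForm q).compl₂ (nicholsAct γ q c) :=
    lin_ext fun u => lin_ext fun v => by
      simp only [LinearMap.comp_apply, LinearMap.compl₂_apply, nicholsAct_word, map_smul,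
        LinearMap.smul_apply, smul_eq_mul]
      exact key u v
  exact LinearMap.congr_fun₂ this a b

/-- Elements of different degrees are orthogonal to each other. -/
theorem nForm_eq_zero_of_degree (q : Fin n → Fin n → ℂ) {χ ψ : CharGroup C} {a b : Nichols q}
    (ha : a ∈ weightSpace (nicholsAct γ q) χ) (hb : b ∈ weightSpace (nicholsAct γ q) ψ)
    (h : nForm q a b ≠ 0) : χ = ψ := by
  apply WithConv.ext
  ext c
  have e := nForm_nicholsAct (γ := γ) q c a b
  rw [ha c, hb c, map_smul, map_smul, LinearMap.smul_apply] at e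
  exact mul_right_cancel₀ h e

end NicholsAlgebra
end GradedLinearMaps

/-! ### Actions of the Nichols algebra and braided exchanges -/

noncomputable section BraidedActions

open NicholsAlgebra WeightModule GradedSpace

variable {C : Type u} [CommRing C] [HopfAlgebra ℂ C] [Coalgebra.IsCocomm ℂ C] {n : ℕ}

namespace QuantumGroup

variable {σ : CharGroup C →* CharGroup C →* ℂˣ} {γ : Fin n → CharGroup C} {g g' : Fin n → C}

section Degrees

variable [h : IsLinkingDatum σ γ g g']
include h

variable (σ γ g g') in
/-- The grouplike element `g_i` acts by the braiding of `γ_i` with the weight. -/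
theorem left_act {V : Type} [AddCommGroup V] [Module ℂ V] {r : C →ₐ[ℂ] Module.End ℂ V}
    {χ : CharGroup C} {x : V} (hx : x ∈ weightSpace r χ) (i : Fin n) :
    r (g i) x = ((σ (γ i) χ : ℂˣ) : ℂ) • x := by
  rw [hx, h.left_eval]

variable (σ γ g g') in
/-- The grouplike element `g'_i` acts by the braiding of the weight with `γ_i`. -/
theorem right_act {V : Type} [AddCommGroup V] [Module ℂ V] {r : C →ₐ[ℂ] Module.End ℂ V}
    {χ : CharGroup C} {x : V} (hx : x ∈ weightSpace r χ) (i : Fin n) :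
    r (g' i) x = ((σ χ (γ i) : ℂˣ) : ℂ) • x := by
  rw [hx, h.right_eval]

variable (g') in
theorem nicholsAct_left (i : Fin n) :
    nicholsAct γ (braidingMatrix γ σ) (g i) = nBraid _ (braidingMatrix γ σ) i :=
  lin_ext fun w => by
    rw [nicholsAct_word, nBraid_proj_word, braidScalar_braidingMatrix, h.left_eval]

variable (g) in
theorem nicholsAct_right (i : Fin n) :
    nicholsAct γ (braidingMatrix γ σ) (g' i) =
      nBraid _ (fun j i => braidingMatrix γ σ i j) i :=
  lin_ext fun w => by
    rw [nicholsAct_word, nBraid_proj_word, braidScalar_braidingMatrix_flip, h.right_eval]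

end Degrees

variable [FiniteDimensional ℂ (Nichols (braidingMatrix γ σ))]

local notation "q" => braidingMatrix γ σ

variable (γ σ) in
/-- The Nichols algebra as a graded vector space. -/
abbrev nicholsSpace : GradedSpace C :=
  { V := Nichols q
    ρ := nicholsAct γ q
    iSup_weightSpace := iSup_weightSpace_nichols γ _ }

local notation "𝔑" => nicholsSpace σ γ

section Operators

variable {V W A : GradedSpace C}

/-- A map `𝔅(X) ⊗ V → V` is homogeneous if it is `C`-linear. -/
def IsHomogeneousAct (a : Nichols q ⊗[ℂ] V.V →ₗ[ℂ] V.V) : Prop :=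
  ∀ c z, a (diag (nicholsAct γ q) V.ρ c z) = V.ρ c (a z)

theorem IsHomogeneousAct.mem {a : Nichols q ⊗[ℂ] V.V →ₗ[ℂ] V.V} (ha : IsHomogeneousAct a)
    {χ ψ : CharGroup C} {b : Nichols q} {v : V.V} (hb : b ∈ weightSpace (nicholsAct γ q) χ)
    (hv : v ∈ weightSpace V.ρ ψ) : a (b ⊗ₜ v) ∈ weightSpace V.ρ (χ * ψ) := fun c => by
  rw [← ha, GradedSpace.tmul_mem_weightSpace hb hv c, map_smul]

variable (γ σ V) in
theorem isHomogeneousAct_mul' : IsHomogeneousAct (V := 𝔑) (LinearMap.mul' ℂ (Nichols q)) :=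
  fun c z => mul_comm_act γ q c z

/-- The action of `x_i`. -/
def opX (a : Nichols q ⊗[ℂ] V.V →ₗ[ℂ] V.V) (i : Fin n) : V.V →ₗ[ℂ] V.V :=
  a ∘ₗ TensorProduct.mk ℂ (Nichols q) V.V (gen q i)

theorem opX_apply (a : Nichols q ⊗[ℂ] V.V →ₗ[ℂ] V.V) (i : Fin n) (v : V.V) :
    opX a i v = a (gen q i ⊗ₜ v) := rfl

theorem opX_mem {a : Nichols q ⊗[ℂ] V.V →ₗ[ℂ] V.V} (ha : IsHomogeneousAct a) (i : Fin n)
    {ψ : CharGroup C} {v : V.V} (hv : v ∈ weightSpace V.ρ ψ) :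
    opX a i v ∈ weightSpace V.ρ (γ i * ψ) :=
  ha.mem (gen_mem_weightSpace i) hv

theorem opX_mul' (i : Fin n) (a : Nichols q) :
    opX (V := 𝔑) (LinearMap.mul' ℂ (Nichols q)) i a = gen q i * a := rfl

/-- The action of the tensor square of the Nichols algebra on `A ⊗ V`, where tensor factors are
exchanged with the braiding. -/
def tensorActL (a : Nichols q ⊗[ℂ] A.V →ₗ[ℂ] A.V) (b : Nichols q ⊗[ℂ] V.V →ₗ[ℂ] V.V) :
    (Nichols q ⊗[ℂ] Nichols q) ⊗[ℂ] (A.V ⊗[ℂ] V.V) →ₗ[ℂ] A.V ⊗[ℂ] V.V :=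
  TensorProduct.map a b ∘ₗ exchange (braid σ 𝔑 A)

theorem tensorActL_tmul (a : Nichols q ⊗[ℂ] A.V →ₗ[ℂ] A.V) (b : Nichols q ⊗[ℂ] V.V →ₗ[ℂ] V.V)
    {χ ψ : CharGroup C} (c : Nichols q) {d : Nichols q} {x : A.V} (v : V.V)
    (hd : d ∈ weightSpace (nicholsAct γ q) χ) (hx : x ∈ weightSpace A.ρ ψ) :
    tensorActL a b ((c ⊗ₜ d) ⊗ₜ (x ⊗ₜ v)) =
      ((σ χ ψ : ℂˣ) : ℂ) • (a (c ⊗ₜ x) ⊗ₜ b (d ⊗ₜ v)) := by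
  rw [tensorActL, LinearMap.comp_apply, exchange_tmul c v (braid_tmul (V := 𝔑) hd hx), map_smul,
    TensorProduct.map_tmul]

variable (g) in
/-- The diagonal action of `x_i`. -/
def diagX (a : Nichols q ⊗[ℂ] A.V →ₗ[ℂ] A.V) (b : Nichols q ⊗[ℂ] V.V →ₗ[ℂ] V.V) (i : Fin n) :
    A.V ⊗[ℂ] V.V →ₗ[ℂ] A.V ⊗[ℂ] V.V :=
  TensorProduct.map (opX a i) LinearMap.id + TensorProduct.map (A.ρ (g i)) (opX b i)

theorem diagX_tmul (a : Nichols q ⊗[ℂ] A.V →ₗ[ℂ] A.V) (b : Nichols q ⊗[ℂ] V.V →ₗ[ℂ] V.V)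
    (i : Fin n) (x : A.V) (v : V.V) :
    diagX g a b i (x ⊗ₜ v) = opX a i x ⊗ₜ v + A.ρ (g i) x ⊗ₜ opX b i v := rfl

/-- The map `(c ⊗ v) ⊗ w ↦ c w ⊗ v`, where `v` and `w` are exchanged with the braiding. -/
def twistL (a : Nichols q ⊗[ℂ] W.V →ₗ[ℂ] W.V) (V : GradedSpace C) :
    (Nichols q ⊗[ℂ] V.V) ⊗[ℂ] W.V →ₗ[ℂ] W.V ⊗[ℂ] V.V :=
  a.rTensor V.V ∘ₗ (TensorProduct.assoc ℂ (Nichols q) W.V V.V).symm.toLinearMap ∘ₗ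
    (braid σ V W).lTensor (Nichols q) ∘ₗ (TensorProduct.assoc ℂ (Nichols q) V.V W.V).toLinearMap

theorem twistL_tmul (a : Nichols q ⊗[ℂ] W.V →ₗ[ℂ] W.V) {χ ψ : CharGroup C} (c : Nichols q) {v : V.V}
    {w : W.V} (hv : v ∈ weightSpace V.ρ χ) (hw : w ∈ weightSpace W.ρ ψ) :
    twistL a V ((c ⊗ₜ v) ⊗ₜ w) = ((σ χ ψ : ℂˣ) : ℂ) • (a (c ⊗ₜ w) ⊗ₜ v) := by
  have e : twistL a V ((c ⊗ₜ v) ⊗ₜ w) = a.rTensor V.V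
    ((TensorProduct.assoc ℂ (Nichols q) W.V V.V).symm
      (c ⊗ₜ[ℂ] braid σ V W (v ⊗ₜ[ℂ] w))) := rfl
  rw [e, braid_tmul hv hw, TensorProduct.tmul_smul, map_smul, map_smul]
  rfl

variable (g') in
/-- Right multiplication with `x_i` on `𝔅(X) ⊗ V`, up to scalars. -/
def rightX (V : GradedSpace C) (i : Fin n) : Nichols q ⊗[ℂ] V.V →ₗ[ℂ] Nichols q ⊗[ℂ] V.V :=
  TensorProduct.map (LinearMap.mulRight ℂ (gen q i)) (V.ρ (g' i))

theorem tensorActL_one {a : Nichols q ⊗[ℂ] A.V →ₗ[ℂ] A.V} {b : Nichols q ⊗[ℂ] V.V →ₗ[ℂ] V.V}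
    (ha : ∀ x, a (1 ⊗ₜ x) = x) (hb : ∀ x, b (1 ⊗ₜ x) = x) (w : A.V ⊗[ℂ] V.V) :
    tensorActL a b ((1 ⊗ₜ 1) ⊗ₜ w) = w := by
  have : tensorActL a b ∘ₗ TensorProduct.mk ℂ _ _ (1 ⊗ₜ 1) = LinearMap.id :=
    ext₂ fun χ ψ x hx y _ => by
      rw [LinearMap.comp_apply, TensorProduct.mk_apply,
        tensorActL_tmul a b 1 y one_mem_weightSpace hx, ha, hb, map_one, MonoidHom.one_apply,
        Units.val_one, one_smul, LinearMap.id_apply]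
  exact LinearMap.congr_fun this w

theorem twistL_one (a : Nichols q ⊗[ℂ] W.V →ₗ[ℂ] W.V) {w : W.V} (hw : w ∈ weightSpace W.ρ 1)
    (z : Nichols q ⊗[ℂ] V.V) :
    twistL a V (z ⊗ₜ w) = (a ∘ₗ (TensorProduct.mk ℂ (Nichols q) W.V).flip w).rTensor V.V z := by
  have : twistL a V ∘ₗ (TensorProduct.mk ℂ (Nichols q ⊗[ℂ] V.V) W.V).flip w =
      (a ∘ₗ (TensorProduct.mk ℂ (Nichols q) W.V).flip w).rTensor V.V :=
    ext₂ (V := 𝔑) fun φ ψ c hc v hv => by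
      rw [LinearMap.comp_apply, LinearMap.flip_apply, TensorProduct.mk_apply,
        twistL_tmul a _ hv hw, map_one, Units.val_one, one_smul]
      rfl
  exact LinearMap.congr_fun this z

/-- In the map `(c ⊗ v) ⊗ w ↦ c w ⊗ v`, the action of `x_i` on `w` is absorbed into `c ⊗ v`: the
element `c` is multiplied by `x_i`, and the exchange of `x_i` with `v` is the action of `g'_i`. -/
theorem twistL_rightX [h : IsLinkingDatum σ γ g g'] {a : Nichols q ⊗[ℂ] W.V →ₗ[ℂ] W.V}
    (hg : IsHomogeneousAct a) (ha : ∀ c d x, a ((c * d) ⊗ₜ x) = a (c ⊗ₜ a (d ⊗ₜ x))) (i : Fin n)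
    (z : Nichols q ⊗[ℂ] V.V) (w : W.V) :
    twistL a V (rightX g' V i z ⊗ₜ w) = twistL a V (z ⊗ₜ opX a i w) := by
  have : twistL a V ∘ₗ (rightX g' V i).rTensor W.V = twistL a V ∘ₗ (opX a i).lTensor _ :=
    ext₃ (V := 𝔑) fun φ ψ χ c hc v hv w hw => by
      have e : rightX g' V i (c ⊗ₜ v) = (c * gen q i) ⊗ₜ V.ρ (g' i) v := rfl
      rw [LinearMap.comp_apply, LinearMap.comp_apply, LinearMap.rTensor_tmul,
        LinearMap.lTensor_tmul, twistL_tmul a _ hv (opX_mem hg i hw), e, right_act σ γ g g' hv,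
        TensorProduct.tmul_smul, ← TensorProduct.smul_tmul', map_smul, twistL_tmul a _ hv hw, ha,
        smul_smul, map_mul, Units.val_mul]
      rfl
  exact LinearMap.congr_fun this (z ⊗ₜ w)

variable [h : IsLinkingDatum σ γ g g']
include h

/-- Multiplication with the coproduct of `x_i` turns into the diagonal operator of `x_i`. -/
theorem tensorActL_primMul {a : Nichols q ⊗[ℂ] A.V →ₗ[ℂ] A.V} {b : Nichols q ⊗[ℂ] V.V →ₗ[ℂ] V.V}
    (hg : IsHomogeneousAct a) (ha : ∀ c d x, a ((c * d) ⊗ₜ x) = a (c ⊗ₜ a (d ⊗ₜ x)))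
    (hb : ∀ c d x, b ((c * d) ⊗ₜ x) = b (c ⊗ₜ b (d ⊗ₜ x))) (i : Fin n)
    (z : Nichols q ⊗[ℂ] Nichols q) (w : A.V ⊗[ℂ] V.V) :
    tensorActL a b (nPrimMul q i z ⊗ₜ w) = diagX g a b i (tensorActL a b (z ⊗ₜ w)) := by
  have : tensorActL a b ∘ₗ (nPrimMul q i).rTensor _ = diagX g a b i ∘ₗ tensorActL a b :=
    ext₄ (V := 𝔑) (W := 𝔑) fun χ ψ φ η c hc d hd x hx v hv => by
      rw [LinearMap.comp_apply, LinearMap.comp_apply, LinearMap.rTensor_tmul, nPrimMul_tmul,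
        TensorProduct.add_tmul, map_add, tensorActL_tmul a b _ v hd hx,
        tensorActL_tmul a b _ v hd hx,
        tensorActL_tmul a b _ v (mul_mem_weightSpace (gen_mem_weightSpace i) hd) hx, map_smul,
        diagX_tmul, left_act σ γ g g' (hg.mem hc hx), opX_apply, opX_apply, ← ha, ← hb,
        ← nicholsAct_left (g := g) g', left_act (r := nicholsAct γ q) σ γ g g' hc, map_mul, map_mul,
        MonoidHom.mul_apply]
      simp only [← TensorProduct.smul_tmul', smul_add, map_smul, smul_smul,
        Units.val_mul]
      congr 2
      ring
  exact LinearMap.congr_fun this (z ⊗ₜ w)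

/-- The exchange intertwines the diagonal operators of `x_i` on `𝔅(X) ⊗ V` and on `W ⊗ V`. -/
theorem twistL_diagX {a : Nichols q ⊗[ℂ] W.V →ₗ[ℂ] W.V} {b : Nichols q ⊗[ℂ] V.V →ₗ[ℂ] V.V}
    (hg : IsHomogeneousAct a) (ha : ∀ c d x, a ((c * d) ⊗ₜ x) = a (c ⊗ₜ a (d ⊗ₜ x)))
    (hb : IsHomogeneousAct b) (i : Fin n) (z : Nichols q ⊗[ℂ] V.V) (w : W.V) :
    twistL a V (diagX (A := 𝔑) g (LinearMap.mul' ℂ (Nichols q)) b i z ⊗ₜ w) =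
      diagX g a b i (twistL a V (z ⊗ₜ w)) := by
  have : twistL a V ∘ₗ (diagX (A := 𝔑) g (LinearMap.mul' ℂ (Nichols q)) b i).rTensor W.V =
      diagX g a b i ∘ₗ twistL a V :=
    ext₃ (V := 𝔑) fun φ ψ χ c hc v hv w hw => by
      rw [LinearMap.comp_apply, LinearMap.comp_apply, LinearMap.rTensor_tmul, diagX_tmul,
        TensorProduct.add_tmul, map_add, opX_mul', twistL_tmul a _ hv hw,
        twistL_tmul a _ hv hw, twistL_tmul a _ (opX_mem hb i hv) hw, map_smul, diagX_tmul,
        ha, left_act (r := nicholsAct γ q) σ γ g g' hc, left_act σ γ g g' (hg.mem hc hw), map_mul, map_mul,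
        MonoidHom.mul_apply]
      simp only [← TensorProduct.smul_tmul', map_smul, smul_add, smul_smul, Units.val_mul,
        TensorProduct.tmul_smul]
      rw [opX_apply]
      congr 2
      ring
  exact LinearMap.congr_fun this (z ⊗ₜ w)

end Operators

end QuantumGroup
end BraidedActions

/-! ### Yetter-Drinfeld modules in terms of linear maps -/

noncomputable section NicholsData

open NicholsAlgebra WeightModule GradedSpace

variable {C : Type u} [CommRing C] [HopfAlgebra ℂ C] [Coalgebra.IsCocomm ℂ C] {n : ℕ}

namespace QuantumGroup

/-- A graded vector space with a homogeneous action and coaction of the Nichols algebra, given by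
linear maps. No axioms on the action and the coaction are imposed. -/
structure NicholsDatum (σ : CharGroup C →* CharGroup C →* ℂˣ) (γ : Fin n → CharGroup C) where
  X : GradedSpace C
  act : Nichols (braidingMatrix γ σ) ⊗[ℂ] X.V →ₗ[ℂ] X.V
  coact : X.V →ₗ[ℂ] Nichols (braidingMatrix γ σ) ⊗[ℂ] X.V
  act_comm : IsHomogeneousAct act
  coact_comm : ∀ c x, coact (X.ρ c x) = diag (nicholsAct γ (braidingMatrix γ σ)) X.ρ c (coact x)

variable {σ : CharGroup C →* CharGroup C →* ℂˣ} {γ : Fin n → CharGroup C} {g g' : Fin n → C}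
variable [FiniteDimensional ℂ (Nichols (braidingMatrix γ σ))]

local notation "q" => braidingMatrix γ σ
local notation "𝔑" => nicholsSpace σ γ
local notation "μN" => LinearMap.mul' ℂ (Nichols (braidingMatrix γ σ))

namespace NicholsDatum

variable (D : NicholsDatum σ γ)

theorem act_mem {χ ψ : CharGroup C} {b : Nichols q} {v : D.X.V}
    (hb : b ∈ weightSpace (nicholsAct γ q) χ) (hv : v ∈ weightSpace D.X.ρ ψ) :
    D.act (b ⊗ₜ v) ∈ weightSpace D.X.ρ (χ * ψ) := D.act_comm.mem hb hv

/-- The right hand side of the Yetter-Drinfeld condition, as a linear map in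
`h₍₁₎ ⊗ h₍₂₎ ⊗ m`. -/
def compatL : (Nichols q ⊗[ℂ] Nichols q) ⊗[ℂ] D.X.V →ₗ[ℂ] Nichols q ⊗[ℂ] D.X.V :=
  twistL (W := 𝔑) μN D.X ∘ₗ (D.coact ∘ₗ D.act).rTensor (Nichols q) ∘ₗ
    (TensorProduct.assoc ℂ (Nichols q) D.X.V (Nichols q)).symm.toLinearMap ∘ₗ
    (braid σ 𝔑 D.X).lTensor (Nichols q) ∘ₗ
    (TensorProduct.assoc ℂ (Nichols q) (Nichols q) D.X.V).toLinearMap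

theorem compatL_tmul {χ ψ : CharGroup C} (c : Nichols q) {d : Nichols q} {m : D.X.V}
    (hd : d ∈ weightSpace (nicholsAct γ q) χ) (hm : m ∈ weightSpace D.X.ρ ψ) :
    D.compatL ((c ⊗ₜ d) ⊗ₜ m) = ((σ χ ψ : ℂˣ) : ℂ) •
      twistL (W := 𝔑) μN D.X (D.coact (D.act (c ⊗ₜ m)) ⊗ₜ d) := by
  have e : D.compatL ((c ⊗ₜ d) ⊗ₜ m) = twistL (W := 𝔑) μN D.X
    ((D.coact ∘ₗ D.act).rTensor (Nichols q)
      ((TensorProduct.assoc ℂ (Nichols q) D.X.V (Nichols q)).symm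
      (c ⊗ₜ[ℂ] braid σ 𝔑 D.X (d ⊗ₜ[ℂ] m)))) := rfl
  rw [e, braid_tmul (V := 𝔑) hd hm, TensorProduct.tmul_smul, map_smul, map_smul, map_smul]
  rfl

/-- The axioms of a Yetter-Drinfeld module in terms of elements. -/
structure IsYetterDrinfeld : Prop where
  one_act : ∀ m, D.act (1 ⊗ₜ m) = m
  mul_act : ∀ a b m, D.act ((a * b) ⊗ₜ m) = D.act (a ⊗ₜ D.act (b ⊗ₜ m))
  coact_counit : ∀ m, (nicholsCounit q).rTensor _ (D.coact m) = 1 ⊗ₜ m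
  coact_comul : ∀ m, TensorProduct.assoc ℂ _ _ _ ((nicholsComul q).rTensor _ (D.coact m)) =
    D.coact.lTensor _ (D.coact m)
  compat : ∀ a m, tensorActL (A := 𝔑) μN D.act (nicholsComul q a ⊗ₜ D.coact m) =
    D.compatL (nicholsComul q a ⊗ₜ m)

theorem compatL_tmul_one (c : Nichols q) (m : D.X.V) :
    D.compatL ((c ⊗ₜ 1) ⊗ₜ m) = D.coact (D.act (c ⊗ₜ m)) := by
  refine forall_of_weight (D.compatL ∘ₗ TensorProduct.mk ℂ _ _ (c ⊗ₜ 1))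
    (D.coact ∘ₗ D.act ∘ₗ TensorProduct.mk ℂ _ _ c) (fun ψ m hm => ?_) m
  rw [LinearMap.comp_apply, TensorProduct.mk_apply, D.compatL_tmul c one_mem_weightSpace hm,
    twistL_one (W := 𝔑) _ one_mem_weightSpace, map_one, MonoidHom.one_apply, Units.val_one,
    one_smul]
  have e : μN ∘ₗ (TensorProduct.mk ℂ (Nichols q) (Nichols q)).flip 1 = LinearMap.id :=
    LinearMap.ext fun a => mul_one a
  change (μN ∘ₗ (TensorProduct.mk ℂ (Nichols q) (Nichols q)).flip 1).rTensor _ _ = _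
  rw [e, LinearMap.rTensor_id]
  rfl

variable (g g') in
/-- The Yetter-Drinfeld condition for a generator `x_i`. -/
def IsGenCompat : Prop := ∀ i m, D.coact (opX D.act i m) =
  diagX (A := 𝔑) g μN D.act i (D.coact m) - rightX g' D.X i (D.coact (D.X.ρ (g i) m))

variable [h : IsLinkingDatum σ γ g g']
include h

theorem compatL_one_tmul_gen (h1 : ∀ m, D.act (1 ⊗ₜ m) = m) (i : Fin n) (m : D.X.V) :
    D.compatL ((1 ⊗ₜ gen q i) ⊗ₜ m) = rightX g' D.X i (D.coact (D.X.ρ (g i) m)) := by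
  refine forall_of_weight (D.compatL ∘ₗ TensorProduct.mk ℂ _ _ (1 ⊗ₜ gen q i))
    (rightX g' D.X i ∘ₗ D.coact ∘ₗ D.X.ρ (g i)) (fun ψ m hm => ?_) m
  have e1 := twistL_rightX (g := g) (g' := g') (W := 𝔑) (V := D.X) (a := μN)
    (isHomogeneousAct_mul' σ γ) (fun c d x => mul_assoc c d x) i (D.coact m) 1
  have e2 : opX (V := 𝔑) μN i (1 : Nichols q) = gen q i := mul_one (gen q i)
  have e : μN ∘ₗ (TensorProduct.mk ℂ (Nichols q) (Nichols q)).flip 1 = LinearMap.id :=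
    LinearMap.ext fun a => mul_one a
  rw [twistL_one (W := 𝔑) _ one_mem_weightSpace, e2] at e1
  rw [LinearMap.comp_apply, TensorProduct.mk_apply,
    D.compatL_tmul 1 (gen_mem_weightSpace i) hm, h1, ← e1, LinearMap.comp_apply,
    LinearMap.comp_apply, left_act σ γ g g' hm, map_smul, map_smul]
  change _ • (μN ∘ₗ (TensorProduct.mk ℂ (Nichols q) (Nichols q)).flip 1).rTensor _ _ = _
  rw [e, LinearMap.rTensor_id]
  rfl

theorem tensorActL_gen (h1 : ∀ m, D.act (1 ⊗ₜ m) = m)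
    (h2 : ∀ a b m, D.act ((a * b) ⊗ₜ m) = D.act (a ⊗ₜ D.act (b ⊗ₜ m))) (i : Fin n)
    (z : Nichols q ⊗[ℂ] D.X.V) :
    tensorActL (A := 𝔑) μN D.act (nicholsComul q (gen q i) ⊗ₜ z) =
      diagX (A := 𝔑) g μN D.act i z := by
  have := tensorActL_primMul (g := g) (g' := g') (A := 𝔑) (a := μN) (b := D.act)
    (isHomogeneousAct_mul' σ γ) (fun c d x => mul_assoc c d x) h2 i (1 ⊗ₜ 1) z
  rw [tensorActL_one (A := 𝔑) (fun x => one_mul x) h1] at this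
  rw [← this, ← nicholsComul_one, ← nicholsComul_gen_mul, mul_one]

variable {D} in
/-- The Yetter-Drinfeld condition for `h = x_i`, with `Δ(x_i) = x_i ⊗ 1 + 1 ⊗ x_i` inserted. -/
theorem IsYetterDrinfeld.isGenCompat (hD : D.IsYetterDrinfeld) : D.IsGenCompat g g' := by
  intro i m
  have e := hD.compat (gen q i) m
  rw [D.tensorActL_gen (g := g) (g' := g') hD.one_act hD.mul_act, nicholsComul_gen,
    TensorProduct.add_tmul, map_add, compatL_tmul_one,
    D.compatL_one_tmul_gen (g := g) (g' := g') hD.one_act] at e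
  rw [opX_apply, e, add_sub_cancel_right]

/-- Both sides of the Yetter-Drinfeld condition change by the same operator when `h` is multiplied with
a generator. This is the side `(h₍₁₎ m)₍₋₁₎ h₍₂₎ ⊗ (h₍₁₎ m)₍₀₎`. -/
theorem compatL_primMul (h2 : ∀ a b m, D.act ((a * b) ⊗ₜ m) = D.act (a ⊗ₜ D.act (b ⊗ₜ m)))
    (hD : D.IsGenCompat g g') (i : Fin n) (z : Nichols q ⊗[ℂ] Nichols q) (m : D.X.V) :
    D.compatL (nPrimMul q i z ⊗ₜ m) = diagX (A := 𝔑) g μN D.act i (D.compatL (z ⊗ₜ m)) := by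
  have : D.compatL ∘ₗ (nPrimMul q i).rTensor _ = diagX (A := 𝔑) g μN D.act i ∘ₗ D.compatL :=
    ext₃ (V := 𝔑) (W := 𝔑) fun χ ψ φ c hc d hd m hm => by
      have e1 := twistL_diagX (g := g) (g' := g') (W := 𝔑) (V := D.X) (a := μN) (b := D.act)
        (isHomogeneousAct_mul' σ γ) (fun c d x => mul_assoc c d x) D.act_comm i
        (D.coact (D.act (c ⊗ₜ m))) d
      have e2 := twistL_rightX (g := g) (g' := g') (W := 𝔑) (V := D.X) (a := μN)
        (isHomogeneousAct_mul' σ γ) (fun c d x => mul_assoc c d x) i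
        (D.coact (D.X.ρ (g i) (D.act (c ⊗ₜ m)))) d
      have e3 : D.coact (D.act ((gen q i * c) ⊗ₜ m)) = _ :=
        (congrArg D.coact (h2 (gen q i) c m)).trans (hD i (D.act (c ⊗ₜ m)))
      rw [LinearMap.comp_apply, LinearMap.comp_apply, LinearMap.rTensor_tmul, nPrimMul_tmul,
        TensorProduct.add_tmul, map_add, D.compatL_tmul _ hd hm,
        D.compatL_tmul _ hd hm, D.compatL_tmul _ (mul_mem_weightSpace (gen_mem_weightSpace i) hd)
          hm, map_smul, e3, TensorProduct.sub_tmul, map_sub, e1, e2,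
        ← nicholsAct_left (g := g) g', left_act (r := nicholsAct γ q) σ γ g g' hc,
        left_act σ γ g g' (D.act_mem hc hm), opX_mul', map_mul, map_mul,
        MonoidHom.mul_apply]
      simp only [← TensorProduct.smul_tmul', map_smul, smul_sub, smul_smul, Units.val_mul]
      have e4 : ((σ ψ φ : ℂˣ) : ℂ) * (σ (γ i) χ * σ (γ i) φ) =
        σ (γ i) φ * σ ψ φ * σ (γ i) χ := by ring
      rw [e4, sub_add_cancel]
  exact LinearMap.congr_fun this (z ⊗ₜ m)

/-- By induction on monomials, the Yetter-Drinfeld condition has to be checked on generators only. -/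
theorem compat_of_isGenCompat (h1 : ∀ m, D.act (1 ⊗ₜ m) = m)
    (h2 : ∀ a b m, D.act ((a * b) ⊗ₜ m) = D.act (a ⊗ₜ D.act (b ⊗ₜ m)))
    (hD : D.IsGenCompat g g') (a : Nichols q) (m : D.X.V) :
    tensorActL (A := 𝔑) μN D.act (nicholsComul q a ⊗ₜ D.coact m) =
      D.compatL (nicholsComul q a ⊗ₜ m) := by
  have : ∀ w, tensorActL (A := 𝔑) μN D.act (nicholsComul q (proj q (word w)) ⊗ₜ D.coact m) =
      D.compatL (nicholsComul q (proj q (word w)) ⊗ₜ m) := by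
    intro w
    induction w using FreeMonoid.inductionOn' with
    | one =>
      rw [word_one, map_one, nicholsComul_one, tensorActL_one (A := 𝔑) (fun x => one_mul x) h1,
        compatL_tmul_one, h1]
    | of_mul i w ih =>
      rw [word_of_mul, ← gen_mul_proj, nicholsComul_gen_mul,
        D.compatL_primMul (g := g) (g' := g') h2 hD, ← ih]
      exact tensorActL_primMul (g := g) (g' := g') (A := 𝔑) (a := μN) (b := D.act)
        (isHomogeneousAct_mul' σ γ) (fun c d x => mul_assoc c d x) h2 i _ _
  have e : tensorActL (A := 𝔑) μN D.act ∘ₗ (TensorProduct.mk ℂ _ _).flip (D.coact m) ∘ₗ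
      nicholsComul q = D.compatL ∘ₗ (TensorProduct.mk ℂ _ _).flip m ∘ₗ nicholsComul q :=
    lin_ext this
  exact LinearMap.congr_fun e a

end NicholsDatum

end QuantumGroup
end NicholsData

/-! ### Representations of `U` and Yetter-Drinfeld modules -/

noncomputable section Representations

open NicholsAlgebra WeightModule GradedSpace

variable {C : Type u} [CommRing C] [HopfAlgebra ℂ C] [Coalgebra.IsCocomm ℂ C] {n : ℕ}

namespace QuantumGroup

variable {σ : CharGroup C →* CharGroup C →* ℂˣ} {γ : Fin n → CharGroup C} {g g' : Fin n → C}

local notation "q" => braidingMatrix γ σ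
local notation "𝔑" => nicholsSpace σ γ
local notation "μN" => LinearMap.mul' ℂ (Nichols (braidingMatrix γ σ))
local notation "U" => QuantumGroup σ γ g g'

section

variable [h : IsLinkingDatum σ γ g g']

variable (σ γ g g') in
/-- The homomorphism `𝔅(X) → U` with `x_i ↦ x_i^*`. It exists since the braiding matrices of `X`
and `X^*` coincide. -/
def ofNicholsY : Nichols q →ₐ[ℂ] U :=
  Ideal.Quotient.liftₐ (nicholsIdeal q) (univ σ γ g g').polyY univ_polyY_eq_zero

theorem ofNicholsY_proj (a : TensorAlg n) :
    ofNicholsY σ γ g g' (proj q a) = (univ σ γ g g').polyY a := rfl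

theorem ofNicholsY_gen (i : Fin n) : ofNicholsY σ γ g g' (gen q i) = y σ γ g g' i :=
  (univ σ γ g g').polyY_ι i

theorem ofNichols_gen (i : Fin n) : ofNichols σ γ g g' (gen q i) = x σ γ g g' i := by
  rw [gen, ofNichols_proj, Realization.polyX_ι]; rfl

/-- The commutation of `x_i` with an element of `𝔅(X^*)`. In the right hand side `1 - g'_i g_i` of the
linking relation, the first term produces one skew derivation, and the second term the other. -/
theorem ofNicholsY_mul_x (i : Fin n) (b : Nichols q) :
    ofNicholsY σ γ g g' b * x σ γ g g' i =
      x σ γ g g' i * ofNicholsY σ γ g g' (nBraid q q i b) + ofNicholsY σ γ g g' (nDerivR q i b) -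
      ofC σ γ g g' (g' i) * ofNicholsY σ γ g g' (nDerivL q i b) * ofC σ γ g g' (g i) := by
  obtain ⟨b, rfl⟩ := proj_surjective _ b
  exact (univ σ γ g g').polyY_mul_x i b

/-- The commutation of `x_j^*` with an element of `𝔅(X)`. -/
theorem y_mul_ofNichols (j : Fin n) (a : Nichols q) :
    y σ γ g g' j * ofNichols σ γ g g' a =
      ofNichols σ γ g g' (nBraid q (fun j i => q i j) j a) * y σ γ g g' j +
      ofNichols σ γ g g' (nDerivL q j a) -
      ofC σ γ g g' (g' j) * ofNichols σ γ g g' (nDerivR q j a) * ofC σ γ g g' (g j) := by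
  obtain ⟨a, rfl⟩ := proj_surjective _ a
  rw [nBraid_proj, nDerivL_proj, nDerivR_proj]
  simp only [ofNichols_proj]
  exact (univ σ γ g g').y_mul_polyX j a

end

variable [FiniteDimensional ℂ (Nichols (braidingMatrix γ σ))]

section Slices

variable {V : Type} [AddCommGroup V] [Module ℂ V]

theorem slice_add {A : Type*} [AddCommGroup A] [Module ℂ A] (f f' : A →ₗ[ℂ] ℂ) (z : A ⊗[ℂ] V) :
    slice (f + f') z = slice f z + slice f' z := by
  simp [slice, LinearMap.rTensor_add]

theorem slice_smul {A : Type*} [AddCommGroup A] [Module ℂ A] (r : ℂ) (f : A →ₗ[ℂ] ℂ)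
    (z : A ⊗[ℂ] V) : slice (r • f) z = r • slice f z := by
  simp [slice, LinearMap.rTensor_smul]

theorem slice_zero {A : Type*} [AddCommGroup A] [Module ℂ A] (z : A ⊗[ℂ] V) :
    slice (0 : A →ₗ[ℂ] ℂ) z = 0 := by
  simp [slice, LinearMap.rTensor_zero]

/-- The form is nondegenerate, so an element of `𝔅(X) ⊗ V` is determined by its pairings. -/
theorem eq_of_slice_nForm {z w : Nichols q ⊗[ℂ] V}
    (h : ∀ b, slice (nForm q b) z = slice (nForm q b) w) : z = w :=
  eq_of_slice (nForm q) (fun a ha => eq_zero_of_nForm q a ha) h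

/-- Pairing both factors of the coproduct is pairing with a product: through the form, a coaction of
`𝔅(X)` becomes an action. -/
theorem slice_comul (b b' : Nichols q) (z : Nichols q ⊗[ℂ] V) :
    slice (nForm q b') (slice (nForm q b)
      (TensorProduct.assoc ℂ _ _ _ ((nicholsComul q).rTensor _ z))) =
      slice (nForm q (b' * b)) z := by
  induction z with
  | zero => simp
  | add z w hz hw => simp only [map_add, hz, hw]
  | tmul a v =>
    rw [slice_tmul, nForm_mul, LinearMap.rTensor_tmul]
    generalize nicholsComul q a = t
    induction t with
    | zero => simp
    | add z w hz hw => simp only [map_add, hz, hw, TensorProduct.add_tmul, add_smul]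
    | tmul c d => simp [smul_smul]

theorem slice_lTensor {W : Type} [AddCommGroup W] [Module ℂ W] (f : V →ₗ[ℂ] W) (b : Nichols q)
    (z : Nichols q ⊗[ℂ] V) :
    slice (nForm q b) (f.lTensor _ z) = f (slice (nForm q b) z) := by
  induction z with
  | zero => simp
  | add z w hz hw => simp only [map_add, hz, hw]
  | tmul a v => simp

theorem slice_one (z : Nichols q ⊗[ℂ] V) :
    slice (nForm q 1) z = TensorProduct.lid ℂ V ((nicholsCounit q).rTensor V z) := by
  have e : nForm q 1 = nicholsCounit q := LinearMap.ext (nForm_one q)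
  rw [e]; rfl

theorem slice_map_tmul {W : Type} [AddCommGroup W] [Module ℂ W] {f f' : Nichols q →ₗ[ℂ] Nichols q}
    (k : V →ₗ[ℂ] W) {b : Nichols q} (hf : ∀ a, nForm q b (f a) = nForm q (f' b) a)
    (z : Nichols q ⊗[ℂ] V) :
    slice (nForm q b) (TensorProduct.map f k z) = k (slice (nForm q (f' b)) z) := by
  induction z with
  | zero => simp
  | add z w hz hw => simp only [map_add, hz, hw]
  | tmul a v => simp [hf]

/-- Elements of `𝔅(X)` which pair nontrivially with `b` have the degree of `b`, so that pairing with
`b` turns the diagonal action of `C` into an action shifted by this degree. -/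
theorem slice_diag {V : GradedSpace C} {χ : CharGroup C} {b : Nichols q}
    (hb : b ∈ weightSpace (nicholsAct γ q) χ) (c : C) (z : Nichols q ⊗[ℂ] V.V) :
    slice (nForm q b) (diag (nicholsAct γ q) V.ρ c z) =
      V.ρ (charShift χ c) (slice (nForm q b) z) := by
  have : slice (nForm q b) ∘ₗ diag (nicholsAct γ q) V.ρ c =
      V.ρ (charShift χ c) ∘ₗ slice (nForm q b) :=
    ext₂ (V := 𝔑) fun ψ φ a ha v hv => by
      have e : diag (nicholsAct γ q) V.ρ c (a ⊗ₜ v) = a ⊗ₜ V.ρ (charShift ψ c) v :=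
        smashAct_tmul V.ρ ha c v
      rw [LinearMap.comp_apply, LinearMap.comp_apply, e, slice_tmul, slice_tmul, map_smul]
      by_cases h0 : nForm q b a = 0
      · rw [h0, zero_smul, zero_smul]
      · rw [nForm_eq_zero_of_degree _ hb ha h0]
  exact LinearMap.congr_fun this z

theorem slice_diagX [h : IsLinkingDatum σ γ g g'] {V : GradedSpace C}
    (a : Nichols q ⊗[ℂ] V.V →ₗ[ℂ] V.V) (i : Fin n) (b : Nichols q) (z : Nichols q ⊗[ℂ] V.V) :
    slice (nForm q b) (diagX (A := 𝔑) g μN a i z) =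
      slice (nForm q (nDerivR q i b)) z + opX a i (slice (nForm q (nBraid q q i b)) z) := by
  have e : diagX (A := 𝔑) g μN a i z = TensorProduct.map (LinearMap.mulLeft ℂ (gen q i))
    LinearMap.id z + TensorProduct.map (nBraid q q i) (opX a i) z := by
    rw [← nicholsAct_left (g := g) g']; rfl
  rw [e, map_add, slice_map_tmul (f' := nDerivR q i) _ (nForm_gen_mul_right q i b),
    slice_map_tmul (f' := nBraid q q i) _ fun a => (nForm_nBraid q q i b a).symm]
  rfl

theorem slice_rightX {V : GradedSpace C} (i : Fin n) (b : Nichols q) (z : Nichols q ⊗[ℂ] V.V) :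
    slice (nForm q b) (rightX g' V i z) = V.ρ (g' i) (slice (nForm q (nDerivL q i b)) z) :=
  slice_map_tmul (f' := nDerivL q i) _ (fun a => nForm_mul_gen_right q i b a) z

end Slices

namespace NicholsDatum

variable [h : IsLinkingDatum σ γ g g'] (D : NicholsDatum σ γ)

/-- A representation of `U` corresponds to an action and a coaction of the Nichols algebra if
`𝔅(X)` acts in the given way and if the action of `𝔅(X^*)` arises from the coaction through the
bilinear form of the Nichols algebra. -/
structure IsRepOf (r : U →ₐ[ℂ] Module.End ℂ D.X.V) : Prop where
  ofC : ∀ c m, r (ofC σ γ g g' c) m = D.X.ρ c m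
  act : ∀ a m, D.act (a ⊗ₜ m) = r (ofNichols σ γ g g' a) m
  coact : ∀ b m, slice (nForm q b) (D.coact m) = r (ofNicholsY σ γ g g' b) m

variable {D}

theorem IsRepOf.x {r : U →ₐ[ℂ] Module.End ℂ D.X.V} (hr : D.IsRepOf r) (i : Fin n) (m : D.X.V) :
    r (x σ γ g g' i) m = opX D.act i m := by
  rw [opX_apply, hr.act, ofNichols_gen]

theorem IsRepOf.y {r : U →ₐ[ℂ] Module.End ℂ D.X.V} (hr : D.IsRepOf r) (i : Fin n) (m : D.X.V) :
    r (y σ γ g g' i) m = slice (nForm q (gen q i)) (D.coact m) := by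
  rw [hr.coact, ofNicholsY_gen]

/-- Paired with `b`, the Yetter-Drinfeld condition for `x_i` is the commutation relation of `x_i` with
the element `b` of `𝔅(X^*)`. -/
theorem IsRepOf.isGenCompat {r : U →ₐ[ℂ] Module.End ℂ D.X.V} (hr : D.IsRepOf r) :
    D.IsGenCompat g g' := fun i m => eq_of_slice_nForm fun b => by
  rw [map_sub, slice_diagX (g := g) (g' := g'), slice_rightX, hr.coact, hr.coact, hr.coact,
    hr.coact, ← hr.x, ← hr.x, ← hr.ofC, ← hr.ofC, ← Module.End.mul_apply, ← map_mul,
    ofNicholsY_mul_x]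
  simp only [map_add, map_sub, map_mul, LinearMap.add_apply, LinearMap.sub_apply,
    Module.End.mul_apply]
  abel

/-- An action and a coaction which come from a representation of `U` form a Yetter-Drinfeld
module. -/
theorem IsRepOf.isYetterDrinfeld {r : U →ₐ[ℂ] Module.End ℂ D.X.V} (hr : D.IsRepOf r) :
    D.IsYetterDrinfeld := by
  have h1 : ∀ m, D.act (1 ⊗ₜ m) = m := fun m => by rw [hr.act, map_one, map_one]; rfl
  have h2 : ∀ a b m, D.act ((a * b) ⊗ₜ m) = D.act (a ⊗ₜ D.act (b ⊗ₜ m)) := fun a b m => by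
    rw [hr.act, hr.act, hr.act, map_mul, map_mul]; rfl
  refine ⟨h1, h2, fun m => ?_, fun m => ?_, D.compat_of_isGenCompat h1 h2 hr.isGenCompat⟩
  · have e := hr.coact 1 m
    rw [slice_one, map_one, map_one] at e
    apply (TensorProduct.lid ℂ D.X.V).injective
    rw [e, TensorProduct.lid_tmul, one_smul]; rfl
  · refine eq_of_slice_nForm fun b => eq_of_slice_nForm fun b' => ?_
    rw [slice_comul, slice_lTensor, hr.coact, hr.coact, hr.coact, map_mul, map_mul]; rfl

theorem IsYetterDrinfeld.slice_mul (hD : D.IsYetterDrinfeld) (b b' : Nichols q) (m : D.X.V) :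
    slice (nForm q (b' * b)) (D.coact m) =
      slice (nForm q b') (D.coact (slice (nForm q b) (D.coact m))) := by
  rw [← slice_comul, hD.coact_comul, slice_lTensor]

theorem IsYetterDrinfeld.slice_one (hD : D.IsYetterDrinfeld) (m : D.X.V) :
    slice (nForm q 1) (D.coact m) = m := by
  rw [QuantumGroup.slice_one, hD.coact_counit, TensorProduct.lid_tmul, one_smul]

/-- The action of the generators of `U` on a Yetter-Drinfeld module. -/
def IsYetterDrinfeld.realization (hD : D.IsYetterDrinfeld) :
    Realization σ γ g g' (Module.End ℂ D.X.V) where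
  ofC := D.X.ρ
  x i := opX D.act i
  y i := slice (nForm q (gen q i)) ∘ₗ D.coact
  commX c i := LinearMap.ext fun m => by
    have e : diag (nicholsAct γ q) D.X.ρ c (gen q i ⊗ₜ m) = gen q i ⊗ₜ D.X.ρ (charShift (γ i) c) m :=
      smashAct_tmul D.X.ρ (gen_mem_weightSpace i) c m
    rw [Module.End.mul_apply, Module.End.mul_apply, opX_apply, opX_apply, ← e, D.act_comm]
  commY c i := LinearMap.ext fun m => by
    rw [Module.End.mul_apply, Module.End.mul_apply, LinearMap.comp_apply, LinearMap.comp_apply,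
      D.coact_comm, slice_diag (gen_mem_weightSpace i), charShift_charShift, mul_inv_cancel,
      charShift_one]
  link i j := LinearMap.ext fun m => by
    have e := congrArg (slice (nForm q (gen q j))) (hD.isGenCompat (g := g) (g' := g') i m)
    have e1 : nDerivR q i (gen q j) = if j = i then 1 else 0 := by
      rw [← mul_one (gen q j), nDerivR_gen_mul]; simp
    have e2 : nDerivL q i (gen q j) = if j = i then 1 else 0 := by
      rw [← mul_one (gen q j), nDerivL_gen_mul]; simp
    rw [map_sub, slice_diagX (g := g) (g' := g'), slice_rightX, nBraid_gen, e1, e2, map_smul,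
      slice_smul, map_smul] at e
    change slice (nForm q (gen q j)) (D.coact (opX D.act i m)) -
      q i j • opX D.act i (slice (nForm q (gen q j)) (D.coact m)) = _
    rw [e]
    by_cases hij : i = j
    · subst hij
      simp only [if_true, hD.slice_one, LinearMap.sub_apply, map_mul, Module.End.mul_apply,
        Module.End.one_apply]
      abel
    · rw [if_neg hij, if_neg (Ne.symm hij), map_zero, slice_zero, slice_zero, map_zero, zero_add,
        sub_zero, sub_self]
      rfl

theorem IsYetterDrinfeld.polyX (hD : D.IsYetterDrinfeld) (a : TensorAlg n) (m : D.X.V) :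
    (hD.realization (g := g) (g' := g')).polyX a m = D.act (proj q a ⊗ₜ m) := by
  induction a using FreeAlgebra.induction generalizing m with
  | grade0 r =>
    rw [AlgHomClass.commutes, AlgHomClass.commutes, Algebra.algebraMap_eq_smul_one (A := Nichols q),
      ← TensorProduct.smul_tmul', map_smul, hD.one_act]; rfl
  | grade1 i => rw [Realization.polyX_ι]; rfl
  | mul a b ha hb => rw [map_mul, Module.End.mul_apply, hb, ha, map_mul, hD.mul_act]
  | add a b ha hb => rw [map_add, LinearMap.add_apply, ha, hb, map_add, TensorProduct.add_tmul,
      map_add]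

theorem IsYetterDrinfeld.polyY (hD : D.IsYetterDrinfeld) (a : TensorAlg n) (m : D.X.V) :
    (hD.realization (g := g) (g' := g')).polyY a m = slice (nForm q (proj q a)) (D.coact m) := by
  induction a using FreeAlgebra.induction generalizing m with
  | grade0 r =>
    rw [AlgHomClass.commutes, AlgHomClass.commutes, Algebra.algebraMap_eq_smul_one (A := Nichols q),
      map_smul, slice_smul, hD.slice_one]; rfl
  | grade1 i => rw [Realization.polyY_ι]; rfl
  | mul a b ha hb => rw [map_mul, Module.End.mul_apply, hb, ha, map_mul, hD.slice_mul]
  | add a b ha hb =>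
    rw [map_add, LinearMap.add_apply, ha, hb, map_add, map_add, slice_add]

/-- The representation of `U` on a Yetter-Drinfeld module. -/
def IsYetterDrinfeld.rep (hD : D.IsYetterDrinfeld) : U →ₐ[ℂ] Module.End ℂ D.X.V :=
  hD.realization.lift
    (fun a ha => LinearMap.ext fun m => by
      rw [hD.polyX, (proj_eq_zero q).2 ha, TensorProduct.zero_tmul, map_zero]; rfl)
    (fun a ha => LinearMap.ext fun m => by
      rw [hD.polyY, (proj_eq_zero q).2 ha, map_zero, slice_zero]; rfl)

theorem IsYetterDrinfeld.isRepOf (hD : D.IsYetterDrinfeld) :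
    D.IsRepOf (hD.rep (g := g) (g' := g')) where
  ofC c m := by rw [rep, Realization.lift_ofC]; rfl
  act a m := by
    obtain ⟨a, rfl⟩ := proj_surjective _ a
    rw [ofNichols_proj, rep, lift_polyX, hD.polyX]
  coact a m := by
    obtain ⟨a, rfl⟩ := proj_surjective _ a
    rw [ofNicholsY_proj, rep, lift_polyY, hD.polyY]

/-- The representation of `U` is determined by the action and the coaction. -/
theorem IsRepOf.unique {r r' : U →ₐ[ℂ] Module.End ℂ D.X.V} (hr : D.IsRepOf r) (hr' : D.IsRepOf r') :
    r = r' :=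
  algHom_ext (fun c => LinearMap.ext fun m => by rw [hr.ofC, hr'.ofC])
    (fun i => LinearMap.ext fun m => by rw [hr.x, hr'.x])
    fun i => LinearMap.ext fun m => by rw [hr.y, hr'.y]

end NicholsDatum

end QuantumGroup
end Representations

/-! ### Tensor products, the unit, and the coaction of a representation -/

noncomputable section Constructions

open NicholsAlgebra WeightModule GradedSpace

variable {C : Type u} [CommRing C] [HopfAlgebra ℂ C] [Coalgebra.IsCocomm ℂ C] {n : ℕ}

namespace QuantumGroup

variable {σ : CharGroup C →* CharGroup C →* ℂˣ} {γ : Fin n → CharGroup C} {g g' : Fin n → C}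
variable [FiniteDimensional ℂ (Nichols (braidingMatrix γ σ))]

local notation "q" => braidingMatrix γ σ
local notation "𝔑" => nicholsSpace σ γ
local notation "μN" => LinearMap.mul' ℂ (Nichols (braidingMatrix γ σ))
local notation "U" => QuantumGroup σ γ g g'

theorem nDerivL_mem (j : Fin n) {χ : CharGroup C} {a : Nichols q}
    (ha : a ∈ weightSpace (nicholsAct γ q) χ) :
    nDerivL q j a ∈ weightSpace (nicholsAct γ q) ((γ j)⁻¹ * χ) := fun c => by
  have : nicholsAct γ q c ∘ₗ nDerivL q j =
      nDerivL q j ∘ₗ nicholsAct γ q (charShift (γ j)⁻¹ c) := lin_ext fun w => by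
    rw [LinearMap.comp_apply, LinearMap.comp_apply, nicholsAct_word, map_smul, char_charShift]
    exact nDerivL_mem_weightSpace j w c
  have e := LinearMap.congr_fun this a
  rw [LinearMap.comp_apply, LinearMap.comp_apply, ha, char_charShift, map_smul] at e
  exact e

theorem nicholsCounit_mul (a b : Nichols q) :
    nicholsCounit q (a * b) = nicholsCounit q a * nicholsCounit q b := by
  obtain ⟨a, rfl⟩ := proj_surjective _ a
  obtain ⟨b, rfl⟩ := proj_surjective _ b
  rw [← map_mul, nicholsCounit_proj, nicholsCounit_proj, nicholsCounit_proj, map_mul]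

section Mul

/-- The product of the Nichols algebra on `(𝔅(X) ⊗ V) ⊗ (𝔅(X) ⊗ W)`, where tensor factors are
exchanged with the braiding. -/
def mulExchange (V W : GradedSpace C) : (Nichols q ⊗[ℂ] V.V) ⊗[ℂ] (Nichols q ⊗[ℂ] W.V) →ₗ[ℂ]
    Nichols q ⊗[ℂ] (V.V ⊗[ℂ] W.V) :=
  (μN).rTensor (V.V ⊗[ℂ] W.V) ∘ₗ exchange (braid σ V 𝔑)

variable {V W : GradedSpace C}

theorem mulExchange_tmul {χ ψ : CharGroup C} (a : Nichols q) {v : V.V} {c : Nichols q} (w : W.V)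
    (hv : v ∈ weightSpace V.ρ χ) (hc : c ∈ weightSpace (nicholsAct γ q) ψ) :
    mulExchange V W ((a ⊗ₜ v) ⊗ₜ (c ⊗ₜ w)) =
      ((σ χ ψ : ℂˣ) : ℂ) • ((a * c) ⊗ₜ (v ⊗ₜ w)) := by
  rw [mulExchange, LinearMap.comp_apply, exchange_tmul a w (braid_tmul (W := 𝔑) hv hc), map_smul]
  rfl

theorem slice_one_mulExchange (x : Nichols q ⊗[ℂ] V.V) (y : Nichols q ⊗[ℂ] W.V) :
    slice (nForm q 1) (mulExchange V W (x ⊗ₜ y)) =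
      slice (nForm q 1) x ⊗ₜ slice (nForm q 1) y := by
  have : slice (nForm q 1) ∘ₗ mulExchange V W =
      TensorProduct.map (slice (nForm q 1)) (slice (nForm q 1)) :=
    ext₄ (V := 𝔑) (X := 𝔑) fun χ ψ φ η a ha v hv c hc w hw => by
      rw [LinearMap.comp_apply, mulExchange_tmul a w hv hc, map_smul, slice_tmul,
        TensorProduct.map_tmul, slice_tmul, slice_tmul]
      have hm : nForm q 1 (a * c) = nForm q 1 a * nForm q 1 c := by
        rw [nForm_one, nForm_one, nForm_one]; exact nicholsCounit_mul a c
      rw [hm, TensorProduct.smul_tmul_smul]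
      by_cases h0 : nForm q 1 c = 0
      · rw [h0, mul_zero, zero_smul, smul_zero]
      · rw [← nForm_eq_zero_of_degree q one_mem_weightSpace hc h0, map_one, Units.val_one, one_smul]
  exact LinearMap.congr_fun this (x ⊗ₜ y)

/-- The Leibniz rule for the left skew derivations, for the product twisted by the braiding; it matches
`Δ(x_j^*) = g'_j ⊗ x_j^* + x_j^* ⊗ 1`. -/
theorem nDerivL_mulExchange [h : IsLinkingDatum σ γ g g'] (j : Fin n) (x : Nichols q ⊗[ℂ] V.V)
    (y : Nichols q ⊗[ℂ] W.V) :
    (nDerivL q j).rTensor _ (mulExchange V W (x ⊗ₜ y)) =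
      mulExchange V W ((nDerivL q j).rTensor _ x ⊗ₜ y) +
      mulExchange V W (diag (nicholsAct γ q) V.ρ (g' j) x ⊗ₜ (nDerivL q j).rTensor _ y) := by
  have : (nDerivL q j).rTensor _ ∘ₗ mulExchange V W =
      mulExchange V W ∘ₗ TensorProduct.map ((nDerivL q j).rTensor _) LinearMap.id +
      mulExchange V W ∘ₗ TensorProduct.map (diag (nicholsAct γ q) V.ρ (g' j))
        ((nDerivL q j).rTensor _) :=
    ext₄ (V := 𝔑) (X := 𝔑) fun χ ψ φ η a ha v hv c hc w hw => by
      rw [LinearMap.comp_apply, mulExchange_tmul a w hv hc, map_smul, LinearMap.rTensor_tmul,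
        nDerivL_mul, LinearMap.add_apply, LinearMap.comp_apply, LinearMap.comp_apply,
        TensorProduct.map_tmul, TensorProduct.map_tmul, LinearMap.rTensor_tmul,
        LinearMap.rTensor_tmul, LinearMap.id_apply, mulExchange_tmul _ w hv hc,
        right_act σ γ g g' (GradedSpace.tmul_mem_weightSpace ha hv), ← TensorProduct.smul_tmul',
        map_smul, mulExchange_tmul _ w hv (nDerivL_mem j hc), ← nicholsAct_right (g' := g') g,
        right_act σ γ g g' ha, TensorProduct.add_tmul, smul_add, smul_mul_assoc,
        ← TensorProduct.smul_tmul', smul_smul, smul_smul]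
      congr 2
      rw [map_mul, map_mul, map_inv, MonoidHom.mul_apply]
      push_cast
      field_simp
  exact LinearMap.congr_fun this (x ⊗ₜ y)

end Mul

/-- The map `𝔅(X) ⊗ V → Hom(𝔅(X), V)` given by the bilinear form of the Nichols algebra. -/
def sliceHom (V : Type) [AddCommGroup V] [Module ℂ V] :
    Nichols q ⊗[ℂ] V →ₗ[ℂ] Nichols q →ₗ[ℂ] V :=
  LinearMap.flip
    { toFun := fun b => slice (nForm q b)
      map_add' := fun b b' => LinearMap.ext fun z => by rw [map_add, slice_add]; rfl
      map_smul' := fun r b => LinearMap.ext fun z => by rw [map_smul, slice_smul]; rfl }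

theorem sliceHom_apply {V : Type} [AddCommGroup V] [Module ℂ V] (z : Nichols q ⊗[ℂ] V)
    (b : Nichols q) : sliceHom V z b = slice (nForm q b) z := rfl

/-- The tensor product of graded vector spaces. -/
abbrev tensorSpace (V W : GradedSpace C) : GradedSpace C :=
  { V := V.V ⊗[ℂ] W.V
    ρ := diag V.ρ W.ρ
    iSup_weightSpace := iSup_weightSpace_diag V.iSup_weightSpace W.iSup_weightSpace }

namespace NicholsDatum

section Tensor

variable (D E : NicholsDatum σ γ)

/-- The action of the Nichols algebra as a morphism of graded vector spaces. -/
def actHom : nicholsMod γ σ ⊗ D.X ⟶ D.X := ⟨D.act, D.act_comm⟩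

/-- The coaction of the Nichols algebra as a morphism of graded vector spaces. -/
def coactHom : D.X ⟶ nicholsMod γ σ ⊗ D.X := ⟨D.coact, D.coact_comm⟩

/-- The tensor product with the diagonal action and the codiagonal coaction. -/
@[reducible]
def tensor : NicholsDatum σ γ where
  X := tensorSpace D.X E.X
  act := tensorActL D.act E.act ∘ₗ (nicholsComul q).rTensor _
  coact := mulExchange D.X E.X ∘ₗ TensorProduct.map D.coact E.coact
  act_comm c z := WeightModule.comm (j := BialgHom.id ℂ C)
    (ActCoact.tensorAct (D := VectGraded σ) (H := nicholsObj γ σ) D.actHom E.actHom) c z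
  coact_comm c z := WeightModule.comm (j := BialgHom.id ℂ C)
    (ActCoact.tensorCoact (D := VectGraded σ) (H := nicholsObj γ σ) D.coactHom E.coactHom) c z

theorem tensor_coact_tmul (v : D.X.V) (w : E.X.V) :
    (D.tensor E).coact (v ⊗ₜ w) = mulExchange D.X E.X (D.coact v ⊗ₜ E.coact w) := rfl

end Tensor

variable {D E : NicholsDatum σ γ}
variable [h : IsLinkingDatum σ γ g g']

theorem diag_ofC {V W : Type} [AddCommGroup V] [Module ℂ V] [AddCommGroup W] [Module ℂ W]
    (r : U →ₐ[ℂ] Module.End ℂ V) (s : U →ₐ[ℂ] Module.End ℂ W) (c : C) :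
    diag r s (ofC σ γ g g' c) = diag (r.comp (ofC σ γ g g')) (s.comp (ofC σ γ g g')) c := by
  have e : Coalgebra.comul (R := ℂ) (ofC σ γ g g' c) = _ := comulU_ofC (σ := σ) (γ := γ) (g := g) (g' := g') c
  rw [diag_apply, diag_apply, e]
  generalize Coalgebra.comul (R := ℂ) c = t
  induction t with
  | zero => simp
  | add t t' ht ht' => simp only [map_add, ht, ht']
  | tmul a b => rfl

theorem diag_x {V W : Type} [AddCommGroup V] [Module ℂ V] [AddCommGroup W] [Module ℂ W]
    (r : U →ₐ[ℂ] Module.End ℂ V) (s : U →ₐ[ℂ] Module.End ℂ W) (i : Fin n) (v : V) (w : W) :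
    diag r s (x σ γ g g' i) (v ⊗ₜ w) =
      r (ofC σ γ g g' (g i)) v ⊗ₜ s (x σ γ g g' i) w + r (x σ γ g g' i) v ⊗ₜ w := by
  have e : Coalgebra.comul (R := ℂ) (x σ γ g g' i) = _ := comulU_x (σ := σ) (γ := γ) (g := g) (g' := g') i
  rw [diag_apply, e, map_add, LinearMap.add_apply, tensorEnd_tmul, tensorEnd_tmul, map_one]
  rfl

theorem diag_y {V W : Type} [AddCommGroup V] [Module ℂ V] [AddCommGroup W] [Module ℂ W]
    (r : U →ₐ[ℂ] Module.End ℂ V) (s : U →ₐ[ℂ] Module.End ℂ W) (i : Fin n) (v : V) (w : W) :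
    diag r s (y σ γ g g' i) (v ⊗ₜ w) =
      r (ofC σ γ g g' (g' i)) v ⊗ₜ s (y σ γ g g' i) w + r (y σ γ g g' i) v ⊗ₜ w := by
  have e : Coalgebra.comul (R := ℂ) (y σ γ g g' i) = _ := comulU_y (σ := σ) (γ := γ) (g := g) (g' := g') i
  rw [diag_apply, e, map_add, LinearMap.add_apply, tensorEnd_tmul, tensorEnd_tmul, map_one]
  rfl

theorem IsRepOf.comp_ofC {r : U →ₐ[ℂ] Module.End ℂ D.X.V} (hr : D.IsRepOf r) :
    r.comp (QuantumGroup.ofC σ γ g g') = D.X.ρ :=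
  AlgHom.ext fun c => LinearMap.ext fun m => hr.ofC c m

/-- The left skew derivations are adjoint to right multiplication with a generator, so on the coaction
they are the action of `x_j^*`. -/
theorem IsRepOf.nDerivL_coact {r : U →ₐ[ℂ] Module.End ℂ D.X.V} (hr : D.IsRepOf r) (j : Fin n)
    (m : D.X.V) : (nDerivL q j).rTensor _ (D.coact m) = D.coact (r (QuantumGroup.y σ γ g g' j) m) :=
  eq_of_slice_nForm fun b => by
    have e := slice_map_tmul (LinearMap.id (M := D.X.V)) (f' := LinearMap.mulRight ℂ (gen q j))
      (fun a => (nForm_mul_gen q j b a).symm) (D.coact m)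
    refine e.trans ?_
    rw [hr.coact, LinearMap.mulRight_apply, hr.coact, map_mul, map_mul, ofNicholsY_gen]
    rfl

/-- The analogue of `nDerivL_coact` for the codiagonal coaction. -/
theorem IsRepOf.nDerivL_tensor {r : U →ₐ[ℂ] Module.End ℂ D.X.V} {s : U →ₐ[ℂ] Module.End ℂ E.X.V}
    (hr : D.IsRepOf r) (hs : E.IsRepOf s) (j : Fin n) (z : D.X.V ⊗[ℂ] E.X.V) :
    (nDerivL q j).rTensor _ ((D.tensor E).coact z) =
      (D.tensor E).coact (diag r s (QuantumGroup.y σ γ g g' j) z) := by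
  induction z with
  | zero => simp
  | add z w hz hw => simp only [map_add, hz, hw]
  | tmul v w =>
    rw [diag_y, map_add, tensor_coact_tmul, tensor_coact_tmul, tensor_coact_tmul,
      nDerivL_mulExchange (g := g) (g' := g'), hr.nDerivL_coact, hs.nDerivL_coact, ← D.coact_comm,
      hr.ofC, add_comm]

/-- The tensor product of representations of `U` corresponds to the diagonal action and the
codiagonal coaction. -/
theorem IsRepOf.tensor {r : U →ₐ[ℂ] Module.End ℂ D.X.V} {s : U →ₐ[ℂ] Module.End ℂ E.X.V}
    (hr : D.IsRepOf r) (hs : E.IsRepOf s) : (D.tensor E).IsRepOf (diag r s) where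
  ofC c z := by rw [diag_ofC, hr.comp_ofC, hs.comp_ofC]
  act a z := by
    have hx : ∀ i, diag r s (QuantumGroup.x σ γ g g' i) = diagX g D.act E.act i := fun i =>
      TensorProduct.ext' fun v w => by
        rw [diag_x, diagX_tmul, hr.x, hs.x, hr.ofC, add_comm]
    have : ∀ w, (D.tensor E).act (proj q (word w) ⊗ₜ z) =
        diag r s (ofNichols σ γ g g' (proj q (word w))) z := by
      intro w
      change tensorActL D.act E.act (nicholsComul q (proj q (word w)) ⊗ₜ z) = _
      induction w using FreeMonoid.inductionOn' with
      | one =>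
        rw [word_one, map_one, nicholsComul_one,
          tensorActL_one hr.isYetterDrinfeld.one_act hs.isYetterDrinfeld.one_act, map_one, map_one]
        rfl
      | of_mul i w ih =>
        rw [word_of_mul, ← gen_mul_proj, nicholsComul_gen_mul,
          tensorActL_primMul (g := g) (g' := g') D.act_comm hr.isYetterDrinfeld.mul_act
            hs.isYetterDrinfeld.mul_act, ih, map_mul, map_mul, ofNichols_gen, hx]
        rfl
    have e : (D.tensor E).act ∘ₗ (TensorProduct.mk ℂ _ _).flip z =
        LinearMap.applyₗ z ∘ₗ (diag r s).toLinearMap ∘ₗ (ofNichols σ γ g g').toLinearMap :=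
      lin_ext this
    exact LinearMap.congr_fun e a
  coact b z := by
    have h1 : ∀ z : D.X.V ⊗[ℂ] E.X.V, slice (nForm q 1) ((D.tensor E).coact z) = z := fun z => by
      induction z with
      | zero => simp
      | add z w hz hw => rw [map_add, map_add, hz, hw]
      | tmul v w =>
        rw [tensor_coact_tmul, slice_one_mulExchange, hr.isYetterDrinfeld.slice_one,
          hs.isYetterDrinfeld.slice_one]
    have h2 : ∀ j b z, slice (nForm q (b * gen q j)) ((D.tensor E).coact z) =
        slice (nForm q b) ((D.tensor E).coact (diag r s (QuantumGroup.y σ γ g g' j) z)) :=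
      fun j b z => by
        rw [← hr.nDerivL_tensor hs]
        exact (slice_map_tmul LinearMap.id (f' := LinearMap.mulRight ℂ (gen q j))
          (fun a => (nForm_mul_gen q j b a).symm) ((D.tensor E).coact z)).symm
    have h3 : ∀ w b z, slice (nForm q (b * proj q (word w))) ((D.tensor E).coact z) =
        slice (nForm q b) ((D.tensor E).coact
          (diag r s (ofNicholsY σ γ g g' (proj q (word w))) z)) := by
      intro w
      induction w using FreeMonoid.inductionOn' with
      | one => intro b z; rw [word_one, map_one, map_one, map_one, mul_one]; rfl
      | of_mul i w ih =>
        intro b z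
        rw [word_of_mul, ← gen_mul_proj, ← mul_assoc, ih, h2, map_mul, map_mul, ofNicholsY_gen]
        rfl
    have h4 : ∀ w, slice (nForm q (proj q (word w))) ((D.tensor E).coact z) =
        diag r s (ofNicholsY σ γ g g' (proj q (word w))) z := fun w => by
      rw [← one_mul (proj q (word w)), h3, h1, one_mul]
    have e : sliceHom _ ((D.tensor E).coact z) =
        LinearMap.applyₗ z ∘ₗ (diag r s).toLinearMap ∘ₗ (ofNicholsY σ γ g g').toLinearMap :=
      lin_ext h4
    exact LinearMap.congr_fun e b

section Unit

variable (σ γ) in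
/-- The trivial one-dimensional graded vector space. -/
abbrev unitSpace (_ : CharGroup C →* CharGroup C →* ℂˣ) (_ : Fin n → CharGroup C) : GradedSpace C :=
  { V := ℂ
    ρ := triv C
    iSup_weightSpace := iSup_weightSpace_triv (BialgHom.id ℂ C) }

variable (σ γ) in
/-- The trivial action and coaction on the unit object. -/
@[reducible]
def unit : NicholsDatum σ γ where
  X := unitSpace σ γ
  act := nicholsCounit q ∘ₗ (TensorProduct.rid ℂ (Nichols q)).toLinearMap
  coact := (TensorProduct.rid ℂ (Nichols q)).symm.toLinearMap ∘ₗ Algebra.linearMap ℂ (Nichols q)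
  act_comm c z := WeightModule.comm (j := BialgHom.id ℂ C)
    (ActCoact.unitAct (D := VectGraded σ) (nicholsObj γ σ)) c z
  coact_comm c z := WeightModule.comm (j := BialgHom.id ℂ C)
    (ActCoact.unitCoact (D := VectGraded σ) (nicholsObj γ σ)) c z

theorem counit_ofNichols (a : Nichols q) :
    Coalgebra.counit (R := ℂ) (ofNichols σ γ g g' a) = nicholsCounit q a := by
  have : (Bialgebra.counitAlgHom ℂ U).toLinearMap ∘ₗ (ofNichols σ γ g g').toLinearMap =
      nicholsCounit q := nichols_ext_gen (by simp) fun i w _ => by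
    have e : Coalgebra.counit (R := ℂ) (QuantumGroup.x σ γ g g' i) = 0 := counitU_x i
    simp [ofNichols_gen, nicholsCounit_gen_mul, e]
  exact LinearMap.congr_fun this a

theorem counit_ofNicholsY (a : Nichols q) :
    Coalgebra.counit (R := ℂ) (ofNicholsY σ γ g g' a) = nicholsCounit q a := by
  have : (Bialgebra.counitAlgHom ℂ U).toLinearMap ∘ₗ (ofNicholsY σ γ g g').toLinearMap =
      nicholsCounit q := nichols_ext_gen (by simp) fun i w _ => by
    have e : Coalgebra.counit (R := ℂ) (QuantumGroup.y σ γ g g' i) = 0 := counitU_y i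
    simp [ofNicholsY_gen, nicholsCounit_gen_mul, e]
  exact LinearMap.congr_fun this a

variable (σ γ) in
theorem isRepOf_unit : (unit σ γ).IsRepOf (triv U) where
  ofC c z := by
    have e : Coalgebra.counit (R := ℂ) (QuantumGroup.ofC σ γ g g' c) = _ := counitU_ofC c
    rw [triv_apply, e]; rfl
  act a z := by
    rw [triv_apply, counit_ofNichols]
    change nicholsCounit q (z • a) = _
    rw [map_smul, smul_eq_mul, mul_comm]
  coact b z := by
    rw [triv_apply, counit_ofNicholsY]
    change slice (nForm q b) (algebraMap ℂ (Nichols q) z ⊗ₜ[ℂ] (1 : ℂ)) = _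
    rw [slice_tmul, Algebra.algebraMap_eq_smul_one, map_smul, nForm_symm, nForm_one, smul_eq_mul,
      smul_eq_mul, mul_one, mul_comm]

end Unit

end NicholsDatum

/-- The bilinear form identifies `𝔅(X) ⊗ V` with `Hom(𝔅(X), V)`. -/
def sliceEquiv (V : Type) [AddCommGroup V] [Module ℂ V] [FiniteDimensional ℂ V] :
    Nichols q ⊗[ℂ] V ≃ₗ[ℂ] Nichols q →ₗ[ℂ] V :=
  LinearEquiv.ofInjectiveOfFinrankEq (sliceHom V)
    (fun z w h => eq_of_slice_nForm fun b => LinearMap.congr_fun h b)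
    (by rw [Module.finrank_tensorProduct, Module.finrank_linearMap])

theorem slice_sliceEquiv_symm {V : Type} [AddCommGroup V] [Module ℂ V] [FiniteDimensional ℂ V]
    (f : Nichols q →ₗ[ℂ] V) (b : Nichols q) :
    slice (nForm q b) ((sliceEquiv V).symm f) = f b :=
  LinearMap.congr_fun ((sliceEquiv V).apply_symm_apply f) b

namespace NicholsDatum

variable [h : IsLinkingDatum σ γ g g']

theorem charWord_inv (w : FreeMonoid (Fin n)) :
    charWord (fun i => (γ i)⁻¹) w = (charWord γ w)⁻¹ := by
  induction w using FreeMonoid.inductionOn' with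
  | one => simp
  | of_mul i w ih => rw [map_mul, map_mul, ih, mul_inv]; simp [charWord]

/-- The action and the coaction of the Nichols algebra on a representation of `U`. -/
@[reducible]
def ofRep (V : GradedSpace C) (r : U →ₐ[ℂ] Module.End ℂ V.V)
    (hr : ∀ c, r (ofC σ γ g g' c) = V.ρ c) : NicholsDatum σ γ where
  X := V
  act := TensorProduct.lift (r.toLinearMap ∘ₗ (ofNichols σ γ g g').toLinearMap)
  coact := (sliceEquiv V.V).symm.toLinearMap ∘ₗ
    (r.toLinearMap ∘ₗ (ofNicholsY σ γ g g').toLinearMap).flip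
  act_comm c z := by
    have : TensorProduct.lift (r.toLinearMap ∘ₗ (ofNichols σ γ g g').toLinearMap) ∘ₗ
        diag (nicholsAct γ q) V.ρ c = V.ρ c ∘ₗ
        TensorProduct.lift (r.toLinearMap ∘ₗ (ofNichols σ γ g g').toLinearMap) :=
      smash_ext fun w m => by
        have e : diag (nicholsAct γ q) V.ρ c (proj q (word w) ⊗ₜ m) =
          proj q (word w) ⊗ₜ V.ρ (charShift (charWord γ w) c) m :=
          smashAct_tmul V.ρ (proj_word_mem_weightSpace w) c m
        rw [LinearMap.comp_apply, LinearMap.comp_apply, e, TensorProduct.lift.tmul,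
          TensorProduct.lift.tmul, ← hr, ← hr]
        simp only [LinearMap.comp_apply, AlgHom.toLinearMap_apply]
        rw [← Module.End.mul_apply, ← Module.End.mul_apply, ← map_mul, ← map_mul, ofNichols_proj,
          ofC_mul_polyX]
    exact LinearMap.congr_fun this z
  coact_comm c m := by
    apply (sliceEquiv V.V).injective
    refine lin_ext fun w => ?_
    change slice _ _ = slice _ _
    rw [slice_diag (proj_word_mem_weightSpace w), LinearMap.comp_apply, LinearMap.comp_apply,
      LinearEquiv.coe_coe, slice_sliceEquiv_symm, slice_sliceEquiv_symm, ← hr, ← hr]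
    simp only [LinearMap.comp_apply, AlgHom.toLinearMap_apply, LinearMap.flip_apply]
    rw [← Module.End.mul_apply, ← Module.End.mul_apply, ← map_mul, ← map_mul, ofNicholsY_proj,
      ofC_mul_polyY, charShift_charShift, charWord_inv, inv_mul_cancel, charShift_one]

theorem isRepOf_ofRep (V : GradedSpace C) (r : U →ₐ[ℂ] Module.End ℂ V.V)
    (hr : ∀ c, r (ofC σ γ g g' c) = V.ρ c) : (ofRep V r hr).IsRepOf r where
  ofC c m := by rw [hr]
  act a m := rfl
  coact b m := slice_sliceEquiv_symm _ b

section Morphisms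

variable {D E : NicholsDatum σ γ}

/-- Maps compatible with action and coaction are `U`-linear. -/
theorem IsRepOf.comm {r : U →ₐ[ℂ] Module.End ℂ D.X.V} {s : U →ₐ[ℂ] Module.End ℂ E.X.V}
    (hr : D.IsRepOf r) (hs : E.IsRepOf s) {f : D.X.V →ₗ[ℂ] E.X.V}
    (hc : ∀ c x, f (D.X.ρ c x) = E.X.ρ c (f x)) (hact : ∀ z, f (D.act z) = E.act (f.lTensor _ z))
    (hco : ∀ x, f.lTensor _ (D.coact x) = E.coact (f x)) (a : U) :
    ∀ x, f (r a x) = s a (f x) := by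
  let S : Subalgebra ℂ U :=
    { carrier := {a | ∀ x, f (r a x) = s a (f x)}
      mul_mem' := fun {a b} ha hb x => by
        simp only [Set.mem_ofPred_eq] at ha hb ⊢
        rw [map_mul, map_mul, Module.End.mul_apply, Module.End.mul_apply, ha, hb]
      add_mem' := fun {a b} ha hb x => by
        simp only [Set.mem_ofPred_eq] at ha hb ⊢
        rw [map_add, map_add, LinearMap.add_apply, LinearMap.add_apply, map_add, ha, hb]
      algebraMap_mem' := fun t x => by
        rw [AlgHomClass.commutes, AlgHomClass.commutes]
        exact map_smul f t x }
  refine subalgebra_eq_top σ γ g g' (S := S) (fun c x => ?_) (fun i x => ?_) (fun i x => ?_) a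
  · rw [hr.ofC, hs.ofC, hc]
  · rw [hr.x, hs.x, opX_apply, opX_apply, hact, LinearMap.lTensor_tmul]
  · rw [hr.y, hs.y, ← hco, slice_lTensor]

theorem IsRepOf.hom_act {r : U →ₐ[ℂ] Module.End ℂ D.X.V} {s : U →ₐ[ℂ] Module.End ℂ E.X.V}
    (hr : D.IsRepOf r) (hs : E.IsRepOf s) {f : D.X.V →ₗ[ℂ] E.X.V}
    (hf : ∀ a x, f (r a x) = s a (f x)) (z : Nichols q ⊗[ℂ] D.X.V) :
    f (D.act z) = E.act (f.lTensor _ z) := by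
  induction z with
  | zero => simp
  | add z w hz hw => simp only [map_add, hz, hw]
  | tmul a m => rw [hr.act, hf, LinearMap.lTensor_tmul, hs.act]

/-- A `U`-linear map is compatible with the coaction, which is determined by its pairings. -/
theorem IsRepOf.hom_coact {r : U →ₐ[ℂ] Module.End ℂ D.X.V} {s : U →ₐ[ℂ] Module.End ℂ E.X.V}
    (hr : D.IsRepOf r) (hs : E.IsRepOf s) {f : D.X.V →ₗ[ℂ] E.X.V}
    (hf : ∀ a x, f (r a x) = s a (f x)) (x : D.X.V) :
    f.lTensor _ (D.coact x) = E.coact (f x) :=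
  eq_of_slice_nForm fun b => by rw [slice_lTensor, hr.coact, hf, hs.coact]

end Morphisms

end NicholsDatum

end QuantumGroup
end Constructions

/-! ### Objects of the Yetter-Drinfeld category -/

noncomputable section Objects

open NicholsAlgebra WeightModule GradedSpace

variable {C : Type u} [CommRing C] [HopfAlgebra ℂ C] [Coalgebra.IsCocomm ℂ C] {n : ℕ}

namespace QuantumGroup

variable {σ : CharGroup C →* CharGroup C →* ℂˣ} {γ : Fin n → CharGroup C} {g g' : Fin n → C}
variable [FiniteDimensional ℂ (Nichols (braidingMatrix γ σ))]

local notation "q" => braidingMatrix γ σ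
local notation "𝔑" => nicholsSpace σ γ
local notation "μN" => LinearMap.mul' ℂ (Nichols (braidingMatrix γ σ))
local notation "U" => QuantumGroup σ γ g g'

/-- The graded vector space underlying an object of `Vect_Γ`. -/
abbrev space (V : VectGraded σ) : GradedSpace C := V

/-- The linear map underlying a morphism of `Vect_Γ`. -/
def toLin {V W : VectGraded σ} (f : V ⟶ W) : (space V).V →ₗ[ℂ] (space W).V :=
  WeightModule.lin (j := BialgHom.id ℂ C) f

theorem toLin_comm {V W : VectGraded σ} (f : V ⟶ W) (c : C) (x : (space V).V) :
    toLin f ((space V).ρ c x) = (space W).ρ c (toLin f x) :=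
  WeightModule.comm (j := BialgHom.id ℂ C) f c x

theorem toLin_injective {V W : VectGraded σ} {f f' : V ⟶ W} (h : toLin f = toLin f') : f = f' :=
  WeightModule.hom_ext h

/-- A linear map of degree zero is a morphism of `Vect_Γ`. -/
def ofLin {V W : VectGraded σ} (f : (space V).V →ₗ[ℂ] (space W).V)
    (h : ∀ c x, f ((space V).ρ c x) = (space W).ρ c (f x)) : V ⟶ W :=
  ⟨f, h⟩

/-- The linear maps underlying an object with an action and a coaction of `𝔅(X)`. -/
@[reducible]
def toDatum (M : ActCoact (nicholsObj γ σ)) : NicholsDatum σ γ where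
  X := space M.X
  act := toLin M.act
  coact := toLin M.coact
  act_comm := toLin_comm M.act
  coact_comm := toLin_comm M.coact

/-- The object of `Vect_Γ` with an action and a coaction of `𝔅(X)` given by linear maps. -/
def NicholsDatum.toObj (D : NicholsDatum σ γ) : ActCoact (nicholsObj γ σ) where
  X := D.X
  act := D.actHom
  coact := D.coactHom

/-- Each axiom is an equation between morphisms of `Vect_Γ`. It holds if and only if it holds for the
underlying linear maps, which are the expected composites by definition. -/
theorem isYetterDrinfeld_iff (M : ActCoact (nicholsObj γ σ)) :
    M.IsYetterDrinfeld ↔ (toDatum M).IsYetterDrinfeld := by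
  set D := toDatum M with hD
  have h₁ : MonObj.one (X := nicholsObj γ σ) ▷ M.X ≫ M.act = (λ_ M.X).hom ↔
      D.act ∘ₗ (Algebra.linearMap ℂ (Nichols q)).rTensor D.X.V =
        (TensorProduct.lid ℂ D.X.V).toLinearMap :=
    ⟨congrArg toLin, fun h => toLin_injective h⟩
  have h₂ : MonObj.mul (X := nicholsObj γ σ) ▷ M.X ≫ M.act = (α_ _ _ M.X).hom ≫ nicholsObj γ σ ◁ M.act ≫ M.act ↔
      D.act ∘ₗ (μN).rTensor D.X.V = (D.act ∘ₗ D.act.lTensor (Nichols q)) ∘ₗ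
        (TensorProduct.assoc ℂ (Nichols q) (Nichols q) D.X.V).toLinearMap :=
    ⟨congrArg toLin, fun h => toLin_injective h⟩
  have h₃ : M.coact ≫ ComonObj.counit (X := nicholsObj γ σ) ▷ M.X = (λ_ M.X).inv ↔
      (nicholsCounit q).rTensor D.X.V ∘ₗ D.coact =
        (TensorProduct.lid ℂ D.X.V).symm.toLinearMap :=
    ⟨congrArg toLin, fun h => toLin_injective h⟩
  have h₄ : M.coact ≫ ComonObj.comul (X := nicholsObj γ σ) ▷ M.X =
        M.coact ≫ nicholsObj γ σ ◁ M.coact ≫ (α_ _ _ M.X).inv ↔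
      (nicholsComul q).rTensor D.X.V ∘ₗ D.coact =
        ((TensorProduct.assoc ℂ (Nichols q) (Nichols q) D.X.V).symm.toLinearMap ∘ₗ
          D.coact.lTensor (Nichols q)) ∘ₗ D.coact :=
    ⟨congrArg toLin, fun h => toLin_injective h⟩
  have h₅ : (ComonObj.comul (X := nicholsObj γ σ) ⊗ₘ M.coact) ≫ tensorμ _ _ _ M.X ≫ (MonObj.mul (X := nicholsObj γ σ) ⊗ₘ M.act) =
      ComonObj.comul (X := nicholsObj γ σ) ▷ M.X ≫ (α_ _ _ M.X).hom ≫ nicholsObj γ σ ◁ (β_ _ M.X).hom ≫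
        (α_ _ M.X _).inv ≫ (M.act ≫ M.coact) ▷ _ ≫ (α_ _ M.X _).hom ≫
          nicholsObj γ σ ◁ (β_ M.X _).hom ≫ (α_ _ _ M.X).inv ≫ MonObj.mul (X := nicholsObj γ σ) ▷ M.X ↔
      tensorActL (A := 𝔑) μN D.act ∘ₗ TensorProduct.map (nicholsComul q) D.coact =
        D.compatL ∘ₗ (nicholsComul q).rTensor D.X.V :=
    ⟨congrArg toLin, fun h => toLin_injective h⟩
  constructor
  · intro h
    refine ⟨fun m => ?_, fun a b m => ?_, fun m => ?_, fun m => ?_, fun a m => ?_⟩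
    · have e := LinearMap.congr_fun (h₁.1 h.one_act) ((1 : ℂ) ⊗ₜ[ℂ] m)
      rwa [LinearMap.comp_apply, LinearMap.rTensor_tmul, Algebra.linearMap_apply, map_one,
        LinearEquiv.coe_coe, TensorProduct.lid_tmul, one_smul] at e
    · exact LinearMap.congr_fun (h₂.1 h.mul_act) ((a ⊗ₜ[ℂ] b) ⊗ₜ[ℂ] m)
    · exact LinearMap.congr_fun (h₃.1 h.coact_counit) m
    · have e := LinearMap.congr_fun (h₄.1 h.coact_comul) m
      exact (TensorProduct.assoc ℂ _ _ _).eq_symm_apply.1 e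
    · exact LinearMap.congr_fun (h₅.1 h.compat) (a ⊗ₜ[ℂ] m)
  · intro h
    refine ⟨h₁.2 ?_, h₂.2 ?_, h₃.2 ?_, h₄.2 ?_, h₅.2 ?_⟩
    · refine TensorProduct.ext' fun (r : ℂ) m => ?_
      rw [LinearMap.comp_apply, LinearMap.rTensor_tmul, Algebra.linearMap_apply,
        Algebra.algebraMap_eq_smul_one, ← TensorProduct.smul_tmul', map_smul, h.one_act]
      rfl
    · exact TensorProduct.ext_threefold fun a b m => h.mul_act a b m
    · exact LinearMap.ext fun m => h.coact_counit m
    · exact LinearMap.ext fun m => (TensorProduct.assoc ℂ _ _ _).eq_symm_apply.2 (h.coact_comul m)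
    · exact TensorProduct.ext' fun a m => h.compat a m

section Monoidal

variable (g g') in
/-- Yetter-Drinfeld modules are closed under the tensor product, because this holds for
representations of `U`. -/
theorem isMonoidal_isYetterDrinfeld [h : IsLinkingDatum σ γ g g'] :
    (isYetterDrinfeld (nicholsObj γ σ)).IsMonoidal where
  prop_unit := (isYetterDrinfeld_iff _).2
    (NicholsDatum.isRepOf_unit (g := g) (g' := g') σ γ).isYetterDrinfeld
  prop_tensor M N hM hN := (isYetterDrinfeld_iff _).2
    ((((isYetterDrinfeld_iff M).1 hM).isRepOf (g := g) (g' := g')).tensor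
      ((isYetterDrinfeld_iff N).1 hN).isRepOf).isYetterDrinfeld

end Monoidal

end QuantumGroup
end Objects

/-! ### The braiding: hexagon identities and `U`-linearity -/

noncomputable section BraidingMap

open NicholsAlgebra WeightModule GradedSpace

variable {C : Type u} [CommRing C] [HopfAlgebra ℂ C] [Coalgebra.IsCocomm ℂ C] {n : ℕ}

/-- An additive property of vectors has to be checked on homogeneous vectors only. -/
theorem GradedSpace.induction {V : GradedSpace C} {P : V.V → Prop} (x : V.V)
    (mem : ∀ χ, ∀ x ∈ weightSpace V.ρ χ, P x) (add : ∀ x y, P x → P y → P (x + y)) : P x := by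
  have hx : x ∈ ⨆ χ, weightSpace (V.ρ.comp (AlgHom.id ℂ C)) χ :=
    V.iSup_weightSpace.ge Submodule.mem_top
  induction hx using Submodule.iSup_induction' with
  | mem χ x hx => exact mem χ x hx
  | zero => exact mem 1 0 (zero_mem _)
  | add x y _ _ h h' => exact add x y h h'

namespace QuantumGroup

variable {σ : CharGroup C →* CharGroup C →* ℂˣ} {γ : Fin n → CharGroup C} {g g' : Fin n → C}
variable [FiniteDimensional ℂ (Nichols (braidingMatrix γ σ))]

local notation "q" => braidingMatrix γ σ
local notation "𝔑" => nicholsSpace σ γ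
local notation "μN" => LinearMap.mul' ℂ (Nichols (braidingMatrix γ σ))
local notation "U" => QuantumGroup σ γ g g'

theorem twistL_natural_right {V V' W : GradedSpace C} (a : Nichols q ⊗[ℂ] W.V →ₗ[ℂ] W.V)
    {f : V.V →ₗ[ℂ] V'.V} (hf : ∀ c x, f (V.ρ c x) = V'.ρ c (f x)) (z : Nichols q ⊗[ℂ] V.V)
    (w : W.V) : twistL a V' (f.lTensor _ z ⊗ₜ w) = f.lTensor _ (twistL a V (z ⊗ₜ w)) := by
  have : twistL a V' ∘ₗ (f.lTensor (Nichols q)).rTensor W.V = f.lTensor W.V ∘ₗ twistL a V :=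
    ext₃ (V := 𝔑) fun φ χ ψ c hc v hv w hw => by
      rw [LinearMap.comp_apply, LinearMap.comp_apply, LinearMap.rTensor_tmul,
        LinearMap.lTensor_tmul, twistL_tmul a _ hv hw,
        twistL_tmul a _ (lin_mem_weightSpace hf hv) hw, map_smul, LinearMap.lTensor_tmul]
  exact LinearMap.congr_fun this (z ⊗ₜ w)

theorem twistL_natural_left {V W W' : GradedSpace C} {a : Nichols q ⊗[ℂ] W.V →ₗ[ℂ] W.V}
    {a' : Nichols q ⊗[ℂ] W'.V →ₗ[ℂ] W'.V}
    {f : W.V →ₗ[ℂ] W'.V} (hf : ∀ c x, f (W.ρ c x) = W'.ρ c (f x))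
    (ha : ∀ z, f (a z) = a' (f.lTensor _ z)) (z : Nichols q ⊗[ℂ] V.V)
    (w : W.V) : twistL a' V (z ⊗ₜ f w) = f.rTensor _ (twistL a V (z ⊗ₜ w)) := by
  have : twistL a' V ∘ₗ f.lTensor (Nichols q ⊗[ℂ] V.V) = f.rTensor V.V ∘ₗ twistL a V :=
    ext₃ (V := 𝔑) fun φ χ ψ c hc v hv w hw => by
      rw [LinearMap.comp_apply, LinearMap.comp_apply, LinearMap.lTensor_tmul, twistL_tmul a _ hv hw,
        twistL_tmul a' _ hv (lin_mem_weightSpace hf hw), map_smul, LinearMap.rTensor_tmul, ha,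
        LinearMap.lTensor_tmul]
  exact LinearMap.congr_fun this (z ⊗ₜ w)

namespace NicholsDatum

variable {D E F : NicholsDatum σ γ}

variable (D E) in
/-- The braiding `m ⊗ w ↦ m₍₋₁₎ w ⊗ m₍₀₎`. -/
def braidL : D.X.V ⊗[ℂ] E.X.V →ₗ[ℂ] E.X.V ⊗[ℂ] D.X.V :=
  twistL E.act D.X ∘ₗ D.coact.rTensor E.X.V

theorem braidL_tmul (m : D.X.V) (w : E.X.V) :
    D.braidL E (m ⊗ₜ w) = twistL E.act D.X (D.coact m ⊗ₜ w) := rfl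

theorem braidL_comm (c : C) (z : D.X.V ⊗[ℂ] E.X.V) :
    D.braidL E (diag D.X.ρ E.X.ρ c z) = diag E.X.ρ D.X.ρ c (D.braidL E z) :=
  -- The linear map underlying the morphism `ydBraiding` of `Vect_Γ` is `braidL` by definition.
  toLin_comm (ydBraiding D.toObj E.toObj) c z

section Hexagon

/-- The first hexagon identity, from the coassociativity of the coaction. -/
theorem braidL_tensor_right (hD : D.IsYetterDrinfeld) (m : D.X.V) (v : E.X.V) (w : F.X.V) :
    TensorProduct.assoc ℂ _ _ _ (D.braidL (E.tensor F) (m ⊗ₜ (v ⊗ₜ w))) =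
      (D.braidL F).lTensor _ (TensorProduct.assoc ℂ _ _ _ (D.braidL E (m ⊗ₜ v) ⊗ₜ w)) := by
  have h1 : ∀ t : E.X.V ⊗[ℂ] D.X.V,
      (D.braidL F).lTensor _ (TensorProduct.assoc ℂ _ _ _ (t ⊗ₜ w)) =
      (twistL F.act D.X).lTensor _ (TensorProduct.assoc ℂ _ _ _ (D.coact.lTensor _ t ⊗ₜ w)) :=
    fun t => by
      induction t with
      | zero => simp
      | add z w hz hw => simp only [map_add, TensorProduct.add_tmul, hz, hw]
      | tmul a b => rfl
  have h2 : ∀ z : Nichols q ⊗[ℂ] D.X.V,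
      TensorProduct.assoc ℂ _ _ _ (twistL (E.tensor F).act D.X (z ⊗ₜ (v ⊗ₜ w))) =
      (twistL F.act D.X).lTensor _ (TensorProduct.assoc ℂ _ _ _
        (twistL E.act (tensorSpace 𝔑 D.X)
          (TensorProduct.assoc ℂ _ _ _ ((nicholsComul q).rTensor _ z) ⊗ₜ v) ⊗ₜ w)) := by
    clear h1
    intro z
    induction z with
    | zero => simp
    | add z w hz hw => simp only [map_add, TensorProduct.add_tmul, hz, hw]
    | tmul a m =>
      induction m using GradedSpace.induction with
      | add m m' h h' => simp only [map_add, TensorProduct.add_tmul, TensorProduct.tmul_add, h, h']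
      | mem χ m hm =>
      induction v using GradedSpace.induction with
      | add m m' h h' => simp only [map_add, TensorProduct.add_tmul, TensorProduct.tmul_add, h, h']
      | mem φ v hv =>
      induction w using GradedSpace.induction with
      | add m m' h h' => simp only [map_add, TensorProduct.add_tmul, TensorProduct.tmul_add, h, h']
      | mem ψ w hw =>
      rw [twistL_tmul (W := tensorSpace E.X F.X) _ a hm (GradedSpace.tmul_mem_weightSpace hv hw),
        LinearMap.rTensor_tmul, LinearMap.comp_apply, LinearMap.rTensor_tmul]
      generalize nicholsComul q a = t
      induction t with
      | zero => simp
      | add t t' h h' => simp only [map_add, smul_add, TensorProduct.add_tmul, h, h']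
      | tmul a b =>
        induction b using GradedSpace.induction (V := 𝔑) with
        | add m m' h h' =>
          simp only [map_add, smul_add, TensorProduct.add_tmul, TensorProduct.tmul_add, h, h']
        | mem η b hb =>
        rw [tensorActL_tmul _ _ a w hb hv, TensorProduct.assoc_tmul,
          twistL_tmul (V := tensorSpace 𝔑 D.X) _ a (GradedSpace.tmul_mem_weightSpace hb hm) hv]
        simp only [← TensorProduct.smul_tmul', map_smul, TensorProduct.assoc_tmul,
          LinearMap.lTensor_tmul]
        rw [twistL_tmul _ b hm hw, TensorProduct.tmul_smul, smul_smul, smul_smul, map_mul, map_mul,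
          MonoidHom.mul_apply, Units.val_mul, Units.val_mul]
        congr 1
        ring
  rw [braidL_tmul, braidL_tmul, h1, ← twistL_natural_right (V' := tensorSpace 𝔑 D.X) _ D.coact_comm,
    ← hD.coact_comul]
  exact h2 (D.coact m)

/-- The second hexagon identity, from the associativity of the action on the third module. -/
theorem braidL_tensor_left (hF : F.IsYetterDrinfeld) (v : D.X.V) (w : E.X.V) (m : F.X.V) :
    (TensorProduct.assoc ℂ _ _ _).symm ((D.tensor E).braidL F ((v ⊗ₜ w) ⊗ₜ m)) =
      (D.braidL F).rTensor _ ((TensorProduct.assoc ℂ _ _ _).symm (v ⊗ₜ E.braidL F (w ⊗ₜ m))) := by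
  have h1 : ∀ t : F.X.V ⊗[ℂ] E.X.V,
      (D.braidL F).rTensor _ ((TensorProduct.assoc ℂ _ _ _).symm (v ⊗ₜ t)) =
      (twistL F.act D.X).rTensor _ ((TensorProduct.assoc ℂ _ _ _).symm (D.coact v ⊗ₜ t)) :=
    fun t => by
      induction t with
      | zero => simp
      | add z w hz hw => simp only [map_add, TensorProduct.tmul_add, hz, hw]
      | tmul a b => rfl
  rw [braidL_tmul, braidL_tmul, h1, tensor_coact_tmul]
  induction m using GradedSpace.induction with
  | add m m' h h' => simp only [map_add, TensorProduct.add_tmul, TensorProduct.tmul_add, h, h']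
  | mem χ m hm =>
  have h2 : ((TensorProduct.assoc ℂ _ _ _).symm.toLinearMap ∘ₗ
        twistL F.act (tensorSpace D.X E.X) ∘ₗ (TensorProduct.mk ℂ _ _).flip m ∘ₗ
          mulExchange D.X E.X) =
      (twistL F.act D.X).rTensor _ ∘ₗ (TensorProduct.assoc ℂ _ _ _).symm.toLinearMap ∘ₗ
        (twistL F.act E.X ∘ₗ (TensorProduct.mk ℂ _ _).flip m).lTensor _ := by
    refine ext₄ (V := 𝔑) (X := 𝔑) fun ψ φ η κ a ha v hv b hb w hw => ?_
    simp only [LinearMap.comp_apply, LinearMap.lTensor_tmul, LinearMap.flip_apply,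
      TensorProduct.mk_apply]
    rw [mulExchange_tmul a w hv hb, ← TensorProduct.smul_tmul', map_smul, map_smul,
      twistL_tmul (V := tensorSpace D.X E.X) _ (a * b) (GradedSpace.tmul_mem_weightSpace hv hw) hm,
      twistL_tmul _ b hw hm, map_smul, TensorProduct.tmul_smul, map_smul, map_smul]
    simp only [LinearEquiv.coe_coe, TensorProduct.assoc_symm_tmul, LinearMap.rTensor_tmul]
    rw [twistL_tmul _ a hv (F.act_mem hb hm), hF.mul_act, ← TensorProduct.smul_tmul', smul_smul,
      smul_smul, map_mul, map_mul, MonoidHom.mul_apply, Units.val_mul, Units.val_mul]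
    congr 1
    ring
  exact LinearMap.congr_fun h2 (D.coact v ⊗ₜ E.coact w)

end Hexagon

variable [h : IsLinkingDatum σ γ g g']

theorem IsRepOf.y_mem {r : U →ₐ[ℂ] Module.End ℂ D.X.V} (hr : D.IsRepOf r) (j : Fin n)
    {χ : CharGroup C} {m : D.X.V} (hm : m ∈ weightSpace D.X.ρ χ) :
    r (QuantumGroup.y σ γ g g' j) m ∈ weightSpace D.X.ρ ((γ j)⁻¹ * χ) := fun c => by
  have e := mk_rel σ γ g g' (.commY c j)
  rw [map_mul, map_mul] at e
  rw [← hr.ofC, ← Module.End.mul_apply, ← map_mul]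
  change r (QuantumGroup.ofC σ γ g g' c * QuantumGroup.y σ γ g g' j) m = _
  have e' : QuantumGroup.ofC σ γ g g' c * QuantumGroup.y σ γ g g' j =
    QuantumGroup.y σ γ g g' j * QuantumGroup.ofC σ γ g g' (charShift (γ j)⁻¹ c) := e
  rw [e', map_mul, Module.End.mul_apply, hr.ofC, hm, map_smul, char_charShift]

/-- The right skew derivations are adjoint to left multiplication with a generator, so on the coaction
they amount to the action of `x_j^*` on the second factor. -/
theorem IsRepOf.lTensor_y_coact {r : U →ₐ[ℂ] Module.End ℂ D.X.V} (hr : D.IsRepOf r) (j : Fin n)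
    (m : D.X.V) : (r (QuantumGroup.y σ γ g g' j)).lTensor _ (D.coact m) =
      (nDerivR q j).rTensor _ (D.coact m) :=
  eq_of_slice_nForm fun b => by
    have e := slice_map_tmul (LinearMap.id (M := D.X.V)) (f' := LinearMap.mulLeft ℂ (gen q j))
      (fun a => (nForm_gen_mul q j b a).symm) (D.coact m)
    refine Eq.trans ?_ e.symm
    rw [slice_lTensor, hr.coact, LinearMap.mulLeft_apply, LinearMap.id_apply, hr.coact, map_mul,
      map_mul, ofNicholsY_gen]
    rfl

/-- The commutation of `x_j^*` with the elements of `𝔅(X)`, in a representation. -/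
theorem IsRepOf.y_act {s : U →ₐ[ℂ] Module.End ℂ E.X.V} (hs : E.IsRepOf s) (j : Fin n)
    (a : Nichols q) (w : E.X.V) : s (QuantumGroup.y σ γ g g' j) (E.act (a ⊗ₜ w)) =
      E.act (nicholsAct γ q (g' j) a ⊗ₜ s (QuantumGroup.y σ γ g g' j) w) +
      E.act (nDerivL q j a ⊗ₜ w) - E.X.ρ (g' j) (E.act (nDerivR q j a ⊗ₜ E.X.ρ (g j) w)) := by
  rw [hs.act, hs.act, hs.act, hs.act, ← hs.ofC, ← hs.ofC, nicholsAct_right (g' := g') g,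
    ← Module.End.mul_apply, ← map_mul, y_mul_ofNichols]
  simp only [map_add, map_sub, map_mul, LinearMap.add_apply, LinearMap.sub_apply,
    Module.End.mul_apply]

/-- The action of `x_j^*` on the image of the braiding, up to a term which vanishes on the
coaction. -/
theorem IsRepOf.y_twistL {r : U →ₐ[ℂ] Module.End ℂ D.X.V} {s : U →ₐ[ℂ] Module.End ℂ E.X.V}
    (hr : D.IsRepOf r) (hs : E.IsRepOf s) (j : Fin n) (z : Nichols q ⊗[ℂ] D.X.V) (w : E.X.V) :
    diag s r (QuantumGroup.y σ γ g g' j) (twistL E.act D.X (z ⊗ₜ w)) =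
      twistL E.act D.X (diag (nicholsAct γ q) D.X.ρ (g' j) z ⊗ₜ
        s (QuantumGroup.y σ γ g g' j) w) +
      twistL E.act D.X ((nDerivL q j).rTensor _ z ⊗ₜ w) +
      (E.X.ρ (g' j)).rTensor _ (twistL E.act D.X
        (((r (QuantumGroup.y σ γ g g' j)).lTensor _ z - (nDerivR q j).rTensor _ z) ⊗ₜ
          E.X.ρ (g j) w)) := by
  induction w using GradedSpace.induction with
  | add m m' h h' =>
    simp only [map_add, TensorProduct.add_tmul, TensorProduct.tmul_add, h, h']
    abel
  | mem χ w hw =>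
  induction z with
  | zero => simp
  | add z z' h h' =>
    simp only [map_add, map_sub, TensorProduct.add_tmul, TensorProduct.sub_tmul, h, h']
    abel
  | tmul a v =>
  induction v using GradedSpace.induction with
  | add v v' h h' =>
    simp only [map_add, map_sub, TensorProduct.add_tmul, TensorProduct.sub_tmul,
      TensorProduct.tmul_add] at h h' ⊢
    rw [h, h']
    abel
  | mem ψ v hv =>
  induction a using GradedSpace.induction (V := 𝔑) with
  | add v v' h h' =>
    simp only [map_add, map_sub, TensorProduct.add_tmul, TensorProduct.sub_tmul,
      TensorProduct.tmul_add] at h h' ⊢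
    rw [h, h']
    abel
  | mem φ a ha =>
  have hw' : E.X.ρ (g j) w = ((σ (γ j) χ : ℂˣ) : ℂ) • w := left_act σ γ g g' hw j
  have hd : diag (nicholsAct γ q) D.X.ρ (g' j) (a ⊗ₜ v) =
      ((σ (φ * ψ) (γ j) : ℂˣ) : ℂ) • (a ⊗ₜ v) :=
    right_act σ γ g g' (GradedSpace.tmul_mem_weightSpace ha hv) j
  have ha' : nicholsAct γ q (g' j) a = ((σ φ (γ j) : ℂˣ) : ℂ) • a := right_act σ γ g g' ha j
  have he : E.X.ρ (g' j) (E.act (a ⊗ₜ w)) = ((σ (φ * χ) (γ j) : ℂˣ) : ℂ) • E.act (a ⊗ₜ w) :=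
    right_act σ γ g g' (E.act_mem ha hw) j
  rw [hw', hd, TensorProduct.sub_tmul, map_sub, map_sub, TensorProduct.tmul_smul,
    TensorProduct.tmul_smul, LinearMap.lTensor_tmul, LinearMap.rTensor_tmul, LinearMap.rTensor_tmul,
    twistL_tmul _ _ hv hw, ← TensorProduct.smul_tmul', map_smul, map_smul, map_smul, map_smul,
    map_smul, twistL_tmul _ _ hv hw, twistL_tmul _ _ hv hw, twistL_tmul _ _ hv (hs.y_mem j hw),
    twistL_tmul _ _ (hr.y_mem j hv) hw, diag_y, hs.y_act, hs.ofC, he, ha', hw']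
  simp only [map_smul, LinearMap.rTensor_tmul, he, ← TensorProduct.smul_tmul',
    TensorProduct.tmul_smul, TensorProduct.add_tmul, TensorProduct.sub_tmul, smul_add, smul_sub,
    smul_smul, map_mul, MonoidHom.mul_apply, Units.val_mul, map_inv, MonoidHom.inv_apply]
  -- The values of `σ` at `γ_j` and `γ_j⁻¹` cancel.
  have e1 : ∀ a b c : ℂˣ, (a * b * ((b⁻¹ : ℂˣ) * c) : ℂ) = c * a := fun a b c => by
    rw [Units.val_inv_eq_inv_val]; field_simp
  have e2 : ∀ a b c d : ℂˣ, (a * ((a⁻¹ : ℂˣ) * b * (c * d)) : ℂ) = b * (c * d) := fun a b c d => by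
    rw [Units.val_inv_eq_inv_val]; field_simp
  rw [e1, e2, mul_comm ((σ (γ j) χ : ℂˣ) : ℂ)]
  abel

/-- The linearity in `x_i` is the Yetter-Drinfeld condition of the first module. -/
theorem IsRepOf.x_braidL {r : U →ₐ[ℂ] Module.End ℂ D.X.V} {s : U →ₐ[ℂ] Module.End ℂ E.X.V}
    (hr : D.IsRepOf r) (hs : E.IsRepOf s) (i : Fin n) (z : D.X.V ⊗[ℂ] E.X.V) :
    D.braidL E (diag r s (QuantumGroup.x σ γ g g' i) z) =
      diag s r (QuantumGroup.x σ γ g g' i) (D.braidL E z) := by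
  have hx : diag s r (QuantumGroup.x σ γ g g' i) = diagX g E.act D.act i :=
    TensorProduct.ext' fun v w => by
      rw [diag_x, diagX_tmul, hr.x, hs.x, hs.ofC, add_comm]
  induction z with
  | zero => simp
  | add z w hz hw => simp only [map_add, hz, hw]
  | tmul m w =>
    rw [diag_x, map_add, braidL_tmul, braidL_tmul, braidL_tmul, hx, hr.x, hs.x, hr.ofC,
      ← twistL_rightX (g := g) (g' := g') E.act_comm hs.isYetterDrinfeld.mul_act,
      hr.isGenCompat, ← map_add, ← TensorProduct.add_tmul, add_sub_cancel,
      twistL_diagX (g := g) (g' := g') E.act_comm hs.isYetterDrinfeld.mul_act D.act_comm]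

/-- The linearity in `x_j^*` is the linking relation on the second module; the term with `g'_j g_j`
cancels by `lTensor_y_coact`. -/
theorem IsRepOf.y_braidL {r : U →ₐ[ℂ] Module.End ℂ D.X.V} {s : U →ₐ[ℂ] Module.End ℂ E.X.V}
    (hr : D.IsRepOf r) (hs : E.IsRepOf s) (j : Fin n) (z : D.X.V ⊗[ℂ] E.X.V) :
    D.braidL E (diag r s (QuantumGroup.y σ γ g g' j) z) =
      diag s r (QuantumGroup.y σ γ g g' j) (D.braidL E z) := by
  induction z with
  | zero => simp
  | add z w hz hw => simp only [map_add, hz, hw]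
  | tmul m w =>
    rw [diag_y, map_add, braidL_tmul, braidL_tmul, braidL_tmul, hr.y_twistL hs,
      hr.lTensor_y_coact, sub_self, TensorProduct.zero_tmul, map_zero, map_zero, add_zero,
      hr.nDerivL_coact, ← D.coact_comm, hr.ofC]

/-- The braiding is `U`-linear. -/
theorem IsRepOf.rep_braidL {r : U →ₐ[ℂ] Module.End ℂ D.X.V} {s : U →ₐ[ℂ] Module.End ℂ E.X.V}
    (hr : D.IsRepOf r) (hs : E.IsRepOf s) (a : U) : ∀ z : D.X.V ⊗[ℂ] E.X.V,
    D.braidL E (diag r s a z) = diag s r a (D.braidL E z) := by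
  let S : Subalgebra ℂ U :=
    { carrier := {a | ∀ z, D.braidL E (diag r s a z) = diag s r a (D.braidL E z)}
      mul_mem' := fun {a b} ha hb x => by
        simp only [Set.mem_ofPred_eq] at ha hb ⊢
        rw [map_mul, map_mul, Module.End.mul_apply, Module.End.mul_apply, ha, hb]
      add_mem' := fun {a b} ha hb x => by
        simp only [Set.mem_ofPred_eq] at ha hb ⊢
        rw [map_add, map_add, LinearMap.add_apply, LinearMap.add_apply, map_add, ha, hb]
      algebraMap_mem' := fun t x => by
        rw [AlgHomClass.commutes, AlgHomClass.commutes]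
        exact map_smul (D.braidL E) t x }
  refine subalgebra_eq_top σ γ g g' (S := S) (fun c x => ?_) (hr.x_braidL hs) (hr.y_braidL hs) a
  rw [diag_ofC, diag_ofC, hr.comp_ofC, hs.comp_ofC, braidL_comm]

end NicholsDatum

end QuantumGroup
end BraidingMap

/-! ### Nilpotency and invertibility of the braiding -/

noncomputable section Nilpotency

open NicholsAlgebra WeightModule GradedSpace

variable {C : Type u} [CommRing C] [HopfAlgebra ℂ C] [Coalgebra.IsCocomm ℂ C] {n : ℕ}

namespace NicholsAlgebra

variable (q : Fin n → Fin n → ℂ)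

/-- The span of the monomials of length at least `k` in a Nichols algebra. -/
def longWords (k : ℕ) : Submodule ℂ (Nichols q) :=
  Submodule.span ℂ {a | ∃ w : FreeMonoid (Fin n), k ≤ w.length ∧ a = proj q (word w)}

theorem longWords_antitone {k l : ℕ} (h : k ≤ l) : longWords q l ≤ longWords q k :=
  Submodule.span_mono fun _ ⟨w, hw, e⟩ => ⟨w, h.trans hw, e⟩

/-- Monomials of different lengths are orthogonal to each other. -/
theorem nForm_longWords {k : ℕ} {u : FreeMonoid (Fin n)} (hu : u.length < k) {a : Nichols q}
    (ha : a ∈ longWords q k) : nForm q (proj q (word u)) a = 0 := by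
  induction ha using Submodule.span_induction with
  | zero => rw [map_zero]
  | add a b _ _ ha hb => rw [map_add, ha, hb, add_zero]
  | smul r a _ ha => rw [map_smul, ha, smul_zero]
  | mem a ha =>
    obtain ⟨w, hw, rfl⟩ := ha
    by_contra h0
    have := congrArg Multiset.card (form_word_word q h0)
    exact absurd (show u.length = w.length from this) (by omega)

/-- Long monomials vanish in a finite-dimensional Nichols algebra: the spaces spanned by long
monomials stabilize, while monomials of different lengths are orthogonal to each other. -/
theorem exists_word_eq_zero [FiniteDimensional ℂ (Nichols q)] :
    ∃ k : ℕ, ∀ w : FreeMonoid (Fin n), k ≤ w.length → proj q (word w) = 0 := by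
  obtain ⟨k, hk⟩ := IsArtinian.monotone_stabilizes
    (⟨fun k => OrderDual.toDual (longWords q k), fun _ _ h => longWords_antitone q h⟩ :
      ℕ →o (Submodule ℂ (Nichols q))ᵒᵈ)
  have hk' : ∀ l, k ≤ l → longWords q k = longWords q l := hk
  refine ⟨k, fun w hw => eq_zero_of_nForm q _ fun b => ?_⟩
  have : (nForm q).flip (proj q (word w)) = 0 := lin_ext fun u => by
    by_contra h0
    have e := congrArg Multiset.card (form_word_word q h0)
    have e' : u.length = w.length := e
    have hw' : proj q (word w) ∈ longWords q (w.length + 1) := by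
      rw [← hk' _ (by omega), hk' _ hw]
      exact Submodule.subset_span ⟨w, le_rfl, rfl⟩
    exact h0 (nForm_longWords q (by omega) hw')
  exact LinearMap.congr_fun this b

end NicholsAlgebra

namespace QuantumGroup

variable {σ : CharGroup C →* CharGroup C →* ℂˣ} {γ : Fin n → CharGroup C} {g g' : Fin n → C}
variable [FiniteDimensional ℂ (Nichols (braidingMatrix γ σ))]

local notation "q" => braidingMatrix γ σ
local notation "𝔑" => nicholsSpace σ γ
local notation "μN" => LinearMap.mul' ℂ (Nichols (braidingMatrix γ σ))
local notation "U" => QuantumGroup σ γ g g'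

namespace NicholsDatum

variable [h : IsLinkingDatum σ γ g g'] {D E : NicholsDatum σ γ}

variable (D) in
/-- The vectors which arise from a homogeneous vector by the action of a monomial in the `x_j^*`
of length at least `k`. -/
def yDescendants (r : U →ₐ[ℂ] Module.End ℂ D.X.V) (k : ℕ) : Set D.X.V :=
  {m | ∃ w : FreeMonoid (Fin n), k ≤ w.length ∧ ∃ χ, ∃ v ∈ weightSpace D.X.ρ χ,
    m = r (ofNicholsY σ γ g g' (proj q (word w))) v}

theorem IsRepOf.exists_weight {r : U →ₐ[ℂ] Module.End ℂ D.X.V} (hr : D.IsRepOf r) {k : ℕ}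
    {m : D.X.V} (hm : m ∈ D.yDescendants r k) : ∃ χ, m ∈ weightSpace D.X.ρ χ := by
  obtain ⟨w, -, χ, v, hv, rfl⟩ := hm
  induction w using FreeMonoid.inductionOn' with
  | one => exact ⟨χ, by rw [word_one, map_one, map_one, map_one]; exact hv⟩
  | of_mul i w ih =>
    obtain ⟨ψ, hψ⟩ := ih
    refine ⟨(γ i)⁻¹ * ψ, ?_⟩
    rw [word_of_mul, ← gen_mul_proj, map_mul, map_mul, ofNicholsY_gen]
    exact hr.y_mem i hψ

theorem y_mem_yDescendants {r : U →ₐ[ℂ] Module.End ℂ D.X.V} {k : ℕ} {m : D.X.V}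
    (hm : m ∈ D.yDescendants r k) {w : FreeMonoid (Fin n)} (hw : w ≠ 1) :
    r (ofNicholsY σ γ g g' (proj q (word w))) m ∈ D.yDescendants r (k + 1) := by
  obtain ⟨w', hk, χ, v, hv, rfl⟩ := hm
  refine ⟨w * w', ?_, χ, v, hv, ?_⟩
  · have : w.length ≠ 0 := fun e => hw (FreeMonoid.length_eq_zero.1 e)
    rw [FreeMonoid.length_mul]
    omega
  · rw [map_mul word, map_mul (proj q), map_mul, map_mul]; rfl

/-- The coaction is `m ↦ 1 ⊗ m` up to terms with a descendant of `m` in the second factor. -/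
theorem IsRepOf.coact_sub_mem {r : U →ₐ[ℂ] Module.End ℂ D.X.V} (hr : D.IsRepOf r) {k : ℕ}
    {m : D.X.V} (hm : m ∈ D.yDescendants r k) : ∃ z,
    D.coact m - 1 ⊗ₜ m =
      (Submodule.span ℂ (D.yDescendants r (k + 1))).subtype.lTensor (Nichols q) z := by
  set T := Submodule.span ℂ (D.yDescendants r (k + 1)) with hT
  have e : T.mkQ.lTensor (Nichols q) (D.coact m) = 1 ⊗ₜ T.mkQ m := by
    -- Pairing with a monomial other than `1` gives a descendant of `m`.
    refine (eq_of_slice_nForm fun b => ?_)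
    have : sliceHom _ (T.mkQ.lTensor (Nichols q) (D.coact m)) =
        sliceHom _ ((1 : Nichols q) ⊗ₜ[ℂ] T.mkQ m) := lin_ext fun w => by
      rw [sliceHom_apply, sliceHom_apply, slice_lTensor, hr.coact, slice_tmul, nForm_symm, nForm_one]
      by_cases hw : w = 1
      · subst hw
        rw [word_one, map_one, map_one, map_one, nicholsCounit_one, one_smul]
        rfl
      · have h1 : nicholsCounit q (proj q (word w)) = 0 := by
          induction w using FreeMonoid.inductionOn' with
          | one => exact absurd rfl hw
          | of_mul i w _ => rw [word_of_mul, ← gen_mul_proj, nicholsCounit_gen_mul]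
        rw [h1, zero_smul, Submodule.mkQ_apply, Submodule.Quotient.mk_eq_zero]
        exact Submodule.subset_span (y_mem_yDescendants hm hw)
    exact LinearMap.congr_fun this b
  have := (lTensor_exact (Nichols q) (LinearMap.exact_subtype_mkQ T) T.mkQ_surjective
    (D.coact m - 1 ⊗ₜ m)).1 (by rw [map_sub, e, LinearMap.lTensor_tmul, sub_self])
  obtain ⟨z, hz⟩ := this
  exact ⟨z, hz.symm⟩

/-- By descending induction on `k`: the braiding maps `m ⊗ w` to a nonzero multiple of `w ⊗ m` plus
terms `w' ⊗ m'` in which `m'` is a further descendant, and all descendants of degree `N` vanish. -/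
theorem IsRepOf.tmul_mem_range {r : U →ₐ[ℂ] Module.End ℂ D.X.V} {s : U →ₐ[ℂ] Module.End ℂ E.X.V}
    (hr : D.IsRepOf r) (hs : E.IsRepOf s) {N : ℕ}
    (hN : ∀ w : FreeMonoid (Fin n), N ≤ w.length → proj q (word w) = 0) (d : ℕ) :
    ∀ k, N ≤ k + d → ∀ m ∈ D.yDescendants r k, ∀ w,
      w ⊗ₜ m ∈ LinearMap.range (D.braidL E) := by
  induction d with
  | zero =>
    rintro k hk m ⟨w', hw, χ, v, hv, rfl⟩ w
    rw [hN w' (by omega), map_zero, map_zero, LinearMap.zero_apply, TensorProduct.tmul_zero]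
    exact zero_mem _
  | succ d ih =>
    intro k hk m hm w
    obtain ⟨χ, hχ⟩ := hr.exists_weight hm
    induction w using GradedSpace.induction with
    | add w w' h h' => rw [TensorProduct.add_tmul]; exact add_mem h h'
    | mem ψ w hw =>
    obtain ⟨z, hz⟩ := hr.coact_sub_mem hm
    have h1 : D.braidL E (m ⊗ₜ w) = ((σ χ ψ : ℂˣ) : ℂ) • (w ⊗ₜ m) +
        twistL E.act D.X ((D.coact m - 1 ⊗ₜ m) ⊗ₜ w) := by
      rw [braidL_tmul, TensorProduct.sub_tmul, map_sub, twistL_tmul _ 1 hχ hw,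
        hs.isYetterDrinfeld.one_act]
      abel
    have h2 : twistL E.act D.X ((D.coact m - 1 ⊗ₜ m) ⊗ₜ w) ∈ LinearMap.range (D.braidL E) := by
      rw [hz]
      clear hz h1
      induction z with
      | zero => simp
      | add z z' h h' => rw [map_add, TensorProduct.add_tmul, map_add]; exact add_mem h h'
      | tmul a t =>
        obtain ⟨t, ht⟩ := t
        rw [LinearMap.lTensor_tmul, Submodule.subtype_apply]
        dsimp only
        induction ht using Submodule.span_induction with
        | zero => simp
        | add t t' _ _ h h' =>
          rw [TensorProduct.tmul_add, TensorProduct.add_tmul, map_add]; exact add_mem h h'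
        | smul c t _ h =>
          rw [TensorProduct.tmul_smul, ← TensorProduct.smul_tmul', map_smul]
          exact Submodule.smul_mem _ _ h
        | mem t ht =>
          obtain ⟨φ, hφ⟩ := hr.exists_weight ht
          rw [twistL_tmul _ a hφ hw]
          exact Submodule.smul_mem _ _ (ih (k + 1) (by omega) t ht _)
    have h3 : w ⊗ₜ m = (((σ χ ψ)⁻¹ : ℂˣ) : ℂ) • (D.braidL E (m ⊗ₜ w) -
        twistL E.act D.X ((D.coact m - 1 ⊗ₜ m) ⊗ₜ w)) := by
      rw [h1, add_sub_cancel_right, smul_smul, Units.inv_mul, one_smul]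
    rw [h3]
    exact Submodule.smul_mem _ _ (sub_mem ⟨_, rfl⟩ h2)

/-- The braiding is surjective by nilpotency, and hence bijective by equality of dimensions. -/
theorem IsRepOf.braidL_bijective {r : U →ₐ[ℂ] Module.End ℂ D.X.V}
    {s : U →ₐ[ℂ] Module.End ℂ E.X.V} (hr : D.IsRepOf r) (hs : E.IsRepOf s) :
    Function.Bijective (D.braidL E) := by
  obtain ⟨N, hN⟩ := exists_word_eq_zero q
  have h1 : Function.Surjective (D.braidL E) := by
    rw [← LinearMap.range_eq_top, eq_top_iff]
    rintro z -
    induction z with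
    | zero => exact zero_mem _
    | add z z' h h' => exact add_mem h h'
    | tmul w m =>
      induction m using GradedSpace.induction with
      | add m m' h h' => rw [TensorProduct.tmul_add]; exact add_mem h h'
      | mem χ m hm =>
        refine hr.tmul_mem_range hs hN N 0 (by omega) m ⟨1, Nat.zero_le _, χ, m, hm, ?_⟩ w
        rw [word_one, map_one, map_one, map_one]
        rfl
  exact ⟨(LinearMap.injective_iff_surjective_of_finrank_eq_finrank
    (by rw [Module.finrank_tensorProduct, Module.finrank_tensorProduct, mul_comm])).2 h1, h1⟩

end NicholsDatum

end QuantumGroup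
end Nilpotency

/-! ### The braided category of representations -/

noncomputable section BraidedRepresentations

open NicholsAlgebra WeightModule GradedSpace

variable {C : Type u} [CommRing C] [HopfAlgebra ℂ C] [Coalgebra.IsCocomm ℂ C] {n : ℕ}

namespace QuantumGroup

variable {σ : CharGroup C →* CharGroup C →* ℂˣ} {γ : Fin n → CharGroup C} {g g' : Fin n → C}
variable [FiniteDimensional ℂ (Nichols (braidingMatrix γ σ))]

local notation "q" => braidingMatrix γ σ
local notation "U" => QuantumGroup σ γ g g'

variable [h : IsLinkingDatum σ γ g g']

/-- The graded vector space underlying a weight module of `U`. -/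
@[reducible]
def restrictSpace (M : WeightModule (incl σ γ g g')) : GradedSpace C where
  V := M.V
  ρ := M.ρ.comp (incl σ γ g g' : C →ₐ[ℂ] U)
  iSup_weightSpace := M.iSup_weightSpace

/-- The action and the coaction of the Nichols algebra on a weight module of `U`. -/
@[reducible]
def repDatum (M : WeightModule (incl σ γ g g')) : NicholsDatum σ γ :=
  NicholsDatum.ofRep (restrictSpace M) M.ρ fun _ => rfl

theorem isRepOf_repDatum (M : WeightModule (incl σ γ g g')) : (repDatum M).IsRepOf M.ρ :=
  NicholsDatum.isRepOf_ofRep _ _ _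

/-- The weight module of `U` given by a representation on a graded vector space. -/
@[reducible]
def NicholsDatum.IsRepOf.toModule {D : NicholsDatum σ γ} {r : U →ₐ[ℂ] Module.End ℂ D.X.V}
    (hr : D.IsRepOf r) : WeightModule (incl σ γ g g') where
  V := D.X.V
  ρ := r
  iSup_weightSpace := by
    have e : r.comp (incl σ γ g g' : C →ₐ[ℂ] U) = D.X.ρ := hr.comp_ofC
    rw [e]
    exact D.X.iSup_weightSpace

/-- Replacing the action of `C` by an equal one does not change a graded vector space. -/
theorem GradedSpace.mk_eq (X : GradedSpace C) {r : C →ₐ[ℂ] Module.End ℂ X.V} (e : r = X.ρ)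
    (hr : ⨆ χ, weightSpace (r.comp (BialgHom.id ℂ C : C →ₐ[ℂ] C)) χ = ⊤) :
    ({ V := X.V, ρ := r, iSup_weightSpace := hr } : GradedSpace C) = X := by
  subst e
  rfl

theorem NicholsDatum.ext_heq {D E : NicholsDatum σ γ} (hX : D.X = E.X) (h1 : HEq D.act E.act)
    (h2 : HEq D.coact E.coact) : D = E := by
  obtain ⟨X, a, b, ha, hb⟩ := D
  obtain ⟨Y, c, d, hc, hd⟩ := E
  dsimp only at hX
  subst hX
  cases h1
  cases h2
  rfl

/-- The action and the coaction are determined by the representation of `U`. -/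
theorem NicholsDatum.IsRepOf.eq_repDatum {D : NicholsDatum σ γ} {r : U →ₐ[ℂ] Module.End ℂ D.X.V}
    (hr : D.IsRepOf r) : repDatum hr.toModule = D := by
  have e : r.comp (incl σ γ g g' : C →ₐ[ℂ] U) = D.X.ρ := hr.comp_ofC
  have h0 := isRepOf_repDatum hr.toModule
  have hact : ∀ z, (repDatum hr.toModule).act z = D.act z := fun z => by
    induction z with
    | zero => simp
    | add z w hz hw => rw [map_add, map_add, hz, hw]
    | tmul a m => rw [h0.act, hr.act]
  have hco : ∀ m, (repDatum hr.toModule).coact m = D.coact m := fun m =>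
    eq_of_slice_nForm fun b => by rw [h0.coact, hr.coact]
  exact NicholsDatum.ext_heq (GradedSpace.mk_eq D.X e _) (heq_of_eq (LinearMap.ext hact))
    (heq_of_eq (LinearMap.ext hco))

theorem NicholsDatum.braidL_heq {D D' E E' : NicholsDatum σ γ} (h : D = D') (h' : E = E') :
    HEq (D.braidL E) (D'.braidL E') := by
  subst h h'
  rfl

/-- The braiding of two Yetter-Drinfeld modules depends only on the representations of `U`. -/
theorem NicholsDatum.IsRepOf.braidL_repDatum {D E : NicholsDatum σ γ}
    {r : U →ₐ[ℂ] Module.End ℂ D.X.V} {s : U →ₐ[ℂ] Module.End ℂ E.X.V} (hr : D.IsRepOf r)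
    (hs : E.IsRepOf s) : (repDatum hr.toModule).braidL (repDatum hs.toModule) = D.braidL E :=
  _root_.eq_of_heq (braidL_heq hr.eq_repDatum hs.eq_repDatum)

section Morphisms

variable {M N : WeightModule (incl σ γ g g')} (f : M ⟶ N)

theorem lin_act (z : Nichols q ⊗[ℂ] M.V) :
    lin f ((repDatum M).act z) = (repDatum N).act ((lin f).lTensor _ z) :=
  (isRepOf_repDatum M).hom_act (isRepOf_repDatum N) (comm f) z

theorem lin_coact (m : M.V) :
    (lin f).lTensor _ ((repDatum M).coact m) = (repDatum N).coact (lin f m) :=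
  (isRepOf_repDatum M).hom_coact (isRepOf_repDatum N) (comm f) m

end Morphisms

section Tensor

variable (M N : WeightModule (incl σ γ g g'))

/-- The action of the Nichols algebra on a weight module of `U`. -/
abbrev repAct : Nichols q ⊗[ℂ] M.V →ₗ[ℂ] M.V := (repDatum M).act

/-- The coaction of the Nichols algebra on a weight module of `U`. -/
abbrev repCoact : M.V →ₗ[ℂ] Nichols q ⊗[ℂ] M.V := (repDatum M).coact

theorem isRepOf_tensor : ((repDatum M).tensor (repDatum N)).IsRepOf (diag M.ρ N.ρ) :=
  (isRepOf_repDatum M).tensor (isRepOf_repDatum N)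

/-- The action on a tensor product of representations is diagonal. -/
theorem repAct_tensor : repAct (M ⊗ N) =
    tensorActL (A := restrictSpace M) (V := restrictSpace N) (repAct M) (repAct N) ∘ₗ
      (nicholsComul q).rTensor (M.V ⊗[ℂ] N.V) :=
  TensorProduct.ext' fun a z =>
    ((isRepOf_repDatum (M ⊗ N)).act a z).trans ((isRepOf_tensor M N).act a z).symm

/-- The coaction on a tensor product of representations is codiagonal. -/
theorem repCoact_tensor : repCoact (M ⊗ N) =
    mulExchange (restrictSpace M) (restrictSpace N) ∘ₗ
      TensorProduct.map (repCoact M) (repCoact N) :=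
  LinearMap.ext fun z => eq_of_slice_nForm fun b =>
    ((isRepOf_repDatum (M ⊗ N)).coact b z).trans ((isRepOf_tensor M N).coact b z).symm

end Tensor

section Braiding

variable {V W : GradedSpace C}

/-- Equal actions of `C` give the same exchange. This serves to replace the action of `C` on a tensor
product of modules by the diagonal action, which is equal to it but not by definition. -/
theorem twistL_congr_left {T : Type} [AddCommGroup T] [Module ℂ T] [FiniteDimensional ℂ T]
    {r s : C →ₐ[ℂ] Module.End ℂ T} (e : r = s)
    (hr : ⨆ χ, weightSpace (r.comp (BialgHom.id ℂ C : C →ₐ[ℂ] C)) χ = ⊤)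
    (hs : ⨆ χ, weightSpace (s.comp (BialgHom.id ℂ C : C →ₐ[ℂ] C)) χ = ⊤)
    (a : Nichols q ⊗[ℂ] T →ₗ[ℂ] T) :
    twistL (W := { V := T, ρ := r, iSup_weightSpace := hr }) a V =
      twistL (W := { V := T, ρ := s, iSup_weightSpace := hs }) a V := by
  subst e
  rfl

theorem twistL_congr_right {T : Type} [AddCommGroup T] [Module ℂ T] [FiniteDimensional ℂ T]
    {r s : C →ₐ[ℂ] Module.End ℂ T} (e : r = s)
    (hr : ⨆ χ, weightSpace (r.comp (BialgHom.id ℂ C : C →ₐ[ℂ] C)) χ = ⊤)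
    (hs : ⨆ χ, weightSpace (s.comp (BialgHom.id ℂ C : C →ₐ[ℂ] C)) χ = ⊤)
    (a : Nichols q ⊗[ℂ] W.V →ₗ[ℂ] W.V) :
    twistL a { V := T, ρ := r, iSup_weightSpace := hr } =
      twistL a { V := T, ρ := s, iSup_weightSpace := hs } := by
  subst e
  rfl

theorem twistL_repAct_tensor (M N : WeightModule (incl σ γ g g')) :
    twistL (W := restrictSpace (M ⊗ N)) (repAct (M ⊗ N)) V =
      twistL (W := tensorSpace (restrictSpace M) (restrictSpace N))
        (tensorActL (A := restrictSpace M) (V := restrictSpace N) (repAct M) (repAct N) ∘ₗ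
          (nicholsComul q).rTensor (M.V ⊗[ℂ] N.V)) V := by
  rw [← repAct_tensor]
  exact twistL_congr_left (T := M.V ⊗[ℂ] N.V) (AlgHom.ext fun c => NicholsDatum.diag_ofC M.ρ N.ρ c) _ _ _

theorem twistL_restrictSpace_tensor (M N : WeightModule (incl σ γ g g'))
    (a : Nichols q ⊗[ℂ] W.V →ₗ[ℂ] W.V) : twistL a (restrictSpace (M ⊗ N)) =
      twistL a (tensorSpace (restrictSpace M) (restrictSpace N)) :=
  twistL_congr_right (T := M.V ⊗[ℂ] N.V) (AlgHom.ext fun c => NicholsDatum.diag_ofC M.ρ N.ρ c) _ _ _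

/-- The linear map underlying the braiding of two weight modules of `U`. -/
def repBraidL (M N : WeightModule (incl σ γ g g')) : M.V ⊗[ℂ] N.V →ₗ[ℂ] N.V ⊗[ℂ] M.V :=
  (repDatum M).braidL (repDatum N)

theorem repBraidL_tmul (M N : WeightModule (incl σ γ g g')) (m : M.V) (v : N.V) :
    repBraidL M N (m ⊗ₜ v) = twistL (V := restrictSpace M) (W := restrictSpace N)
      (repAct N) (repCoact M m ⊗ₜ v) := rfl

theorem repBraidL_tensor_right (M N P : WeightModule (incl σ γ g g')) (m : M.V) (v : N.V)
    (w : P.V) : TensorProduct.assoc ℂ N.V P.V M.V (twistL (W := restrictSpace (N ⊗ P))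
        (repAct (N ⊗ P)) (restrictSpace M) (repCoact M m ⊗ₜ (v ⊗ₜ w))) =
      (repBraidL M P).lTensor N.V (TensorProduct.assoc ℂ N.V M.V P.V
        (repBraidL M N (m ⊗ₜ v) ⊗ₜ w)) := by
  have e := NicholsDatum.braidL_tensor_right (D := repDatum M) (E := repDatum N) (F := repDatum P)
    (isRepOf_repDatum M).isYetterDrinfeld m v w
  rw [twistL_repAct_tensor]
  exact e

theorem repBraidL_tensor_left (M N P : WeightModule (incl σ γ g g')) (v : M.V) (w : N.V)
    (m : P.V) : (TensorProduct.assoc ℂ P.V M.V N.V).symm (twistL (W := restrictSpace P)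
        (repAct P) (restrictSpace (M ⊗ N)) (repCoact (M ⊗ N) (v ⊗ₜ[ℂ] w) ⊗ₜ m)) =
      (repBraidL M P).rTensor N.V ((TensorProduct.assoc ℂ M.V P.V N.V).symm
        (v ⊗ₜ repBraidL N P (w ⊗ₜ m))) := by
  have e := NicholsDatum.braidL_tensor_left (D := repDatum M) (E := repDatum N) (F := repDatum P)
    (isRepOf_repDatum P).isYetterDrinfeld v w m
  rw [twistL_restrictSpace_tensor, repCoact_tensor]
  exact e

end Braiding

/-- The braiding of the representations of `U`. -/
def repBraiding (M N : WeightModule (incl σ γ g g')) : M ⊗ N ≅ N ⊗ M :=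
  WeightModule.isoMk (LinearEquiv.ofBijective ((repDatum M).braidL (repDatum N))
    ((isRepOf_repDatum M).braidL_bijective (isRepOf_repDatum N)))
    ((isRepOf_repDatum M).rep_braidL (isRepOf_repDatum N))

instance braidedRep : BraidedCategory (WeightModule (incl σ γ g g')) where
  braiding := repBraiding
  braiding_naturality_right M {N N'} f := WeightModule.hom_ext (TensorProduct.ext' fun m w =>
    twistL_natural_left (V := restrictSpace M) (W := restrictSpace N) (W' := restrictSpace N')
      (fun c x => comm f (incl σ γ g g' c) x) (lin_act f) ((repDatum M).coact m) w)
  braiding_naturality_left {M M'} f N := WeightModule.hom_ext (TensorProduct.ext' fun m w => by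
    change twistL (repDatum N).act (restrictSpace M') ((repDatum M').coact (lin f m) ⊗ₜ w) =
      (lin f).lTensor _ (twistL (repDatum N).act (restrictSpace M) ((repDatum M).coact m ⊗ₜ w))
    rw [← lin_coact]
    exact twistL_natural_right (V := restrictSpace M) (V' := restrictSpace M')
      (W := restrictSpace N) _ (fun c x => comm f (incl σ γ g g' c) x) _ w)
  hexagon_forward M N P := WeightModule.hom_ext (TensorProduct.ext_threefold fun m v w =>
    repBraidL_tensor_right M N P m v w)
  hexagon_reverse M N P := by
    -- This makes the left hand side a map on `(M ⊗ N) ⊗ P`, whose elements are sums of pure tensors.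
    rw [← cancel_epi (α_ M N P).hom]
    exact WeightModule.hom_ext (TensorProduct.ext_threefold fun v w m =>
      repBraidL_tensor_left M N P v w m)

end QuantumGroup
end BraidedRepresentations

/-! ### The equivalence of categories -/

noncomputable section Equivalence

open NicholsAlgebra WeightModule GradedSpace

variable {C : Type u} [CommRing C] [HopfAlgebra ℂ C] [Coalgebra.IsCocomm ℂ C] {n : ℕ}

namespace QuantumGroup

variable {σ : CharGroup C →* CharGroup C →* ℂˣ} {γ : Fin n → CharGroup C} {g g' : Fin n → C}
variable [FiniteDimensional ℂ (Nichols (braidingMatrix γ σ))]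

local notation "q" => braidingMatrix γ σ
local notation "U" => QuantumGroup σ γ g g'
local notation "𝒴" => YetterDrinfeld (nicholsObj γ σ)

variable [h : IsLinkingDatum σ γ g g']

section Functor

/-- The representation of `U` on a Yetter-Drinfeld module over the Nichols algebra. -/
def repOf (M : 𝒴) : U →ₐ[ℂ] Module.End ℂ (space M.obj.X).V :=
  ((isYetterDrinfeld_iff M.obj).1 M.property).rep

theorem isRepOf_repOf (M : 𝒴) : (toDatum M.obj).IsRepOf (repOf (g := g) (g' := g') M) :=
  ((isYetterDrinfeld_iff M.obj).1 M.property).isRepOf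

theorem toLin_act {M N : ActCoact (nicholsObj γ σ)} (f : M ⟶ N)
    (z : Nichols q ⊗[ℂ] (space M.X).V) :
    toLin f.hom ((toDatum M).act z) = (toDatum N).act ((toLin f.hom).lTensor _ z) :=
  LinearMap.congr_fun (congrArg toLin f.act_hom) z

theorem toLin_coact {M N : ActCoact (nicholsObj γ σ)} (f : M ⟶ N) (m : (space M.X).V) :
    (toLin f.hom).lTensor _ ((toDatum M).coact m) = (toDatum N).coact (toLin f.hom m) :=
  LinearMap.congr_fun (congrArg toLin f.coact_hom) m

variable (σ γ g g') in
/-- The functor from Yetter-Drinfeld modules over the Nichols algebra to representations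
of `U`. -/
def toRep : 𝒴 ⥤ WeightModule (incl σ γ g g') where
  obj M := (isRepOf_repOf M).toModule
  map {M N} f := ⟨toLin f.hom.hom, fun a x =>
    (isRepOf_repOf M).comm (isRepOf_repOf N) (toLin_comm f.hom.hom) (toLin_act f.hom)
      (toLin_coact f.hom) a x⟩

instance : (toRep σ γ g g').Faithful where
  map_injective {M N f f'} h := by
    have e : toLin f.hom.hom = toLin f'.hom.hom := congrArg (lin (j := incl σ γ g g')) h
    exact InducedCategory.hom_ext (ActCoact.hom_ext (toLin_injective e))

instance : (toRep σ γ g g').Full where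
  map_surjective {M N} f := by
    let l : (space M.obj.X).V →ₗ[ℂ] (space N.obj.X).V := lin (j := incl σ γ g g') f
    refine ⟨ObjectProperty.homMk ⟨ofLin (V := M.obj.X) (W := N.obj.X) l fun c x => ?_,
      toLin_injective (LinearMap.ext fun z => ?_), toLin_injective (LinearMap.ext fun m => ?_)⟩, rfl⟩
    · have e1 := (isRepOf_repOf (g := g) (g' := g') M).ofC c x
      have e2 := (isRepOf_repOf (g := g) (g' := g') N).ofC c (l x)
      exact (congrArg l e1).symm.trans ((comm f _ x).trans e2)
    · exact (isRepOf_repOf M).hom_act (isRepOf_repOf N) (comm f) z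
    · exact (isRepOf_repOf M).hom_coact (isRepOf_repOf N) (comm f) m

/-- The Yetter-Drinfeld module of a weight module of `U`. -/
def ofWeightModule (Y : WeightModule (incl σ γ g g')) : 𝒴 where
  obj := (repDatum Y).toObj
  property := (isYetterDrinfeld_iff _).2 (isRepOf_repDatum Y).isYetterDrinfeld

instance : (toRep σ γ g g').EssSurj where
  mem_essImage Y := ⟨ofWeightModule Y, ⟨WeightModule.isoMk (LinearEquiv.refl ℂ Y.V) fun a x =>
    LinearMap.congr_fun (DFunLike.congr_fun
      ((isRepOf_repOf (ofWeightModule Y)).unique (isRepOf_repDatum Y)) a) x⟩⟩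

instance : (toRep σ γ g g').IsEquivalence where

variable (σ γ g g') in
/-- The functor `toRep` is the identity on the underlying graded vector spaces. -/
def toRepRestrict : toRep σ γ g g' ⋙ WeightModule.restrict (incl σ γ g g') σ ≅
    (isYetterDrinfeld (nicholsObj γ σ)).ι ⋙ ActCoact.forget _ :=
  NatIso.ofComponents (fun M => WeightModule.isoMk (j := BialgHom.id ℂ C)
    (LinearEquiv.refl ℂ (space M.obj.X).V) fun c x => (isRepOf_repOf M).ofC c x)
    fun _ => WeightModule.hom_ext (j := BialgHom.id ℂ C) rfl

end Functor

section Monoidal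

variable [(isYetterDrinfeld (nicholsObj γ σ)).IsMonoidal]

/-- The functor from Yetter-Drinfeld modules to representations of `U` preserves tensor products
strictly. -/
theorem repOf_tensor (M N : 𝒴) : repOf (g := g) (g' := g') (M ⊗ N) =
    diag (V := (space M.obj.X).V) (W := (space N.obj.X).V) (repOf M) (repOf N) :=
  (isRepOf_repOf (M ⊗ N)).unique ((isRepOf_repOf M).tensor (isRepOf_repOf N))

theorem repOf_unit : repOf (g := g) (g' := g') (𝟙_ 𝒴) = triv U :=
  (isRepOf_repOf (𝟙_ 𝒴)).unique (NicholsDatum.isRepOf_unit σ γ)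

/-- The structure of a tensor functor on `toRep`, given by identity maps. -/
def toRepMonoidal : (toRep σ γ g g').CoreMonoidal where
  εIso := WeightModule.isoMk (LinearEquiv.refl ℂ ℂ) fun a x =>
    (LinearMap.congr_fun (DFunLike.congr_fun repOf_unit a) x).symm
  μIso M N := WeightModule.isoMk
    (LinearEquiv.refl ℂ ((space M.obj.X).V ⊗[ℂ] (space N.obj.X).V)) fun a x =>
    (LinearMap.congr_fun (DFunLike.congr_fun (repOf_tensor M N) a) x).symm
  μIso_hom_natural_left _ _ := WeightModule.hom_ext rfl
  μIso_hom_natural_right _ _ := WeightModule.hom_ext rfl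
  associativity _ _ _ := WeightModule.hom_ext (TensorProduct.ext_threefold fun _ _ _ => rfl)
  left_unitality _ := WeightModule.hom_ext (TensorProduct.ext' fun _ _ => rfl)
  right_unitality _ := WeightModule.hom_ext (TensorProduct.ext' fun _ _ => rfl)

instance : (toRep σ γ g g').Monoidal := toRepMonoidal.toMonoidal

open Functor.LaxMonoidal

variable (σ γ g g') in
/-- The braiding of the category of Yetter-Drinfeld modules, transported from that of the
representations of `U`. -/
@[reducible]
def braidedYetterDrinfeld : BraidedCategory 𝒴 :=
  BraidedCategory.ofFullyFaithful (toRep σ γ g g')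

variable (σ γ g g') in
/-- The functor `toRep` is braided. -/
@[reducible]
def toRepBraided : letI := braidedYetterDrinfeld σ γ g g'; (toRep σ γ g g').Braided :=
  let _ := braidedYetterDrinfeld σ γ g g'
  { braided := fun X Y => by
      simp +instances [BraidedCategory.ofFullyFaithful, BraidedCategory.ofFaithful] }

/-- The braiding transported from the representations of `U` is `m ⊗ w ↦ m₍₋₁₎ w ⊗ m₍₀₎`. -/
theorem braiding_hom (M N : 𝒴) : letI := braidedYetterDrinfeld σ γ g g';
    (β_ M N).hom.hom.hom = ydBraiding M.obj N.obj := by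
  let _ := braidedYetterDrinfeld σ γ g g'
  let _ := toRepBraided σ γ g g'
  have e := Functor.LaxBraided.braided (F := toRep σ γ g g') M N
  have e' := congrArg (lin (j := incl σ γ g g')) e
  refine toLin_injective (V := M.obj.X ⊗ N.obj.X) ?_
  exact e'.trans ((isRepOf_repOf M).braidL_repDatum (isRepOf_repOf N))

end Monoidal

end QuantumGroup
end Equivalence

/-! ### Transparent representations -/

noncomputable section TransparentRepresentations

open NicholsAlgebra WeightModule GradedSpace

variable {C : Type u} [CommRing C] [HopfAlgebra ℂ C] [Coalgebra.IsCocomm ℂ C] {n : ℕ}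

namespace WeightModule

variable {A : Type v} [Ring A] [Bialgebra ℂ A] {j : C →ₐc[ℂ] A}

/-- A module on which `A` acts through the counit is a direct sum of copies of the unit object. -/
theorem exists_isColimit_of_trivial (X : WeightModule j)
    (hX : ∀ a x, X.ρ a x = Coalgebra.counit (R := ℂ) a • x) :
    ∃ (k : ℕ) (f : Fin k → (𝟙_ (WeightModule j) ⟶ X)),
      Nonempty (Limits.IsColimit (Limits.Cofan.mk X f)) := by
  let b := Module.finBasis ℂ X.V
  let f (i : Fin (Module.finrank ℂ X.V)) : 𝟙_ (WeightModule j) ⟶ X :=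
    ⟨LinearMap.toSpanSingleton ℂ X.V (b i), fun a (z : ℂ) => by
      rw [hX]
      exact mul_smul _ z (b i)⟩
  have hf : ∀ i, lin (f i) (1 : ℂ) = b i := fun i => one_smul ℂ (b i)
  refine ⟨_, f, ⟨Limits.Cofan.IsColimit.mk _ (fun s =>
    ⟨b.constr ℂ fun i => lin (s.inj i) (1 : ℂ), fun a x => ?_⟩) (fun s i => ?_)
    fun s m hm => ?_⟩⟩
  · refine (congrArg (b.constr ℂ fun i => lin (s.inj i) (1 : ℂ)) (hX a x)).trans ?_
    rw [map_smul]
    have e : Coalgebra.counit (R := ℂ) a • (b.constr ℂ fun i => lin (s.inj i) (1 : ℂ)) =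
        s.pt.ρ a ∘ₗ b.constr ℂ fun i => lin (s.inj i) (1 : ℂ) := b.ext fun i => by
      rw [LinearMap.smul_apply, LinearMap.comp_apply, b.constr_basis]
      exact (map_smul (lin (s.inj i)) (Coalgebra.counit (R := ℂ) a) (1 : ℂ)).symm.trans
        (comm (s.inj i) a (1 : ℂ))
    exact LinearMap.congr_fun e x
  · refine WeightModule.hom_ext (LinearMap.ext_ring ?_)
    exact (congrArg (b.constr ℂ fun i => lin (s.inj i) (1 : ℂ)) (hf i)).trans
      (b.constr_basis ℂ _ i)
  · refine WeightModule.hom_ext (b.ext fun i => ?_)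
    have e : lin (f i ≫ m) (1 : ℂ) = lin (s.inj i) (1 : ℂ) :=
      congrArg (fun l => lin l (1 : ℂ)) (hm i)
    exact (congrArg (lin m) (hf i)).symm.trans (e.trans
      (b.constr_basis ℂ (fun i => lin (s.inj i) (1 : ℂ)) i).symm)

end WeightModule

namespace QuantumGroup

variable {σ : CharGroup C →* CharGroup C →* ℂˣ} {γ : Fin n → CharGroup C} {g g' : Fin n → C}

local notation "q" => braidingMatrix γ σ
local notation "𝔑" => nicholsSpace σ γ
local notation "U" => QuantumGroup σ γ g g'

variable (σ) in
/-- If `γ_i` were trivial, then the skew derivation `∂_i` would be a derivation with `∂_i(x_i) = 1`,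
and `[∂_i, x_i] = 1` has no solution on a finite-dimensional space. -/
theorem weight_gen_ne_one [FiniteDimensional ℂ (Nichols (braidingMatrix γ σ))] (i : Fin n) : γ i ≠ 1 := by
  intro hi
  have e : nDerivR q i ∘ₗ LinearMap.mulLeft ℂ (gen q i) =
      LinearMap.mulLeft ℂ (gen q i) ∘ₗ nDerivR q i + LinearMap.id := lin_ext fun w => by
    simp only [LinearMap.comp_apply, LinearMap.add_apply, LinearMap.mulLeft_apply,
      nDerivR_gen_mul, nBraid_proj_word, braidScalar_braidingMatrix, hi, map_one, if_true,
      MonoidHom.one_apply, Units.val_one, one_smul, LinearMap.id_apply]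
  -- A commutator has trace zero, while the identity has the dimension as its trace.
  have t := congrArg (LinearMap.trace ℂ _) e
  rw [map_add, LinearMap.trace_comp_comm', LinearMap.trace_id, left_eq_add, Nat.cast_eq_zero,
    Module.finrank_zero_iff] at t
  have h1 : nicholsCounit q 1 = 1 := by simp
  rw [Subsingleton.elim (1 : Nichols q) 0, map_zero] at h1
  exact zero_ne_one h1

variable [FiniteDimensional ℂ (Nichols (braidingMatrix γ σ))]

/-- The homomorphism which maps all generators to zero is the counit. -/
theorem lift_zero_apply {R : Type*} [Ring R] [Algebra ℂ R] (a : TensorAlg n) :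
    FreeAlgebra.lift ℂ (fun _ : Fin n => (0 : R)) a =
      algebraMap ℂ R (nicholsCounit q (proj q a)) := by
  have : FreeAlgebra.lift ℂ (fun _ : Fin n => (0 : R)) =
      (Algebra.ofId ℂ R).comp FreeAlgebra.algebraMapInv := by
    ext i; simp [FreeAlgebra.algebraMapInv]
  rw [this, nicholsCounit_proj]; rfl

/-- The one-dimensional representation of `C` on which `C` acts through a character. -/
def charEnd (χ : CharGroup C) : C →ₐ[ℂ] Module.End ℂ ℂ := (Algebra.lmul ℂ ℂ).comp χ.ofConv

theorem charEnd_apply (χ : CharGroup C) (c : C) (z : ℂ) : charEnd χ c z = χ c * z := rfl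

variable (σ γ) in
/-- The one-dimensional representation of `C` given by a character, with the `x_i^*` acting by
zero. -/
def vacuumRep (χ : CharGroup C) : BorelRep σ γ ℂ where
  ofC := charEnd χ
  y _ := 0
  commY c i := by rw [mul_zero, zero_mul]
  nichols := lift_zero_eq_zero _

variable [h : IsLinkingDatum σ γ g g']

variable (σ γ g g') in
/-- The Verma module of a highest weight. -/
def verma (χ : CharGroup C) : WeightModule (incl σ γ g g') where
  V := Nichols q ⊗[ℂ] ℂ
  ρ := (vacuumRep σ γ χ).ind g g'
  iSup_weightSpace := by
    refine eq_top_iff.2 fun z _ => ?_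
    induction z with
    | zero => exact zero_mem _
    | add x y hx hy => exact add_mem (hx Submodule.mem_top) (hy Submodule.mem_top)
    | tmul a m =>
      induction a using GradedSpace.induction (V := 𝔑) with
      | add a b ha hb =>
        rw [TensorProduct.add_tmul]
        exact add_mem (ha Submodule.mem_top) (hb Submodule.mem_top)
      | mem ψ a ha =>
        refine Submodule.mem_iSup_of_mem (ψ * χ) fun c => ?_
        rw [← char_charShift]
        exact (ind_ofC _ ha c m).trans (TensorProduct.tmul_smul (χ (charShift ψ c)) a m)

variable (σ γ g g') in
/-- The highest weight vector of a Verma module. -/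
def vacuum (χ : CharGroup C) : (verma σ γ g g' χ).V := (1 : Nichols q) ⊗ₜ[ℂ] (1 : ℂ)

theorem vacuum_mem (χ : CharGroup C) : vacuum σ γ g g' χ ∈ (verma σ γ g g' χ).weight χ := fun c =>
  (ind_ofC (vacuumRep σ γ χ) one_mem_weightSpace c (1 : ℂ)).trans (by
    rw [charShift_one]
    exact TensorProduct.tmul_smul (χ c) (1 : Nichols q) (1 : ℂ))

theorem repCoact_vacuum (χ : CharGroup C) :
    repCoact (verma σ γ g g' χ) (vacuum σ γ g g' χ) = 1 ⊗ₜ vacuum σ γ g g' χ :=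
  eq_of_slice_nForm fun b => by
    obtain ⟨a, rfl⟩ := proj_surjective _ b
    refine ((isRepOf_repDatum (verma σ γ g g' χ)).coact _ _).trans ?_
    rw [slice_tmul, nForm_symm, nForm_one, ofNicholsY_proj]
    refine (ind_polyY_one (vacuumRep σ γ χ) a (1 : ℂ)).trans ?_
    refine (congrArg (fun f : Module.End ℂ ℂ => (1 : Nichols q) ⊗ₜ[ℂ] f (1 : ℂ))
      (lift_zero_apply (σ := σ) (γ := γ) a)).trans ?_
    exact TensorProduct.tmul_smul (nicholsCounit q (proj q a)) (1 : Nichols q) (1 : ℂ)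

theorem repAct_vacuum (χ : CharGroup C) (a : Nichols q) :
    repAct (verma σ γ g g' χ) (a ⊗ₜ vacuum σ γ g g' χ) = a ⊗ₜ[ℂ] (1 : ℂ) :=
  ((isRepOf_repDatum (verma σ γ g g' χ)).act _ _).trans
    ((ind_ofNichols (vacuumRep σ γ χ) a 1 1).trans (by rw [mul_one]))

theorem repCoact_slice_one (X : WeightModule (incl σ γ g g')) (m : X.V) :
    slice (nForm q 1) (repCoact X m) = m :=
  (isRepOf_repDatum X).isYetterDrinfeld.slice_one m

theorem repAct_one (X : WeightModule (incl σ γ g g')) (m : X.V) :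
    repAct X (1 ⊗ₜ m) = m :=
  (isRepOf_repDatum X).isYetterDrinfeld.one_act m

variable (σ γ g g') in
/-- The coefficient of the highest weight vector of a Verma module. -/
def vacuumCoeff (χ : CharGroup C) : (verma σ γ g g' χ).V →ₗ[ℂ] ℂ :=
  (TensorProduct.lid ℂ ℂ).toLinearMap ∘ₗ (nicholsCounit q).rTensor ℂ

theorem vacuumCoeff_repAct (χ : CharGroup C) (a : Nichols q) :
    vacuumCoeff σ γ g g' χ (repAct (verma σ γ g g' χ) (a ⊗ₜ vacuum σ γ g g' χ)) =
      nicholsCounit q a := by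
  rw [repAct_vacuum]
  exact mul_one _

theorem vacuumCoeff_vacuum (χ : CharGroup C) :
    vacuumCoeff σ γ g g' χ (vacuum σ γ g g' χ) = 1 := by
  rw [← repAct_one (verma σ γ g g' χ) (vacuum σ γ g g' χ), vacuumCoeff_repAct]
  simp

/-- The coefficient of the highest weight vector in the braiding of `m` with it. Only the component
`1 ⊗ m` of the coaction contributes. -/
theorem vacuumCoeff_repBraidL (X : WeightModule (incl σ γ g g')) (χ μ : CharGroup C) {m : X.V}
    (hm : m ∈ X.weight μ) :
    (vacuumCoeff σ γ g g' χ).rTensor X.V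
      (repBraidL X (verma σ γ g g' χ) (m ⊗ₜ vacuum σ γ g g' χ)) =
        ((σ μ χ : ℂˣ) : ℂ) • ((1 : ℂ) ⊗ₜ m) := by
  have e : (vacuumCoeff σ γ g g' χ).rTensor X.V ∘ₗ
      twistL (W := restrictSpace (verma σ γ g g' χ)) (repAct (verma σ γ g g' χ)) (restrictSpace X) ∘ₗ
        (TensorProduct.mk ℂ _ _).flip (vacuum σ γ g g' χ) =
      (vacuumCoeff σ γ g g' χ).rTensor X.V ∘ₗ
        braid σ (restrictSpace X) (restrictSpace (verma σ γ g g' χ)) ∘ₗ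
          (TensorProduct.mk ℂ _ _).flip (vacuum σ γ g g' χ) ∘ₗ slice (nForm q 1) :=
    ext₂ (V := 𝔑) (W := restrictSpace X) fun φ ψ a ha x hx => by
      simp only [LinearMap.comp_apply, LinearMap.flip_apply, TensorProduct.mk_apply, slice_tmul,
        nForm_one, ← TensorProduct.smul_tmul']
      rw [twistL_tmul (W := restrictSpace (verma σ γ g g' χ)) (V := restrictSpace X) _ a hx
        (vacuum_mem χ), map_smul, map_smul, braid_tmul (V := restrictSpace X) (W := restrictSpace (verma σ γ g g' χ)) hx
          (vacuum_mem χ), map_smul, map_smul, LinearMap.rTensor_tmul, LinearMap.rTensor_tmul,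
        vacuumCoeff_repAct, vacuumCoeff_vacuum, smul_comm, TensorProduct.smul_tmul' (nicholsCounit q a),
        smul_eq_mul, mul_one]
  refine (LinearMap.congr_fun e (repCoact X m)).trans ?_
  simp only [LinearMap.comp_apply, LinearMap.flip_apply, TensorProduct.mk_apply]
  rw [repCoact_slice_one,
    braid_tmul (V := restrictSpace X) (W := restrictSpace (verma σ γ g g' χ)) hm (vacuum_mem χ),
    map_smul, LinearMap.rTensor_tmul, vacuumCoeff_vacuum]

/-- The coaction on the highest weight vector is trivial, so it braids by `σ`. -/
theorem repBraidL_vacuum (X : WeightModule (incl σ γ g g')) (χ μ : CharGroup C) {m : X.V}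
    (hm : m ∈ X.weight μ) :
    repBraidL (verma σ γ g g' χ) X (vacuum σ γ g g' χ ⊗ₜ m) =
      ((σ χ μ : ℂˣ) : ℂ) • (m ⊗ₜ vacuum σ γ g g' χ) := by
  rw [repBraidL_tmul, repCoact_vacuum,
    twistL_tmul (W := restrictSpace X) (V := restrictSpace (verma σ γ g g' χ)) _ _ (vacuum_mem χ) hm,
    repAct_one]

/-- The double braiding with the highest weight vectors of all Verma modules shows that the weights
of a transparent representation are in the radical of the symmetrization of `σ`. -/
theorem weight_eq_one_of_transparent (hσ : IsNondegenerateBichar σ)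
    {X : WeightModule (incl σ γ g g')} (hX : ∀ Y, (β_ X Y).hom ≫ (β_ Y X).hom = 𝟙 (X ⊗ Y))
    {μ : CharGroup C} {m : X.V} (hm : m ∈ X.weight μ) (h0 : m ≠ 0) : μ = 1 := by
  refine hσ μ fun χ => ?_
  -- The double braiding is trivial in the other order as well, by conjugation with the braiding.
  have e1 : (β_ (verma σ γ g g' χ) X).hom ≫ (β_ X (verma σ γ g g' χ)).hom = 𝟙 _ := by
    rw [← cancel_mono (β_ (verma σ γ g g' χ) X).hom, Category.assoc, hX, Category.comp_id,
      Category.id_comp]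
  have e2 : repBraidL X (verma σ γ g g' χ) (repBraidL (verma σ γ g g' χ) X
      (vacuum σ γ g g' χ ⊗ₜ m)) = vacuum σ γ g g' χ ⊗ₜ m :=
    LinearMap.congr_fun (congrArg (lin (j := incl σ γ g g')) e1) (vacuum σ γ g g' χ ⊗ₜ m)
  have e3 := congrArg ((vacuumCoeff σ γ g g' χ).rTensor X.V) e2
  rw [repBraidL_vacuum X χ μ hm, map_smul, map_smul, vacuumCoeff_repBraidL X χ μ hm,
    LinearMap.rTensor_tmul, vacuumCoeff_vacuum] at e3
  have e4 := congrArg (TensorProduct.lid ℂ X.V) e3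
  rw [map_smul, map_smul, TensorProduct.lid_tmul, one_smul, smul_smul] at e4
  have e5 := smul_left_injective ℂ h0 (e4.trans (one_smul ℂ m).symm)
  rw [mul_comm]
  exact Units.ext e5

/-- If `σ` is nondegenerate, then `U` acts on a transparent representation through the counit. -/
theorem rep_eq_counit_of_transparent (hσ : IsNondegenerateBichar σ)
    {X : WeightModule (incl σ γ g g')} (hX : ∀ Y, (β_ X Y).hom ≫ (β_ Y X).hom = 𝟙 (X ⊗ Y))
    (a : U) (x : X.V) : X.ρ a x = Coalgebra.counit (R := ℂ) a • x := by
  -- All vectors have weight `1`, and so operators which shift the weight vanish.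
  have hone : ∀ m, m ∈ X.weight 1 := fun m => by
    induction m using GradedSpace.induction (V := restrictSpace X) with
    | add m m' h h' => exact add_mem h h'
    | mem χ m hm =>
      by_cases h0 : m = 0
      · rw [h0]; exact zero_mem _
      · rwa [weight_eq_one_of_transparent hσ hX hm h0] at hm
  have hzero : ∀ χ : CharGroup C, χ ≠ 1 → ∀ (f : Module.End ℂ X.V),
      (∀ c, X.ρ (ofC σ γ g g' c) * f = f * X.ρ (ofC σ γ g g' (charShift χ c))) → f = 0 :=
    fun χ hχ f hf => LinearMap.ext fun m => by
      by_contra h0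
      refine hχ ((mul_one χ).symm.trans (weight_eq_one_of_transparent hσ hX (m := f m) ?_ h0))
      intro c
      refine (LinearMap.congr_fun (hf c) m).trans ?_
      rw [← char_charShift, ← map_smul]
      exact congrArg f (hone m (charShift χ c))
  have e : X.ρ = (Algebra.ofId ℂ (Module.End ℂ X.V)).comp (Bialgebra.counitAlgHom ℂ U) := by
    refine algHom_ext (fun c => LinearMap.ext fun m => ?_) (fun i => ?_) fun i => ?_
    · refine (hone m c).trans ?_
      have e : Coalgebra.counit (R := ℂ) (ofC σ γ g g' c) = _ := counitU_ofC c
      simp only [AlgHom.comp_apply, Bialgebra.counitAlgHom_apply, e]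
      rfl
    · have e : Coalgebra.counit (R := ℂ) (QuantumGroup.x σ γ g g' i) = 0 := counitU_x i
      simp only [AlgHom.comp_apply, Bialgebra.counitAlgHom_apply, e, map_zero]
      exact hzero _ (weight_gen_ne_one σ i) _ fun c => by rw [← map_mul, ofC_mul_x, map_mul]
    · have e : Coalgebra.counit (R := ℂ) (QuantumGroup.y σ γ g g' i) = 0 := counitU_y i
      simp only [AlgHom.comp_apply, Bialgebra.counitAlgHom_apply, e, map_zero]
      exact hzero _ (inv_ne_one.2 (weight_gen_ne_one σ i)) _ fun c => by
        rw [← map_mul, ofC_mul_y, map_mul]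
  rw [e]; rfl

/-- Transparent representations are trivial, hence direct sums of copies of the unit object. -/
theorem isNondegenerateBraiding_rep (hσ : IsNondegenerateBichar σ) :
    IsNondegenerateBraiding (WeightModule (incl σ γ g g')) := fun X hX =>
  X.exists_isColimit_of_trivial (rep_eq_counit_of_transparent hσ hX)

end QuantumGroup
end TransparentRepresentations

/-! ### Transparent Yetter-Drinfeld modules -/

noncomputable section TransparentYetterDrinfeld

open NicholsAlgebra WeightModule GradedSpace

section Transport

universe v₁ v₂ u₁ u₂

variable {𝒞 : Type u₁} [Category.{v₁} 𝒞] [MonoidalCategory 𝒞] [BraidedCategory 𝒞]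
variable {𝒟 : Type u₂} [Category.{v₂} 𝒟] [MonoidalCategory 𝒟] [BraidedCategory 𝒟]

open Functor.LaxMonoidal Functor.OplaxMonoidal Functor.Monoidal

/-- Braided, essentially surjective functors preserve transparent objects. -/
theorem transparent_obj (F : 𝒞 ⥤ 𝒟) [F.Braided] [F.EssSurj] {X : 𝒞}
    (hX : ∀ Y, (β_ X Y).hom ≫ (β_ Y X).hom = 𝟙 (X ⊗ Y)) (Y : 𝒟) :
    (β_ (F.obj X) Y).hom ≫ (β_ Y (F.obj X)).hom = 𝟙 (F.obj X ⊗ Y) := by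
  have h1 : ∀ Z, (β_ (F.obj X) (F.obj Z)).hom ≫ (β_ (F.obj Z) (F.obj X)).hom = 𝟙 _ := fun Z => by
    have e := congrArg F.map (hX Z)
    rw [F.map_comp, Functor.map_braiding, Functor.map_braiding, F.map_id, Category.assoc,
      Category.assoc, μ_δ_assoc] at e
    rw [← cancel_epi (δ F X Z), ← cancel_mono (μ F X Z)]
    simpa using e
  have e : F.obj X ◁ (F.objObjPreimageIso Y).hom ≫
      (β_ (F.obj X) Y).hom ≫ (β_ Y (F.obj X)).hom = F.obj X ◁ (F.objObjPreimageIso Y).hom := by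
    rw [BraidedCategory.braiding_naturality_right_assoc, BraidedCategory.braiding_naturality_left,
      reassoc_of% h1]
  rw [← cancel_epi (F.obj X ◁ (F.objObjPreimageIso Y).hom), e, Category.comp_id]

/-- Nondegeneracy of the braiding is reflected by braided equivalences. -/
theorem IsNondegenerateBraiding.of_functor (F : 𝒞 ⥤ 𝒟) [F.Braided] [F.IsEquivalence]
    (h : IsNondegenerateBraiding 𝒟) : IsNondegenerateBraiding 𝒞 := fun X hX => by
  obtain ⟨k, f, ⟨hf⟩⟩ := h (F.obj X) (transparent_obj F hX)
  refine ⟨k, fun i => F.preimage (η F ≫ f i), ⟨Limits.Cofan.IsColimit.mk _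
    (fun s => F.preimage (Limits.Cofan.IsColimit.desc hf fun i => ε F ≫ F.map (s.inj i)))
    (fun s i => F.map_injective ?_) fun s m hm => F.map_injective ?_⟩⟩
  · have e := Limits.Cofan.IsColimit.fac hf (fun i => ε F ≫ F.map (s.inj i)) i
    simpa using congrArg (η F ≫ ·) e
  · refine Limits.Cofan.IsColimit.hom_ext hf _ _ fun i => ?_
    rw [F.map_preimage, Limits.Cofan.IsColimit.fac, ← hm i]
    simp

end Transport

variable {C : Type u} [CommRing C] [HopfAlgebra ℂ C] [Coalgebra.IsCocomm ℂ C] {n : ℕ}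

namespace QuantumGroup

variable {σ : CharGroup C →* CharGroup C →* ℂˣ} {γ : Fin n → CharGroup C} {g g' : Fin n → C}

variable [FiniteDimensional ℂ (Nichols (braidingMatrix γ σ))]

local notation "q" => braidingMatrix γ σ
local notation "𝔑" => nicholsSpace σ γ
local notation "U" => QuantumGroup σ γ g g'
local notation "𝒴" => YetterDrinfeld (nicholsObj γ σ)

variable [h : IsLinkingDatum σ γ g g']

section Character

variable {χ : CharGroup C} (hχ : ∀ ψ, σ χ ψ * σ ψ χ = 1)

/-- A character in the radical of the symmetrization of `σ` extends to a character of `U` which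
vanishes on the `x_i` and `x_i^*`: the right hand side `1 - g'_i g_i` of the linking relation is
mapped to `1 - σ(χ, γ_i) σ(γ_i, χ) = 0`. -/
def charRealization : Realization σ γ g g' (Module.End ℂ ℂ) where
  ofC := charEnd χ
  x _ := 0
  y _ := 0
  commX c i := by rw [mul_zero, zero_mul]
  commY c i := by rw [mul_zero, zero_mul]
  link i j := by
    have e : charEnd χ (g' i * g i) = 1 := LinearMap.ext fun z => by
      rw [charEnd_apply, map_mul, ← h.left_eval, ← h.right_eval, ← Units.val_mul, hχ,
        Units.val_one, one_mul]
      rfl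
    rw [e, sub_self, ite_self, mul_zero, smul_zero, sub_zero]

variable (γ g g') in
/-- The one-dimensional representation of `U` given by a character in the radical of the
symmetrization of `σ`. -/
def charModule : WeightModule (incl σ γ g g') where
  V := ℂ
  ρ := (charRealization hχ).lift (lift_zero_eq_zero _) (lift_zero_eq_zero _)
  iSup_weightSpace := eq_top_iff.2 fun z _ => Submodule.mem_iSup_of_mem χ fun c =>
    LinearMap.congr_fun (Realization.lift_ofC _ _ _ c) z

theorem charModule_ofC (c : C) (z : (charModule γ g g' hχ).V) :
    (charModule γ g g' hχ).ρ (ofC σ γ g g' c) z = χ c • z :=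
  LinearMap.congr_fun (f := (charModule γ g g' hχ).ρ (ofC σ γ g g' c))
    ((charRealization hχ).lift_ofC (lift_zero_eq_zero _) (lift_zero_eq_zero _) c) z

end Character

/-- The action and the coaction are trivial, and all vectors are of weight `χ`. -/
structure NicholsDatum.IsTrivialOfWeight (D : NicholsDatum σ γ) (χ : CharGroup C) : Prop where
  mem : ∀ z, z ∈ weightSpace D.X.ρ χ
  act : ∀ b z, D.act (b ⊗ₜ z) = nicholsCounit q b • z
  coact : ∀ z, D.coact z = 1 ⊗ₜ z

/-- On a module on which all `x_i` and `x_i^*` vanish, action and coaction are trivial. -/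
theorem isTrivialOfWeight_charModule {χ : CharGroup C} (hχ : ∀ ψ, σ χ ψ * σ ψ χ = 1) :
    (repDatum (charModule γ g g' hχ)).IsTrivialOfWeight χ where
  mem z c := charModule_ofC hχ c z
  act b z := by
    obtain ⟨a, rfl⟩ := proj_surjective _ b
    refine ((isRepOf_repDatum (charModule γ g g' hχ)).act _ _).trans ?_
    rw [ofNichols_proj]
    exact LinearMap.congr_fun (f := (charModule γ g g' hχ).ρ ((univ σ γ g g').polyX a))
      ((lift_polyX (charRealization hχ) (lift_zero_eq_zero _) (lift_zero_eq_zero _) a).trans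
        (lift_zero_apply (σ := σ) (γ := γ) a)) z
  coact z := eq_of_slice_nForm fun b => by
    obtain ⟨a, rfl⟩ := proj_surjective _ b
    refine ((isRepOf_repDatum (charModule γ g g' hχ)).coact _ _).trans ?_
    rw [slice_tmul, nForm_symm, nForm_one, ofNicholsY_proj]
    exact LinearMap.congr_fun (f := (charModule γ g g' hχ).ρ ((univ σ γ g g').polyY a))
      ((lift_polyY (charRealization hχ) (lift_zero_eq_zero _) (lift_zero_eq_zero _) a).trans
        (lift_zero_apply (σ := σ) (γ := γ) a)) z

namespace NicholsDatum.IsTrivialOfWeight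

variable {D E : NicholsDatum σ γ} {χ : CharGroup C} (hD : D.IsTrivialOfWeight χ)
  (hE : E.IsYetterDrinfeld)
include hD hE

theorem braidL_left {ψ : CharGroup C} (z : D.X.V) {w : E.X.V} (hw : w ∈ weightSpace E.X.ρ ψ) :
    D.braidL E (z ⊗ₜ w) = ((σ χ ψ : ℂˣ) : ℂ) • (w ⊗ₜ z) := by
  rw [braidL_tmul, hD.coact, twistL_tmul _ _ (hD.mem z) hw, hE.one_act]

theorem braidL_right {ψ : CharGroup C} (z : D.X.V) {w : E.X.V} (hw : w ∈ weightSpace E.X.ρ ψ) :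
    E.braidL D (w ⊗ₜ z) = ((σ ψ χ : ℂˣ) : ℂ) • (z ⊗ₜ w) := by
  have e : twistL D.act E.X ∘ₗ (TensorProduct.mk ℂ _ D.X.V).flip z =
      braid σ E.X D.X ∘ₗ (TensorProduct.mk ℂ _ D.X.V).flip z ∘ₗ slice (nForm q 1) :=
    ext₂ (V := 𝔑) (W := E.X) fun φ η a ha v hv => by
      simp only [LinearMap.comp_apply, LinearMap.flip_apply, TensorProduct.mk_apply, slice_tmul,
        nForm_one]
      rw [twistL_tmul _ a hv (hD.mem z), hD.act, ← TensorProduct.smul_tmul',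
        ← TensorProduct.smul_tmul', map_smul, braid_tmul hv (hD.mem z), smul_comm]
  refine (LinearMap.congr_fun e (E.coact w)).trans ?_
  simp only [LinearMap.comp_apply, LinearMap.flip_apply, TensorProduct.mk_apply]
  rw [hE.slice_one, braid_tmul hw (hD.mem z)]

/-- If the weight is in the radical of the symmetrization of `σ`, then the double braiding with any
other module is trivial. -/
theorem braidL_braidL (hχ : ∀ ψ, σ χ ψ * σ ψ χ = 1) (t : D.X.V ⊗[ℂ] E.X.V) :
    E.braidL D (D.braidL E t) = t := by
  induction t with
  | zero => rw [map_zero, map_zero]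
  | add t s ht hs => rw [map_add, map_add, ht, hs]
  | tmul z w =>
    induction w using GradedSpace.induction with
    | add w w' h h' => rw [TensorProduct.tmul_add, map_add, map_add, h, h']
    | mem ψ w hw =>
      rw [hD.braidL_left hE z hw, map_smul, hD.braidL_right hE z hw, smul_smul, ← Units.val_mul,
        hχ, Units.val_one, one_smul]

end NicholsDatum.IsTrivialOfWeight

section

variable [(isYetterDrinfeld (nicholsObj γ σ)).IsMonoidal]

/-- A character `χ` in the radical of the symmetrization of `σ` gives a one-dimensional transparent
module of weight `χ`. If `χ ≠ 1`, then there are no nonzero maps from the unit object to this module,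
so that it is not a direct sum of copies of the unit object. -/
theorem isNondegenerateBichar_of_braiding (hY : letI := braidedYetterDrinfeld σ γ g g'
    IsNondegenerateBraiding 𝒴) : IsNondegenerateBichar σ := by
  intro χ hχ
  let _ := braidedYetterDrinfeld σ γ g g'
  let M : 𝒴 := ofWeightModule (charModule γ g g' hχ)
  obtain ⟨k, f, ⟨hf⟩⟩ := hY M fun E => by
    refine InducedCategory.hom_ext (ActCoact.hom_ext (toLin_injective (LinearMap.ext fun t => ?_)))
    have e1 := congrArg toLin (braiding_hom (g := g) (g' := g') M E)
    have e2 := congrArg toLin (braiding_hom (g := g) (g' := g') E M)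
    refine (congrArg (toLin (β_ E M).hom.hom.hom) (LinearMap.congr_fun e1 t)).trans ?_
    refine (LinearMap.congr_fun e2 _).trans ?_
    exact (isTrivialOfWeight_charModule (g := g) (g' := g') hχ).braidL_braidL
      ((isYetterDrinfeld_iff E.obj).1 E.property) hχ t
  by_contra h1
  -- A morphism from the unit object intertwines the counit with `χ`.
  have hf0 : ∀ i, toLin (f i).hom.hom = 0 := fun i => LinearMap.ext_ring <| by
    by_contra h0
    refine h1 (WithConv.ext (AlgHom.ext fun c => ?_))
    have e := toLin_comm (f i).hom.hom c (1 : ℂ)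
    have e' : Coalgebra.counit (R := ℂ) c • toLin (f i).hom.hom (1 : ℂ) =
        χ c • toLin (f i).hom.hom (1 : ℂ) := by
      refine Eq.trans ?_ (e.trans (charModule_ofC hχ c _))
      refine (map_smul (toLin (f i).hom.hom) (Coalgebra.counit (R := ℂ) c) (1 : ℂ)).symm.trans ?_
      rfl
    exact (smul_left_injective ℂ h0 e').symm
  -- The identity and the zero morphism of `M` agree on all summands.
  let z : M ⟶ M := (toRep σ γ g g').preimage ⟨0, fun a x => by simp⟩
  have hz : toLin z.hom.hom = 0 :=
    congrArg (lin (j := incl σ γ g g')) ((toRep σ γ g g').map_preimage _)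
  have e : 𝟙 M = z := Limits.Cofan.IsColimit.hom_ext hf _ _ fun i =>
    InducedCategory.hom_ext (ActCoact.hom_ext (toLin_injective (LinearMap.ext fun t => by
      refine (LinearMap.congr_fun (hf0 i) t).trans ?_
      exact (LinearMap.congr_fun hz (toLin (f i).hom.hom t)).symm)))
  have e' : (LinearMap.id : ℂ →ₗ[ℂ] ℂ) = 0 := (congrArg (fun m => toLin m.hom.hom) e).trans hz
  exact one_ne_zero (LinearMap.congr_fun e' (1 : ℂ))

end

end QuantumGroup
end TransparentYetterDrinfeld

/-! ### The braided category of representations of `U` and its nondegeneracy -/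

theorem mainTheorem1 {C : Type u} [CommRing C] [HopfAlgebra ℂ C] [Coalgebra.IsCocomm ℂ C]
    (σ : CharGroup C →* CharGroup C →* ℂˣ) {n : ℕ} (γ : Fin n → CharGroup C) (g g' : Fin n → C)
    (hg : ∀ i, IsGroupLikeElem ℂ (g i)) (hg' : ∀ i, IsGroupLikeElem ℂ (g' i))
    (hσ : ∀ i (χ : CharGroup C), ((σ (γ i) χ : ℂˣ) : ℂ) = χ (g i))
    (hσ' : ∀ i (χ : CharGroup C), ((σ χ (γ i) : ℂˣ) : ℂ) = χ (g' i))
    [FiniteDimensional ℂ (Nichols (NicholsAlgebra.braidingMatrix γ σ))] :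
    Function.Bijective (QuantumGroup.mulMap σ γ g g') ∧
    ∃ H : HopfStructure (QuantumGroup σ γ g g'), QuantumGroup.IsStandard σ γ g g' H ∧
      letI := H.toHopfAlgebra
      ∃ ι : C →ₐc[ℂ] QuantumGroup σ γ g g', (∀ c, ι c = QuantumGroup.ofC σ γ g g' c) ∧
      ∃ (_ : (isYetterDrinfeld (NicholsAlgebra.nicholsObj γ σ)).IsMonoidal)
        (_ : BraidedCategory (YetterDrinfeld (NicholsAlgebra.nicholsObj γ σ)))
        (_ : BraidedCategory (WeightModule ι)),
        (∀ M N : YetterDrinfeld (NicholsAlgebra.nicholsObj γ σ),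
          (β_ M N).hom.hom.hom = ydBraiding M.obj N.obj) ∧
        (∃ F : YetterDrinfeld (NicholsAlgebra.nicholsObj γ σ) ⥤ WeightModule ι,
          F.IsEquivalence ∧ Nonempty F.Braided ∧
          Nonempty (F ⋙ WeightModule.restrict ι σ ≅
            (isYetterDrinfeld (NicholsAlgebra.nicholsObj γ σ)).ι ⋙ ActCoact.forget _)) ∧
        (IsNondegenerateBraiding (YetterDrinfeld (NicholsAlgebra.nicholsObj γ σ)) ↔
          IsNondegenerateBichar σ) ∧
        (IsNondegenerateBraiding (WeightModule ι) ↔ IsNondegenerateBichar σ) := by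
  have : QuantumGroup.IsLinkingDatum σ γ g g' := ⟨hg, hg', hσ, hσ'⟩
  refine ⟨QuantumGroup.mulMap_bijective, QuantumGroup.hopfStructure σ γ g g',
    QuantumGroup.isStandard_hopfStructure σ γ g g', QuantumGroup.incl σ γ g g', fun _ => rfl, ?_⟩
  let _ := QuantumGroup.isMonoidal_isYetterDrinfeld (σ := σ) (γ := γ) g g'
  let _ := QuantumGroup.braidedYetterDrinfeld σ γ g g'
  let _ := QuantumGroup.toRepBraided σ γ g g'
  -- The three nondegeneracy conditions imply each other cyclically.
  have h1 : IsNondegenerateBichar σ →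
      IsNondegenerateBraiding (WeightModule (QuantumGroup.incl σ γ g g')) :=
    QuantumGroup.isNondegenerateBraiding_rep
  have h2 : IsNondegenerateBraiding (WeightModule (QuantumGroup.incl σ γ g g')) →
      IsNondegenerateBraiding (YetterDrinfeld (NicholsAlgebra.nicholsObj γ σ)) :=
    IsNondegenerateBraiding.of_functor (QuantumGroup.toRep σ γ g g')
  have h3 : IsNondegenerateBraiding (YetterDrinfeld (NicholsAlgebra.nicholsObj γ σ)) →
      IsNondegenerateBichar σ := QuantumGroup.isNondegenerateBichar_of_braiding (g := g) (g' := g')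
  exact ⟨inferInstance, inferInstance, QuantumGroup.braidedRep, QuantumGroup.braiding_hom,
    ⟨QuantumGroup.toRep σ γ g g', inferInstance, ⟨inferInstance⟩,
      ⟨QuantumGroup.toRepRestrict σ γ g g'⟩⟩, ⟨h3, h2 ∘ h1⟩, ⟨h3 ∘ h2, h1⟩⟩
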